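/- Conventions. Let $S$ be an oriented embedded $C^1$ submanifold of dimension $k\ge 1$, without boundary and not necessarily closed, of a smooth (Hausdorff, second countable) manifold $V$, of locally finite $k$-dimensional area, i.e. every test form (smooth compactly supported $k$-form) is absolutely integrable on $S$. For a Borel set $A\subset S$ let $[A]$ be the current $\omega\mapsto\int_A\omega$; write $S$ also for $[S]$. For a smooth $1$-form $\theta$, the current $T\llcorner\theta$ is $\phi\mapsto T(\theta\wedge\phi)$. For a Riemannian metric $g$, the mass is $\mathcal M_g(T)=\sup T(\omega)$ over test forms $\omega$ with $\|\omega\|_\infty\le1$ for the pointwise Euclidean norm induced by $g$ on forms. If $\theta$ is a contact form, $\mathcal M_g(T\llcorner\theta)$ is the oblique mass of $T$. 1. Let $\dim V=2n+1$, $n\ge1$. Let $(g,\theta)$ and $(g',\theta')$ be pairs of a Riemannian metric and a contact form on $V$ with $|\theta|_g=1$, $|\theta'|_{g'}=1$, having the same subRiemannian data: $\ker\theta=\ker\theta'$, and $g=g'$ on this hyperplane field $\eta$. Assume that either $\theta=\theta'$, or both contact forms are normalized by the subRiemannian data, in the sense that $(d\theta)^n|_\eta$ equals, up to sign, $n!$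 times the volume form of $g|_\eta$, and likewise for $(g',\theta')$. Then $\mathcal M_g(S\llcorner\theta)=\mathcal M_{g'}(S\llcorner\theta')$ for every $S$ as above, in all dimensions $k\ge1$. In 2 and 3, $V=\mathbb H^n=\mathbb R^{2n+1}$, $n\ge1$, is the Heisenberg group with coordinates $(x,y,t)$, contact form $\theta=dt-\frac12\sum_j(x_jdy_j-y_jdx_j)$, left-invariant metric $\sum_j(dx_j^2+dy_j^2)+\theta^2$, corresponding mass $\mathcal M$, and dilations $\mathfrak s_\lambda(x,y,t)=(\lambda x,\lambda y,\lambda^2t)$. 2. Let $\mathcal S^{k+1}$ be the spherical Hausdorff measure of either the subRiemannian distance or the Cygan–Korányi distance $d(p,q)=\varrho(p^{-1}q)$, $\varrho(x,y,t)=((|x|^2+|y|^2)^2+16t^2)^{1/4}$. For every $S\subset\mathbb H^n$ as above there is a continuous function $c:S\to[0,\infty)$ such that $\mathcal M([A]\llcorner\theta)=\int_A c\,d\mathcal S^{k+1}$ for every Borel set $A\subset S$. 3. For every $S\subset\mathbb H^n$ as above with $\mathcal M(S)<\infty$ (in particular for every such $S$ that is not horizontal), $$\mathcal M(S\llcorner\theta)=\lim_{\lambda\to+\infty}\lambda^{-k-1}\mathcal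 M((\mathfrak s_\lambda)_\#S).$$ -/

import Mathlib

open Set Filter Topology MeasureTheory Manifold
open scoped ENNReal NNReal ContDiff

attribute [instance 2000] chartedSpaceSelf

noncomputable section

namespace ObliqueMass

/-! ### Differential forms on a manifold

`V` is a manifold modelled on the finite-dimensional space `E`, without boundary. By definition of
`TangentSpace`, the tangent space at each point `x` is the vector space `E` (through the preferred
chart at `x`), so that a differential form is a map from `V` to alternating forms on `E`. -/

section Forms

variable {E : Type*} [NormedAddCommGroup E] [NormedSpace ℝ E]
variable {V : Type*} [TopologicalSpace V] [ChartedSpace E V]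

/-- Differential `k`-forms on `V` (no regularity); `E` is the tangent space at each point. -/
abbrev DForm (E : Type*) [NormedAddCommGroup E] [NormedSpace ℝ E] (V : Type*) (k : ℕ) :=
  V → E [⋀^Fin k]→L[ℝ] ℝ

/-- A `1`-form, given as a field of linear functionals, viewed as a `DForm` of degree `1`. -/
def oneForm (θ : V → E →L[ℝ] ℝ) : DForm E V 1 :=
  fun x => ContinuousAlternatingMap.ofSubsingleton ℝ E ℝ (0 : Fin 1) (θ x)

/-- The pullback of a differential form by a map between manifolds modelled on `F` and `E`. -/
def pullback {F : Type*} [NormedAddCommGroup F] [NormedSpace ℝ F] {W : Type*} [TopologicalSpace W]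
    [ChartedSpace F W] {k : ℕ} (f : W → V) (η : DForm E V k) : DForm F W k :=
  fun x => (η (f x)).compContinuousLinearMap (mfderiv 𝓘(ℝ, F) 𝓘(ℝ, E) f x : F →L[ℝ] E)

/-- The expression of a form in the preferred chart at `x`. -/
def chartForm {k : ℕ} (η : DForm E V k) (x : V) : DForm E E k :=
  pullback (chartAt E x).symm η

/-- A form is smooth if its expression in every preferred chart is smooth. -/
def IsSmoothForm {k : ℕ} (η : DForm E V k) : Prop :=
  ∀ x : V, ContDiffOn ℝ ∞ (chartForm η x) (chartAt E x).target

/-- Test forms: smooth forms with compact support. -/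
def IsTestForm {k : ℕ} (η : DForm E V k) : Prop :=
  IsSmoothForm η ∧ IsCompact (closure {x | η x ≠ 0})

/-- Exterior derivative, computed at `x` in the preferred chart at `x`. -/
def extD {k : ℕ} (η : DForm E V k) : DForm E V (k + 1) :=
  fun x => extDeriv (chartForm η x) (chartAt E x x)

/-- The wedge product `θ ∧ φ` of a `1`-form and a `k`-form,
`(θ ∧ φ)(v₀, …, v_k) = ∑ i, (-1)^i θ(v_i) φ(v₀, …, v_{i-1}, v_{i+1}, …, v_k)`. -/
def wedge {k : ℕ} (θ : V → E →L[ℝ] ℝ) (φ : DForm E V k) : DForm E V (k + 1) :=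
  fun x => ContinuousAlternatingMap.alternatizeUncurryFin ((θ x).smulRight (φ x))

end Forms

/-! ### Functionals on forms and their mass -/

section Mass

variable {E : Type*} [NormedAddCommGroup E] [NormedSpace ℝ E]
variable {V : Type*} [TopologicalSpace V] [ChartedSpace E V]

/-- `e` is an orthonormal family for the bilinear form `b`. -/
def IsOrtho {ι : Type*} (b : E → E → ℝ) (e : ι → E) : Prop :=
  (∀ i, b (e i) (e i) = 1) ∧ ∀ i j, i ≠ j → b (e i) (e j) = 0

open scoped Classical in
/-- The squared Euclidean norm of an alternating form with respect to an orthonormal basis: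
the sum of the squares of its coefficients, indexed by increasing multi-indices. -/
def normSq {k m : ℕ} (e : Fin m → E) (η : E [⋀^Fin k]→L[ℝ] ℝ) : ℝ :=
  ∑ I : Fin k → Fin m, if StrictMono I then (η (e ∘ I)) ^ 2 else 0

/-- `‖η‖_∞ ≤ 1`, with the pointwise Euclidean norm on forms induced by the metric `g`. -/
def SupNormLeOne {k : ℕ} (g : V → E → E → ℝ) (η : DForm E V k) : Prop :=
  ∀ x : V, ∀ e : Fin (Module.finrank ℝ E) → E, IsOrtho (g x) e → normSq e (η x) ≤ 1

/-- The mass, with respect to the Riemannian metric `g`, of a functional on `k`-forms. -/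
def mass {k : ℕ} (g : V → E → E → ℝ) (T : DForm E V k → ℝ) : ℝ≥0∞ :=
  ⨆ (η : DForm E V k) (_ : IsTestForm η) (_ : SupNormLeOne g η), ENNReal.ofReal (T η)

/-- The restriction `T ⌞ θ`, defined by `⟨T ⌞ θ, φ⟩ = ⟨T, θ ∧ φ⟩`. -/
def restrictTo {k : ℕ} (T : DForm E V (k + 1) → ℝ) (θ : V → E →L[ℝ] ℝ) : DForm E V k → ℝ :=
  fun φ => T (wedge θ φ)

/-- The pushforward `f_# T`, defined by `⟨f_# T, η⟩ = ⟨T, f^* η⟩`. -/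
def pushforward {k : ℕ} (f : V → V) (T : DForm E V k → ℝ) : DForm E V k → ℝ :=
  fun η => T (pullback f η)

/-- The oblique mass `M(T ⌞ θ)`. -/
def obliqueMass {k : ℕ} (g : V → E → E → ℝ) (θ : V → E →L[ℝ] ℝ) (T : DForm E V (k + 1) → ℝ) :
    ℝ≥0∞ :=
  mass g (restrictTo T θ)

end Mass

/-! ### Oriented `C¹` submanifolds and their currents of integration -/

/-- An oriented, embedded `k`-dimensional `C¹` submanifold (without boundary, not necessarily
closed) of a manifold `V`, described by a countable oriented atlas of local parametrizations.
Some of the parametrizations may have empty domain. -/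
structure OrientedSubmanifold (E : Type*) [NormedAddCommGroup E] [NormedSpace ℝ E]
    (V : Type*) [TopologicalSpace V] [ChartedSpace E V] (k : ℕ) where
  /-- the underlying set -/
  carrier : Set V
  /-- the domains of the parametrizations -/
  dom : ℕ → Set (Fin k → ℝ)
  /-- the parametrizations -/
  param : ℕ → (Fin k → ℝ) → V
  isOpen_dom : ∀ i, IsOpen (dom i)
  contMDiffOn_param : ∀ i, ContMDiffOn 𝓘(ℝ, Fin k → ℝ) 𝓘(ℝ, E) 1 (param i) (dom i)
  immersion : ∀ i, ∀ u ∈ dom i,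
    Function.Injective (mfderiv 𝓘(ℝ, Fin k → ℝ) 𝓘(ℝ, E) (param i) u)
  injOn_param : ∀ i, InjOn (param i) (dom i)
  /-- each parametrization is open onto its image, for the topology of `carrier` induced by `V` -/
  embedding : ∀ i, ∀ O ⊆ dom i, IsOpen O → ∃ W : Set V, IsOpen W ∧ param i '' O = carrier ∩ W
  carrier_eq : carrier = ⋃ i, param i '' dom i
  /-- the changes of parameters preserve the orientation -/
  oriented : ∀ i j, ∀ u ∈ dom i, ∀ v ∈ dom j, param i u = param j v →
    ∀ A : (Fin k → ℝ) →ₗ[ℝ] (Fin k → ℝ),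
      (∀ w : Fin k → ℝ, (mfderiv 𝓘(ℝ, Fin k → ℝ) 𝓘(ℝ, E) (param i) u w : E) =
        (mfderiv 𝓘(ℝ, Fin k → ℝ) 𝓘(ℝ, E) (param j) v (A w) : E)) →
      0 < LinearMap.det A

namespace OrientedSubmanifold

variable {E : Type*} [NormedAddCommGroup E] [NormedSpace ℝ E]
variable {V : Type*} [TopologicalSpace V] [ChartedSpace E V] {k : ℕ}

/-- The part of the `i`-th domain whose image is not covered by the previous parametrizations:
the images of the pieces form a partition of the submanifold. -/
def piece (S : OrientedSubmanifold E V k) (i : ℕ) : Set (Fin k → ℝ) :=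
  {u ∈ S.dom i | ∀ j < i, S.param i u ∉ S.param j '' S.dom j}

/-- The coefficient of the pullback of `η` by the `i`-th parametrization,
`η(∂₁φ, …, ∂_kφ)`. -/
def coeff (S : OrientedSubmanifold E V k) (i : ℕ) (η : DForm E V k) (u : Fin k → ℝ) : ℝ :=
  pullback (S.param i) η u (fun l => Pi.single l (1 : ℝ))

/-- The current of integration `η ↦ ∫_{S ∩ A} η` on a subset `A` of the submanifold `S`. -/
def current (S : OrientedSubmanifold E V k) (A : Set V) (η : DForm E V k) : ℝ :=
  ∑' i, ∫ u in S.piece i ∩ S.param i ⁻¹' A, S.coeff i η u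

/-- Every test form is absolutely integrable over `S`, i.e. `S` has locally finite `k`-dimensional
area in `V`, so that the current of integration on `S` is defined. -/
def CarriesCurrent (S : OrientedSubmanifold E V k) : Prop :=
  ∀ η : DForm E V k, IsTestForm η → ∑' i, ∫⁻ u in S.piece i, ‖S.coeff i η u‖ₑ ≠ ⊤

end OrientedSubmanifold

/-! ### Contact manifolds and compatible Riemannian metrics -/

section Contact

variable {E : Type*} [NormedAddCommGroup E] [NormedSpace ℝ E]
variable {V : Type*} [TopologicalSpace V] [ChartedSpace E V]

/-- `θ` is a contact form: a smooth nowhere vanishing `1`-form whose differential is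
nondegenerate on the hyperplanes `ker θ`. -/
def IsContactForm (θ : V → E →L[ℝ] ℝ) : Prop :=
  IsSmoothForm (oneForm θ) ∧ ∀ x : V, θ x ≠ 0 ∧
    ∀ v : E, θ x v = 0 → (∀ w : E, θ x w = 0 → extD (oneForm θ) x ![v, w] = 0) → v = 0

/-- A smooth Riemannian metric as a family of bilinear functions on the tangent spaces. -/
def metricOf [IsManifold 𝓘(ℝ, E) ∞ V]
    (g : Bundle.ContMDiffRiemannianMetric 𝓘(ℝ, E) ∞ E (fun x : V => TangentSpace 𝓘(ℝ, E) x)) :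
    V → E → E → ℝ :=
  fun x v w => g.inner x v w

/-- `|θ|_g = 1` at every point. -/
def IsUnitForm (g : V → E → E → ℝ) (θ : V → E →L[ℝ] ℝ) : Prop :=
  ∀ x : V, ∀ e : Fin (Module.finrank ℝ E) → E, IsOrtho (g x) e → ∑ i, (θ x (e i)) ^ 2 = 1

/-- Same subRiemannian data: the same field of hyperplanes, and the same quadratic forms on
the hyperplanes. -/
def SameSubRiemannian (g : V → E → E → ℝ) (θ : V → E →L[ℝ] ℝ)
    (g' : V → E → E → ℝ) (θ' : V → E →L[ℝ] ℝ) : Prop :=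
  ∀ x : V, (∀ v : E, θ x v = 0 ↔ θ' x v = 0) ∧
    ∀ v w : E, θ x v = 0 → θ x w = 0 → g x v w = g' x v w

/-- The contact form `θ` is normalized by the quadratic forms on the hyperplanes: `(dθ)ⁿ` is
`± n!` times the volume form of `g` on `ker θ`, i.e. the matrix of `dθ` in
orthonormal bases of `ker θ` has determinant of absolute value `1`. This
determines `θ` up to sign from the hyperplanes and the quadratic forms on them. -/
def IsNormalized (n : ℕ) (g : V → E → E → ℝ) (θ : V → E →L[ℝ] ℝ) : Prop :=
  ∀ x : V, ∀ e : Fin (2 * n) → E, (∀ i, θ x (e i) = 0) → IsOrtho (g x) e →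
    |(Matrix.of fun i j => extD (oneForm θ) x ![e i, e j]).det| = 1

end Contact

/-! ### Heisenberg groups -/

/-- The Heisenberg group of dimension `2n+1` in exponential coordinates `(x, y, t)`. -/
abbrev Heis (n : ℕ) := (Fin n → ℝ) × (Fin n → ℝ) × ℝ

namespace Heis

variable {n : ℕ}

/-- The group law. -/
def mul (p q : Heis n) : Heis n :=
  (p.1 + q.1, p.2.1 + q.2.1,
    p.2.2 + q.2.2 + (1 / 2) * ∑ j, (p.1 j * q.2.1 j - p.2.1 j * q.1 j))

/-- The inverse for the group law. -/
def inv (p : Heis n) : Heis n := -p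

/-- The contact form `θ = dt - ½ ∑ (x_j dy_j - y_j dx_j)`. -/
def contact (n : ℕ) (p : Heis n) : Heis n →L[ℝ] ℝ :=
  LinearMap.toContinuousLinearMap
    { toFun := fun v => v.2.2 - (1 / 2) * ∑ j, (p.1 j * v.2.1 j - p.2.1 j * v.1 j)
      map_add' := by
        intro v w
        have h : ∑ j, (p.1 j * (v + w).2.1 j - p.2.1 j * (v + w).1 j) =
            ∑ j, (p.1 j * v.2.1 j - p.2.1 j * v.1 j) +
              ∑ j, (p.1 j * w.2.1 j - p.2.1 j * w.1 j) := by
          rw [← Finset.sum_add_distrib]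
          refine Finset.sum_congr rfl fun j _ => ?_
          simp only [Prod.fst_add, Prod.snd_add, Pi.add_apply]
          ring
        rw [h]
        simp only [Prod.snd_add]
        ring
      map_smul' := by
        intro c v
        have h : ∑ j, (p.1 j * (c • v).2.1 j - p.2.1 j * (c • v).1 j) =
            c * ∑ j, (p.1 j * v.2.1 j - p.2.1 j * v.1 j) := by
          rw [Finset.mul_sum]
          refine Finset.sum_congr rfl fun j _ => ?_
          simp only [Prod.smul_fst, Prod.smul_snd, Pi.smul_apply, smul_eq_mul]
          ring
        rw [h]
        simp only [Prod.smul_snd, smul_eq_mul, RingHom.id_apply]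
        ring }

/-- The left-invariant Riemannian metric `∑ (dx_j² + dy_j²) + θ²`, for which the left-invariant
fields `X_j = ∂_{x_j} - ½ y_j ∂_t`, `Y_j = ∂_{y_j} + ½ x_j ∂_t`, `Z = ∂_t` are orthonormal. -/
def metric (n : ℕ) (p v w : Heis n) : ℝ :=
  ∑ j, (v.1 j * w.1 j + v.2.1 j * w.2.1 j) + contact n p v * contact n p w

/-- The anisotropic dilation `s_r (x, y, t) = (r x, r y, r² t)`. -/
def dilation (r : ℝ) (p : Heis n) : Heis n := (r • p.1, r • p.2.1, r ^ 2 * p.2.2)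

/-- The Cygan-Korányi norm. -/
def gauge (p : Heis n) : ℝ :=
  ((∑ j, (p.1 j ^ 2 + p.2.1 j ^ 2)) ^ 2 + 16 * p.2.2 ^ 2) ^ (1 / 4 : ℝ)

/-- The left-invariant Cygan-Korányi distance. -/
def koranyiDist (p q : Heis n) : ℝ≥0∞ := ENNReal.ofReal (gauge (mul (inv p) q))

/-- Horizontal `C¹` curves parametrized by `[0, 1]`. -/
def IsHorizontalArc (γ : ℝ → Heis n) : Prop :=
  ContDiffOn ℝ 1 γ (Icc 0 1) ∧
    ∀ s ∈ Icc (0 : ℝ) 1, contact n (γ s) (derivWithin γ (Icc 0 1) s) = 0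

/-- The length of a horizontal curve parametrized by `[0, 1]`. -/
def arcLength (γ : ℝ → Heis n) : ℝ≥0∞ :=
  ∫⁻ s in Icc (0 : ℝ) 1, ENNReal.ofReal (Real.sqrt
    (∑ j, ((derivWithin γ (Icc 0 1) s).1 j ^ 2 + (derivWithin γ (Icc 0 1) s).2.1 j ^ 2)))

/-- The subRiemannian distance: infimum of the lengths of piecewise `C¹` horizontal curves (finite
concatenations of `C¹` horizontal arcs) from `p` to `q`. -/
def subRiemannianDist (p q : Heis n) : ℝ≥0∞ :=
  ⨅ (N : ℕ) (γ : ℕ → ℝ → Heis n) (_ : ∀ i ≤ N, IsHorizontalArc (γ i))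
    (_ : ∀ i < N, γ i 1 = γ (i + 1) 0) (_ : γ 0 0 = p) (_ : γ N 1 = q),
    ∑ i ∈ Finset.range (N + 1), arcLength (γ i)

end Heis

/-! ### Spherical Hausdorff measure -/

section Spherical

variable {X : Type*}

/-- The spherical Hausdorff outer measure of dimension `s` of a distance function `d`: the
supremum over `δ > 0` of the infima of `∑ (2 r_i)^s` over countable covers by
closed balls of radii `r_i ≤ δ`. -/
def sphericalOuter (d : X → X → ℝ≥0∞) (s : ℕ) : OuterMeasure X :=
  ⨆ (δ : ℝ≥0) (_ : 0 < δ), OuterMeasure.boundedBy fun A : Set X =>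
    ⨅ (p : X) (r : ℝ≥0) (_ : r ≤ δ) (_ : A ⊆ {q | d p q ≤ r}), (2 * (r : ℝ≥0∞)) ^ s

/-- The integral over `A` of `f` with respect to the spherical Hausdorff measure, i.e. the measure
given by the outer measure `sphericalOuter d s` on its Carathéodory `σ`-algebra. -/
def sphericalIntegral (d : X → X → ℝ≥0∞) (s : ℕ) (A : Set X) (f : X → ℝ≥0) : ℝ≥0∞ :=
  letI : MeasurableSpace X := (sphericalOuter d s).caratheodory
  ∫⁻ x, A.indicator (fun x => (f x : ℝ≥0∞)) x ∂((sphericalOuter d s).toMeasure le_rfl)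

end Spherical

end ObliqueMass

end

/-! Throughout, the submanifold has dimension `k + 1` and the spherical measure dimension `k + 2`.
The form `θ ∧ φ` depends only on the restriction of `φ` to the hyperplanes `ker θ`, and its norm,
for `|θ| = 1`, is the norm of that restriction. All three statements rest on this.

Dependence on the subRiemannian data. Two contact forms with the same kernel satisfy `θ = h θ'`.
Here `h ^ 2 = 1`: this is clear if `θ = θ'`; otherwise `dθ = h dθ'` on the kernel, so the
determinants that express the normalization differ by the factor `h ^ (2 * n)`
(`sq_apply_grad_eq_one`). Given a test form `φ`, project it onto the hyperplanes along the
`g'`-gradient of `θ'` and multiply by `h`; the resulting `ψ` satisfies `θ ∧ φ = θ' ∧ ψ`, and its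
`g'`-norm is the norm of the restriction of `φ` to the kernel, hence at most the `g`-norm of `φ`.
Thus each competitor for one oblique mass yields one for the other (`obliqueMass_le_of_eq_smul`).
The argument applies to any functional on forms.

Limit of rescaled masses. The dilation by `r` multiplies horizontal covectors by `r` and `θ` by `r ^
2`. Splitting a pulled-back form into its horizontal part and a multiple of `θ` bounds the mass of
the dilated current below by `r ^ (k + 2)` times the oblique mass (`obliqueMass_le_dilation`), and
above by the same quantity plus `r ^ (k + 1)` times the mass (`mass_dilation_le`). After division,
the extra term is the finite mass divided by `r`.

Density with respect to the spherical measure. The density turns out to be a constant. (a) The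
oblique mass of a Borel part of the submanifold is the integral of an oblique Jacobian, the supremum
of `θ ∧ ζ` on the tangent frame over unit left-invariant forms `ζ` (`obliqueMass_eq_oblMeas`);
nearly optimal choices of `ζ` on disjoint pieces are glued with bump functions. (b) The Jacobian
vanishes exactly where the tangent plane is horizontal, and the set of these points is null for the
spherical measure (`IsHomNorm.sphericalOuter_characteristic`): at small scale `τ` the vertical
extent is `o(τ)`, so few balls are needed. (c) At any other point the submanifold is close, at small
scales, to a vertical plane (`IsAdapted.exists_inv_plane_mul_le`), and in suitable coordinates of
that plane the Jacobian is a determinant (`exists_adapted`). The oblique mass of a ball of radius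
`r` is then almost at most `r ^ (k + 2)` times `sliceSup`, the largest volume of the sections of
unit balls by the plane, with almost equality for well chosen centers near the point. The upper
bound, summed over covers, estimates the oblique mass by the spherical measure; the lower bound
gives the converse by Vitali's theorem. (d) `sliceSup` is the same for all vertical planes of a
given dimension (`volume_slice_le_sliceSup`). Orthogonal maps of the horizontal layer need not
preserve the symplectic form, but inside a plane the discrepancy is a vertical shear, which
preserves volume. Of the two distances, only the properties collected in `IsHomNorm` are needed; in
particular, the distance to the origin depends only on `|z|` and `t`. -/

noncomputable section

namespace ObliqueMass

/-! ### Orthonormal frames and the Euclidean norm of alternating forms -/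

section Frames

variable {E : Type*} [NormedAddCommGroup E] [NormedSpace ℝ E]

/-- A function of two vectors which is an inner product. -/
structure IsInner (b : E → E → ℝ) : Prop where
  add_left : ∀ u v w, b (u + v) w = b u w + b v w
  smul_left : ∀ (c : ℝ) v w, b (c • v) w = c * b v w
  symm : ∀ v w, b v w = b w v
  pos : ∀ v, v ≠ 0 → 0 < b v v

namespace IsInner

variable {b : E → E → ℝ}

/-- The bilinear form of an inner product. -/
def bilin (hb : IsInner b) : LinearMap.BilinForm ℝ E :=
  LinearMap.mk₂ ℝ b hb.add_left hb.smul_left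
    (fun u v w => by rw [hb.symm, hb.add_left, hb.symm v, hb.symm w])
    (fun c v w => by rw [hb.symm, hb.smul_left, hb.symm w, smul_eq_mul])

@[simp] lemma bilin_apply (hb : IsInner b) (v w : E) : hb.bilin v w = b v w := rfl

lemma smul_right (hb : IsInner b) (c : ℝ) (v w : E) : b v (c • w) = c * b v w := by
  rw [hb.symm, hb.smul_left, hb.symm]

lemma sum_right (hb : IsInner b) {ι : Type*} [Fintype ι] (c : ι → ℝ) (e : ι → E) (v : E) :
    b v (∑ i, c i • e i) = ∑ i, c i * b v (e i) := by
  rw [← hb.bilin_apply, map_sum]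
  simp

lemma linearIndependent (hb : IsInner b) {ι : Type*} [Fintype ι] {e : ι → E} (he : IsOrtho b e) :
    LinearIndependent ℝ e := by
  classical
  rw [Fintype.linearIndependent_iff]
  intro c hc i
  have h := hb.sum_right c e (e i)
  rw [hc, Finset.sum_eq_single i, he.1, mul_one] at h
  · rw [← h, ← hb.bilin_apply, map_zero]
  · intro j _ hj
    rw [he.2 i j hj.symm, mul_zero]
  · simp

lemma expand (hb : IsInner b) [FiniteDimensional ℝ E] {ι : Type*} [Fintype ι] {e : ι → E}
    (he : IsOrtho b e) (hcard : Fintype.card ι = Module.finrank ℝ E) (v : E) :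
    v = ∑ i, b (e i) v • e i := by
  classical
  have hli := hb.linearIndependent he
  have hspan := hli.span_eq_top_of_card_eq_finrank' hcard
  obtain ⟨c, hc⟩ : ∃ c : ι → ℝ, ∑ i, c i • e i = v := by
    have : v ∈ Submodule.span ℝ (Set.range e) := hspan ▸ Submodule.mem_top
    exact (Submodule.mem_span_range_iff_exists_fun ℝ).1 this
  conv_lhs => rw [← hc]
  refine Finset.sum_congr rfl fun i _ => ?_
  rw [← hc, hb.sum_right, Finset.sum_eq_single i, he.1, mul_one]
  · intro j _ hj
    rw [he.2 i j hj.symm, mul_zero]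
  · simp

/-- Stated for a subspace because orthonormal frames are needed both in the whole tangent space and
in `ker θ`. -/
lemma restrict_exists (hb : IsInner b) (W : Submodule ℝ E) [FiniteDimensional ℝ W] {m : ℕ}
    (hm : Module.finrank ℝ W = m) :
    ∃ e : Fin m → E, (∀ i, e i ∈ W) ∧ IsOrtho b e := by
  subst hm
  obtain ⟨v, hv⟩ := LinearMap.BilinForm.exists_orthogonal_basis
    (B := hb.bilin.restrict W) ⟨fun x y => hb.symm x y⟩
  have hpos : ∀ i, 0 < b (v i) (v i) := fun i =>
    hb.pos _ (by simpa using v.ne_zero i)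
  refine ⟨fun i => (Real.sqrt (b (v i) (v i)))⁻¹ • (v i : E), fun i => W.smul_mem _ (v i).2, ?_, ?_⟩
  · intro i
    dsimp only
    rw [hb.smul_left, hb.smul_right, ← mul_assoc, ← mul_inv, Real.mul_self_sqrt (hpos i).le,
      inv_mul_cancel₀ (hpos i).ne']
  · intro i j hij
    have : b (v i) (v j) = 0 := hv hij
    dsimp only
    rw [hb.smul_left, hb.smul_right, this, mul_zero, mul_zero]

lemma exists_frame (hb : IsInner b) [FiniteDimensional ℝ E] :
    ∃ e : Fin (Module.finrank ℝ E) → E, IsOrtho b e := by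
  obtain ⟨e, -, he⟩ := hb.restrict_exists ⊤ (m := Module.finrank ℝ E) (by simp)
  exact ⟨e, he⟩

end IsInner

/-- The sum of the squares of all coefficients of an alternating form in a frame. -/
def fullSq {ι : Type*} [Fintype ι] {k : ℕ} (e : ι → E) (η : E [⋀^Fin k]→L[ℝ] ℝ) : ℝ :=
  ∑ I : Fin k → ι, (η (e ∘ I)) ^ 2

lemma fullSq_nonneg {ι : Type*} [Fintype ι] {k : ℕ} (e : ι → E) (η : E [⋀^Fin k]→L[ℝ] ℝ) :
    0 ≤ fullSq e η := Finset.sum_nonneg fun _ _ => sq_nonneg _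

lemma exists_unique_perm_strictMono {k m : ℕ} (I : Fin k → Fin m) (hI : Function.Injective I) :
    ∃! σ : Equiv.Perm (Fin k), StrictMono (I ∘ σ) := by
  refine ⟨Tuple.sort I, ?_, ?_⟩
  · exact (Tuple.monotone_sort I).strictMono_of_injective (hI.comp (Tuple.sort I).injective)
  · intro σ hσ
    rw [Tuple.eq_sort_iff]
    refine ⟨hσ.monotone, fun i j hij h => ?_⟩
    exact absurd (hσ hij) (by simp [h])

-- Coefficients with a repeated index vanish, and the others change only by a sign under
-- permutation, so each increasing multi-index is counted `k!` times. The sum over all multi-indices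
-- needs no order on the index type and behaves better under changes of frame; norm bounds therefore
-- take the form `fullSq ≤ k!` from here on.
open scoped Classical in
lemma fullSq_eq_factorial_mul_normSq {k m : ℕ} (e : Fin m → E) (η : E [⋀^Fin k]→L[ℝ] ℝ) :
    fullSq e η = (k.factorial : ℝ) * normSq e η := by
  have h1 : ∀ I : Fin k → Fin m, (η (e ∘ I)) ^ 2 =
      ∑ σ : Equiv.Perm (Fin k), if StrictMono (I ∘ σ) then (η (e ∘ I)) ^ 2 else 0 := by
    intro I
    by_cases hI : Function.Injective I
    · obtain ⟨σ, hσ, huniq⟩ := exists_unique_perm_strictMono I hI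
      rw [Finset.sum_eq_single σ, if_pos hσ]
      · intro τ _ hτ
        rw [if_neg fun h => hτ (huniq τ h)]
      · simp
    · have h0 : η (e ∘ I) = 0 := by
        simp only [Function.Injective, not_forall] at hI
        obtain ⟨i, j, hij, hne⟩ := hI
        exact η.map_eq_zero_of_eq _ (by simp [hij]) hne
      simp [h0]
  have h2 : ∀ (σ : Equiv.Perm (Fin k)) (I : Fin k → Fin m),
      (η (e ∘ I)) ^ 2 = (η (e ∘ (I ∘ σ))) ^ 2 := by
    intro σ I
    have : η (e ∘ (I ∘ σ)) = Equiv.Perm.sign σ • η (e ∘ I) :=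
      η.toAlternatingMap.map_perm (e ∘ I) σ
    rw [this]
    rcases Int.units_eq_one_or (Equiv.Perm.sign σ) with h | h <;> simp [h]
  unfold fullSq normSq
  rw [Finset.sum_congr rfl fun I _ => h1 I, Finset.sum_comm]
  have h3 : ∀ σ : Equiv.Perm (Fin k),
      (∑ I : Fin k → Fin m, if StrictMono (I ∘ σ) then (η (e ∘ I)) ^ 2 else 0) =
        ∑ I : Fin k → Fin m, if StrictMono I then (η (e ∘ I)) ^ 2 else 0 := by
    intro σ
    refine Fintype.sum_equiv (Equiv.arrowCongr σ.symm (Equiv.refl _)) _ _ fun I => ?_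
    have : (Equiv.arrowCongr σ.symm (Equiv.refl (Fin m))) I = I ∘ σ := by
      ext i; simp
    rw [this, h2 σ I]
  rw [Finset.sum_congr rfl fun σ _ => h3 σ, Finset.sum_const, Finset.card_univ,
    Fintype.card_perm, Fintype.card_fin, nsmul_eq_mul]

/-- The matrix of scalar products between two orthonormal frames is orthogonal; expanding
multilinearly, it cancels slot by slot. The two index types may differ, so that frames of the form
`(Z, u)` indexed by `Option` can be used. -/
lemma fullSq_eq_of_isOrtho [FiniteDimensional ℝ E] {b : E → E → ℝ} (hb : IsInner b)
    {ι κ : Type*} [Fintype ι] [Fintype κ] {e : ι → E} {f : κ → E}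
    (he : IsOrtho b e) (hf : IsOrtho b f) (hι : Fintype.card ι = Module.finrank ℝ E)
    (hκ : Fintype.card κ = Module.finrank ℝ E) {k : ℕ} (η : E [⋀^Fin k]→L[ℝ] ℝ) :
    fullSq f η = fullSq e η := by
  classical
  have horth : ∀ i j, ∑ l, b (e i) (f l) * b (e j) (f l) = if i = j then 1 else 0 := by
    intro i j
    have h := hb.sum_right (fun l => b (f l) (e j)) f (e i)
    rw [← hb.expand hf hκ (e j)] at h
    have h' : b (e i) (e j) = if i = j then 1 else 0 := by
      split_ifs with hij
      · rw [hij, he.1]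
      · exact he.2 i j hij
    rw [← h', h]
    refine Finset.sum_congr rfl fun l _ => ?_
    rw [hb.symm (f l), mul_comm]
  have hexp : ∀ I : Fin k → κ, η (f ∘ I) =
      ∑ J : Fin k → ι, (∏ l, b (e (J l)) (f (I l))) * η (e ∘ J) := by
    intro I
    have : f ∘ I = fun l => ∑ i, b (e i) (f (I l)) • e i := by
      ext1 l
      exact hb.expand he hι (f (I l))
    rw [this]
    have h2 := η.toContinuousMultilinearMap.toMultilinearMap.map_sum
      (fun (l : Fin k) (i : ι) => b (e i) (f (I l)) • e i)
    refine h2.trans (Finset.sum_congr rfl fun J _ => ?_)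
    exact η.toContinuousMultilinearMap.toMultilinearMap.map_smul_univ
      (fun l => b (e (J l)) (f (I l))) (fun l => e (J l))
  unfold fullSq
  calc ∑ I : Fin k → κ, (η (f ∘ I)) ^ 2
      = ∑ I : Fin k → κ, ∑ J : Fin k → ι, ∑ J' : Fin k → ι,
          (∏ l, b (e (J l)) (f (I l)) * b (e (J' l)) (f (I l))) * (η (e ∘ J) * η (e ∘ J')) := by
        refine Finset.sum_congr rfl fun I _ => ?_
        rw [hexp, sq, Finset.sum_mul_sum]
        refine Finset.sum_congr rfl fun J _ => Finset.sum_congr rfl fun J' _ => ?_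
        rw [Finset.prod_mul_distrib]; ring
    _ = ∑ J : Fin k → ι, ∑ J' : Fin k → ι, (∑ I : Fin k → κ,
          ∏ l, b (e (J l)) (f (I l)) * b (e (J' l)) (f (I l))) * (η (e ∘ J) * η (e ∘ J')) := by
        rw [Finset.sum_comm]
        refine Finset.sum_congr rfl fun J _ => ?_
        rw [Finset.sum_comm]
        refine Finset.sum_congr rfl fun J' _ => ?_
        rw [Finset.sum_mul]
    _ = ∑ J : Fin k → ι, (η (e ∘ J)) ^ 2 := by
        refine Finset.sum_congr rfl fun J _ => ?_
        -- Exchanging sum and product gives one factor for each slot, and each factor is the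
        -- orthogonality relation `horth`.
        have hprod : ∀ J' : Fin k → ι, (∑ I : Fin k → κ,
            ∏ l, b (e (J l)) (f (I l)) * b (e (J' l)) (f (I l))) = if J = J' then 1 else 0 := by
          intro J'
          have := (Finset.prod_univ_sum (fun _ : Fin k => (Finset.univ : Finset κ))
            (fun l i => b (e (J l)) (f i) * b (e (J' l)) (f i))).symm
          rw [Fintype.piFinset_univ] at this
          rw [this, Finset.prod_congr rfl fun l _ => horth (J l) (J' l)]
          split_ifs with h
          · subst h; simp
          · obtain ⟨l, hl⟩ := Function.ne_iff.1 h
            exact Finset.prod_eq_zero (Finset.mem_univ l) (by simp [hl])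
        rw [Finset.sum_eq_single J]
        · rw [hprod, if_pos rfl]; ring
        · intro J' _ hJ'
          rw [hprod, if_neg hJ'.symm, zero_mul]
        · simp

/-- The constraint `‖η‖_∞ ≤ 1` can be tested on one frame at each point. -/
lemma supNormLeOne_iff [FiniteDimensional ℝ E] {V : Type*} [TopologicalSpace V] [ChartedSpace E V]
    {g : V → E → E → ℝ} (hg : ∀ x, IsInner (g x))
    {ι : Type*} [Fintype ι] (hι : Fintype.card ι = Module.finrank ℝ E) {e : V → ι → E}
    (he : ∀ x, IsOrtho (g x) (e x)) {k : ℕ} (η : DForm E V k) :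
    SupNormLeOne g η ↔ ∀ x, fullSq (e x) (η x) ≤ (k.factorial : ℝ) := by
  have hk : (0 : ℝ) < (k.factorial : ℝ) := by exact_mod_cast k.factorial_pos
  have key : ∀ x (f : Fin (Module.finrank ℝ E) → E), IsOrtho (g x) f →
      (normSq f (η x) ≤ 1 ↔ fullSq (e x) (η x) ≤ (k.factorial : ℝ)) := by
    intro x f hf
    rw [← fullSq_eq_of_isOrtho (hg x) (he x) hf hι (by simp), fullSq_eq_factorial_mul_normSq]
    constructor
    · intro h; nlinarith
    · intro h; by_contra h'; nlinarith
  constructor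
  · intro h x
    obtain ⟨f, hf⟩ := (hg x).exists_frame
    exact (key x f hf).1 (h x f hf)
  · intro h x f hf
    exact (key x f hf).2 (h x)

end Frames

/-! ### Wedge products and contractions -/

section Wedge

variable {E : Type*} [NormedAddCommGroup E] [NormedSpace ℝ E]

lemma wedge_apply {V : Type*} {k : ℕ} (θ : V → E →L[ℝ] ℝ) (φ : DForm E V k) (x : V) (v : Fin (k + 1) → E) :
    wedge θ φ x v = ∑ i : Fin (k + 1), (-1) ^ (i : ℕ) * (θ x (v i) * φ x (i.removeNth v)) := by
  simp only [wedge, ContinuousAlternatingMap.alternatizeUncurryFin_apply]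
  simp

/-- The projection onto the kernel of `θ` along `Z`. -/
def horProj (θ : E →L[ℝ] ℝ) (Z : E) : E →L[ℝ] E :=
  ContinuousLinearMap.id ℝ E - θ.smulRight Z

@[simp] lemma horProj_apply (θ : E →L[ℝ] ℝ) (Z v : E) : horProj θ Z v = v - θ v • Z := rfl

/-- Expand the horizontal projection in all slots at once: a term with `Z` in two slots vanishes, so
only `φ v` and the terms with a single `Z` survive. This is the splitting of `φ` into a part that
kills `Z` and a multiple of `θ`. -/
lemma map_sub_smul_of_map_eq_zero {k : ℕ} (φ : E [⋀^Fin (k + 1)]→L[ℝ] ℝ) (θ : E →L[ℝ] ℝ) (Z : E)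
    (v : Fin (k + 1) → E) :
    φ v = φ (fun i => horProj θ Z (v i)) +
      ∑ i : Fin (k + 1), (-1) ^ (i : ℕ) * (θ (v i) * φ (Fin.cons Z (i.removeNth v))) := by
  classical
  set m' : Fin (k + 1) → E := fun i => (-θ (v i)) • Z with hm'
  have h1 : (fun i => horProj θ Z (v i)) = v + m' := by
    ext1 i; simp [hm', sub_eq_add_neg]
  have h2 : φ (v + m') = ∑ s : Finset (Fin (k + 1)), φ (s.piecewise v m') :=
    φ.toContinuousMultilinearMap.toMultilinearMap.map_add_univ v m'
  have h3 : ∀ i, φ (Finset.piecewise ({i}ᶜ : Finset (Fin (k + 1))) v m') =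
      -((-1) ^ (i : ℕ) * (θ (v i) * φ (Fin.cons Z (i.removeNth v)))) := by
    intro i
    have e1 : Finset.piecewise ({i}ᶜ : Finset (Fin (k + 1))) v m' =
        Function.update v i ((-θ (v i)) • Z) := by
      ext1 j
      by_cases hj : j = i
      · subst hj; simp [hm']
      · simp [hj]
    have e2 : Function.update v i Z = i.insertNth Z (i.removeNth v) := by
      rw [Fin.insertNth_removeNth]
    have e3 : φ (Function.update v i Z) = (-1) ^ (i : ℕ) * φ (Fin.cons Z (i.removeNth v)) := by
      rw [e2]
      have := φ.toAlternatingMap.map_insertNth i Z (i.removeNth v)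
      simpa [Matrix.vecCons] using this
    rw [e1, φ.map_update_smul, e3, smul_eq_mul]
    ring
  have h4 : ∑ s : Finset (Fin (k + 1)), φ (s.piecewise v m') =
      φ v + ∑ i, φ (Finset.piecewise ({i}ᶜ : Finset (Fin (k + 1))) v m') := by
    have hinj : Function.Injective fun i : Fin (k + 1) => ({i}ᶜ : Finset (Fin (k + 1))) :=
      fun i j h => by simpa using h
    have hnot : Finset.univ ∉ Finset.univ.image fun i : Fin (k + 1) =>
        ({i}ᶜ : Finset (Fin (k + 1))) := by simp
    rw [← Finset.sum_subset (Finset.subset_univ (insert Finset.univ (Finset.univ.image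
      fun i : Fin (k + 1) => ({i}ᶜ : Finset (Fin (k + 1)))))), Finset.sum_insert hnot,
      Finset.sum_image hinj.injOn]
    · simp
    · intro s _ hs
      simp only [Finset.mem_insert, Finset.mem_image, Finset.mem_univ, true_and, not_or,
        not_exists] at hs
      have hne : sᶜ.Nonempty := by
        rw [Finset.nonempty_iff_ne_empty, Ne, Finset.compl_eq_empty_iff]; exact hs.1
      obtain ⟨i, hi⟩ := hne
      have : ∃ j ∈ sᶜ, j ≠ i := by
        by_contra! hcon
        refine hs.2 i ?_
        rw [← compl_compl s]
        congr 1
        ext j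
        simp only [Finset.mem_singleton]
        exact ⟨fun h => by rw [h]; exact hi, fun h => hcon j h⟩
      obtain ⟨j, hj, hji⟩ := this
      rw [Finset.mem_compl] at hi hj
      have : s.piecewise v m' = Function.update (Function.update (s.piecewise v m') i
          ((-θ (v i)) • Z)) j ((-θ (v j)) • Z) := by
        ext1 l
        by_cases hl : l = j
        · subst hl; simp [hj, hm']
        · by_cases hl' : l = i
          · subst hl'; simp [hi, hl, hm']
          · simp [hl, hl']
      rw [this, φ.map_update_smul, Function.update_comm hji.symm, φ.map_update_smul]
      rw [φ.map_eq_zero_of_eq _ (i := i) (j := j) (by simp [Function.update_of_ne hji]) hji.symm]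
      simp
  rw [h1, h2, h4, Finset.sum_congr rfl fun i _ => h3 i]
  simp


/-- The frame `(Z, u)`. -/
def consFrame {ι : Type*} (Z : E) (u : ι → E) : Option ι → E := fun o => o.elim Z u

@[simp] lemma consFrame_none {E ι : Type*} (Z : E) (u : ι → E) : consFrame Z u none = Z := rfl

@[simp] lemma consFrame_some {E ι : Type*} (Z : E) (u : ι → E) (i : ι) :
    consFrame Z u (some i) = u i := rfl

lemma sum_option_pi {ι : Type*} [Fintype ι] {k : ℕ} (f : (Fin k → Option ι) → ℝ)
    (hf : ∀ I i, I i = none → f I = 0) :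
    ∑ I, f I = ∑ J : Fin k → ι, f (fun i => some (J i)) := by
  symm
  refine Finset.sum_of_injOn (fun J i => some (J i)) ?_ (by simp) ?_ (by simp)
  · intro J _ J' _ h
    ext1 i
    exact Option.some_injective _ (congrFun h i)
  · intro I _ hI
    by_cases h : ∃ i, I i = none
    · obtain ⟨i, hi⟩ := h
      exact hf I i hi
    · push Not at h
      refine absurd ?_ hI
      have : ∀ i, ∃ j, I i = some j := fun i => Option.ne_none_iff_exists'.1 (h i)
      choose J hJ using this
      exact ⟨J, by simp, by ext1 i; simp [hJ]⟩

variable {ι : Type*} [Fintype ι]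

/-- The contraction of an alternating form with a vector. -/
def contract {k : ℕ} (Z : E) (η : E [⋀^Fin (k + 1)]→L[ℝ] ℝ) : E [⋀^Fin k]→L[ℝ] ℝ :=
  η.curryLeft Z

@[simp] lemma contract_apply {k : ℕ} (Z : E) (η : E [⋀^Fin (k + 1)]→L[ℝ] ℝ) (v : Fin k → E) :
    contract Z η v = η (Fin.cons Z v) := rfl

/-- The coefficients without `Z` are among all coefficients: restriction to the hyperplane spanned
by `u` does not increase the norm. -/
lemma fullSq_le_fullSq_consFrame {k : ℕ} (Z : E) (u : ι → E) (φ : E [⋀^Fin k]→L[ℝ] ℝ) :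
    fullSq u φ ≤ fullSq (consFrame Z u) φ := by
  unfold fullSq
  have hinj : Function.Injective fun (J : Fin k → ι) (i : Fin k) => some (J i) :=
    fun J J' h => by ext1 i; exact Option.some_injective _ (congrFun h i)
  calc ∑ J : Fin k → ι, (φ (u ∘ J)) ^ 2
      = ∑ J : Fin k → ι, (φ (consFrame Z u ∘ fun i => some (J i))) ^ 2 := rfl
    _ = ∑ I ∈ Finset.univ.map ⟨_, hinj⟩, (φ (consFrame Z u ∘ I)) ^ 2 := by
        rw [Finset.sum_map]; rfl
    _ ≤ _ := Finset.sum_le_sum_of_subset_of_nonneg (Finset.subset_univ _)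
        fun _ _ _ => sq_nonneg _

/-- The projection kills `Z` and fixes the vectors of `u`, so only purely horizontal coefficients
remain. The projected form is thus the extension of least norm of the restriction of `φ` to the
hyperplane. -/
lemma fullSq_consFrame_horProj {k : ℕ} {θ : E →L[ℝ] ℝ} {Z : E} {u : ι → E} (hZ : θ Z = 1)
    (hu : ∀ i, θ (u i) = 0) (φ : E [⋀^Fin k]→L[ℝ] ℝ) :
    fullSq (consFrame Z u) (φ.compContinuousLinearMap (horProj θ Z)) = fullSq u φ := by
  unfold fullSq
  rw [sum_option_pi]
  · refine Finset.sum_congr rfl fun J _ => ?_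
    have : horProj θ Z ∘ (consFrame Z u ∘ fun i => some (J i)) = u ∘ J := by
      ext1 i; simp [hu]
    rw [ContinuousAlternatingMap.compContinuousLinearMap_apply, this]
  · intro I i hi
    rw [ContinuousAlternatingMap.compContinuousLinearMap_apply]
    rw [φ.map_coord_zero i (by simp [hi, hZ])]
    simp

/-- In a nonzero coefficient `Z` fills at most one slot; there are `k + 1` choices for this slot,
and they all contribute equally because moving `Z` to the front costs only a sign. -/
lemma fullSq_consFrame_succ {k : ℕ} (Z : E) (u : ι → E) (η : E [⋀^Fin (k + 1)]→L[ℝ] ℝ) :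
    fullSq (consFrame Z u) η = fullSq u η + (k + 1) * fullSq u (contract Z η) := by
  classical
  set e := consFrame Z u with he
  have h1 : ∀ I : Fin (k + 1) → Option ι, (η (e ∘ I)) ^ 2 =
      (if ∀ i, I i ≠ none then (η (e ∘ I)) ^ 2 else 0) +
        ∑ j, if I j = none then (η (e ∘ I)) ^ 2 else 0 := by
    intro I
    by_cases h : ∃ i, I i = none
    · obtain ⟨i, hi⟩ := h
      rw [if_neg (by push Not; exact ⟨i, hi⟩), zero_add]
      rw [Finset.sum_eq_single i, if_pos hi]
      · intro j _ hji
        split_ifs with hj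
        · rw [η.map_eq_zero_of_eq (e ∘ I) (i := i) (j := j) (by simp [hi, hj]) hji.symm]
          simp
        · rfl
      · simp
    · push Not at h
      rw [if_pos h, Finset.sum_eq_zero, add_zero]
      intro j _
      rw [if_neg (h j)]
  have h2 : ∀ j : Fin (k + 1), (∑ I : Fin (k + 1) → Option ι,
      if I j = none then (η (e ∘ I)) ^ 2 else 0) = fullSq u (contract Z η) := by
    intro j
    rw [← (Fin.insertNthEquiv (fun _ => Option ι) j).sum_comp, Fintype.sum_prod_type,
      Finset.sum_eq_single none]
    · have h3 : ∀ I' : Fin k → Option ι,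
          (η (e ∘ j.insertNth (α := fun _ => Option ι) none I')) ^ 2 =
            (η (Fin.cons Z (e ∘ I'))) ^ 2 := by
        intro I'
        have e1 : e ∘ j.insertNth (α := fun _ => Option ι) none I' = j.insertNth Z (e ∘ I') := by
          ext1 i
          refine Fin.succAboveCases j ?_ (fun l => ?_) i <;> simp [he]
        have e2 : η (j.insertNth Z (e ∘ I')) = (-1) ^ (j : ℕ) * η (Fin.cons Z (e ∘ I')) := by
          have := η.toAlternatingMap.map_insertNth j Z (e ∘ I')
          simpa [Matrix.vecCons] using this
        rw [e1, e2, mul_pow, ← pow_mul, mul_comm (j : ℕ), pow_mul]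
        simp
      have h4 : ∀ I' : Fin k → Option ι, (if (Fin.insertNthEquiv (fun _ => Option ι) j (none, I')) j
          = none then (η (e ∘ (Fin.insertNthEquiv (fun _ => Option ι) j (none, I')))) ^ 2 else 0) =
            (η (Fin.cons Z (e ∘ I'))) ^ 2 := by
        intro I'
        rw [if_pos (by simp)]
        exact h3 I'
      rw [Finset.sum_congr rfl fun I' _ => h4 I']
      unfold fullSq
      rw [sum_option_pi]
      · rfl
      · intro I i hi
        rw [η.map_eq_zero_of_eq _ (i := 0) (j := i.succ) (by simp [hi, he])
          (Fin.succ_ne_zero i).symm]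
        simp
    · intro o _ ho
      refine Finset.sum_eq_zero fun I _ => ?_
      simp [ho]
    · simp
  unfold fullSq at h2 ⊢
  rw [Finset.sum_congr rfl fun I _ => h1 I, Finset.sum_add_distrib, Finset.sum_comm,
    Finset.sum_congr rfl fun j _ => h2 j, sum_option_pi]
  · simp [he, Function.comp_def]
  · intro I i hi
    rw [if_neg]
    push Not
    exact ⟨i, hi⟩

lemma contract_wedge {V : Type*} {k : ℕ} (θ : V → E →L[ℝ] ℝ) (φ : DForm E V k) (x : V) {Z : E}
    (hZ : θ x Z = 1) (v : Fin k → E) (hv : ∀ i, θ x (v i) = 0) :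
    contract Z (wedge θ φ x) v = φ x v := by
  rw [contract_apply, wedge_apply, Fin.sum_univ_succ]
  simp [hZ, hv]

/-- The form `θ ∧ φ` has no purely horizontal coefficient. The factor `k + 1` is `(k + 1)! / k!`, so
in terms of Euclidean norms `|θ ∧ φ|` is the norm of `φ` on the hyperplane. -/
lemma fullSq_consFrame_wedge {V : Type*} {k : ℕ} (θ : V → E →L[ℝ] ℝ) (φ : DForm E V k) (x : V)
    {Z : E} {u : ι → E} (hZ : θ x Z = 1) (hu : ∀ i, θ x (u i) = 0) :
    fullSq (consFrame Z u) (wedge θ φ x) = (k + 1) * fullSq u (φ x) := by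
  rw [fullSq_consFrame_succ]
  have h1 : fullSq u (wedge θ φ x) = 0 := by
    unfold fullSq
    refine Finset.sum_eq_zero fun I _ => ?_
    rw [wedge_apply, Finset.sum_eq_zero, sq, zero_mul]
    intro i _
    simp [hu]
  have h2 : fullSq u (contract Z (wedge θ φ x)) = fullSq u (φ x) := by
    unfold fullSq
    refine Finset.sum_congr rfl fun I _ => ?_
    rw [contract_wedge θ φ x hZ (u ∘ I) (fun i => hu (I i))]
  rw [h1, h2, zero_add]

/-- The difference between a vector and its projection is a multiple of `Z`, which already fills the
first slot. -/
lemma contract_horProj {k : ℕ} (θ : E →L[ℝ] ℝ) (Z : E) (η : E [⋀^Fin (k + 1)]→L[ℝ] ℝ)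
    (w : Fin k → E) : contract Z η (fun i => horProj θ Z (w i)) = contract Z η w := by
  cases k with
  | zero => congr 1; exact Subsingleton.elim _ _
  | succ k =>
    rw [map_sub_smul_of_map_eq_zero (contract Z η) θ Z w, Finset.sum_eq_zero, add_zero]
    intro i _
    rw [contract_apply, η.map_eq_zero_of_eq _ (i := 0) (j := 1) rfl (by simp)]
    ring

/-- A form splits into its horizontal part and a multiple of `θ`. -/
lemma eq_horProj_add_wedge {V : Type*} {k : ℕ} (θ : V → E →L[ℝ] ℝ) (Z : V → E)
    (η : DForm E V (k + 1)) (x : V) :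
    η x = (η x).compContinuousLinearMap (horProj (θ x) (Z x)) +
      wedge θ (fun y => contract (Z y) (η y)) x := by
  ext v
  rw [ContinuousAlternatingMap.add_apply, wedge_apply,
    map_sub_smul_of_map_eq_zero (η x) (θ x) (Z x) v]
  rfl

end Wedge

/-! ### Smoothness of fields of alternating forms -/

section Smooth

variable {E : Type*} [NormedAddCommGroup E] [NormedSpace ℝ E] [FiniteDimensional ℝ E]

/-- The coefficients of an alternating form in a basis, as a linear map. -/
def coeffLM (E : Type*) [NormedAddCommGroup E] [NormedSpace ℝ E] [FiniteDimensional ℝ E] (k : ℕ) :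
    (E [⋀^Fin k]→L[ℝ] ℝ) →ₗ[ℝ] ((Fin k → Fin (Module.finrank ℝ E)) → ℝ) where
  toFun φ I := φ (Module.finBasis ℝ E ∘ I)
  map_add' _ _ := rfl
  map_smul' _ _ := rfl

lemma coeffLM_injective (k : ℕ) : Function.Injective (coeffLM E k) := by
  intro φ ψ h
  have : φ.toMultilinearMap = ψ.toMultilinearMap :=
    Module.Basis.ext_multilinear (fun _ => Module.finBasis ℝ E) fun I => congrFun h I
  ext v
  exact congrArg (fun f => f v) this

instance finiteDimensional_alternating (k : ℕ) : FiniteDimensional ℝ (E [⋀^Fin k]→L[ℝ] ℝ) :=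
  Module.Finite.of_injective (coeffLM E k) (coeffLM_injective k)

variable {X : Type*} [NormedAddCommGroup X] [NormedSpace ℝ X] {n : WithTop ℕ∞} {s : Set X} {x : X}
  {k : ℕ}

/-- In finite dimension a form is recovered linearly from finitely many of its values, through a
left inverse of the coefficient map. -/
lemma contDiffWithinAt_form_of_apply {f : X → E [⋀^Fin k]→L[ℝ] ℝ}
    (h : ∀ v, ContDiffWithinAt ℝ n (fun y => f y v) s x) : ContDiffWithinAt ℝ n f s x := by
  obtain ⟨L, hL⟩ := (coeffLM E k).exists_leftInverse_of_injective
    (LinearMap.ker_eq_bot.2 (coeffLM_injective k))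
  have h1 : ContDiffWithinAt ℝ n (fun y => coeffLM E k (f y)) s x :=
    contDiffWithinAt_pi.2 fun I => h _
  have h2 := (LinearMap.toContinuousLinearMap L).contDiff.contDiffAt.comp_contDiffWithinAt x h1
  refine h2.congr_of_eventuallyEq (Eventually.of_forall fun y => ?_) ?_
  · exact (LinearMap.congr_fun hL (f y)).symm
  · exact (LinearMap.congr_fun hL (f x)).symm

lemma contDiffWithinAt_form_apply {f : X → E [⋀^Fin k]→L[ℝ] ℝ} {w : Fin k → X → E}
    (hf : ContDiffWithinAt ℝ n f s x) (hw : ∀ i, ContDiffWithinAt ℝ n (w i) s x) :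
    ContDiffWithinAt ℝ n (fun y => f y (fun i => w i y)) s x := by
  classical
  set b := Module.finBasis ℝ E
  have h1 : ∀ y, f y (fun i => w i y) =
      ∑ J : Fin k → Fin (Module.finrank ℝ E), (∏ l, b.coord (J l) (w l y)) * f y (b ∘ J) := by
    intro y
    have : (fun i => w i y) = fun i => ∑ j, b.coord j (w i y) • b j := by
      ext1 i
      exact (b.sum_repr (w i y)).symm
    rw [this]
    refine ((f y).toMultilinearMap.map_sum
      (fun (l : Fin k) j => b.coord j (w l y) • b j)).trans (Finset.sum_congr rfl fun J _ => ?_)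
    exact (f y).toMultilinearMap.map_smul_univ (fun l => b.coord (J l) (w l y)) (fun l => b (J l))
  simp_rw [h1]
  refine ContDiffWithinAt.sum fun J _ => ContDiffWithinAt.mul ?_ ?_
  · refine contDiffWithinAt_prod fun l _ => ?_
    exact (LinearMap.toContinuousLinearMap (b.coord (J l))).contDiff.contDiffAt.comp_contDiffWithinAt
      x (hw l)
  · exact (ContinuousAlternatingMap.apply ℝ E ℝ (b ∘ J)).contDiff.contDiffAt.comp_contDiffWithinAt
      x hf

lemma contDiffWithinAt_form_comp {F : Type*} [NormedAddCommGroup F] [NormedSpace ℝ F]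
    [FiniteDimensional ℝ F] {f : X → E [⋀^Fin k]→L[ℝ] ℝ} {L : X → F →L[ℝ] E}
    (hf : ContDiffWithinAt ℝ n f s x) (hL : ∀ v, ContDiffWithinAt ℝ n (fun y => L y v) s x) :
    ContDiffWithinAt ℝ n (fun y => (f y).compContinuousLinearMap (L y)) s x :=
  contDiffWithinAt_form_of_apply fun v =>
    contDiffWithinAt_form_apply (w := fun i y => L y (v i)) hf fun i => hL (v i)

end Smooth

/-! ### Forms and currents on a vector space -/

section Model

variable {E : Type*} [NormedAddCommGroup E] [NormedSpace ℝ E]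

lemma chartForm_model {k : ℕ} (η : DForm E E k) (x : E) : chartForm η x = η := by
  funext y
  have : mfderiv 𝓘(ℝ, E) 𝓘(ℝ, E) (chartAt E x).symm y = ContinuousLinearMap.id ℝ E := by
    simp only [chartAt_self_eq, OpenPartialHomeomorph.refl_symm]
    exact mfderiv_id
  unfold chartForm pullback
  rw [this]
  rfl

lemma isSmoothForm_model_iff {k : ℕ} (η : DForm E E k) : IsSmoothForm η ↔ ContDiff ℝ ∞ η := by
  unfold IsSmoothForm
  simp_rw [chartForm_model, chartAt_self_eq]
  simp [contDiffOn_univ]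

lemma IsTestForm.of_subset {k l : ℕ} {η : DForm E E k} {φ : DForm E E l} (hη : IsTestForm η)
    (hφ : ContDiff ℝ ∞ φ) (h : ∀ x, η x = 0 → φ x = 0) : IsTestForm φ :=
  ⟨(isSmoothForm_model_iff φ).2 hφ, hη.2.of_isClosed_subset isClosed_closure
    (closure_mono fun x hx h0 => hx (h x h0))⟩

lemma IsTestForm.contDiff {k : ℕ} {η : DForm E E k} (hη : IsTestForm η) : ContDiff ℝ ∞ η :=
  (isSmoothForm_model_iff η).1 hη.1

lemma pullback_model {k : ℕ} (f : E → E) (L : E →L[ℝ] E) (hf : ∀ x, f x = L x) (η : DForm E E k)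
    (x : E) : pullback f η x = (η (L x)).compContinuousLinearMap L := by
  have hfL : f = L := funext hf
  subst hfL
  unfold pullback
  rw [mfderiv_eq_fderiv, L.fderiv]

namespace OrientedSubmanifold

variable {k : ℕ} (S : OrientedSubmanifold E E k)

/-- The derivative of the `i`-th parametrization. -/
def tangent (i : ℕ) (u : Fin k → ℝ) : (Fin k → ℝ) →L[ℝ] E := fderiv ℝ (S.param i) u

lemma contDiffOn_param (i : ℕ) : ContDiffOn ℝ 1 (S.param i) (S.dom i) :=
  contMDiffOn_iff_contDiffOn.1 (S.contMDiffOn_param i)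

lemma continuousOn_tangent (i : ℕ) : ContinuousOn (S.tangent i) (S.dom i) :=
  (S.contDiffOn_param i).continuousOn_fderiv_of_isOpen (S.isOpen_dom i) le_rfl

lemma continuousOn_param (i : ℕ) : ContinuousOn (S.param i) (S.dom i) :=
  (S.contDiffOn_param i).continuousOn

lemma tangent_injective (i : ℕ) {u : Fin k → ℝ} (hu : u ∈ S.dom i) :
    Function.Injective (S.tangent i u) := by
  have := S.immersion i u hu
  rwa [mfderiv_eq_fderiv] at this

lemma coeff_eq (i : ℕ) (η : DForm E E k) (u : Fin k → ℝ) :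
    S.coeff i η u = η (S.param i u) fun l => S.tangent i u (Pi.single l 1) := by
  unfold coeff pullback
  rw [mfderiv_eq_fderiv]
  rfl

lemma continuousOn_coeff [FiniteDimensional ℝ E] (i : ℕ) {η : DForm E E k} (hη : Continuous η) :
    ContinuousOn (S.coeff i η) (S.dom i) := by
  rw [show S.coeff i η = fun u => η (S.param i u) fun l => S.tangent i u (Pi.single l 1) from
    funext fun u => S.coeff_eq i η u]
  intro u hu
  have h1 : ContDiffWithinAt ℝ 0 (fun p : (E [⋀^Fin k]→L[ℝ] ℝ) × (Fin k → E) => p.1 p.2) univ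
      (η (S.param i u), fun l => S.tangent i u (Pi.single l 1)) := by
    refine contDiffWithinAt_form_apply (f := fun p : (E [⋀^Fin k]→L[ℝ] ℝ) × (Fin k → E) => p.1)
      (w := fun i p => p.2 i) contDiff_fst.contDiffWithinAt fun i => ?_
    exact ((ContinuousLinearMap.proj (R := ℝ) (φ := fun _ : Fin k => E) i).contDiff.comp
      contDiff_snd).contDiffWithinAt
  have h2 : ContinuousWithinAt (fun u => ((η (S.param i u), fun l => S.tangent i u (Pi.single l 1)) :
      (E [⋀^Fin k]→L[ℝ] ℝ) × (Fin k → E))) (S.dom i) u := by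
    refine ContinuousWithinAt.prodMk ?_ ?_
    · exact hη.continuousAt.comp_continuousWithinAt (S.continuousOn_param i u hu)
    · rw [continuousWithinAt_pi]
      intro l
      exact (S.continuousOn_tangent i u hu).clm_apply continuousWithinAt_const
  exact ContinuousWithinAt.comp (g := fun p : (E [⋀^Fin k]→L[ℝ] ℝ) × (Fin k → E) => p.1 p.2)
    (x := u) h1.continuousWithinAt h2 (mapsTo_univ _ _)

lemma piece_subset (i : ℕ) : S.piece i ⊆ S.dom i := fun _ hu => hu.1

/-- By `embedding`, the image of an earlier parametrization is relatively open in the submanifold,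
so its preimage in `dom i` is open. -/
lemma measurableSet_piece (i : ℕ) : MeasurableSet (S.piece i) := by
  have h1 : ∀ j, MeasurableSet {u ∈ S.dom i | S.param i u ∉ S.param j '' S.dom j} := by
    intro j
    obtain ⟨W, hW, hjW⟩ := S.embedding j (S.dom j) subset_rfl (S.isOpen_dom j)
    have : {u ∈ S.dom i | S.param i u ∉ S.param j '' S.dom j} =
        S.dom i \ (S.dom i ∩ S.param i ⁻¹' W) := by
      ext u
      simp only [mem_ofPred_eq, Set.mem_sdiff, mem_inter_iff, mem_preimage, hjW]
      constructor
      · rintro ⟨h, h'⟩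
        refine ⟨h, fun h'' => h' ⟨?_, h''.2⟩⟩
        rw [S.carrier_eq]
        exact mem_iUnion.2 ⟨i, mem_image_of_mem _ h⟩
      · rintro ⟨h, h'⟩
        exact ⟨h, fun h'' => h' ⟨h, h''.2⟩⟩
    rw [this]
    exact (S.isOpen_dom i).measurableSet.diff
      ((S.continuousOn_param i).isOpen_inter_preimage (S.isOpen_dom i) hW).measurableSet
  have : S.piece i = S.dom i ∩ ⋂ (j : ℕ) (_ : j < i),
      {u ∈ S.dom i | S.param i u ∉ S.param j '' S.dom j} := by
    ext u
    simp only [piece, mem_ofPred_eq, mem_inter_iff, mem_iInter]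
    constructor
    · rintro ⟨h, h'⟩
      exact ⟨h, fun j hj => ⟨h, h' j hj⟩⟩
    · rintro ⟨h, h'⟩
      exact ⟨h, fun j hj => (h' j hj).2⟩
  rw [this]
  exact (S.isOpen_dom i).measurableSet.inter
    (MeasurableSet.iInter fun j => MeasurableSet.iInter fun _ => h1 j)

/-- The part of the `i`-th piece which is mapped into `A`. -/
def part (A : Set E) (i : ℕ) : Set (Fin k → ℝ) := S.piece i ∩ S.param i ⁻¹' A

lemma part_subset (A : Set E) (i : ℕ) : S.part A i ⊆ S.piece i := inter_subset_left

lemma measurableSet_part [MeasurableSpace E] [BorelSpace E] {A : Set E} (hA : MeasurableSet A)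
    (i : ℕ) : MeasurableSet (S.part A i) := by
  have h1 : Measurable fun u : S.piece i => S.param i u :=
    (continuousOn_iff_continuous_domRestrict.1
      ((S.continuousOn_param i).mono (S.piece_subset i))).measurable
  have h2 := (MeasurableEmbedding.subtype_coe (S.measurableSet_piece i)).measurableSet_image.2
    (h1 hA)
  convert h2 using 1
  ext u
  simp [part, and_comm]

variable {S}

lemma integrableOn_coeff [FiniteDimensional ℝ E] (hS : S.CarriesCurrent) {η : DForm E E k}
    (hη : IsTestForm η) (i : ℕ) : IntegrableOn (S.coeff i η) (S.piece i) := by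
  refine ⟨((S.continuousOn_coeff i hη.contDiff.continuous).mono
    (S.piece_subset i)).aestronglyMeasurable (S.measurableSet_piece i), ?_⟩
  exact lt_of_le_of_lt (ENNReal.le_tsum i) (hS η hη).lt_top

lemma summable_integral_coeff [FiniteDimensional ℝ E] (hS : S.CarriesCurrent)
    {η : DForm E E k} (hη : IsTestForm η) (A : Set E) :
    Summable fun i => ∫ u in S.piece i ∩ S.param i ⁻¹' A, S.coeff i η u := by
  refine Summable.of_norm (Summable.of_nonneg_of_le (fun _ => norm_nonneg _) (fun i => ?_)
    (ENNReal.summable_toReal (hS η hη)))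
  refine (norm_integral_le_lintegral_norm _).trans ?_
  refine ENNReal.toReal_mono
    (lt_of_le_of_lt (ENNReal.le_tsum i) (hS η hη).lt_top).ne ?_
  simp_rw [ofReal_norm]
  exact lintegral_mono_set inter_subset_left

/-- Additivity requires integrability, hence test forms. Homogeneity in `current_smul` holds for
every form, because integrals and sums without convergence are zero by convention. -/
lemma current_add [FiniteDimensional ℝ E] (hS : S.CarriesCurrent) {η φ : DForm E E k}
    (hη : IsTestForm η) (hφ : IsTestForm φ) (A : Set E) :
    S.current A (fun x => η x + φ x) = S.current A η + S.current A φ := by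
  unfold current
  rw [← (summable_integral_coeff hS hη A).tsum_add (summable_integral_coeff hS hφ A)]
  congr 1
  funext i
  rw [← integral_add ((integrableOn_coeff hS hη i).mono_set inter_subset_left)
    ((integrableOn_coeff hS hφ i).mono_set inter_subset_left)]
  rfl

lemma current_smul (c : ℝ) (η : DForm E E k) (A : Set E) :
    S.current A (fun x => c • η x) = c * S.current A η := by
  unfold current
  rw [← tsum_mul_left]
  congr 1
  funext i
  rw [← integral_const_mul]
  rfl

end OrientedSubmanifold

end Model

/-! ### Forms on the Heisenberg group, dilations, and the limit of rescaled masses. -/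

namespace Heis

variable {n : ℕ}

lemma contact_apply (p v : Heis n) :
    contact n p v = v.2.2 - (1 / 2) * ∑ j, (p.1 j * v.2.1 j - p.2.1 j * v.1 j) := rfl

/-- The vertical vector `∂_t`. -/
def vert (n : ℕ) : Heis n := (0, 0, 1)

/-- The left-invariant horizontal frame `X_j, Y_j`. -/
def horFrame (p : Heis n) : Fin n ⊕ Fin n → Heis n
  | .inl j => (Pi.single j 1, 0, -(1 / 2) * p.2.1 j)
  | .inr j => (0, Pi.single j 1, (1 / 2) * p.1 j)

/-- The left-invariant frame `Z, X_j, Y_j`. -/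
def frame (p : Heis n) : Option (Fin n ⊕ Fin n) → Heis n := consFrame (vert n) (horFrame p)

@[simp] lemma contact_vert (p : Heis n) : contact n p (vert n) = 1 := by
  simp [contact_apply, vert]

@[simp] lemma contact_horFrame (p : Heis n) (i : Fin n ⊕ Fin n) :
    contact n p (horFrame p i) = 0 := by
  rcases i with j | j
  · simp [contact_apply, horFrame, Pi.single_apply]
  · simp [contact_apply, horFrame, Pi.single_apply]

lemma isInner_metric (p : Heis n) : IsInner (metric n p) where
  add_left u v w := by
    simp only [metric, map_add, Prod.fst_add, Prod.snd_add, Pi.add_apply, add_mul]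
    simp only [Finset.sum_add_distrib]
    ring
  smul_left c v w := by
    simp only [metric, map_smul, Prod.smul_fst, Prod.smul_snd, Pi.smul_apply, smul_eq_mul, mul_add,
      Finset.mul_sum, mul_assoc]
  symm v w := by
    simp only [metric, mul_comm]
  pos v hv := by
    have h1 : 0 ≤ ∑ j, (v.1 j * v.1 j + v.2.1 j * v.2.1 j) :=
      Finset.sum_nonneg fun j _ => add_nonneg (mul_self_nonneg _) (mul_self_nonneg _)
    have h2 := mul_self_nonneg (contact n p v)
    unfold metric
    by_contra hcon
    have h3 : ∑ j, (v.1 j * v.1 j + v.2.1 j * v.2.1 j) = 0 := by linarith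
    have h4 : contact n p v = 0 := by
      have : contact n p v * contact n p v = 0 := by linarith
      exact mul_self_eq_zero.1 this
    rw [Finset.sum_eq_zero_iff_of_nonneg
      fun j _ => add_nonneg (mul_self_nonneg _) (mul_self_nonneg _)] at h3
    have h5 : ∀ j, v.1 j = 0 ∧ v.2.1 j = 0 := fun j => by
      have := h3 j (Finset.mem_univ j)
      constructor <;> nlinarith [mul_self_nonneg (v.1 j), mul_self_nonneg (v.2.1 j)]
    rw [contact_apply] at h4
    simp only [h5, mul_zero, sub_zero, Finset.sum_const_zero] at h4
    exact hv (Prod.ext (funext fun j => (h5 j).1) (Prod.ext (funext fun j => (h5 j).2) h4))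

lemma isOrtho_frame (p : Heis n) : IsOrtho (metric n p) (frame p) := by
  constructor
  · rintro (_ | i)
    · simp [frame, metric, vert]
      simp [contact_apply]
    · simp only [frame, consFrame_some, metric, contact_horFrame]
      rcases i with j | j <;> simp [horFrame, Pi.single_apply]
  · rintro (_ | i) (_ | j) h
    · exact absurd rfl h
    · simp [frame, metric, vert]
    · simp [frame, metric, vert]
    · simp only [frame, consFrame_some, metric, contact_horFrame]
      rcases i with i | i <;> rcases j with j | j <;> simp [horFrame, Pi.single_apply] <;>
        exact fun h' => h (by rw [h'])

lemma finrank_heis : Fintype.card (Option (Fin n ⊕ Fin n)) = Module.finrank ℝ (Heis n) := by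
  simp [add_assoc]

lemma supNormLeOne_metric_iff {k : ℕ} (η : DForm (Heis n) (Heis n) k) :
    SupNormLeOne (metric n) η ↔ ∀ p, fullSq (frame p) (η p) ≤ (k.factorial : ℝ) :=
  supNormLeOne_iff isInner_metric finrank_heis isOrtho_frame η

lemma contDiff_contact {m : WithTop ℕ∞} : ContDiff ℝ m (contact n) := by
  rw [contDiff_clm_apply_iff]
  intro v
  simp only [contact_apply]
  fun_prop

lemma contDiff_wedge {k : ℕ} {m : WithTop ℕ∞} {φ : DForm (Heis n) (Heis n) k}
    (hφ : ContDiff ℝ m φ) : ContDiff ℝ m (wedge (contact n) φ) := by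
  have h : ContDiff ℝ m fun x => (contact n x).smulRight (φ x) :=
    ContDiff.smulRight contDiff_contact hφ
  exact (ContinuousAlternatingMap.alternatizeUncurryFinCLM ℝ (Heis n) ℝ).contDiff.comp h

lemma isTestForm_wedge {k : ℕ} {φ : DForm (Heis n) (Heis n) k} (hφ : IsTestForm φ) :
    IsTestForm (wedge (contact n) φ) := by
  refine hφ.of_subset (contDiff_wedge hφ.contDiff) fun x hx => ?_
  ext v
  simp [wedge_apply, hx]

/-- The horizontal part of a form. -/
def horPart {k : ℕ} (η : DForm (Heis n) (Heis n) k) : DForm (Heis n) (Heis n) k :=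
  fun p => (η p).compContinuousLinearMap (horProj (contact n p) (vert n))

/-- The contraction of a form with the vertical vector field. -/
def vertPart {k : ℕ} (η : DForm (Heis n) (Heis n) (k + 1)) : DForm (Heis n) (Heis n) k :=
  fun p => contract (vert n) (η p)

lemma horPart_add_wedge_vertPart {k : ℕ} (η : DForm (Heis n) (Heis n) (k + 1)) (p : Heis n) :
    η p = horPart η p + wedge (contact n) (vertPart η) p :=
  eq_horProj_add_wedge (contact n) (fun _ => vert n) η p

lemma isTestForm_horPart {k : ℕ} {η : DForm (Heis n) (Heis n) k} (hη : IsTestForm η) :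
    IsTestForm (horPart η) := by
  refine hη.of_subset ?_ fun x hx => by simp [horPart, hx]; rfl
  rw [contDiff_iff_contDiffAt]
  intro x
  refine contDiffWithinAt_form_comp (s := univ) hη.contDiff.contDiffWithinAt fun v => ?_
  simp only [horProj_apply]
  have h : ContDiff ℝ ∞ fun y : Heis n => contact n y v :=
    contDiff_contact.clm_apply contDiff_const
  exact (contDiff_const.sub (h.smul contDiff_const)).contDiffWithinAt

lemma isTestForm_vertPart {k : ℕ} {η : DForm (Heis n) (Heis n) (k + 1)} (hη : IsTestForm η) :
    IsTestForm (vertPart η) := by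
  refine hη.of_subset ?_ fun x hx => ?_
  · rw [contDiff_iff_contDiffAt]
    intro x
    refine contDiffWithinAt_form_of_apply (s := univ) fun v => ?_
    exact contDiffWithinAt_form_apply (w := fun i _ => Fin.cons (α := fun _ => Heis n) (vert n) v i)
      hη.contDiff.contDiffWithinAt fun i => contDiffWithinAt_const
  · ext v
    simp [vertPart, hx]

/-- The dilations as linear maps. -/
def dilationL (n : ℕ) (r : ℝ) : Heis n →L[ℝ] Heis n :=
  (r • ContinuousLinearMap.fst ℝ _ _).prod
    ((r • (ContinuousLinearMap.fst ℝ _ _).comp (ContinuousLinearMap.snd ℝ _ _)).prod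
      (r ^ 2 • (ContinuousLinearMap.snd ℝ _ _).comp (ContinuousLinearMap.snd ℝ _ _)))

lemma dilationL_apply (r : ℝ) (p : Heis n) : dilationL n r p = dilation r p := rfl

lemma pullback_dilation {k : ℕ} (r : ℝ) (η : DForm (Heis n) (Heis n) k) (p : Heis n) :
    pullback (dilation r) η p = (η (dilation r p)).compContinuousLinearMap (dilationL n r) :=
  pullback_model (dilation r) (dilationL n r) (fun _ => rfl) η p

lemma dilation_dilation (r s : ℝ) (p : Heis n) : dilation r (dilation s p) = dilation (r * s) p := by
  simp [dilation, mul_smul, mul_pow, mul_assoc]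

lemma dilation_one (p : Heis n) : dilation 1 p = p := by
  simp [dilation]

lemma contact_dilation (r : ℝ) (p v : Heis n) :
    contact n (dilation r p) (dilation r v) = r ^ 2 * contact n p v := by
  simp only [contact_apply, dilation, Pi.smul_apply, smul_eq_mul, mul_sub, Finset.mul_sum]
  congr 1
  refine Finset.sum_congr rfl fun j _ => ?_
  ring

lemma dilation_horFrame (r : ℝ) (p : Heis n) (i : Fin n ⊕ Fin n) :
    dilation r (horFrame p i) = r • horFrame (dilation r p) i := by
  rcases i with j | j
  · simp [dilation, horFrame]
    ring
  · simp [dilation, horFrame]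
    ring

lemma dilation_vert (r : ℝ) : dilation r (vert n) = r ^ 2 • vert n := by
  simp [dilation, vert]

lemma isTestForm_pullback_dilation {k : ℕ} {r : ℝ} (hr : r ≠ 0) {η : DForm (Heis n) (Heis n) k}
    (hη : IsTestForm η) : IsTestForm (pullback (F := Heis n) (dilation r) η) := by
  have hfun : pullback (F := Heis n) (dilation r) η =
      fun p => (η (dilationL n r p)).compContinuousLinearMap (dilationL n r) :=
    funext fun p => pullback_dilation r η p
  refine ⟨(isSmoothForm_model_iff _).2 ?_, ?_⟩
  · rw [hfun, contDiff_iff_contDiffAt]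
    intro x
    refine contDiffWithinAt_form_comp (s := univ) ?_ fun v => contDiffWithinAt_const
    exact (hη.contDiff.comp (dilationL n r).contDiff).contDiffWithinAt
  · have hK : IsCompact (dilationL n r⁻¹ '' closure {x | η x ≠ 0}) :=
      hη.2.image (dilationL n r⁻¹).continuous
    refine hK.of_isClosed_subset isClosed_closure (closure_minimal ?_ hK.isClosed)
    intro x hx
    refine ⟨dilation r x, subset_closure fun h0 => hx ?_, ?_⟩
    · rw [pullback_dilation, h0]; rfl
    · rw [dilationL_apply, dilation_dilation, inv_mul_cancel₀ hr, dilation_one]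

lemma fullSq_horFrame_pullback_dilation {k : ℕ} (r : ℝ) (η : DForm (Heis n) (Heis n) k)
    (p : Heis n) : fullSq (horFrame p) (pullback (dilation r) η p) =
      (r ^ k) ^ 2 * fullSq (horFrame (dilation r p)) (η (dilation r p)) := by
  unfold fullSq
  rw [Finset.mul_sum]
  refine Finset.sum_congr rfl fun I _ => ?_
  rw [← mul_pow, pullback_dilation, ContinuousAlternatingMap.compContinuousLinearMap_apply]
  have h1 : dilationL n r ∘ horFrame p ∘ I = fun i => r • (horFrame (dilation r p) ∘ I) i := by
    ext1 i
    exact dilation_horFrame r p (I i)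
  have h2 : η (dilation r p) (fun i => r • (horFrame (dilation r p) ∘ I) i) =
      (∏ _i : Fin k, r) • η (dilation r p) (horFrame (dilation r p) ∘ I) :=
    (η (dilation r p)).toMultilinearMap.map_smul_univ (fun _ => r) _
  rw [h1, h2]
  simp

lemma contract_pullback_dilation {k : ℕ} (r : ℝ) (η : DForm (Heis n) (Heis n) (k + 1))
    (p : Heis n) : contract (vert n) (pullback (dilation r) η p) =
      r ^ 2 • pullback (dilation r) (vertPart η) p := by
  ext v
  rw [contract_apply, pullback_dilation, ContinuousAlternatingMap.smul_apply, pullback_dilation,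
    ContinuousAlternatingMap.compContinuousLinearMap_apply,
    ContinuousAlternatingMap.compContinuousLinearMap_apply, vertPart, contract_apply]
  have h1 : dilationL n r ∘ (Fin.cons (vert n) v : Fin (k + 1) → Heis n) =
      Fin.cons (r ^ 2 • vert n) (dilationL n r ∘ v) := by
    ext1 i
    refine Fin.cases ?_ (fun i => ?_) i
    · exact dilation_vert r
    · rfl
  rw [h1]
  exact (η (dilation r p)).map_vecCons_smul _ _ _

lemma le_mass {E V : Type*} [NormedAddCommGroup E] [NormedSpace ℝ E] [TopologicalSpace V]
    [ChartedSpace E V] {k : ℕ} {g : V → E → E → ℝ} {T : DForm E V k → ℝ} {η : DForm E V k}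
    (hη : IsTestForm η) (hn : SupNormLeOne g η) : ENNReal.ofReal (T η) ≤ mass g T :=
  le_iSup₂_of_le η hη (le_iSup (fun _ : SupNormLeOne g η => ENNReal.ofReal (T η)) hn)

lemma le_mass_of_fullSq_le {k : ℕ} {T : DForm (Heis n) (Heis n) k → ℝ}
    (hT : ∀ (c : ℝ) η, T (fun x => c • η x) = c * T η)
    {η : DForm (Heis n) (Heis n) k} (hη : IsTestForm η) {c : ℝ} (hc : 0 < c)
    (hn : ∀ p, fullSq (frame p) (η p) ≤ c ^ 2 * (k.factorial : ℝ)) :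
    ENNReal.ofReal (T η) ≤ ENNReal.ofReal c * mass (metric n) T := by
  set φ : DForm (Heis n) (Heis n) k := fun x => c⁻¹ • η x with hφ
  have h1 : IsTestForm φ := hη.of_subset (hη.contDiff.const_smul c⁻¹) fun x hx => by simp [hφ, hx]
  have h2 : SupNormLeOne (metric n) φ := by
    rw [supNormLeOne_metric_iff]
    intro p
    have : fullSq (frame p) (φ p) = (c⁻¹) ^ 2 * fullSq (frame p) (η p) := by
      unfold fullSq
      rw [Finset.mul_sum]
      refine Finset.sum_congr rfl fun I _ => ?_
      rw [← mul_pow]; rfl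
    rw [this]
    calc (c⁻¹) ^ 2 * fullSq (frame p) (η p) ≤ (c⁻¹) ^ 2 * (c ^ 2 * (k.factorial : ℝ)) := by
          gcongr; exact hn p
      _ = _ := by field_simp
  have h3 : T η = c * T φ := by
    rw [hφ, hT, ← mul_assoc, mul_inv_cancel₀ hc.ne', one_mul]
  rw [h3, ENNReal.ofReal_mul hc.le]
  gcongr
  exact le_mass h1 h2

lemma fullSq_frame_wedge {k : ℕ} (φ : DForm (Heis n) (Heis n) k) (p : Heis n) :
    fullSq (frame p) (wedge (contact n) φ p) = (k + 1) * fullSq (horFrame p) (φ p) :=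
  fullSq_consFrame_wedge (contact n) φ p (contact_vert p) (contact_horFrame p)

variable {k : ℕ} {T : DForm (Heis n) (Heis n) (k + 1) → ℝ}

/-- Given a competitor `φ`, test the dilated current on `θ ∧ ψ`, where `ψ` is `r ^ k` times the
pullback of `φ` by the inverse dilation. The norm of `θ ∧ ψ` sees only horizontal coefficients, on
which this pullback acts as `r⁻¹ ^ k`, so the form is admissible. Pulling it back by the dilation
gives `r ^ (k + 2) • θ ∧ φ`, with `r ^ 2` coming from `θ`. -/
lemma obliqueMass_le_dilation (hT : ∀ (c : ℝ) η, T (fun x => c • η x) = c * T η) {r : ℝ}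
    (hr : 0 < r) : ENNReal.ofReal (r ^ (k + 2)) * obliqueMass (metric n) (contact n) T ≤
      mass (metric n) (pushforward (dilation r) T) := by
  unfold obliqueMass
  rw [mass, ENNReal.mul_iSup]
  refine iSup_le fun φ => ?_
  rw [ENNReal.mul_iSup]
  refine iSup_le fun hφ => ?_
  rw [ENNReal.mul_iSup]
  refine iSup_le fun hn => ?_
  rw [← ENNReal.ofReal_mul (by positivity)]
  set ψ : DForm (Heis n) (Heis n) k := fun x => r ^ k • pullback (dilation r⁻¹) φ x with hψ
  have hψt : IsTestForm ψ := by
    have h := isTestForm_pullback_dilation (inv_ne_zero hr.ne') hφ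
    exact h.of_subset (h.contDiff.const_smul _) fun x hx => by simp [hψ, hx]
  have hnorm : SupNormLeOne (metric n) (wedge (contact n) ψ) := by
    rw [supNormLeOne_metric_iff] at hn ⊢
    intro p
    rw [fullSq_frame_wedge]
    have h1 : fullSq (horFrame p) (ψ p) =
        fullSq (horFrame (dilation r⁻¹ p)) (φ (dilation r⁻¹ p)) := by
      have h2 : fullSq (horFrame p) (ψ p) =
          (r ^ k) ^ 2 * fullSq (horFrame p) (pullback (dilation r⁻¹) φ p) := by
        unfold fullSq
        rw [Finset.mul_sum]
        refine Finset.sum_congr rfl fun I _ => ?_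
        rw [← mul_pow]; rfl
      rw [h2, fullSq_horFrame_pullback_dilation, ← mul_assoc, ← mul_pow, ← mul_pow,
        mul_inv_cancel₀ hr.ne']
      simp
    rw [h1, Nat.factorial_succ]
    push_cast
    gcongr
    exact (fullSq_le_fullSq_consFrame _ _ _).trans (hn _)
  have hpull : pullback (dilation r) (wedge (contact n) ψ) =
      fun x => r ^ (k + 2) • wedge (contact n) φ x := by
    funext p
    ext v
    rw [pullback_dilation, ContinuousAlternatingMap.compContinuousLinearMap_apply, wedge_apply,
      ContinuousAlternatingMap.smul_apply, wedge_apply, smul_eq_mul, Finset.mul_sum]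
    refine Finset.sum_congr rfl fun i _ => ?_
    have h1 : ψ (dilation r p) (i.removeNth (dilationL n r ∘ v)) =
        r ^ k * φ p (i.removeNth v) := by
      simp only [hψ]
      rw [ContinuousAlternatingMap.smul_apply, pullback_dilation,
        ContinuousAlternatingMap.compContinuousLinearMap_apply, dilation_dilation,
        inv_mul_cancel₀ hr.ne', dilation_one, smul_eq_mul]
      congr 2
      ext1 j
      simp only [Function.comp, Fin.removeNth, dilationL_apply, dilation_dilation]
      rw [inv_mul_cancel₀ hr.ne', dilation_one]
    rw [h1, Function.comp_apply, dilationL_apply, contact_dilation]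
    ring
  have h2 : r ^ (k + 2) * restrictTo T (contact n) φ =
      pushforward (dilation r) T (wedge (contact n) ψ) := by
    rw [pushforward, hpull, hT, restrictTo]
  rw [h2]
  exact le_mass (isTestForm_wedge hψt) hnorm

/-- The pulled-back form splits into a horizontal part of norm at most `r ^ (k + 1)`, tested against
`T`, and `θ` times a form of norm at most `r ^ (k + 2)`, tested against `T ⌞ θ`. -/
lemma mass_dilation_le (hT : ∀ (c : ℝ) η, T (fun x => c • η x) = c * T η)
    (hadd : ∀ η φ, IsTestForm η → IsTestForm φ → T (fun x => η x + φ x) = T η + T φ) {r : ℝ}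
    (hr : 0 < r) : mass (metric n) (pushforward (dilation r) T) ≤
      ENNReal.ofReal (r ^ (k + 1)) * mass (metric n) T +
        ENNReal.ofReal (r ^ (k + 2)) * obliqueMass (metric n) (contact n) T := by
  refine iSup_le fun η => iSup_le fun hη => iSup_le fun hn => ?_
  rw [supNormLeOne_metric_iff] at hn
  set ζ : DForm (Heis n) (Heis n) (k + 1) := pullback (dilation r) η with hζ
  have hζt : IsTestForm ζ := isTestForm_pullback_dilation hr.ne' hη
  have h1 : T ζ = T (horPart ζ) + restrictTo T (contact n) (vertPart ζ) := by
    rw [restrictTo, ← hadd _ _ (isTestForm_horPart hζt) (isTestForm_wedge (isTestForm_vertPart hζt))]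
    congr 1
    funext p
    exact horPart_add_wedge_vertPart ζ p
  have h2 : ENNReal.ofReal (T (horPart ζ)) ≤
      ENNReal.ofReal (r ^ (k + 1)) * mass (metric n) T := by
    refine le_mass_of_fullSq_le hT (isTestForm_horPart hζt) (by positivity) fun p => ?_
    have : fullSq (frame p) (horPart ζ p) = fullSq (horFrame p) (ζ p) :=
      fullSq_consFrame_horProj (contact_vert p) (contact_horFrame p) (ζ p)
    rw [this, hζ, fullSq_horFrame_pullback_dilation]
    gcongr
    exact (fullSq_le_fullSq_consFrame _ _ _).trans (hn _)
  have h3 : ENNReal.ofReal (restrictTo T (contact n) (vertPart ζ)) ≤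
      ENNReal.ofReal (r ^ (k + 2)) * obliqueMass (metric n) (contact n) T := by
    refine le_mass_of_fullSq_le (T := restrictTo T (contact n)) (fun c φ => ?_)
      (isTestForm_vertPart hζt) (by positivity) fun p => ?_
    · rw [restrictTo, restrictTo, ← hT]
      congr 1
      funext p
      ext v
      rw [ContinuousAlternatingMap.smul_apply, wedge_apply, wedge_apply, smul_eq_mul,
        Finset.mul_sum]
      refine Finset.sum_congr rfl fun i _ => ?_
      rw [ContinuousAlternatingMap.smul_apply, smul_eq_mul]
      ring
    -- A second contraction with the vertical field gives zero, so the vertical part has no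
    -- coefficient involving it. In degree zero there are no slots at all.
    · have e1 : fullSq (frame p) (vertPart ζ p) = fullSq (horFrame p) (vertPart ζ p) := by
        cases k with
        | zero => simp [fullSq, frame, Subsingleton.elim _ (![] : Fin 0 → Heis n)]
        | succ k =>
          have : contract (vert n) (vertPart ζ p) = 0 := by
            ext v
            rw [contract_apply, vertPart, contract_apply]
            exact (ζ p).map_eq_zero_of_eq _ (i := 0) (j := 1) rfl (by simp)
          rw [frame, fullSq_consFrame_succ, this]
          simp [fullSq]
      have e2 : fullSq (horFrame p) (vertPart ζ p) =
          (r ^ 2) ^ 2 * fullSq (horFrame p) (pullback (dilation r) (vertPart η) p) := by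
        unfold fullSq
        rw [Finset.mul_sum]
        refine Finset.sum_congr rfl fun I _ => ?_
        rw [vertPart, hζ, contract_pullback_dilation, ← mul_pow]
        rfl
      rw [e1, e2, fullSq_horFrame_pullback_dilation]
      have e3 := hn (dilation r p)
      rw [frame, fullSq_consFrame_succ, Nat.factorial_succ] at e3
      have e4 := fullSq_nonneg (horFrame (dilation r p)) (η (dilation r p))
      -- Discarding the nonnegative horizontal term of `e3` and dividing by `k + 1` turns the bound
      -- `(k + 1)!` into `k!`.
      have e5 : fullSq (horFrame (dilation r p)) (vertPart η (dilation r p)) ≤ k.factorial := by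
        push_cast at e3
        have : (k + 1 : ℝ) * fullSq (horFrame (dilation r p)) (vertPart η (dilation r p)) ≤
          (k + 1) * k.factorial := by
            unfold vertPart; linarith
        exact le_of_mul_le_mul_left this (by positivity)
      calc _ ≤ (r ^ 2) ^ 2 * ((r ^ k) ^ 2 * (k.factorial : ℝ)) := by gcongr
        _ = _ := by ring
  rw [pushforward, ← hζ, h1]
  exact ENNReal.ofReal_add_le.trans (add_le_add h2 h3)

/-- The oblique mass is the limit of the rescaled masses of the dilated currents. -/
theorem tendsto_mass_dilation (hT : ∀ (c : ℝ) η, T (fun x => c • η x) = c * T η)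
    (hadd : ∀ η φ, IsTestForm η → IsTestForm φ → T (fun x => η x + φ x) = T η + T φ)
    (hfin : mass (metric n) T ≠ ⊤) :
    Tendsto (fun r : ℝ => (ENNReal.ofReal (r ^ (k + 2)))⁻¹ *
      mass (metric n) (pushforward (dilation r) T)) atTop
      (𝓝 (obliqueMass (metric n) (contact n) T)) := by
  -- The upper function of the squeeze; finiteness of the mass is what makes its first term tend to
  -- zero.
  have hlim : Tendsto (fun r : ℝ => ENNReal.ofReal r⁻¹ * mass (metric n) T +
      obliqueMass (metric n) (contact n) T) atTop
      (𝓝 (obliqueMass (metric n) (contact n) T)) := by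
    have h1 : Tendsto (fun r : ℝ => ENNReal.ofReal r⁻¹) atTop (𝓝 0) := by
      have := ENNReal.tendsto_ofReal (tendsto_inv_atTop_zero (𝕜 := ℝ))
      simpa using this
    have h2 := ENNReal.Tendsto.mul_const (b := mass (metric n) T) h1 (Or.inr hfin)
    rw [zero_mul] at h2
    have h3 := h2.add_const (obliqueMass (metric n) (contact n) T)
    rwa [zero_add] at h3
  refine tendsto_of_tendsto_of_tendsto_of_le_of_le' tendsto_const_nhds hlim ?_ ?_
  · filter_upwards [eventually_gt_atTop 0] with r hr
    have h0 : ENNReal.ofReal (r ^ (k + 2)) ≠ 0 := by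
      rw [Ne, ENNReal.ofReal_eq_zero, not_le]; positivity
    calc _ = (ENNReal.ofReal (r ^ (k + 2)))⁻¹ * (ENNReal.ofReal (r ^ (k + 2)) *
          obliqueMass (metric n) (contact n) T) := by
          rw [← mul_assoc, ENNReal.inv_mul_cancel h0 ENNReal.ofReal_ne_top, one_mul]
      _ ≤ _ := by gcongr; exact obliqueMass_le_dilation hT hr
  · filter_upwards [eventually_gt_atTop 0] with r hr
    have h0 : ENNReal.ofReal (r ^ (k + 2)) ≠ 0 := by
      rw [Ne, ENNReal.ofReal_eq_zero, not_le]; positivity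
    calc _ ≤ (ENNReal.ofReal (r ^ (k + 2)))⁻¹ * (ENNReal.ofReal (r ^ (k + 1)) * mass (metric n) T +
        ENNReal.ofReal (r ^ (k + 2)) * obliqueMass (metric n) (contact n) T) := by
          gcongr; exact mass_dilation_le hT hadd hr
      _ = _ := by
          rw [mul_add, ← mul_assoc, ← mul_assoc, ENNReal.inv_mul_cancel h0 ENNReal.ofReal_ne_top,
            one_mul, ← ENNReal.ofReal_inv_of_pos (by positivity),
            ← ENNReal.ofReal_mul (by positivity)]
          congr 3
          field_simp
          ring

end Heis

/-! ### Contact forms and metrics in charts -/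

section Charts

variable {E : Type*} [NormedAddCommGroup E] [NormedSpace ℝ E]
variable {V : Type*} [TopologicalSpace V] [ChartedSpace E V]

/-- The derivative of the inverse of the preferred chart at `x`. -/
def chartDeriv (E : Type*) [NormedAddCommGroup E] [NormedSpace ℝ E]
    {V : Type*} [TopologicalSpace V] [ChartedSpace E V] (x : V) (u : E) : E →L[ℝ] E :=
  mfderiv 𝓘(ℝ, E) 𝓘(ℝ, E) (chartAt E x).symm u

variable [IsManifold 𝓘(ℝ, E) ∞ V]

lemma chartDeriv_bijective (x : V) {u : E} (hu : u ∈ (chartAt E x).target) :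
    Function.Bijective (chartDeriv E x u) := by
  have : IsManifold 𝓘(ℝ, E) 1 V := IsManifold.of_le (n := ∞) (by norm_cast)
  exact (mdifferentiable_chart (I := 𝓘(ℝ, E)) x).symm.mfderiv_bijective hu

/-- The tangent space at `x` is identified with `E` by the preferred chart at `x` itself. This lets
`dθ`, which is computed in that chart, be evaluated on frames of the tangent space at `x`. -/
lemma chartDeriv_self (x : V) : chartDeriv E x (chartAt E x x) = ContinuousLinearMap.id ℝ E := by
  have : IsManifold 𝓘(ℝ, E) 1 V := IsManifold.of_le (n := ∞) (by norm_cast)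
  have hd : MDifferentiableAt 𝓘(ℝ, E) 𝓘(ℝ, E) (chartAt E x).symm (chartAt E x x) :=
    (mdifferentiable_chart (I := 𝓘(ℝ, E)) x).mdifferentiableAt_symm (mem_chart_target E x)
  have : writtenInExtChartAt 𝓘(ℝ, E) 𝓘(ℝ, E) (chartAt E x x) (chartAt E x).symm
      =ᶠ[𝓝 (chartAt E x x)] id := by
    filter_upwards [(chartAt E x).open_target.mem_nhds (mem_chart_target E x)] with u hu
    simp only [writtenInExtChartAt, extChartAt, (chartAt E x).left_inv (mem_chart_source E x)]
    exact (chartAt E x).right_inv hu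
  have h2 : fderivWithin ℝ (writtenInExtChartAt 𝓘(ℝ, E) 𝓘(ℝ, E) (chartAt E x x)
      (chartAt E x).symm) (range 𝓘(ℝ, E)) (chartAt E x x) = ContinuousLinearMap.id ℝ E := by
    rw [ModelWithCorners.range_eq_univ, fderivWithin_univ, this.fderiv_eq, fderiv_id]
  unfold chartDeriv mfderiv
  exact (if_pos hd).trans h2

/-- The constant field `v`, transported by the inverse chart, is a smooth section along it, being
part of the tangent map. Inserting such sections in the metric gives the smoothness of
`chartMetric`. -/
lemma contMDiffOn_chartDeriv (x : V) (v : E) :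
    ContMDiffOn 𝓘(ℝ, E) (𝓘(ℝ, E).prod 𝓘(ℝ, E)) ∞
      (fun u => Bundle.TotalSpace.mk' E (E := fun y : V => TangentSpace 𝓘(ℝ, E) y)
        ((chartAt E x).symm u) (chartDeriv E x u v)) (chartAt E x).target := by
  have h1 : ContMDiffOn 𝓘(ℝ, E) 𝓘(ℝ, E) ∞ (chartAt E x).symm (chartAt E x).target :=
    contMDiffOn_chart_symm
  have ho := (chartAt E x).open_target
  have h2 := h1.contMDiffOn_tangentMapWithin (m := ∞) (by simp) ho.uniqueMDiffOn
  have h3 : ContMDiff 𝓘(ℝ, E) (𝓘(ℝ, E).prod 𝓘(ℝ, E)) ∞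
      (fun u : E => (⟨u, v⟩ : TangentBundle 𝓘(ℝ, E) E)) :=
    contMDiff_vectorSpace_iff_contDiff.2 contDiff_const
  have h4 := h2.comp h3.contMDiffOn (s := (chartAt E x).target) (fun u hu => hu)
  refine h4.congr fun u hu => ?_
  simp only [Function.comp, tangentMapWithin, chartDeriv]
  rw [mfderivWithin_of_isOpen ho hu]
  rfl

variable (g : Bundle.ContMDiffRiemannianMetric 𝓘(ℝ, E) ∞ E
  (fun x : V => TangentSpace 𝓘(ℝ, E) x))

lemma isInner_metricOf (x : V) : IsInner (metricOf g x) where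
  add_left u v w := by
    have := congrArg (fun f => f w) ((g.inner x).map_add u v)
    exact this
  smul_left c v w := by
    have := congrArg (fun f => f w) ((g.inner x).map_smul c v)
    exact this
  symm v w := g.symm x v w
  pos v hv := g.pos x v hv

variable [FiniteDimensional ℝ E]

/-- The metric as a continuous bilinear form on the model space. -/
def metricCLM (y : V) : E →L[ℝ] E →L[ℝ] ℝ := g.inner y

/-- The expression of the metric in the preferred chart at `x`. -/
def chartMetric (x : V) (u : E) : E →L[ℝ] E →L[ℝ] ℝ :=
  (metricCLM g ((chartAt E x).symm u)).bilinearComp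
    (chartDeriv E x u) (chartDeriv E x u)

lemma chartMetric_apply (x : V) (u v w : E) : chartMetric g x u v w =
    metricOf g ((chartAt E x).symm u) (chartDeriv E x u v) (chartDeriv E x u w) := rfl

lemma contDiffOn_chartMetric (x : V) :
    ContDiffOn ℝ ∞ (chartMetric g x) (chartAt E x).target := by
  rw [contDiffOn_clm_apply]
  intro v
  rw [contDiffOn_clm_apply]
  intro w
  have h0 : ContMDiffOn 𝓘(ℝ, E) 𝓘(ℝ, E) ∞ (chartAt E x).symm (chartAt E x).target :=
    contMDiffOn_chart_symm
  have h1 := g.contMDiff.comp_contMDiffOn h0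
  have h2 := ContMDiffOn.clm_bundle_apply₂ (E₃ := fun _ : V => ℝ) (F₃ := ℝ) h1
    (contMDiffOn_chartDeriv x v) (contMDiffOn_chartDeriv x w)
  rw [← contMDiffOn_iff_contDiffOn]
  intro u hu
  have h3 := h2 u hu
  rw [Bundle.contMDiffWithinAt_totalSpace] at h3
  exact h3.2

lemma chartMetric_injective (x : V) {u : E} (hu : u ∈ (chartAt E x).target) :
    Function.Injective (chartMetric g x u) := by
  rw [injective_iff_map_eq_zero]
  intro v hv
  by_contra hv0
  have h1 : chartDeriv E x u v ≠ 0 := fun h =>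
    hv0 ((chartDeriv_bijective x hu).1 (h.trans (map_zero _).symm))
  have h2 := (isInner_metricOf g ((chartAt E x).symm u)).pos _ h1
  rw [← chartMetric_apply, hv] at h2
  exact lt_irrefl _ h2

/-- The gradient of a 1-form. -/
def grad (θ : V → E →L[ℝ] ℝ) (y : V) : E :=
  ∑ i, θ y ((isInner_metricOf g y).exists_frame.choose i) •
    (isInner_metricOf g y).exists_frame.choose i

/-- This identity characterizes the gradient, so the frame chosen in its definition, which need not
vary smoothly, is immaterial. Smoothness is obtained from the formula `chartGrad`. -/
lemma metricOf_grad (θ : V → E →L[ℝ] ℝ) (y : V) (v : E) : metricOf g y v (grad g θ y) = θ y v := by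
  have hb := isInner_metricOf g y
  have he := hb.exists_frame.choose_spec
  rw [grad, hb.sum_right]
  conv_rhs => rw [hb.expand he (by simp) v, map_sum]
  refine Finset.sum_congr rfl fun i _ => ?_
  rw [map_smul, smul_eq_mul, hb.symm v, mul_comm]

lemma apply_grad_self {θ : V → E →L[ℝ] ℝ} (hθ : IsUnitForm (metricOf g) θ) (y : V) :
    θ y (grad g θ y) = 1 := by
  have he := (isInner_metricOf g y).exists_frame.choose_spec
  have h := hθ y _ he
  rw [grad, map_sum, ← h]
  refine Finset.sum_congr rfl fun i _ => ?_
  rw [map_smul, smul_eq_mul, sq]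

/-- The expression of a `1`-form in the preferred chart at `x`. -/
def chartOneForm (θ : V → E →L[ℝ] ℝ) (x : V) (u : E) : E →L[ℝ] ℝ :=
  (θ ((chartAt E x).symm u)).comp (chartDeriv E x u)

lemma chartForm_apply {k : ℕ} (η : DForm E V k) (x : V) (u : E) : chartForm η x u =
    (η ((chartAt E x).symm u)).compContinuousLinearMap (chartDeriv E x u) := rfl

lemma contDiffOn_chartOneForm {θ : V → E →L[ℝ] ℝ} (hθ : IsSmoothForm (oneForm θ)) (x : V) :
    ContDiffOn ℝ ∞ (chartOneForm θ x) (chartAt E x).target := by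
  rw [contDiffOn_clm_apply]
  intro v
  exact (ContinuousAlternatingMap.apply ℝ E ℝ (fun _ : Fin 1 => v)).contDiff.comp_contDiffOn (hθ x)

/-- The expression of the gradient in the preferred chart at `x`. -/
def chartGrad (θ : V → E →L[ℝ] ℝ) (x : V) (u : E) : E :=
  (chartMetric g x u).inverse (chartOneForm θ x u)

lemma exists_equiv_chartMetric (x : V) {u : E} (hu : u ∈ (chartAt E x).target) :
    ∃ A : E ≃L[ℝ] (E →L[ℝ] ℝ), (A : E →L[ℝ] (E →L[ℝ] ℝ)) = chartMetric g x u := by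
  have hdim : Module.finrank ℝ E = Module.finrank ℝ (E →L[ℝ] ℝ) := by
    rw [← (LinearMap.toContinuousLinearMap (𝕜 := ℝ) (E := E) (F' := ℝ)).finrank_eq]
    exact (Subspace.dual_finrank_eq (K := ℝ) (V := E)).symm
  let L := LinearEquiv.ofInjectiveOfFinrankEq (chartMetric g x u : E →ₗ[ℝ] (E →L[ℝ] ℝ))
    (chartMetric_injective g x hu) hdim
  exact ⟨L.toContinuousLinearEquiv, by ext v w; rfl⟩

/-- Both vectors represent `θ` for the metric, so their difference is orthogonal to itself. -/
lemma chartDeriv_chartGrad (θ : V → E →L[ℝ] ℝ) (x : V) {u : E} (hu : u ∈ (chartAt E x).target) :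
    chartDeriv E x u (chartGrad g θ x u) = grad g θ ((chartAt E x).symm u) := by
  obtain ⟨A, hA⟩ := exists_equiv_chartMetric g x hu
  have h1 : chartMetric g x u (chartGrad g θ x u) = chartOneForm θ x u := by
    rw [chartGrad, ← hA, ContinuousLinearMap.inverse_equiv]
    simp
  have hb := isInner_metricOf g ((chartAt E x).symm u)
  by_contra hne
  have h2 := hb.pos _ (sub_ne_zero.2 hne)
  obtain ⟨w, hw⟩ := (chartDeriv_bijective x hu).2
    (chartDeriv E x u (chartGrad g θ x u) - grad g θ ((chartAt E x).symm u))
  have h3 := congrArg (fun f => f w) h1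
  simp only [chartMetric_apply, chartOneForm, ContinuousLinearMap.comp_apply] at h3
  rw [hw, ← metricOf_grad g θ, hb.symm] at h3
  have h4 : ∀ a b c : E, metricOf g ((chartAt E x).symm u) a (b - c) =
      metricOf g ((chartAt E x).symm u) a b - metricOf g ((chartAt E x).symm u) a c := by
    intro a b c
    rw [← hb.bilin_apply, map_sub]; rfl
  rw [h4, h3, sub_self] at h2
  exact lt_irrefl _ h2

lemma contDiffOn_chartGrad {θ : V → E →L[ℝ] ℝ} (hθ : IsSmoothForm (oneForm θ)) (x : V) :
    ContDiffOn ℝ ∞ (chartGrad g θ x) (chartAt E x).target := by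
  intro u hu
  obtain ⟨A, hA⟩ := exists_equiv_chartMetric g x hu
  have h1 : ContDiffAt ℝ ∞ ContinuousLinearMap.inverse (chartMetric g x u) := by
    rw [← hA]; exact contDiffAt_map_inverse A
  exact (h1.comp_contDiffWithinAt u (contDiffOn_chartMetric g x u hu)).clm_apply
    (contDiffOn_chartOneForm hθ x u hu)

/-- The horizontal part of a form with respect to a metric, multiplied by a function. -/
def projForm {k : ℕ} (h : V → ℝ) (θ : V → E →L[ℝ] ℝ) (φ : DForm E V k) : DForm E V k :=
  fun y => h y • (φ y).compContinuousLinearMap (horProj (θ y) (grad g θ y))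

lemma isTestForm_projForm {k : ℕ} {h : V → ℝ} {θ : V → E →L[ℝ] ℝ} {φ : DForm E V k}
    (hh : ∀ x, ContDiffOn ℝ ∞ (fun u => h ((chartAt E x).symm u)) (chartAt E x).target)
    (hθ : IsSmoothForm (oneForm θ)) (hφ : IsTestForm φ) : IsTestForm (projForm g h θ φ) := by
  constructor
  · intro x
    have h1 : EqOn (chartForm (projForm g h θ φ) x) (fun u => h ((chartAt E x).symm u) •
        (chartForm φ x u).compContinuousLinearMap
          (horProj (chartOneForm θ x u) (chartGrad g θ x u))) (chartAt E x).target := by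
      intro u hu
      ext v
      simp only [chartForm_apply, projForm, ContinuousAlternatingMap.compContinuousLinearMap_apply,
        ContinuousAlternatingMap.smul_apply]
      congr 2
      ext1 i
      simp only [Function.comp, horProj_apply, map_sub, map_smul, chartOneForm,
        ContinuousLinearMap.comp_apply]
      rw [chartDeriv_chartGrad g θ x hu]
    refine ContDiffOn.congr ?_ h1
    intro u hu
    refine (hh x u hu).smul (contDiffWithinAt_form_comp (hφ.1 x u hu) fun v => ?_)
    simp only [horProj_apply]
    exact contDiffWithinAt_const.sub (((contDiffOn_chartOneForm hθ x u hu).clm_apply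
      contDiffWithinAt_const).smul (contDiffOn_chartGrad g hθ x u hu))
  · refine hφ.2.of_isClosed_subset isClosed_closure (closure_mono fun y hy h0 => hy ?_)
    simp only [projForm, h0]
    ext v
    simp

lemma ne_zero_of_isUnitForm {θ : V → E →L[ℝ] ℝ} (hθ : IsUnitForm (metricOf g) θ) (y : V) :
    (θ y : E →ₗ[ℝ] ℝ) ≠ 0 := fun h => by
  have h1 := apply_grad_self g hθ y
  have h2 : θ y (grad g θ y) = 0 := LinearMap.congr_fun h _
  rw [h2] at h1
  exact zero_ne_one h1

lemma isOrtho_consFrame_grad {θ : V → E →L[ℝ] ℝ} (hθ : IsUnitForm (metricOf g) θ) {y : V}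
    {ι : Type*} {u : ι → E} (hu : ∀ i, θ y (u i) = 0) (huo : IsOrtho (metricOf g y) u) :
    IsOrtho (metricOf g y) (consFrame (grad g θ y) u) := by
  have hb := isInner_metricOf g y
  constructor
  · rintro (_ | i)
    · rw [consFrame_none, metricOf_grad, apply_grad_self g hθ]
    · exact huo.1 i
  · rintro (_ | i) (_ | j) hij
    · exact absurd rfl hij
    · rw [consFrame_none, consFrame_some, hb.symm, metricOf_grad, hu]
    · rw [consFrame_none, consFrame_some, metricOf_grad, hu]
    · exact huo.2 i j fun h => hij (by rw [h])

lemma card_option_ker {E : Type*} [NormedAddCommGroup E] [NormedSpace ℝ E] [FiniteDimensional ℝ E]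
    (α : E →L[ℝ] ℝ) (hα : (α : E →ₗ[ℝ] ℝ) ≠ 0) :
    Fintype.card (Option (Fin (Module.finrank ℝ (LinearMap.ker (α : E →ₗ[ℝ] ℝ))))) =
      Module.finrank ℝ E := by
  rw [Fintype.card_option, Fintype.card_fin]
  exact Module.Dual.finrank_ker_add_one_of_ne_zero hα

/-- Comparison of the oblique masses when the contact forms are equal up to sign. -/
lemma obliqueMass_le_of_eq_smul {k : ℕ} {g g' : Bundle.ContMDiffRiemannianMetric 𝓘(ℝ, E) ∞ E
      (fun x : V => TangentSpace 𝓘(ℝ, E) x)} {θ θ' : V → E →L[ℝ] ℝ}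
    (hθ : IsSmoothForm (oneForm θ)) (hθ' : IsSmoothForm (oneForm θ'))
    (hu : IsUnitForm (metricOf g) θ) (hu' : IsUnitForm (metricOf g') θ')
    (hs : SameSubRiemannian (metricOf g) θ (metricOf g') θ')
    (hh : ∀ y, (θ y (grad g' θ' y)) ^ 2 = 1) (T : DForm E V (k + 1) → ℝ) :
    obliqueMass (metricOf g) θ T ≤ obliqueMass (metricOf g') θ' T := by
  refine iSup_le fun φ => iSup_le fun hφ => iSup_le fun hn => ?_
  set h : V → ℝ := fun y => θ y (grad g' θ' y) with hdef
  -- The `θ'`-horizontal part of `v` also lies in `ker θ`, so `θ v` comes entirely from the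
  -- component along the gradient of `θ'`.
  have hker : ∀ y v, θ y v = h y * θ' y v := by
    intro y v
    have h1 : θ' y (v - θ' y v • grad g' θ' y) = 0 := by
      rw [map_sub, map_smul, apply_grad_self g' hu', smul_eq_mul, mul_one, sub_self]
    have h2 := ((hs y).1 _).2 h1
    rw [map_sub, map_smul, smul_eq_mul, sub_eq_zero] at h2
    rw [h2, mul_comm]
  have hsm : ∀ x, ContDiffOn ℝ ∞ (fun u => h ((chartAt E x).symm u)) (chartAt E x).target := by
    intro x
    have h1 : ContDiffOn ℝ ∞ (fun u => chartOneForm θ x u (chartGrad g' θ' x u))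
        (chartAt E x).target :=
      (contDiffOn_chartOneForm hθ x).clm_apply (contDiffOn_chartGrad g' hθ' x)
    refine h1.congr fun u hu => ?_
    simp only [hdef, chartOneForm, ContinuousLinearMap.comp_apply]
    rw [chartDeriv_chartGrad g' θ' x hu]
  -- A form vanishing on horizontal vectors is `θ'` times its contraction with the gradient. The
  -- contraction of `θ ∧ φ` is `h φ` on horizontal vectors, and it can be evaluated after projecting
  -- its arguments.
  have hw : wedge θ φ = wedge θ' (projForm g' h θ' φ) := by
    funext y
    ext v
    have e1 := map_sub_smul_of_map_eq_zero (wedge θ φ y) (θ' y) (grad g' θ' y) v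
    have e2 : ∀ w, θ y (horProj (θ' y) (grad g' θ' y) w) = 0 := by
      intro w
      rw [hker, horProj_apply, map_sub, map_smul, apply_grad_self g' hu']
      simp
    have e3 : wedge θ φ y (fun i => horProj (θ' y) (grad g' θ' y) (v i)) = 0 := by
      rw [wedge_apply]
      exact Finset.sum_eq_zero fun i _ => by rw [e2]; ring
    rw [e1, e3, zero_add, wedge_apply]
    refine Finset.sum_congr rfl fun i _ => ?_
    congr 2
    rw [← contract_apply, ← contract_horProj (θ' y), contract_apply, wedge_apply,
      Fin.sum_univ_succ, Finset.sum_eq_zero]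
    · simp only [projForm, hdef, ContinuousAlternatingMap.smul_apply, smul_eq_mul,
        ContinuousAlternatingMap.compContinuousLinearMap_apply, Fin.val_zero, pow_zero, one_mul,
        Fin.cons_zero, Fin.removeNth_zero, Fin.tail_cons, add_zero]
      rfl
    · intro j _
      simp only [Fin.cons_succ]
      rw [e2]
      ring
  -- An orthonormal frame `u` of the common kernel is orthonormal for both metrics and is completed
  -- by the gradient for each of them. In the `g'`-frame only the coefficients of `φ` on `u` remain,
  -- and they are bounded by the `g`-norm of `φ`.
  have hnorm : SupNormLeOne (metricOf g') (projForm g' h θ' φ) := by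
    have hex : ∀ y, ∃ e : Fin (Module.finrank ℝ (LinearMap.ker (θ' y : E →ₗ[ℝ] ℝ))) → E,
        (∀ i, e i ∈ LinearMap.ker (θ' y : E →ₗ[ℝ] ℝ)) ∧ IsOrtho (metricOf g' y) e :=
      fun y => (isInner_metricOf g' y).restrict_exists _ rfl
    intro y e he
    obtain ⟨u, huker, huo⟩ := hex y
    have huker' : ∀ i, θ' y (u i) = 0 := huker
    have huker2 : ∀ i, θ y (u i) = 0 := fun i => ((hs y).1 _).2 (huker' i)
    have huo2 : IsOrtho (metricOf g y) u :=
      ⟨fun i => by rw [(hs y).2 _ _ (huker2 i) (huker2 i)]; exact huo.1 i,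
        fun i j hij => by rw [(hs y).2 _ _ (huker2 i) (huker2 j)]; exact huo.2 i j hij⟩
    have hcard := card_option_ker (θ' y) (ne_zero_of_isUnitForm g' hu' y)
    have f' := isOrtho_consFrame_grad g' hu' huker' huo
    have f := isOrtho_consFrame_grad g hu huker2 huo2
    have hb := isInner_metricOf g y
    have hb' := isInner_metricOf g' y
    obtain ⟨e0, he0⟩ := hb.exists_frame
    have h1 := hn y e0 he0
    have hk : (0 : ℝ) < (k.factorial : ℝ) := by exact_mod_cast k.factorial_pos
    have h2 : fullSq e0 (φ y) ≤ (k.factorial : ℝ) := by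
      rw [fullSq_eq_factorial_mul_normSq]; nlinarith
    rw [fullSq_eq_of_isOrtho hb f he0 hcard (by simp)] at h2
    have h3 : fullSq e (projForm g' h θ' φ y) ≤ (k.factorial : ℝ) := by
      rw [fullSq_eq_of_isOrtho hb' f' he hcard (by simp)]
      have h4 : fullSq (consFrame (grad g' θ' y) u) (projForm g' h θ' φ y) =
          h y ^ 2 * fullSq (consFrame (grad g' θ' y) u)
            ((φ y).compContinuousLinearMap (horProj (θ' y) (grad g' θ' y))) := by
        unfold fullSq
        rw [Finset.mul_sum]
        refine Finset.sum_congr rfl fun I _ => ?_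
        rw [← mul_pow]; rfl
      rw [h4, hh y, one_mul, fullSq_consFrame_horProj (apply_grad_self g' hu' y) huker']
      exact (fullSq_le_fullSq_consFrame _ _ _).trans h2
    rw [fullSq_eq_factorial_mul_normSq] at h3
    by_contra hcon
    nlinarith
  have : restrictTo T θ φ = restrictTo T θ' (projForm g' h θ' φ) := by
    rw [restrictTo, restrictTo, hw]
  rw [this]
  exact Heis.le_mass (isTestForm_projForm g' hsm hθ' hφ) hnorm

lemma extD_oneForm_apply {θ : V → E →L[ℝ] ℝ} (hθ : IsSmoothForm (oneForm θ)) (y : V) (v w : E) :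
    extD (oneForm θ) y ![v, w] = fderiv ℝ (chartOneForm θ y) (chartAt E y y) v w -
      fderiv ℝ (chartOneForm θ y) (chartAt E y y) w v := by
  have hmem := (chartAt E y).open_target.mem_nhds (mem_chart_target E y)
  have hd : DifferentiableAt ℝ (chartForm (oneForm θ) y) (chartAt E y y) :=
    ((hθ y).contDiffAt hmem).differentiableAt (by simp)
  have hd' : DifferentiableAt ℝ (chartOneForm θ y) (chartAt E y y) :=
    ((contDiffOn_chartOneForm hθ y).contDiffAt hmem).differentiableAt (by simp)
  have h1 : ∀ z : E, ∀ a : Fin 1 → E, fderiv ℝ (fun u => chartForm (oneForm θ) y u a)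
      (chartAt E y y) z = fderiv ℝ (chartOneForm θ y) (chartAt E y y) z (a 0) := by
    intro z a
    have : (fun u => chartForm (oneForm θ) y u a) = fun u => chartOneForm θ y u (a 0) := rfl
    rw [this, fderiv_clm_apply hd' (differentiableAt_const _)]
    simp
  rw [extD, extDeriv_apply hd, Fin.sum_univ_two, h1, h1]
  simp [Fin.removeNth, sub_eq_add_neg]

/-- Normalized contact forms with the same subRiemannian data agree up to sign. -/
lemma sq_apply_grad_eq_one {n : ℕ} (hn : 1 ≤ n) (hdim : Module.finrank ℝ E = 2 * n + 1)
    {g g' : Bundle.ContMDiffRiemannianMetric 𝓘(ℝ, E) ∞ E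
      (fun x : V => TangentSpace 𝓘(ℝ, E) x)} {θ θ' : V → E →L[ℝ] ℝ}
    (hθ : IsSmoothForm (oneForm θ)) (hθ' : IsSmoothForm (oneForm θ'))
    (hu' : IsUnitForm (metricOf g') θ')
    (hs : SameSubRiemannian (metricOf g) θ (metricOf g') θ')
    (hN : IsNormalized n (metricOf g) θ) (hN' : IsNormalized n (metricOf g') θ') (y : V) :
    (θ y (grad g' θ' y)) ^ 2 = 1 := by
  set h : V → ℝ := fun y => θ y (grad g' θ' y) with hdef
  have hker : ∀ y v, θ y v = h y * θ' y v := by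
    intro y v
    have h1 : θ' y (v - θ' y v • grad g' θ' y) = 0 := by
      rw [map_sub, map_smul, apply_grad_self g' hu', smul_eq_mul, mul_one, sub_self]
    have h2 := ((hs y).1 _).2 h1
    rw [map_sub, map_smul, smul_eq_mul, sub_eq_zero] at h2
    rw [h2, mul_comm]
  have hcard := card_option_ker (θ' y) (ne_zero_of_isUnitForm g' hu' y)
  rw [Fintype.card_option, Fintype.card_fin, hdim] at hcard
  obtain ⟨e, hek, heo⟩ := (isInner_metricOf g' y).restrict_exists
    (LinearMap.ker (θ' y : E →ₗ[ℝ] ℝ)) (m := 2 * n) (by omega)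
  have hek' : ∀ i, θ' y (e i) = 0 := hek
  have hek2 : ∀ i, θ y (e i) = 0 := fun i => ((hs y).1 _).2 (hek' i)
  have heo2 : IsOrtho (metricOf g y) e :=
    ⟨fun i => by rw [(hs y).2 _ _ (hek2 i) (hek2 i)]; exact heo.1 i,
      fun i j hij => by rw [(hs y).2 _ _ (hek2 i) (hek2 j)]; exact heo.2 i j hij⟩
  have h1 := hN y e hek2 heo2
  have h2 := hN' y e hek' heo
  set u0 := chartAt E y y with hu0
  have hmem := (chartAt E y).open_target.mem_nhds (mem_chart_target E y)
  set H : E → ℝ := fun u => chartOneForm θ y u (chartGrad g' θ' y u) with hH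
  have hHd : DifferentiableAt ℝ H u0 :=
    ((((contDiffOn_chartOneForm hθ y).clm_apply
      (contDiffOn_chartGrad g' hθ' y)).contDiffAt hmem).differentiableAt (by simp))
  have hd' : DifferentiableAt ℝ (chartOneForm θ' y) u0 :=
    ((contDiffOn_chartOneForm hθ' y).contDiffAt hmem).differentiableAt (by simp)
  have hEq : chartOneForm θ y =ᶠ[𝓝 u0] fun u => H u • chartOneForm θ' y u := by
    filter_upwards [hmem] with u hu
    ext v
    simp only [hH, chartOneForm, ContinuousLinearMap.comp_apply, ContinuousLinearMap.smul_apply,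
      smul_eq_mul]
    rw [chartDeriv_chartGrad g' θ' y hu, hker]
  have hsymm : (chartAt E y).symm u0 = y := (chartAt E y).left_inv (mem_chart_source E y)
  have hH0 : H u0 = h y := by
    simp only [hH, chartOneForm, ContinuousLinearMap.comp_apply]
    rw [chartDeriv_chartGrad g' θ' y (mem_chart_target E y), hsymm]
  have h0 : ∀ i, chartOneForm θ' y u0 (e i) = 0 := by
    intro i
    rw [chartOneForm, hsymm, hu0, chartDeriv_self]
    exact hek' i
  -- The product rule also produces the derivative of `H` times `θ'`, which vanishes on the
  -- horizontal vector `e j`.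
  have hD : ∀ i j, fderiv ℝ (chartOneForm θ y) u0 (e i) (e j) =
      h y * fderiv ℝ (chartOneForm θ' y) u0 (e i) (e j) := by
    intro i j
    rw [hEq.fderiv_eq, fderiv_fun_smul hHd hd', hH0]
    simp [h0]
  have hmat : (Matrix.of fun i j => extD (oneForm θ) y ![e i, e j]) =
      h y • (Matrix.of fun i j => extD (oneForm θ') y ![e i, e j]) := by
    ext i j
    simp only [Matrix.of_apply, Matrix.smul_apply, smul_eq_mul]
    rw [extD_oneForm_apply hθ, extD_oneForm_apply hθ', hD, hD]
    ring
  -- The matrices have even size `2 * n`, so the determinant is multiplied by `(h ^ 2) ^ n`,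
  -- whatever the sign of `h`.
  rw [hmat, Matrix.det_smul, abs_mul, h2, mul_one, Fintype.card_fin, pow_mul, abs_pow,
    abs_of_nonneg (sq_nonneg _)] at h1
  exact (pow_eq_one_iff_of_nonneg (sq_nonneg _) (by omega)).1 h1

/-- The oblique mass depends only on the subRiemannian data. -/
theorem obliqueMass_eq_of_sameSubRiemannian {n : ℕ} (hn : 1 ≤ n)
    (hdim : Module.finrank ℝ E = 2 * n + 1)
    (g g' : Bundle.ContMDiffRiemannianMetric 𝓘(ℝ, E) ∞ E
      (fun x : V => TangentSpace 𝓘(ℝ, E) x)) (θ θ' : V → E →L[ℝ] ℝ)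
    (hθ : IsSmoothForm (oneForm θ)) (hθ' : IsSmoothForm (oneForm θ'))
    (hu : IsUnitForm (metricOf g) θ) (hu' : IsUnitForm (metricOf g') θ')
    (hs : SameSubRiemannian (metricOf g) θ (metricOf g') θ')
    (hN : θ = θ' ∨ (IsNormalized n (metricOf g) θ ∧ IsNormalized n (metricOf g') θ'))
    {k : ℕ} (T : DForm E V (k + 1) → ℝ) :
    obliqueMass (metricOf g) θ T = obliqueMass (metricOf g') θ' T := by
  have hs' : SameSubRiemannian (metricOf g') θ' (metricOf g) θ := fun y =>
    ⟨fun v => ((hs y).1 v).symm, fun v w hv hw =>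
      ((hs y).2 v w (((hs y).1 v).2 hv) (((hs y).1 w).2 hw)).symm⟩
  rcases hN with rfl | ⟨hN, hN'⟩
  · refine le_antisymm (obliqueMass_le_of_eq_smul hθ hθ' hu hu' hs (fun y => ?_) T)
      (obliqueMass_le_of_eq_smul hθ' hθ hu' hu hs' (fun y => ?_) T)
    · rw [apply_grad_self g' hu', one_pow]
    · rw [apply_grad_self g hu, one_pow]
  · exact le_antisymm
      (obliqueMass_le_of_eq_smul hθ hθ' hu hu' hs
        (sq_apply_grad_eq_one hn hdim hθ hθ' hu' hs hN hN') T)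
      (obliqueMass_le_of_eq_smul hθ' hθ hu' hu hs'
        (sq_apply_grad_eq_one hn hdim hθ' hθ hu hs' hN' hN) T)

end Charts

namespace Heis

variable {n : ℕ}

/-! ### The group law -/

/-- The squared Euclidean norm of the horizontal component. -/
def zsq (p : Heis n) : ℝ := ∑ j, (p.1 j ^ 2 + p.2.1 j ^ 2)

/-- The symplectic form of the horizontal components. -/
def symp (p q : Heis n) : ℝ := ∑ j, (p.1 j * q.2.1 j - p.2.1 j * q.1 j)

/-- The Euclidean scalar product of the horizontal components. -/
def hdot (p q : Heis n) : ℝ := ∑ j, (p.1 j * q.1 j + p.2.1 j * q.2.1 j)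

lemma zsq_nonneg (p : Heis n) : 0 ≤ zsq p :=
  Finset.sum_nonneg fun _ _ => add_nonneg (sq_nonneg _) (sq_nonneg _)

lemma zsq_add (p q : Heis n) : zsq (p + q) = zsq p + zsq q + 2 * hdot p q := by
  simp only [zsq, hdot, Finset.mul_sum, ← Finset.sum_add_distrib, Prod.fst_add, Prod.snd_add,
    Pi.add_apply]
  exact Finset.sum_congr rfl fun j _ => by ring

lemma symp_add_left (p q r : Heis n) : symp (p + q) r = symp p r + symp q r := by
  simp only [symp, ← Finset.sum_add_distrib, Prod.fst_add, Prod.snd_add, Pi.add_apply]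
  exact Finset.sum_congr rfl fun j _ => by ring

lemma symp_add_right (p q r : Heis n) : symp p (q + r) = symp p q + symp p r := by
  simp only [symp, ← Finset.sum_add_distrib, Prod.fst_add, Prod.snd_add, Pi.add_apply]
  exact Finset.sum_congr rfl fun j _ => by ring

lemma symp_self (p : Heis n) : symp p p = 0 :=
  Finset.sum_eq_zero fun j _ => by ring

lemma symp_swap (p q : Heis n) : symp p q = -symp q p := by
  simp only [symp, ← Finset.sum_neg_distrib]
  exact Finset.sum_congr rfl fun j _ => by ring

lemma symp_neg_left (p q : Heis n) : symp (-p) q = -symp p q := by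
  simp only [symp, ← Finset.sum_neg_distrib, Prod.fst_neg, Prod.snd_neg, Pi.neg_apply]
  exact Finset.sum_congr rfl fun j _ => by ring

lemma symp_neg_right (p q : Heis n) : symp p (-q) = -symp p q := by
  rw [symp_swap, symp_neg_left, symp_swap q, neg_neg]

/-- The symplectic form does not see the vertical components. -/
lemma symp_vert_left (a : ℝ) (q : Heis n) : symp ((0, 0, a) : Heis n) q = 0 := by
  simp [symp]

lemma symp_vert_right (a : ℝ) (q : Heis n) : symp q ((0, 0, a) : Heis n) = 0 := by
  simp [symp]

lemma mul_eq (p q : Heis n) : mul p q = p + q + (0, 0, (1 / 2) * symp p q) := by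
  refine Prod.ext ?_ (Prod.ext ?_ ?_) <;> simp [mul, symp]

lemma contact_eq (p v : Heis n) : contact n p v = v.2.2 - (1 / 2) * symp p v := rfl

lemma mul_assoc' (p q r : Heis n) : mul (mul p q) r = mul p (mul q r) := by
  simp only [mul_eq, symp_add_left, symp_add_right, symp_vert_left, symp_vert_right]
  refine Prod.ext ?_ (Prod.ext ?_ ?_) <;> simp <;> ring

lemma inv_mul_self (p : Heis n) : mul (inv p) p = 0 := by
  rw [mul_eq, inv, symp_neg_left, symp_self]
  simp

lemma mul_inv_self (p : Heis n) : mul p (inv p) = 0 := by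
  rw [mul_eq, inv, symp_neg_right, symp_self]
  simp

lemma zero_mul' (p : Heis n) : mul 0 p = p := by
  rw [mul_eq]
  simp [symp]

lemma mul_zero' (p : Heis n) : mul p 0 = p := by
  rw [mul_eq]
  simp [symp]

lemma inv_mul (p q : Heis n) : inv (mul p q) = mul (inv q) (inv p) := by
  simp only [mul_eq, inv, symp_neg_left, symp_neg_right, neg_neg]
  rw [symp_swap q p]
  refine Prod.ext ?_ (Prod.ext ?_ ?_) <;> simp <;> ring

lemma inv_inv' (p : Heis n) : inv (inv p) = p := neg_neg p

lemma mul_inv_mul_cancel (p q : Heis n) : mul p (mul (inv p) q) = q := by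
  rw [← mul_assoc', mul_inv_self, zero_mul']

lemma inv_mul_mul_cancel (p q : Heis n) : mul (inv p) (mul p q) = q := by
  rw [← mul_assoc', inv_mul_self, zero_mul']

lemma symp_dilation (r : ℝ) (p q : Heis n) :
    symp (dilation r p) (dilation r q) = r ^ 2 * symp p q := by
  simp only [symp, dilation, Finset.mul_sum, Pi.smul_apply, smul_eq_mul]
  exact Finset.sum_congr rfl fun j _ => by ring

lemma zsq_dilation (r : ℝ) (p : Heis n) : zsq (dilation r p) = r ^ 2 * zsq p := by
  simp only [zsq, dilation, Finset.mul_sum, Pi.smul_apply, smul_eq_mul]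
  exact Finset.sum_congr rfl fun j _ => by ring

lemma dilation_mul (r : ℝ) (p q : Heis n) :
    dilation r (mul p q) = mul (dilation r p) (dilation r q) := by
  simp only [mul_eq, symp_dilation]
  refine Prod.ext ?_ (Prod.ext ?_ ?_) <;> simp [dilation, smul_add] <;> ring

lemma dilation_inv (r : ℝ) (p : Heis n) : dilation r (inv p) = inv (dilation r p) := by
  refine Prod.ext ?_ (Prod.ext ?_ ?_) <;> simp [dilation, inv]

/-- The Hermitian Cauchy-Schwarz inequality. -/
lemma hdot_sq_add_symp_sq_le (p q : Heis n) : hdot p q ^ 2 + symp p q ^ 2 ≤ zsq p * zsq q := by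
  let w : Heis n → Fin n → ℂ := fun p j => ⟨p.1 j, p.2.1 j⟩
  have h1 : (⟨hdot p q, symp p q⟩ : ℂ) = ∑ j, (starRingEnd ℂ) (w p j) * w q j := by
    apply Complex.ext
    · simp only [Complex.re_sum, hdot]
      exact Finset.sum_congr rfl fun j _ => by simp [w]
    · simp only [Complex.im_sum, symp]
      exact Finset.sum_congr rfl fun j _ => by simp [w]; ring
  have h2 : ∀ p : Heis n, zsq p = ∑ j, ‖w p j‖ ^ 2 := fun p =>
    Finset.sum_congr rfl fun j _ => by
      rw [← Complex.normSq_eq_norm_sq, Complex.normSq_apply]; ring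
  have h3 : ‖(⟨hdot p q, symp p q⟩ : ℂ)‖ ≤ ∑ j, ‖w p j‖ * ‖w q j‖ := by
    rw [h1]
    refine (norm_sum_le _ _).trans (Finset.sum_le_sum fun j _ => ?_)
    rw [norm_mul, RCLike.norm_conj]
  have h4 : hdot p q ^ 2 + symp p q ^ 2 = ‖(⟨hdot p q, symp p q⟩ : ℂ)‖ ^ 2 := by
    rw [← Complex.normSq_eq_norm_sq, Complex.normSq_apply]; ring
  rw [h4, h2, h2]
  calc _ ≤ (∑ j, ‖w p j‖ * ‖w q j‖) ^ 2 := by gcongr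
    _ ≤ _ := Finset.sum_mul_sq_le_sq_mul_sq _ _ _

lemma abs_symp_le (p q : Heis n) : |symp p q| ≤ Real.sqrt (zsq p) * Real.sqrt (zsq q) := by
  rw [← Real.sqrt_mul (zsq_nonneg p)]
  apply Real.abs_le_sqrt
  nlinarith [hdot_sq_add_symp_sq_le p q, sq_nonneg (hdot p q)]

/-! ### Homogeneous norms -/

/-- Homogeneous norms which depend only on `|z|` and `t`. -/
structure IsHomNorm (N : Heis n → ℝ) : Prop where
  mul_le : ∀ p q, N (mul p q) ≤ N p + N q
  map_inv : ∀ p, N (inv p) = N p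
  map_dilation : ∀ r : ℝ, 0 < r → ∀ p, N (dilation r p) = r * N p
  rot : ∀ p q : Heis n, zsq p = zsq q → p.2.2 = q.2.2 → N p = N q
  bound : ∃ C : ℝ, 0 < C ∧ ∀ p : Heis n, Real.sqrt (zsq p) ≤ C * N p ∧
    Real.sqrt |p.2.2| ≤ C * N p ∧ N p ≤ C * (Real.sqrt (zsq p) + Real.sqrt |p.2.2|)

lemma gauge_eq (p : Heis n) : gauge p = Real.sqrt ‖(⟨zsq p, 4 * p.2.2⟩ : ℂ)‖ := by
  have h : ‖(⟨zsq p, 4 * p.2.2⟩ : ℂ)‖ = Real.sqrt (zsq p ^ 2 + 16 * p.2.2 ^ 2) := by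
    rw [← Real.sqrt_sq (norm_nonneg _), ← Complex.normSq_eq_norm_sq, Complex.normSq_apply]
    congr 1; ring
  have h0 : 0 ≤ zsq p ^ 2 + 16 * p.2.2 ^ 2 := by positivity
  rw [h, gauge, Real.sqrt_eq_rpow, Real.sqrt_eq_rpow, ← Real.rpow_mul h0]
  norm_num [zsq]

lemma gauge_nonneg (p : Heis n) : 0 ≤ gauge p := by
  rw [gauge_eq]; exact Real.sqrt_nonneg _

lemma gauge_sq (p : Heis n) : gauge p ^ 2 = ‖(⟨zsq p, 4 * p.2.2⟩ : ℂ)‖ := by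
  rw [gauge_eq, Real.sq_sqrt (norm_nonneg _)]

lemma zsq_le_gauge_sq (p : Heis n) : zsq p ≤ gauge p ^ 2 := by
  rw [gauge_sq]
  exact (le_abs_self _).trans (Complex.abs_re_le_norm (⟨zsq p, 4 * p.2.2⟩ : ℂ))

lemma abs_le_gauge_sq (p : Heis n) : 4 * |p.2.2| ≤ gauge p ^ 2 := by
  rw [gauge_sq]
  have := Complex.abs_im_le_norm (⟨zsq p, 4 * p.2.2⟩ : ℂ)
  rwa [abs_mul, abs_of_pos (by norm_num : (0 : ℝ) < 4)] at this

lemma gauge_sq_le (p : Heis n) : gauge p ^ 2 ≤ zsq p + 4 * |p.2.2| := by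
  rw [gauge_sq]
  have := Complex.norm_le_abs_re_add_abs_im (⟨zsq p, 4 * p.2.2⟩ : ℂ)
  rwa [abs_mul, abs_of_pos (by norm_num : (0 : ℝ) < 4), abs_of_nonneg (zsq_nonneg p)] at this

/-- The square of the norm is the modulus of `zsq p + 4 i t`. For a product, these complex numbers
add up to twice the Hermitian product of the horizontal components, which is bounded by `gauge p *
gauge q`. The right side is then the square of `gauge p + gauge q`. -/
lemma gauge_mul_le (p q : Heis n) : gauge (mul p q) ≤ gauge p + gauge q := by
  have hz : zsq (mul p q) = zsq p + zsq q + 2 * hdot p q := by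
    rw [← zsq_add, mul_eq]
    simp [zsq]
  have ht : 4 * (mul p q).2.2 = 4 * p.2.2 + 4 * q.2.2 + 2 * symp p q := by
    rw [mul_eq]; simp; ring
  have h1 : (⟨zsq (mul p q), 4 * (mul p q).2.2⟩ : ℂ) =
      ⟨zsq p, 4 * p.2.2⟩ + ⟨zsq q, 4 * q.2.2⟩ + 2 * ⟨hdot p q, symp p q⟩ := by
    rw [hz, ht]
    apply Complex.ext <;> simp
  have h2 : ‖(⟨hdot p q, symp p q⟩ : ℂ)‖ ≤ gauge p * gauge q := by
    refine abs_le_of_sq_le_sq' ?_ (mul_nonneg (gauge_nonneg p) (gauge_nonneg q)) |>.2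
    rw [← Complex.normSq_eq_norm_sq, Complex.normSq_apply, mul_pow]
    calc _ = hdot p q ^ 2 + symp p q ^ 2 := by ring
      _ ≤ zsq p * zsq q := hdot_sq_add_symp_sq_le p q
      _ ≤ _ := mul_le_mul (zsq_le_gauge_sq p) (zsq_le_gauge_sq q) (zsq_nonneg q) (sq_nonneg _)
  refine abs_le_of_sq_le_sq' ?_ (add_nonneg (gauge_nonneg p) (gauge_nonneg q)) |>.2
  rw [gauge_sq, h1]
  calc _ ≤ ‖(⟨zsq p, 4 * p.2.2⟩ : ℂ)‖ + ‖(⟨zsq q, 4 * q.2.2⟩ : ℂ)‖ +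
        ‖2 * (⟨hdot p q, symp p q⟩ : ℂ)‖ := norm_add₃_le
    _ ≤ gauge p ^ 2 + gauge q ^ 2 + 2 * (gauge p * gauge q) := by
        rw [norm_mul, gauge_sq, gauge_sq]
        gcongr
        simp
    _ = _ := by ring

lemma isHomNorm_gauge : IsHomNorm (gauge (n := n)) where
  mul_le := gauge_mul_le
  map_inv p := by simp [gauge, inv]
  map_dilation r hr p := by
    refine (sq_eq_sq₀ (gauge_nonneg _) (mul_nonneg hr.le (gauge_nonneg _))).1 ?_
    rw [mul_pow, gauge_sq, gauge_sq, zsq_dilation]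
    have : (⟨r ^ 2 * zsq p, 4 * (dilation r p).2.2⟩ : ℂ) =
        ((r ^ 2 : ℝ) : ℂ) * ⟨zsq p, 4 * p.2.2⟩ := by
      apply Complex.ext
      · rw [Complex.re_ofReal_mul]
      · rw [Complex.im_ofReal_mul]; simp only [dilation]; ring
    rw [this, norm_mul, Complex.norm_real, Real.norm_of_nonneg (sq_nonneg r)]
  rot p q h h' := by rw [gauge_eq, gauge_eq, h, h']
  bound := by
    refine ⟨2, two_pos, fun p => ?_⟩
    have hg := gauge_nonneg p
    refine ⟨?_, ?_, ?_⟩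
    · rw [Real.sqrt_le_left (by positivity)]
      nlinarith [zsq_le_gauge_sq p]
    · rw [Real.sqrt_le_left (by positivity)]
      nlinarith [abs_le_gauge_sq p, abs_nonneg p.2.2]
    · refine abs_le_of_sq_le_sq' ?_ (by positivity) |>.2
      have h1 := Real.sq_sqrt (zsq_nonneg p)
      have h2 := Real.sq_sqrt (abs_nonneg p.2.2)
      nlinarith [gauge_sq_le p, mul_nonneg (Real.sqrt_nonneg (zsq p)) (Real.sqrt_nonneg |p.2.2|)]

end Heis

namespace Heis

variable {n : ℕ}

/-! ### The subRiemannian distance -/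

lemma arcLength_eq (γ : ℝ → Heis n) : arcLength γ =
    ∫⁻ s in Icc (0 : ℝ) 1, ENNReal.ofReal (Real.sqrt (zsq (derivWithin γ (Icc 0 1) s))) := rfl

/-- `ℓ` is the length of a concatenation of horizontal arcs from `p` to `q`. -/
def IsPathLength (p q : Heis n) (ℓ : ℝ≥0∞) : Prop :=
  ∃ (N : ℕ) (γ : ℕ → ℝ → Heis n), (∀ i ≤ N, IsHorizontalArc (γ i)) ∧
    (∀ i < N, γ i 1 = γ (i + 1) 0) ∧ γ 0 0 = p ∧ γ N 1 = q ∧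
      ℓ = ∑ i ∈ Finset.range (N + 1), arcLength (γ i)

lemma subRiemannianDist_le {p q : Heis n} {ℓ : ℝ≥0∞} (h : IsPathLength p q ℓ) :
    subRiemannianDist p q ≤ ℓ := by
  obtain ⟨N, γ, h1, h2, h3, h4, rfl⟩ := h
  exact (iInf₂_le N γ).trans ((iInf₂_le h1 h2).trans (iInf₂_le h3 h4))

lemma le_subRiemannianDist {p q : Heis n} {x : ℝ≥0∞} (h : ∀ ℓ, IsPathLength p q ℓ → x ≤ ℓ) :
    x ≤ subRiemannianDist p q :=
  le_iInf₂ fun N γ => le_iInf₂ fun h1 h2 => le_iInf₂ fun h3 h4 =>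
    h _ ⟨N, γ, h1, h2, h3, h4, rfl⟩

lemma IsPathLength.trans {p q r : Heis n} {ℓ ℓ' : ℝ≥0∞} (h : IsPathLength p q ℓ)
    (h' : IsPathLength q r ℓ') : IsPathLength p r (ℓ + ℓ') := by
  obtain ⟨N, γ, h1, h2, h3, h4, rfl⟩ := h
  obtain ⟨N', γ', h1', h2', h3', h4', rfl⟩ := h'
  refine ⟨N + 1 + N', fun i => if i ≤ N then γ i else γ' (i - (N + 1)), ?_, ?_, ?_, ?_, ?_⟩
  · intro i hi
    dsimp only
    split_ifs with h
    · exact h1 i h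
    · exact h1' _ (by omega)
  · intro i hi
    dsimp only
    rcases lt_trichotomy i N with h | h | h
    · rw [if_pos h.le, if_pos (by omega)]
      exact h2 i h
    · subst h
      rw [if_pos le_rfl, if_neg (by omega), h4, show i + 1 - (i + 1) = 0 by omega, h3']
    · rw [if_neg (by omega), if_neg (by omega),
        show i + 1 - (N + 1) = (i - (N + 1)) + 1 by omega]
      exact h2' _ (by omega)
  · simpa using h3
  · dsimp only
    rw [if_neg (by omega), show N + 1 + N' - (N + 1) = N' by omega, h4']
  · have e1 : ∀ i ∈ Finset.range (N + 1),
        arcLength (if i ≤ N then γ i else γ' (i - (N + 1))) = arcLength (γ i) := fun i hi => by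
      rw [if_pos (by rw [Finset.mem_range] at hi; omega)]
    have e2 : ∀ i ∈ Finset.range (N' + 1), arcLength (if N + 1 + i ≤ N then γ (N + 1 + i) else
        γ' (N + 1 + i - (N + 1))) = arcLength (γ' i) := fun i hi => by
      rw [if_neg (by omega), show N + 1 + i - (N + 1) = i by omega]
    symm
    rw [show N + 1 + N' + 1 = (N + 1) + (N' + 1) by omega]
    refine (Finset.sum_range_add _ _ _).trans ?_
    exact congrArg₂ (· + ·) (Finset.sum_congr rfl e1) (Finset.sum_congr rfl e2)

lemma subRiemannianDist_triangle (p q r : Heis n) :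
    subRiemannianDist p r ≤ subRiemannianDist p q + subRiemannianDist q r := by
  rw [← tsub_le_iff_right]
  refine le_subRiemannianDist fun ℓ h => ?_
  rw [tsub_le_iff_right, ← tsub_le_iff_left]
  refine le_subRiemannianDist fun ℓ' h' => ?_
  rw [tsub_le_iff_left]
  exact subRiemannianDist_le (h.trans h')

lemma IsHorizontalArc.differentiableWithinAt {γ : ℝ → Heis n} (h : IsHorizontalArc γ) {s : ℝ}
    (hs : s ∈ Icc (0 : ℝ) 1) : DifferentiableWithinAt ℝ γ (Icc 0 1) s :=
  h.1.differentiableOn one_ne_zero s hs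

/-- Affine maps preserving horizontality and scaling horizontal lengths map arcs to arcs. -/
lemma arc_map {γ : ℝ → Heis n} (hγ : IsHorizontalArc γ) (c : Heis n) (L : Heis n →L[ℝ] Heis n)
    (hc : ∀ p v, contact n p v = 0 → contact n (c + L p) (L v) = 0) {r : ℝ} (hr : 0 ≤ r)
    (hz : ∀ v, zsq (L v) = r ^ 2 * zsq v) :
    IsHorizontalArc (fun s => c + L (γ s)) ∧
      arcLength (fun s => c + L (γ s)) = ENNReal.ofReal r * arcLength γ := by
  have hd : ∀ s ∈ Icc (0 : ℝ) 1, derivWithin (fun s => c + L (γ s)) (Icc 0 1) s =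
      L (derivWithin γ (Icc 0 1) s) := by
    intro s hs
    have h1 := (hγ.differentiableWithinAt hs).hasDerivWithinAt
    exact ((L.hasFDerivAt.comp_hasDerivWithinAt s h1).const_add c).derivWithin
      (uniqueDiffOn_Icc zero_lt_one s hs)
  refine ⟨⟨contDiffOn_const.add (L.contDiff.comp_contDiffOn hγ.1), fun s hs => ?_⟩, ?_⟩
  · rw [hd s hs]
    exact hc _ _ (hγ.2 s hs)
  · rw [arcLength_eq, arcLength_eq, ← lintegral_const_mul' _ _ ENNReal.ofReal_ne_top]
    refine setLIntegral_congr_fun measurableSet_Icc fun s hs => ?_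
    rw [hd s hs, hz, Real.sqrt_mul (sq_nonneg r), Real.sqrt_sq hr, ENNReal.ofReal_mul hr]

/-- One statement for left translations, dilations and unitary rotations. -/
lemma subRiemannianDist_map_le (c : Heis n) (L : Heis n →L[ℝ] Heis n)
    (hc : ∀ p v, contact n p v = 0 → contact n (c + L p) (L v) = 0) {r : ℝ} (hr : 0 < r)
    (hz : ∀ v, zsq (L v) = r ^ 2 * zsq v) (p q : Heis n) :
    subRiemannianDist (c + L p) (c + L q) ≤ ENNReal.ofReal r * subRiemannianDist p q := by
  have h0 : ENNReal.ofReal r ≠ 0 := by rwa [Ne, ENNReal.ofReal_eq_zero, not_le]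
  rw [← ENNReal.div_le_iff' h0 ENNReal.ofReal_ne_top]
  refine le_subRiemannianDist fun ℓ h => ?_
  rw [ENNReal.div_le_iff' h0 ENNReal.ofReal_ne_top]
  obtain ⟨N, γ, h1, h2, h3, h4, rfl⟩ := h
  refine subRiemannianDist_le ⟨N, fun i s => c + L (γ i s), fun i hi => ?_, fun i hi => ?_, ?_, ?_, ?_⟩
  · exact (arc_map (h1 i hi) c L hc hr.le hz).1
  · dsimp only; rw [h2 i hi]
  · dsimp only; rw [h3]
  · dsimp only; rw [h4]
  · rw [Finset.mul_sum]
    refine Finset.sum_congr rfl fun i hi => ?_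
    rw [(arc_map (h1 i (by rw [Finset.mem_range] at hi; omega)) c L hc hr.le hz).2]

lemma subRiemannianDist_symm_le (p q : Heis n) : subRiemannianDist q p ≤ subRiemannianDist p q := by
  refine le_subRiemannianDist fun ℓ h => subRiemannianDist_le ?_
  obtain ⟨N, γ, h1, h2, h3, h4, rfl⟩ := h
  have hd : ∀ i ≤ N, ∀ s ∈ Icc (0 : ℝ) 1, derivWithin (fun s => γ i (1 - s)) (Icc 0 1) s =
      -derivWithin (γ i) (Icc 0 1) (1 - s) := by
    intro i hi s hs
    have hs' : 1 - s ∈ Icc (0 : ℝ) 1 := ⟨by linarith [hs.2], by linarith [hs.1]⟩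
    have e1 := ((h1 i hi).differentiableWithinAt hs').hasDerivWithinAt
    have e2 : HasDerivWithinAt (fun s : ℝ => 1 - s) (-1) (Icc 0 1) s :=
      ((hasDerivAt_id s).const_sub 1).hasDerivWithinAt
    have e3 := (e1.scomp s e2 (fun u hu => ⟨by linarith [hu.2], by linarith [hu.1]⟩)).derivWithin
      (uniqueDiffOn_Icc zero_lt_one s hs)
    rw [neg_one_smul] at e3
    exact e3
  refine ⟨N, fun i s => γ (N - i) (1 - s), fun i hi => ⟨?_, fun s hs => ?_⟩, fun i hi => ?_, ?_, ?_,
    ?_⟩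
  · exact (h1 (N - i) (by omega)).1.comp (contDiffOn_const.sub contDiffOn_id)
      (fun u hu => ⟨by simpa using hu.2, by simpa using hu.1⟩)
  · rw [hd (N - i) (by omega) s hs, map_neg,
      (h1 (N - i) (by omega)).2 (1 - s) ⟨by linarith [hs.2], by linarith [hs.1]⟩, neg_zero]
  · dsimp only
    rw [sub_self, sub_zero, show N - i = N - (i + 1) + 1 by omega, h2 _ (by omega)]
  · simpa using h4
  · simpa using h3
  · rw [← Finset.sum_range_reflect]
    refine Finset.sum_congr rfl fun i hi => ?_
    rw [Finset.mem_range] at hi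
    rw [show N + 1 - 1 - i = N - i by omega, arcLength_eq, arcLength_eq]
    have e1 : ∀ s ∈ Icc (0 : ℝ) 1,
        ENNReal.ofReal (Real.sqrt (zsq (derivWithin (fun s => γ (N - i) (1 - s)) (Icc 0 1) s))) =
        ENNReal.ofReal (Real.sqrt (zsq (derivWithin (γ (N - i)) (Icc 0 1) (1 - s)))) := by
      intro s hs
      rw [hd (N - i) (by omega) s hs]
      simp [zsq]
    -- The change of variable `s ↦ 1 - s` is made on the whole line, after writing both integrals
    -- with indicators of `[0, 1]`.
    rw [setLIntegral_congr_fun measurableSet_Icc e1, ← lintegral_indicator measurableSet_Icc,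
      ← lintegral_indicator measurableSet_Icc, ← lintegral_sub_left_eq_self _ (1 : ℝ)]
    refine lintegral_congr fun s => ?_
    simp only [indicator, mem_Icc, sub_nonneg, sub_le_self_iff, and_comm]

lemma subRiemannianDist_symm (p q : Heis n) : subRiemannianDist p q = subRiemannianDist q p :=
  le_antisymm (subRiemannianDist_symm_le q p) (subRiemannianDist_symm_le p q)

/-- The linear part of a left translation. -/
def transL (a : Heis n) : Heis n →L[ℝ] Heis n :=
  LinearMap.toContinuousLinearMap
    { toFun := fun v => v + (0, 0, (1 / 2) * symp a v)
      map_add' := fun v w => by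
        rw [symp_add_right]
        refine Prod.ext ?_ (Prod.ext ?_ ?_) <;> simp <;> ring
      map_smul' := fun c v => by
        have : symp a (c • v) = c * symp a v := by
          simp only [symp, Finset.mul_sum]
          exact Finset.sum_congr rfl fun j _ => by simp; ring
        rw [this]
        refine Prod.ext ?_ (Prod.ext ?_ ?_) <;> simp; ring }

lemma transL_apply (a v : Heis n) : transL a v = v + (0, 0, (1 / 2) * symp a v) := rfl

lemma mul_eq_transL (a p : Heis n) : mul a p = a + transL a p := by
  rw [mul_eq, transL_apply, add_assoc]

lemma zsq_add_vert (v : Heis n) (t : ℝ) : zsq (v + (0, 0, t)) = zsq v := by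
  simp [zsq]

lemma contact_mul_transL (a p v : Heis n) :
    contact n (a + transL a p) (transL a v) = contact n p v := by
  simp only [contact_eq, transL_apply, symp_add_left, symp_add_right, symp_vert_left,
    symp_vert_right]
  simp
  ring

lemma subRiemannianDist_mul_left_le (a p q : Heis n) :
    subRiemannianDist (mul a p) (mul a q) ≤ subRiemannianDist p q := by
  rw [mul_eq_transL, mul_eq_transL]
  have := subRiemannianDist_map_le a (transL a) (fun p v h => by rw [contact_mul_transL, h])
    one_pos (fun v => by rw [transL_apply, zsq_add_vert, one_pow, one_mul]) p q
  simpa using this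

lemma subRiemannianDist_mul_left (a p q : Heis n) :
    subRiemannianDist (mul a p) (mul a q) = subRiemannianDist p q := by
  refine le_antisymm (subRiemannianDist_mul_left_le a p q) ?_
  have := subRiemannianDist_mul_left_le (inv a) (mul a p) (mul a q)
  rwa [inv_mul_mul_cancel, inv_mul_mul_cancel] at this

lemma subRiemannianDist_eq_inv_mul (p q : Heis n) :
    subRiemannianDist p q = subRiemannianDist 0 (mul (inv p) q) := by
  rw [← subRiemannianDist_mul_left (inv p) p q, inv_mul_self]

lemma subRiemannianDist_dilation_le {r : ℝ} (hr : 0 < r) (p : Heis n) :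
    subRiemannianDist 0 (dilation r p) ≤ ENNReal.ofReal r * subRiemannianDist 0 p := by
  have := subRiemannianDist_map_le 0 (dilationL n r) (fun p v h => by
    rw [zero_add, dilationL_apply, dilationL_apply, contact_dilation, h, mul_zero]) hr
    (fun v => zsq_dilation r v) 0 p
  simpa only [map_zero, zero_add, dilationL_apply] using this

/-! #### Rotations -/

/-- The horizontal component as a vector of `ℂⁿ`. -/
def toC (p : Heis n) : EuclideanSpace ℂ (Fin n) := WithLp.toLp 2 fun j => ⟨p.1 j, p.2.1 j⟩

lemma norm_toC_sq (p : Heis n) : ‖toC p‖ ^ 2 = zsq p := by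
  rw [EuclideanSpace.norm_sq_eq]
  refine Finset.sum_congr rfl fun j _ => ?_
  rw [← Complex.normSq_eq_norm_sq, Complex.normSq_apply]
  simp only [toC]
  ring

lemma inner_toC_im (p q : Heis n) : (inner ℂ (toC p) (toC q)).im = symp p q := by
  rw [PiLp.inner_apply, Complex.im_sum]
  refine Finset.sum_congr rfl fun j _ => ?_
  simp [toC]
  ring

/-- Send the line of `w` to the line of `w'` isometrically and extend: unitary maps act transitively
on spheres. -/
lemma exists_unitary {F : Type*} [NormedAddCommGroup F] [InnerProductSpace ℂ F]
    [FiniteDimensional ℂ F] {w w' : F} (h : ‖w‖ = ‖w'‖) : ∃ U : F →ₗᵢ[ℂ] F, U w = w' := by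
  by_cases hw : w = 0
  · refine ⟨LinearIsometry.id, ?_⟩
    have h2 : w' = 0 := by rw [← norm_eq_zero, ← h, hw, norm_zero]
    rw [hw, h2, map_zero]
  · set e := LinearEquiv.toSpanNonzeroSingleton ℂ F w hw with he
    let L : Submodule.span ℂ {w} →ₗ[ℂ] F :=
      (LinearMap.toSpanSingleton ℂ F w').comp e.symm.toLinearMap
    have hLe : ∀ c, L (e c) = c • w' := by
      intro c
      show (e.symm (e c)) • w' = c • w'
      rw [e.symm_apply_apply]
    have hL : ∀ x, ‖L x‖ = ‖x‖ := by
      intro x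
      obtain ⟨c, rfl⟩ := e.surjective x
      rw [hLe, norm_smul, ← h, ← norm_smul]
      rfl
    let I : Submodule.span ℂ {w} →ₗᵢ[ℂ] F := ⟨L, hL⟩
    refine ⟨I.extend, ?_⟩
    have h1 := LinearIsometry.extend_apply I (e 1)
    have h2 : ((e 1 : Submodule.span ℂ {w}) : F) = w := by simp [he]
    rw [h2] at h1
    rw [h1]
    exact (hLe 1).trans (one_smul _ _)

/-- The rotation of `ℍⁿ` associated with a unitary map. -/
def rotL (U : EuclideanSpace ℂ (Fin n) →ₗᵢ[ℂ] EuclideanSpace ℂ (Fin n)) : Heis n →L[ℝ] Heis n :=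
  LinearMap.toContinuousLinearMap
    { toFun := fun v => (fun j => (U (toC v) j).re, fun j => (U (toC v) j).im, v.2.2)
      map_add' := fun v w => by
        have : toC (v + w) = toC v + toC w := by
          ext j; apply Complex.ext <;> simp [toC]
        rw [this, map_add]
        refine Prod.ext ?_ (Prod.ext ?_ ?_) <;> [ext j; ext j; skip] <;> simp
      map_smul' := fun c v => by
        have : toC (c • v) = (c : ℂ) • toC v := by
          ext j; apply Complex.ext <;> simp [toC]
        rw [this, map_smul]
        refine Prod.ext ?_ (Prod.ext ?_ ?_) <;> [ext j; ext j; skip] <;> simp }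

lemma toC_rotL (U : EuclideanSpace ℂ (Fin n) →ₗᵢ[ℂ] EuclideanSpace ℂ (Fin n)) (v : Heis n) :
    toC (rotL U v) = U (toC v) := by
  ext j
  apply Complex.ext <;> rfl

lemma zsq_rotL (U : EuclideanSpace ℂ (Fin n) →ₗᵢ[ℂ] EuclideanSpace ℂ (Fin n)) (v : Heis n) :
    zsq (rotL U v) = zsq v := by
  rw [← norm_toC_sq, toC_rotL, U.norm_map, norm_toC_sq]

lemma symp_rotL (U : EuclideanSpace ℂ (Fin n) →ₗᵢ[ℂ] EuclideanSpace ℂ (Fin n)) (v w : Heis n) :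
    symp (rotL U v) (rotL U w) = symp v w := by
  rw [← inner_toC_im, toC_rotL, toC_rotL, U.inner_map_map, inner_toC_im]

/-- A unitary map of the horizontal layer preserves the imaginary part of the Hermitian product,
which is the symplectic form, hence the contact form. Since one such map takes `toC p` to `toC q`,
the distance to the origin depends only on `|z|` and `t`. -/
lemma subRiemannianDist_rot_le {p q : Heis n} (hz : zsq p = zsq q) (ht : p.2.2 = q.2.2) :
    subRiemannianDist 0 q ≤ subRiemannianDist 0 p := by
  have hn : ‖toC p‖ = ‖toC q‖ := by
    rw [← sq_eq_sq₀ (norm_nonneg _) (norm_nonneg _), norm_toC_sq, norm_toC_sq, hz]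
  obtain ⟨U, hU⟩ := exists_unitary hn
  have hq : rotL U p = q := by
    refine Prod.ext ?_ (Prod.ext ?_ ht)
    · funext j
      show (U (toC p) j).re = _
      rw [hU]; rfl
    · funext j
      show (U (toC p) j).im = _
      rw [hU]; rfl
  have := subRiemannianDist_map_le 0 (rotL U) (fun p v h => by
    rw [zero_add, contact_eq, symp_rotL]
    exact h) one_pos (fun v => by rw [zsq_rotL, one_pow, one_mul]) 0 p
  simpa [hq] using this

/-! #### Comparison with the Cygan-Korányi norm -/

/-- A segment from the origin inside `t = 0` is horizontal because the symplectic form vanishes on a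
vector and its multiples. -/
lemma isPathLength_segment (v : Heis n) (hv : v.2.2 = 0) :
    IsPathLength 0 v (ENNReal.ofReal (Real.sqrt (zsq v))) := by
  have hd : ∀ s ∈ Icc (0 : ℝ) 1, derivWithin (fun s : ℝ => s • v) (Icc 0 1) s = v := by
    intro s hs
    have := ((hasDerivAt_id s).smul_const v).hasDerivWithinAt (s := Icc (0 : ℝ) 1)
    rw [one_smul] at this
    exact this.derivWithin (uniqueDiffOn_Icc zero_lt_one s hs)
  refine ⟨0, fun _ s => s • v, fun i _ => ⟨by fun_prop, fun s hs => ?_⟩, fun i hi => by omega,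
    by simp, by simp, ?_⟩
  · rw [hd s hs, contact_eq, hv]
    have : symp (s • v) v = s * symp v v := by
      simp only [symp, Finset.mul_sum]
      exact Finset.sum_congr rfl fun j _ => by simp; ring
    rw [this, symp_self]
    simp
  · rw [zero_add, Finset.sum_range_one, arcLength_eq]
    rw [setLIntegral_congr_fun measurableSet_Icc (g := fun _ => ENNReal.ofReal (Real.sqrt (zsq v)))
      fun s hs => by dsimp only; rw [hd s hs]]
    simp

lemma subRiemannianDist_zero_mul_le (p q : Heis n) : subRiemannianDist 0 (mul p q) ≤
    subRiemannianDist 0 p + subRiemannianDist 0 q := by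
  refine (subRiemannianDist_triangle 0 p _).trans_eq ?_
  congr 1
  conv_lhs => rw [← mul_zero' p]
  rw [mul_zero' p]
  conv_lhs => arg 1; rw [← mul_zero' p]
  rw [subRiemannianDist_mul_left]

/-- The commutator of translations by `a` along `X` and `b` along `Y` is the vertical translation by
`a * b`; it is a path of four horizontal segments, of total length `2 (|a| + |b|)`. -/
lemma subRiemannianDist_vert_le (hn : 1 ≤ n) (a b : ℝ) :
    subRiemannianDist 0 ((0, 0, a * b) : Heis n) ≤ ENNReal.ofReal (2 * (|a| + |b|)) := by
  let j0 : Fin n := ⟨0, hn⟩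
  let X : ℝ → Heis n := fun c => (Pi.single j0 c, 0, 0)
  let Y : ℝ → Heis n := fun c => (0, Pi.single j0 c, 0)
  have hX : ∀ c, subRiemannianDist 0 (X c) ≤ ENNReal.ofReal |c| := by
    intro c
    refine (subRiemannianDist_le (isPathLength_segment (X c) rfl)).trans_eq ?_
    congr 1
    rw [← Real.sqrt_sq_eq_abs]
    congr 1
    simp [zsq, X, Pi.single_apply]
  have hY : ∀ c, subRiemannianDist 0 (Y c) ≤ ENNReal.ofReal |c| := by
    intro c
    refine (subRiemannianDist_le (isPathLength_segment (Y c) rfl)).trans_eq ?_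
    congr 1
    rw [← Real.sqrt_sq_eq_abs]
    congr 1
    simp [zsq, Y, Pi.single_apply]
  have hprod : ((0, 0, a * b) : Heis n) = mul (mul (X a) (Y b)) (mul (X (-a)) (Y (-b))) := by
    simp only [mul_eq]
    refine Prod.ext ?_ (Prod.ext ?_ ?_)
    · funext j; simp [X, Y, Pi.single_apply]; split_ifs <;> simp
    · funext j; simp [X, Y, Pi.single_apply]; split_ifs <;> simp
    · simp [X, Y, symp, Pi.single_apply]; ring
  rw [hprod]
  refine (subRiemannianDist_zero_mul_le _ _).trans ((add_le_add (subRiemannianDist_zero_mul_le _ _)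
    (subRiemannianDist_zero_mul_le _ _)).trans ((add_le_add (add_le_add (hX a) (hY b))
      (add_le_add (hX (-a)) (hY (-b)))).trans_eq ?_))
  rw [← ENNReal.ofReal_add (by positivity) (by positivity),
    ← ENNReal.ofReal_add (by positivity) (by positivity),
    ← ENNReal.ofReal_add (by positivity) (by positivity)]
  simp only [abs_neg]
  congr 1; ring

/-- Follow a horizontal segment to `(z, 0)` and then a commutator with both sides equal to `√|t|` in
absolute value; the sign of `t` is put in `a`. -/
lemma subRiemannianDist_zero_le (hn : 1 ≤ n) (p : Heis n) : subRiemannianDist 0 p ≤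
    ENNReal.ofReal (Real.sqrt (zsq p) + 4 * Real.sqrt |p.2.2|) := by
  have h1 : p = mul (p.1, p.2.1, 0) (0, 0, p.2.2) := by
    rw [mul_eq, symp_vert_right]
    refine Prod.ext ?_ (Prod.ext ?_ ?_) <;> simp
  have h2 := subRiemannianDist_le (isPathLength_segment ((p.1, p.2.1, 0) : Heis n) rfl)
  have h3 : subRiemannianDist 0 ((0, 0, p.2.2) : Heis n) ≤
      ENNReal.ofReal (4 * Real.sqrt |p.2.2|) := by
    obtain ⟨a, b, hab, ha, hb⟩ : ∃ a b : ℝ, a * b = p.2.2 ∧ |a| = Real.sqrt |p.2.2| ∧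
        |b| = Real.sqrt |p.2.2| := by
      rcases le_total 0 p.2.2 with h | h
      · refine ⟨Real.sqrt |p.2.2|, Real.sqrt |p.2.2|, ?_, ?_, ?_⟩
        · rw [Real.mul_self_sqrt (abs_nonneg _), abs_of_nonneg h]
        · exact abs_of_nonneg (Real.sqrt_nonneg _)
        · exact abs_of_nonneg (Real.sqrt_nonneg _)
      · refine ⟨-Real.sqrt |p.2.2|, Real.sqrt |p.2.2|, ?_, ?_, ?_⟩
        · rw [neg_mul, Real.mul_self_sqrt (abs_nonneg _), abs_of_nonpos h, neg_neg]
        · rw [abs_neg]; exact abs_of_nonneg (Real.sqrt_nonneg _)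
        · exact abs_of_nonneg (Real.sqrt_nonneg _)
    rw [← hab]
    refine (subRiemannianDist_vert_le hn a b).trans_eq ?_
    rw [ha, hb, hab]; congr 1; ring
  conv_lhs => rw [h1]
  rw [ENNReal.ofReal_add (by positivity) (by positivity)]
  exact (subRiemannianDist_zero_mul_le _ _).trans (add_le_add h2 h3)

lemma enorm_sub_le_of_isHorizontalArc {γ : ℝ → Heis n} (f : Heis n →L[ℝ] ℝ) {w : ℝ → ℝ≥0∞}
    (hγ : ContDiffOn ℝ 1 γ (Icc 0 1))
    (hw : ∀ s ∈ Icc (0 : ℝ) 1, ‖f (derivWithin γ (Icc 0 1) s)‖ₑ ≤ w s) {s : ℝ}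
    (hs : s ∈ Icc (0 : ℝ) 1) : ‖f (γ s) - f (γ 0)‖ₑ ≤ ∫⁻ u in Icc (0 : ℝ) 1, w u := by
  have h1 : ContDiffOn ℝ 1 (fun u => f (γ u)) (Icc 0 s) :=
    (f.contDiff.comp_contDiffOn hγ).mono (Icc_subset_Icc_right hs.2)
  refine (enorm_sub_le_lintegral_deriv_of_contDiffOn_Icc h1 hs.1).trans ?_
  rw [setLIntegral_congr Ioo_ae_eq_Icc.symm]
  calc ∫⁻ u in Ioo 0 s, ‖deriv (fun u => f (γ u)) u‖ₑ ≤ ∫⁻ u in Ioo 0 s, w u := by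
        refine setLIntegral_mono' measurableSet_Ioo fun u hu => ?_
        have hu' : u ∈ Icc (0 : ℝ) 1 := ⟨hu.1.le, hu.2.le.trans hs.2⟩
        have hmem : Icc (0 : ℝ) 1 ∈ 𝓝 u := Icc_mem_nhds hu.1 (hu.2.trans_le hs.2)
        have hd := (hγ.differentiableOn one_ne_zero u hu').hasDerivWithinAt
        have h2 : HasDerivAt (fun u => f (γ u)) (f (derivWithin γ (Icc 0 1) u)) u :=
          f.hasFDerivAt.comp_hasDerivAt u (hd.hasDerivAt hmem)
        rw [h2.deriv]
        exact hw u hu'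
    _ ≤ _ := lintegral_mono_set (Ioo_subset_Icc_self.trans (Icc_subset_Icc_right hs.2))

/-- For an arc of length `ℓ` starting at the origin, each horizontal coordinate stays within `ℓ`;
then horizontality expresses the derivative of `t` by the symplectic form and gives `|t| ≤ n ℓ ^ 2`.
Hence the square of the norm is at most `6 n ℓ ^ 2 ≤ ((2 n + 1) ℓ) ^ 2`. The general case follows by
left translation. -/
lemma gauge_le_arcLength : ∃ C : ℝ, 0 < C ∧ ∀ γ : ℝ → Heis n, IsHorizontalArc γ →
    ENNReal.ofReal (gauge (mul (inv (γ 0)) (γ 1))) ≤ ENNReal.ofReal C * arcLength γ := by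
  have key : ∀ γ : ℝ → Heis n, IsHorizontalArc γ → γ 0 = 0 →
      ENNReal.ofReal (gauge (γ 1)) ≤ ENNReal.ofReal (2 * n + 1) * arcLength γ := by
    intro γ hγ h0
    rcases eq_or_ne (arcLength γ) ⊤ with htop | htop
    · rw [htop, ENNReal.mul_top]
      · exact le_top
      · rw [Ne, ENNReal.ofReal_eq_zero, not_le]; positivity
    obtain ⟨ℓ, hℓ⟩ : ∃ ℓ : ℝ≥0, arcLength γ = ℓ := ⟨_, (ENNReal.coe_toNNReal htop).symm⟩
    let X : Fin n → Heis n →L[ℝ] ℝ := fun j =>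
      (ContinuousLinearMap.proj (R := ℝ) (φ := fun _ : Fin n => ℝ) j).comp
        (ContinuousLinearMap.fst ℝ _ _)
    let Y : Fin n → Heis n →L[ℝ] ℝ := fun j =>
      (ContinuousLinearMap.proj (R := ℝ) (φ := fun _ : Fin n => ℝ) j).comp
        ((ContinuousLinearMap.fst ℝ _ _).comp (ContinuousLinearMap.snd ℝ _ _))
    let Z : Heis n →L[ℝ] ℝ := (ContinuousLinearMap.snd ℝ _ _).comp (ContinuousLinearMap.snd ℝ _ _)
    have hcoord : ∀ (v : Heis n) j, |v.1 j| ≤ Real.sqrt (zsq v) ∧ |v.2.1 j| ≤ Real.sqrt (zsq v) := by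
      intro v j
      have h := Finset.single_le_sum (f := fun j => v.1 j ^ 2 + v.2.1 j ^ 2)
        (fun j _ => add_nonneg (sq_nonneg _) (sq_nonneg _)) (Finset.mem_univ j)
      constructor <;> refine Real.abs_le_sqrt ?_ <;> unfold zsq <;>
        nlinarith [sq_nonneg (v.1 j), sq_nonneg (v.2.1 j)]
    have hX : ∀ j, ∀ s ∈ Icc (0 : ℝ) 1, |(γ s).1 j| ≤ ℓ := by
      intro j s hs
      have := enorm_sub_le_of_isHorizontalArc (X j) (w := fun s =>
        ENNReal.ofReal (Real.sqrt (zsq (derivWithin γ (Icc 0 1) s)))) hγ.1 (fun s _ => by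
          rw [← ofReal_norm]
          exact ENNReal.ofReal_le_ofReal (hcoord _ j).1) hs
      rw [← arcLength_eq, hℓ, h0, map_zero, sub_zero, ← ofReal_norm, ENNReal.ofReal_le_coe] at this
      exact this
    have hY : ∀ j, ∀ s ∈ Icc (0 : ℝ) 1, |(γ s).2.1 j| ≤ ℓ := by
      intro j s hs
      have := enorm_sub_le_of_isHorizontalArc (Y j) (w := fun s =>
        ENNReal.ofReal (Real.sqrt (zsq (derivWithin γ (Icc 0 1) s)))) hγ.1 (fun s _ => by
          rw [← ofReal_norm]
          exact ENNReal.ofReal_le_ofReal (hcoord _ j).2) hs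
      rw [← arcLength_eq, hℓ, h0, map_zero, sub_zero, ← ofReal_norm, ENNReal.ofReal_le_coe] at this
      exact this
    have hone : (1 : ℝ) ∈ Icc (0 : ℝ) 1 := ⟨zero_le_one, le_rfl⟩
    have hZ : |(γ 1).2.2| ≤ n * ℓ * ℓ := by
      have := enorm_sub_le_of_isHorizontalArc Z (w := fun s => ENNReal.ofReal (n * ℓ) *
        ENNReal.ofReal (Real.sqrt (zsq (derivWithin γ (Icc 0 1) s)))) hγ.1 (fun s hs => by
          rw [← ofReal_norm, ← ENNReal.ofReal_mul (by positivity)]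
          refine ENNReal.ofReal_le_ofReal ?_
          have h1 := hγ.2 s hs
          set v := derivWithin γ (Icc 0 1) s
          rw [contact_eq, sub_eq_zero] at h1
          show |v.2.2| ≤ _
          rw [h1, abs_mul]
          have h2 : |symp (γ s) v| ≤ ∑ j : Fin n, 2 * (ℓ * Real.sqrt (zsq v)) := by
            refine (Finset.abs_sum_le_sum_abs _ _).trans (Finset.sum_le_sum fun j _ => ?_)
            refine (abs_sub _ _).trans ?_
            rw [abs_mul, abs_mul, two_mul]
            have := hcoord v j
            have hx := hX j s hs
            have hy := hY j s hs
            gcongr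
            · exact this.2
            · exact this.1
          rw [Finset.sum_const, Finset.card_univ, Fintype.card_fin, nsmul_eq_mul] at h2
          rw [abs_of_pos (by norm_num : (0 : ℝ) < 1 / 2)]
          linarith) hone
      rw [lintegral_const_mul' _ _ ENNReal.ofReal_ne_top, ← arcLength_eq, hℓ, h0, map_zero, sub_zero,
        ← ofReal_norm, ← ENNReal.ofReal_coe_nnreal, ← ENNReal.ofReal_mul (by positivity),
        ENNReal.ofReal_le_ofReal_iff (by positivity)] at this
      exact this
    rw [hℓ, ← ENNReal.ofReal_coe_nnreal, ← ENNReal.ofReal_mul (by positivity)]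
    refine ENNReal.ofReal_le_ofReal (abs_le_of_sq_le_sq' ?_ (by positivity)).2
    have hz : zsq (γ 1) ≤ ∑ j : Fin n, 2 * (ℓ : ℝ) ^ 2 := by
      refine Finset.sum_le_sum fun j _ => ?_
      have h1 := sq_le_sq' (abs_le.1 (hX j 1 hone)).1 (abs_le.1 (hX j 1 hone)).2
      have h2 := sq_le_sq' (abs_le.1 (hY j 1 hone)).1 (abs_le.1 (hY j 1 hone)).2
      linarith
    rw [Finset.sum_const, Finset.card_univ, Fintype.card_fin, nsmul_eq_mul] at hz
    have h3 : (n : ℝ) ≤ n ^ 2 := by exact_mod_cast Nat.le_self_pow two_ne_zero n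
    have h4 : (0 : ℝ) ≤ (ℓ : ℝ) ^ 2 := sq_nonneg _
    nlinarith [gauge_sq_le (γ 1), mul_nonneg (Nat.cast_nonneg (α := ℝ) n) h4,
      mul_le_mul_of_nonneg_right h3 h4]
  refine ⟨2 * n + 1, by positivity, fun γ hγ => ?_⟩
  have h := arc_map hγ (inv (γ 0)) (transL (inv (γ 0)))
    (fun p v h => by rw [contact_mul_transL, h]) zero_le_one
    (fun v => by rw [transL_apply, zsq_add_vert, one_pow, one_mul])
  have := key _ h.1 (by rw [← mul_eq_transL, inv_mul_self])
  rw [h.2] at this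
  simpa [← mul_eq_transL] using this

lemma exists_gauge_le_subRiemannianDist (n : ℕ) : ∃ C : ℝ, 0 < C ∧ ∀ p q : Heis n,
    ENNReal.ofReal (gauge (mul (inv p) q)) ≤ ENNReal.ofReal C * subRiemannianDist p q := by
  obtain ⟨C, hC, h⟩ := gauge_le_arcLength (n := n)
  refine ⟨C, hC, fun p q => ?_⟩
  have h0 : ENNReal.ofReal C ≠ 0 := by rwa [Ne, ENNReal.ofReal_eq_zero, not_le]
  rw [← ENNReal.div_le_iff' h0 ENNReal.ofReal_ne_top]
  refine le_subRiemannianDist fun ℓ hℓ => ?_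
  rw [ENNReal.div_le_iff' h0 ENNReal.ofReal_ne_top]
  obtain ⟨N, γ, h1, h2, rfl, rfl, rfl⟩ := hℓ
  have key : ∀ m ≤ N, ENNReal.ofReal (gauge (mul (inv (γ 0 0)) (γ m 1))) ≤
      ENNReal.ofReal C * ∑ i ∈ Finset.range (m + 1), arcLength (γ i) := by
    intro m
    induction m with
    | zero =>
      intro hm
      simpa using h (γ 0) (h1 0 hm)
    | succ m ih =>
      intro hm
      have e1 : mul (inv (γ 0 0)) (γ (m + 1) 1) =
          mul (mul (inv (γ 0 0)) (γ m 1)) (mul (inv (γ (m + 1) 0)) (γ (m + 1) 1)) := by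
        rw [h2 m (by omega), mul_assoc', mul_inv_mul_cancel]
      rw [e1, Finset.sum_range_succ, mul_add]
      refine (ENNReal.ofReal_le_ofReal (gauge_mul_le _ _)).trans (ENNReal.ofReal_add_le.trans ?_)
      exact add_le_add (ih (by omega)) (h _ (h1 _ hm))
  exact key N le_rfl

/-! #### The subRiemannian norm -/

/-- The subRiemannian distance to the origin. -/
def srNorm (p : Heis n) : ℝ := (subRiemannianDist 0 p).toReal

lemma subRiemannianDist_zero_ne_top (hn : 1 ≤ n) (p : Heis n) : subRiemannianDist 0 p ≠ ⊤ :=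
  ne_top_of_le_ne_top ENNReal.ofReal_ne_top (subRiemannianDist_zero_le hn p)

lemma subRiemannianDist_eq_srNorm (hn : 1 ≤ n) (p q : Heis n) :
    subRiemannianDist p q = ENNReal.ofReal (srNorm (mul (inv p) q)) := by
  rw [subRiemannianDist_eq_inv_mul, srNorm, ENNReal.ofReal_toReal (subRiemannianDist_zero_ne_top hn _)]

lemma isHomNorm_srNorm (hn : 1 ≤ n) : IsHomNorm (srNorm (n := n)) where
  mul_le p q := by
    have hp := subRiemannianDist_zero_ne_top hn p
    have hq := subRiemannianDist_zero_ne_top hn q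
    rw [srNorm, srNorm, srNorm, ← ENNReal.toReal_add hp hq]
    exact ENNReal.toReal_mono (ENNReal.add_ne_top.2 ⟨hp, hq⟩) (subRiemannianDist_zero_mul_le p q)
  map_inv p := by
    rw [srNorm, srNorm, subRiemannianDist_symm 0 p, subRiemannianDist_eq_inv_mul p 0, mul_zero']
  map_dilation r hr p := by
    rw [srNorm, srNorm, ← ENNReal.toReal_ofReal hr.le, ← ENNReal.toReal_mul,
      ENNReal.toReal_ofReal hr.le]
    congr 1
    refine le_antisymm (subRiemannianDist_dilation_le hr p) ?_
    have h := subRiemannianDist_dilation_le (inv_pos.2 hr) (dilation r p)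
    rw [dilation_dilation, inv_mul_cancel₀ hr.ne', dilation_one] at h
    calc ENNReal.ofReal r * subRiemannianDist 0 p
        ≤ ENNReal.ofReal r * (ENNReal.ofReal r⁻¹ * subRiemannianDist 0 (dilation r p)) := by gcongr
      _ = _ := by
        rw [← mul_assoc, ← ENNReal.ofReal_mul hr.le, mul_inv_cancel₀ hr.ne', ENNReal.ofReal_one,
          one_mul]
  rot p q h h' := by
    rw [srNorm, srNorm, le_antisymm (subRiemannianDist_rot_le h.symm h'.symm)
      (subRiemannianDist_rot_le h h')]
  bound := by
    obtain ⟨C, hC, h⟩ := exists_gauge_le_subRiemannianDist n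
    obtain ⟨D, hD, hg⟩ := (isHomNorm_gauge (n := n)).bound
    refine ⟨max (D * C) 4, lt_max_of_lt_right (by norm_num), fun p => ?_⟩
    have hs : 0 ≤ srNorm p := ENNReal.toReal_nonneg
    have h1 : gauge p ≤ C * srNorm p := by
      have := h 0 p
      rw [← ENNReal.ofReal_toReal (subRiemannianDist_zero_ne_top hn p),
        ← ENNReal.ofReal_mul hC.le] at this
      have h' := (ENNReal.ofReal_le_ofReal_iff (mul_nonneg hC.le hs)).1 this
      simpa [inv, zero_mul'] using h'
    have h2 : D * gauge p ≤ max (D * C) 4 * srNorm p := by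
      calc D * gauge p ≤ D * (C * srNorm p) := by gcongr
        _ = (D * C) * srNorm p := by ring
        _ ≤ _ := by gcongr; exact le_max_left _ _
    refine ⟨(hg p).1.trans h2, (hg p).2.1.trans h2, ?_⟩
    have h3 : srNorm p ≤ Real.sqrt (zsq p) + 4 * Real.sqrt |p.2.2| :=
      ENNReal.toReal_le_of_le_ofReal (by positivity) (subRiemannianDist_zero_le hn p)
    have h4 : (4 : ℝ) ≤ max (D * C) 4 := le_max_right _ _
    nlinarith [Real.sqrt_nonneg (zsq p), Real.sqrt_nonneg |p.2.2|]

end Heis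

namespace Heis

variable {n : ℕ}

/-! ### Horizontal layer and vertical subgroups -/

/-- The horizontal layer `ℝ²ⁿ`. -/
abbrev Hor (n : ℕ) := EuclideanSpace ℝ (Fin n ⊕ Fin n)

/-- The horizontal coordinates of a point. -/
def hor (n : ℕ) : Heis n →L[ℝ] Hor n :=
  LinearMap.toContinuousLinearMap
    { toFun := fun p => WithLp.toLp 2 (Sum.elim p.1 p.2.1)
      map_add' := fun p q => by ext (i | i) <;> simp
      map_smul' := fun c p => by ext (i | i) <;> simp }

/-- The point with given horizontal and vertical coordinates. -/
def lift (z : Hor n) (t : ℝ) : Heis n := (fun j => z (Sum.inl j), fun j => z (Sum.inr j), t)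

lemma hor_apply (p : Heis n) : hor n p = WithLp.toLp 2 (Sum.elim p.1 p.2.1) := rfl

@[simp] lemma hor_lift (z : Hor n) (t : ℝ) : hor n (lift z t) = z := by
  ext (i | i) <;> simp [hor_apply, lift]

@[simp] lemma lift_snd (z : Hor n) (t : ℝ) : (lift z t).2.2 = t := rfl

lemma lift_hor (p : Heis n) : lift (hor n p) p.2.2 = p := by
  refine Prod.ext ?_ (Prod.ext ?_ rfl) <;> ext j <;> simp [hor_apply, lift]

lemma heis_ext {p q : Heis n} (h : hor n p = hor n q) (h' : p.2.2 = q.2.2) : p = q := by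
  rw [← lift_hor p, ← lift_hor q, h, h']

lemma norm_hor_sq (p : Heis n) : ‖hor n p‖ ^ 2 = zsq p := by
  rw [EuclideanSpace.norm_sq_eq, Fintype.sum_sum_type, zsq, Finset.sum_add_distrib]
  simp [hor_apply]

lemma sqrt_zsq (p : Heis n) : Real.sqrt (zsq p) = ‖hor n p‖ := by
  rw [← norm_hor_sq, Real.sqrt_sq (norm_nonneg _)]

lemma inner_hor (p q : Heis n) : inner ℝ (hor n p) (hor n q) = hdot p q := by
  rw [PiLp.inner_apply, Fintype.sum_sum_type, hdot, Finset.sum_add_distrib]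
  simp [hor_apply, mul_comm]

@[simp] lemma hor_mul (p q : Heis n) : hor n (mul p q) = hor n p + hor n q := by
  ext (i | i) <;> simp [hor_apply, mul]

@[simp] lemma hor_inv (p : Heis n) : hor n (inv p) = -hor n p := map_neg _ _

lemma mul_snd (p q : Heis n) : (mul p q).2.2 = p.2.2 + q.2.2 + (1 / 2) * symp p q := rfl

lemma inv_snd (p : Heis n) : (inv p).2.2 = -p.2.2 := rfl

lemma symp_inv_left (p q : Heis n) : symp (inv p) q = -symp p q := symp_neg_left p q

@[simp] lemma hor_dilation (r : ℝ) (p : Heis n) : hor n (dilation r p) = r • hor n p := by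
  ext (i | i) <;> simp [hor_apply, dilation]

lemma abs_symp_le_norm (p q : Heis n) : |symp p q| ≤ ‖hor n p‖ * ‖hor n q‖ := by
  simpa only [sqrt_zsq] using abs_symp_le p q

/-- The symplectic form as a linear functional of its second argument. -/
def sympL (p : Heis n) : Heis n →L[ℝ] ℝ :=
  LinearMap.toContinuousLinearMap
    { toFun := symp p
      map_add' := symp_add_right p
      map_smul' := fun c q => by
        simp only [symp, Prod.smul_fst, Prod.smul_snd, Pi.smul_apply, smul_eq_mul, Finset.mul_sum,
          RingHom.id_apply]
        exact Finset.sum_congr rfl fun j _ => by ring }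

lemma sympL_apply (p q : Heis n) : sympL p q = symp p q := rfl

/-- Points of the vertical plane spanned by the vertical direction and by `w`. -/
def plane {k : ℕ} (w : Fin k → Hor n) : (Fin (k + 1) → ℝ) →L[ℝ] Heis n :=
  LinearMap.toContinuousLinearMap
    { toFun := fun y => lift (∑ i, y i.succ • w i) (y 0)
      map_add' := fun y y' => heis_ext
        (by simp [add_smul, Finset.sum_add_distrib]) (by simp)
      map_smul' := fun c y => heis_ext
        (by simp [Finset.smul_sum, mul_smul]) (by simp) }

lemma plane_apply {k : ℕ} (w : Fin k → Hor n) (y : Fin (k + 1) → ℝ) :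
    plane w y = lift (∑ i, y i.succ • w i) (y 0) := rfl

@[simp] lemma hor_plane {k : ℕ} (w : Fin k → Hor n) (y : Fin (k + 1) → ℝ) :
    hor n (plane w y) = ∑ i, y i.succ • w i := by rw [plane_apply, hor_lift]

@[simp] lemma plane_snd {k : ℕ} (w : Fin k → Hor n) (y : Fin (k + 1) → ℝ) :
    (plane w y).2.2 = y 0 := rfl

/-! ### Continuity of homogeneous norms -/

namespace IsHomNorm

variable {N : Heis n → ℝ}

lemma nonneg (hN : IsHomNorm N) (p : Heis n) : 0 ≤ N p := by
  obtain ⟨C, hC, h⟩ := hN.bound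
  have := (Real.sqrt_nonneg _).trans (h p).1
  exact nonneg_of_mul_nonneg_right this hC

lemma map_zero (hN : IsHomNorm N) : N 0 = 0 := by
  obtain ⟨C, hC, h⟩ := hN.bound
  have := (h 0).2.2
  simp [zsq] at this
  exact le_antisymm this (hN.nonneg 0)

lemma continuous (hN : IsHomNorm N) : Continuous N := by
  obtain ⟨C, hC, h⟩ := hN.bound
  rw [continuous_iff_continuousAt]
  intro p
  rw [ContinuousAt, tendsto_iff_dist_tendsto_zero]
  have h1 : Tendsto (fun q => C * (‖hor n (mul (inv p) q)‖ + Real.sqrt |(mul (inv p) q).2.2|))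
      (𝓝 p) (𝓝 0) := by
    have : Continuous fun q => C * (‖hor n (mul (inv p) q)‖ +
        Real.sqrt |(mul (inv p) q).2.2|) := by
      simp only [hor_mul, mul_snd, ← sympL_apply]
      fun_prop
    have h2 := this.tendsto p
    simpa [inv_mul_self] using h2
  refine squeeze_zero (fun _ => dist_nonneg) (fun q => ?_) h1
  have e : N (mul (inv p) q) ≤ C * (‖hor n (mul (inv p) q)‖ + Real.sqrt |(mul (inv p) q).2.2|) := by
    rw [← sqrt_zsq]; exact (h _).2.2
  refine le_trans ?_ e
  rw [Real.dist_eq, abs_le]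
  constructor
  · have := hN.mul_le q (inv (mul (inv p) q))
    rw [hN.map_inv, inv_mul, inv_inv', mul_inv_mul_cancel] at this
    linarith
  · have := hN.mul_le p (mul (inv p) q)
    rw [mul_inv_mul_cancel] at this
    linarith

end IsHomNorm

/-! ### Sections of balls by vertical planes -/

/-- The section of the ball of center `a` and radius `r` by the vertical plane directed by `w`. -/
def slice (N : Heis n → ℝ) {k : ℕ} (w : Fin k → Hor n) (a : Heis n) (r : ℝ) :
    Set (Fin (k + 1) → ℝ) := {y | N (mul (inv a) (plane w y)) ≤ r}

/-- The largest area of the sections of unit balls by the vertical plane directed by `w`. -/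
def sliceSup (N : Heis n → ℝ) {k : ℕ} (w : Fin k → Hor n) : ℝ≥0∞ :=
  ⨆ a, volume (slice N w a 1)

lemma continuous_mul_left (a : Heis n) : Continuous (mul a) := by
  have : mul a = fun q => a + q + (0, 0, (1 / 2) * sympL a q) := funext fun q => mul_eq a q
  rw [this]
  fun_prop

/-- The linear map of the plane acting as the dilation. -/
def planeDil (k : ℕ) (r : ℝ) : (Fin (k + 1) → ℝ) →ₗ[ℝ] (Fin (k + 1) → ℝ) :=
  Matrix.toLin' (Matrix.diagonal fun i => if i = 0 then r ^ 2 else r)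

lemma planeDil_apply {k : ℕ} (r : ℝ) (y : Fin (k + 1) → ℝ) (i : Fin (k + 1)) :
    planeDil k r y i = (if i = 0 then r ^ 2 else r) * y i := by
  rw [planeDil, Matrix.toLin'_apply, Matrix.mulVec_diagonal]

lemma plane_planeDil {k : ℕ} (w : Fin k → Hor n) (r : ℝ) (y : Fin (k + 1) → ℝ) :
    plane w (planeDil k r y) = dilation r (plane w y) := by
  refine heis_ext ?_ ?_
  · rw [hor_dilation, hor_plane, hor_plane, Finset.smul_sum]
    refine Finset.sum_congr rfl fun i _ => ?_
    rw [planeDil_apply, if_neg (Fin.succ_ne_zero i), mul_smul]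
  · simp [planeDil_apply, dilation]

/-- The vertical coordinate has weight two and the `k` horizontal ones weight one: a vertical plane
of dimension `k + 1` has homogeneous dimension `k + 2`. -/
lemma det_planeDil (k : ℕ) (r : ℝ) : LinearMap.det (planeDil k r) = r ^ (k + 2) := by
  rw [planeDil, LinearMap.det_toLin', Matrix.det_diagonal, Fin.prod_univ_succ]
  simp [Fin.succ_ne_zero]
  ring

lemma slice_dilation {N : Heis n → ℝ} (hN : IsHomNorm N) {k : ℕ} (w : Fin k → Hor n) (a : Heis n)
    {r : ℝ} (hr : 0 < r) : slice N w (dilation r a) r = planeDil k r '' slice N w a 1 := by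
  have key : ∀ y, planeDil k r y ∈ slice N w (dilation r a) r ↔ y ∈ slice N w a 1 := fun y => by
    simp only [slice, mem_ofPred_eq]
    rw [plane_planeDil, ← dilation_inv, ← dilation_mul, hN.map_dilation r hr]
    exact mul_le_iff_le_one_right hr
  ext y
  constructor
  · intro hy
    have e : planeDil k r (planeDil k r⁻¹ y) = y := by
      ext i
      rw [planeDil_apply, planeDil_apply]
      split_ifs <;> field_simp
    exact ⟨_, (key _).1 (by rwa [e]), e⟩
  · rintro ⟨y, hy, rfl⟩
    exact (key y).2 hy

lemma volume_slice_dilation {N : Heis n → ℝ} (hN : IsHomNorm N) {k : ℕ} (w : Fin k → Hor n)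
    (a : Heis n) {r : ℝ} (hr : 0 < r) :
    volume (slice N w (dilation r a) r) = ENNReal.ofReal r ^ (k + 2) * volume (slice N w a 1) := by
  rw [slice_dilation hN w a hr, Measure.addHaar_image_linearMap, det_planeDil,
    abs_of_pos (by positivity), ENNReal.ofReal_pow hr.le]

lemma volume_slice_le {N : Heis n → ℝ} (hN : IsHomNorm N) {k : ℕ} (w : Fin k → Hor n)
    (a : Heis n) {r : ℝ} (hr : 0 < r) :
    volume (slice N w a r) ≤ ENNReal.ofReal r ^ (k + 2) * sliceSup N w := by
  have : a = dilation r (dilation r⁻¹ a) := by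
    rw [dilation_dilation, mul_inv_cancel₀ hr.ne', dilation_one]
  rw [this, volume_slice_dilation hN w _ hr]
  gcongr
  exact le_iSup (fun a => volume (slice N w a 1)) _

/-- Shears along the vertical direction preserve the volume. -/
lemma volume_preimage_shear {k : ℕ} (f : (Fin (k + 1) → ℝ) →ₗ[ℝ] ℝ) (hf : f (Pi.single 0 1) = 0)
    (s : Set (Fin (k + 1) → ℝ)) :
    volume (LinearMap.transvection f (Pi.single (0 : Fin (k + 1)) (1 : ℝ)) ⁻¹' s) = volume s := by
  have h : LinearMap.det (LinearMap.transvection f (Pi.single (0 : Fin (k + 1)) (1 : ℝ))) = 1 := by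
    rw [LinearMap.transvection.det, hf, add_zero]
  rw [Measure.addHaar_preimage_linearMap _ (by rw [h]; exact one_ne_zero), h]
  simp

lemma shear_zero {k : ℕ} (f : (Fin (k + 1) → ℝ) →ₗ[ℝ] ℝ) (y : Fin (k + 1) → ℝ) :
    LinearMap.transvection f (Pi.single (0 : Fin (k + 1)) (1 : ℝ)) y 0 = y 0 + f y := by
  simp [LinearMap.transvection]

lemma shear_succ {k : ℕ} (f : (Fin (k + 1) → ℝ) →ₗ[ℝ] ℝ) (y : Fin (k + 1) → ℝ) (i : Fin k) :
    LinearMap.transvection f (Pi.single (0 : Fin (k + 1)) (1 : ℝ)) y i.succ = y i.succ := by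
  simp [LinearMap.transvection, Fin.succ_ne_zero]

lemma plane_single_zero {k : ℕ} (w : Fin k → Hor n) : hor n (plane w (Pi.single 0 1)) = 0 := by
  simp [Fin.succ_ne_zero]

lemma symp_plane_single_zero {k : ℕ} (w : Fin k → Hor n) (a : Heis n) :
    symp a (plane w (Pi.single 0 1)) = 0 := by
  have := abs_symp_le_norm a (plane w (Pi.single 0 1))
  rw [plane_single_zero, norm_zero, mul_zero] at this
  exact abs_nonpos_iff.1 this

/-- The functional `½ symp(a, plane w y)`. -/
def sympPlane {k : ℕ} (w : Fin k → Hor n) (a : Heis n) : (Fin (k + 1) → ℝ) →ₗ[ℝ] ℝ :=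
  (1 / 2 : ℝ) • ((sympL a).comp (plane w)).toLinearMap

lemma sympPlane_apply {k : ℕ} (w : Fin k → Hor n) (a : Heis n) (y : Fin (k + 1) → ℝ) :
    sympPlane w a y = (1 / 2) * symp a (plane w y) := rfl

lemma sympPlane_single {k : ℕ} (w : Fin k → Hor n) (a : Heis n) :
    sympPlane w a (Pi.single 0 1) = 0 := by
  rw [sympPlane_apply, symp_plane_single_zero, mul_zero]

lemma hor_inv_mul_plane {k : ℕ} (w : Fin k → Hor n) (a : Heis n) (y : Fin (k + 1) → ℝ) :
    hor n (mul (inv a) (plane w y)) = ∑ i, y i.succ • w i - hor n a := by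
  rw [hor_mul, hor_inv, hor_plane]; abel

lemma inv_mul_plane_snd {k : ℕ} (w : Fin k → Hor n) (a : Heis n) (y : Fin (k + 1) → ℝ) :
    (mul (inv a) (plane w y)).2.2 = y 0 - a.2.2 - sympPlane w a y := by
  rw [mul_snd, inv_snd, plane_snd, symp_inv_left, sympPlane_apply]; ring

lemma exists_orthonormalBasis_extending {k : ℕ} {w : Fin k → Hor n} (hw : Orthonormal ℝ w) :
    ∃ (h : k ≤ 2 * n) (b : OrthonormalBasis (Fin (2 * n)) ℝ (Hor n)),
      ∀ i, b (Fin.castLE h i) = w i := by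
  have hd : Module.finrank ℝ (Hor n) = 2 * n := by
    rw [finrank_euclideanSpace, Fintype.card_sum, Fintype.card_fin]; ring
  have hk : k ≤ 2 * n := by
    have := hw.linearIndependent.fintype_card_le_finrank
    rwa [Fintype.card_fin, hd] at this
  refine ⟨hk, ?_⟩
  let v : Fin (2 * n) → Hor n := fun i => if h : (i : ℕ) < k then w ⟨i, h⟩ else 0
  have hv : Orthonormal ℝ (Set.domRestrict {i : Fin (2 * n) | (i : ℕ) < k} v) := by
    have : Set.domRestrict {i : Fin (2 * n) | (i : ℕ) < k} v =
        w ∘ fun i : {i : Fin (2 * n) | (i : ℕ) < k} => (⟨i, i.2⟩ : Fin k) := by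
      funext i
      exact dif_pos i.2
    rw [this]
    refine hw.comp _ fun i j h => ?_
    have := congrArg Fin.val h
    exact Subtype.ext (Fin.ext this)
  obtain ⟨b, hb⟩ := hv.exists_orthonormalBasis_extension_of_card_eq
    (by rw [hd, Fintype.card_fin])
  refine ⟨b, fun i => ?_⟩
  rw [hb _ (show ((Fin.castLE hk i : Fin (2 * n)) : ℕ) < k from i.2)]
  exact dif_pos i.2

lemma exists_linearIsometry {k : ℕ} {w w' : Fin k → Hor n} (hw : Orthonormal ℝ w)
    (hw' : Orthonormal ℝ w') : ∃ O : Hor n ≃ₗᵢ[ℝ] Hor n, ∀ i, O (w i) = w' i := by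
  obtain ⟨h, b, hb⟩ := exists_orthonormalBasis_extending hw
  obtain ⟨h', b', hb'⟩ := exists_orthonormalBasis_extending hw'
  refine ⟨b.equiv b' (Equiv.refl _), fun i => ?_⟩
  rw [← hb, OrthonormalBasis.equiv_apply_basis, ← hb']
  rfl

/-- An orthogonal map `O` taking `w` to `w'` matches the horizontal distances to the centers, but
not the symplectic terms in the vertical coordinate. Those terms are linear on the plane and vanish
on its vertical direction, so their difference `f` defines a shear of determinant one. After the
shear the values of `|z|` and `t` agree, and `rot` identifies the norms. -/
lemma volume_slice_le_sliceSup {N : Heis n → ℝ} (hN : IsHomNorm N) {k : ℕ} {w w' : Fin k → Hor n}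
    (hw : Orthonormal ℝ w) (hw' : Orthonormal ℝ w') (a : Heis n) :
    volume (slice N w a 1) ≤ sliceSup N w' := by
  obtain ⟨O, hO⟩ := exists_linearIsometry hw hw'
  let b := lift (O (hor n a)) a.2.2
  let f := sympPlane w' b - sympPlane w a
  have : slice N w a 1 = LinearMap.transvection f (Pi.single (0 : Fin (k + 1)) (1 : ℝ)) ⁻¹'
      slice N w' b 1 := by
    ext y
    have hs : sympPlane w' b (LinearMap.transvection f (Pi.single (0 : Fin (k + 1)) (1 : ℝ)) y) =
        sympPlane w' b y := by
      rw [LinearMap.transvection]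
      simp only [LinearMap.coe_mk, AddHom.coe_mk, map_add, map_smul, sympPlane_single, smul_zero,
        add_zero]
    simp only [slice, mem_preimage, mem_ofPred_eq]
    rw [hN.rot (mul (inv a) (plane w y)) (mul (inv b) (plane w' _))]
    · rw [← norm_hor_sq, ← norm_hor_sq, hor_inv_mul_plane, hor_inv_mul_plane]
      simp only [shear_succ]
      rw [← O.norm_map]
      simp only [map_sub, map_sum, map_smul, hO, b, hor_lift]
    · rw [inv_mul_plane_snd, inv_mul_plane_snd, hs, shear_zero]
      simp only [b, f, lift_snd, LinearMap.sub_apply]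
      ring
  rw [this, volume_preimage_shear]
  · exact le_iSup (fun a => volume (slice N w' a 1)) _
  · simp only [f, LinearMap.sub_apply, sympPlane_single, sub_zero]

lemma sliceSup_eq {N : Heis n → ℝ} (hN : IsHomNorm N) {k : ℕ} {w w' : Fin k → Hor n}
    (hw : Orthonormal ℝ w) (hw' : Orthonormal ℝ w') : sliceSup N w = sliceSup N w' :=
  le_antisymm (iSup_le fun a => volume_slice_le_sliceSup hN hw hw' a)
    (iSup_le fun a => volume_slice_le_sliceSup hN hw' hw a)

/-- A shear removes the symplectic term. The slice then lies within `C` of the center in the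
horizontal coordinates and within `C ^ 2` in the vertical one, uniformly in the center. -/
lemma sliceSup_ne_top {N : Heis n → ℝ} (hN : IsHomNorm N) {k : ℕ} {w : Fin k → Hor n}
    (hw : Orthonormal ℝ w) : sliceSup N w ≠ ⊤ := by
  obtain ⟨C, hC, h⟩ := hN.bound
  refine ne_top_of_le_ne_top (b := volume (Metric.closedBall (0 : Fin (k + 1) → ℝ) (C + C ^ 2)))
    (isCompact_closedBall _ _).measure_lt_top.ne (iSup_le fun a => ?_)
  rw [← volume_preimage_shear (-sympPlane w a) (by simp [sympPlane_single]),
    ← Measure.addHaar_closedBall_center volume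
      (Fin.cons (α := fun _ => ℝ) a.2.2 fun i => inner ℝ (w i) (hor n a))]
  rw [volume_preimage_shear _ (by simp [sympPlane_single]),
    ← volume_preimage_shear (-sympPlane w a) (by simp [sympPlane_single]) (Metric.closedBall _ _)]
  refine measure_mono fun y hy => ?_
  obtain ⟨h1, h2, -⟩ := h (mul (inv a) (plane w y))
  have hy' : N (mul (inv a) (plane w y)) ≤ 1 := hy
  have hCy : C * N (mul (inv a) (plane w y)) ≤ C := mul_le_of_le_one_right hC.le hy'
  rw [sqrt_zsq, hor_inv_mul_plane] at h1
  have h2' := h2.trans hCy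
  rw [inv_mul_plane_snd, Real.sqrt_le_left hC.le] at h2'
  rw [mem_preimage, mem_closedBall_iff_norm, pi_norm_le_iff_of_nonneg (by positivity)]
  intro i
  rw [Pi.sub_apply, Real.norm_eq_abs]
  refine Fin.cases ?_ (fun i => ?_) i
  · rw [shear_zero, Fin.cons_zero, LinearMap.neg_apply]
    rw [show y 0 + -sympPlane w a y - a.2.2 = y 0 - a.2.2 - sympPlane w a y by ring]
    linarith
  · rw [shear_succ, Fin.cons_succ]
    have e : y i.succ - inner ℝ (w i) (hor n a) =
        inner ℝ (w i) (∑ i, y i.succ • w i - hor n a) := by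
      rw [inner_sub_right, hw.inner_right_fintype]
    rw [e]
    refine (abs_real_inner_le_norm _ _).trans ?_
    rw [hw.1, one_mul]
    nlinarith

lemma sliceSup_pos {N : Heis n → ℝ} (hN : IsHomNorm N) {k : ℕ} (w : Fin k → Hor n) :
    0 < sliceSup N w := by
  refine lt_of_lt_of_le ?_ (le_iSup (fun a => volume (slice N w a 1)) 0)
  have : slice N w 0 1 ∈ 𝓝 (0 : Fin (k + 1) → ℝ) := by
    have hc : Continuous fun y => N (mul (inv (0 : Heis n)) (plane w y)) :=
      hN.continuous.comp ((continuous_mul_left _).comp (plane w).continuous)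
    have h0 : N (mul (inv (0 : Heis n)) (plane w 0)) < 1 := by
      rw [_root_.map_zero, inv_mul_self, hN.map_zero]; exact one_pos
    filter_upwards [hc.continuousAt.eventually_lt continuousAt_const h0] with y hy using hy.le
  exact Measure.measure_pos_of_mem_nhds _ this

end Heis

namespace Heis

variable {n : ℕ}

/-! ### The oblique Jacobian -/

@[simp] lemma contact_zero (v : Heis n) : contact n 0 v = v.2.2 := by simp [contact_apply]

/-- The left-invariant trivialization of the tangent bundle. -/
def coframe (p : Heis n) : Heis n →L[ℝ] Heis n :=
  (ContinuousLinearMap.fst ℝ _ _).prod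
    (((ContinuousLinearMap.fst ℝ _ _).comp (ContinuousLinearMap.snd ℝ _ _)).prod (contact n p))

lemma coframe_apply (p v : Heis n) : coframe p v = (v.1, v.2.1, contact n p v) := rfl

@[simp] lemma hor_coframe (p v : Heis n) : hor n (coframe p v) = hor n v := rfl

@[simp] lemma coframe_snd (p v : Heis n) : (coframe p v).2.2 = contact n p v := rfl

lemma coframe_neg_coframe (p v : Heis n) : coframe (-p) (coframe p v) = v := by
  refine Prod.ext rfl (Prod.ext rfl ?_)
  simp [coframe_apply, contact_apply, Finset.sum_add_distrib]
  ring_nf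

lemma coframe_coframe_neg (p v : Heis n) : coframe p (coframe (-p) v) = v := by
  simpa using coframe_neg_coframe (-p) v

lemma coframe_injective (p : Heis n) : Function.Injective (coframe p) :=
  Function.LeftInverse.injective (coframe_neg_coframe p)

lemma coframe_frame (p : Heis n) (i : Option (Fin n ⊕ Fin n)) :
    coframe p (frame p i) = frame 0 i := by
  rcases i with _ | i
  · simp [frame, coframe_apply, vert]
    simp [contact_apply]
  · rw [frame, frame, consFrame_some, consFrame_some, coframe_apply, contact_horFrame]
    rcases i with i | i <;> simp [horFrame]

lemma contDiff_coframe {m : WithTop ℕ∞} (v : Heis n) : ContDiff ℝ m fun p => coframe p v :=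
  contDiff_const.prodMk (contDiff_const.prodMk (contDiff_contact.clm_apply contDiff_const))

/-- The unit ball of the space of left-invariant `k`-forms. -/
def unitForms (n k : ℕ) : Set (Heis n [⋀^Fin k]→L[ℝ] ℝ) :=
  {ζ | fullSq (frame 0) ζ ≤ (k.factorial : ℝ)}

lemma fullSq_smul {k : ℕ} {ι : Type*} [Fintype ι] (e : ι → Heis n) (c : ℝ)
    (ζ : Heis n [⋀^Fin k]→L[ℝ] ℝ) : fullSq e (c • ζ) = c ^ 2 * fullSq e ζ := by
  simp [fullSq, Finset.mul_sum, mul_pow]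

lemma zero_mem_unitForms (k : ℕ) : (0 : Heis n [⋀^Fin k]→L[ℝ] ℝ) ∈ unitForms n k := by
  have := fullSq_smul (frame (0 : Heis n)) 0 (0 : Heis n [⋀^Fin k]→L[ℝ] ℝ)
  rw [zero_smul, sq, zero_mul, zero_mul] at this
  exact this.le.trans (Nat.cast_nonneg _)

lemma neg_mem_unitForms {k : ℕ} {ζ : Heis n [⋀^Fin k]→L[ℝ] ℝ} (hζ : ζ ∈ unitForms n k) :
    -ζ ∈ unitForms n k := by
  have := fullSq_smul (frame (0 : Heis n)) (-1 : ℝ) ζ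
  rw [neg_one_smul ℝ ζ, neg_one_sq, one_mul] at this
  exact this.le.trans hζ

lemma fullSq_frame_comp_coframe {k : ℕ} (ζ : Heis n [⋀^Fin k]→L[ℝ] ℝ) (p : Heis n) :
    fullSq (frame p) (ζ.compContinuousLinearMap (coframe p)) = fullSq (frame 0) ζ := by
  unfold fullSq
  refine Finset.sum_congr rfl fun I _ => ?_
  rw [ContinuousAlternatingMap.compContinuousLinearMap_apply]
  rw [show coframe p ∘ (frame p ∘ I) = frame 0 ∘ I from funext fun i => coframe_frame p (I i)]

lemma isCompact_unitForms (n k : ℕ) : IsCompact (unitForms n k) := by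
  let L : (Heis n [⋀^Fin k]→L[ℝ] ℝ) →ₗ[ℝ] ((Fin k → Option (Fin n ⊕ Fin n)) → ℝ) :=
    { toFun := fun φ I => φ (frame 0 ∘ I)
      map_add' := fun _ _ => rfl
      map_smul' := fun _ _ => rfl }
  have hli := (isInner_metric (0 : Heis n)).linearIndependent (isOrtho_frame 0)
  let b := basisOfLinearIndependentOfCardEqFinrank hli finrank_heis
  have hb : ⇑b = frame (0 : Heis n) := coe_basisOfLinearIndependentOfCardEqFinrank _ _
  have hL : Function.Injective L := by
    intro φ ψ h
    have : φ.toMultilinearMap = ψ.toMultilinearMap :=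
      Module.Basis.ext_multilinear (fun _ => b) fun I => by
        have := congrFun h I
        rw [hb]
        exact this
    ext v
    exact congrArg (fun f => f v) this
  have he := LinearMap.isClosedEmbedding_of_injective (LinearMap.ker_eq_bot.2 hL)
  have hK : IsCompact {x : (Fin k → Option (Fin n ⊕ Fin n)) → ℝ | ∑ I, x I ^ 2 ≤ k.factorial} := by
    refine Metric.isCompact_of_isClosed_isBounded
      (isClosed_le (by fun_prop) continuous_const) ?_
    refine (Metric.isBounded_closedBall (x := (0 : (Fin k → Option (Fin n ⊕ Fin n)) → ℝ))
      (r := (k.factorial : ℝ))).subset fun x hx => ?_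
    rw [mem_closedBall_zero_iff, pi_norm_le_iff_of_nonneg (by positivity)]
    intro I
    have h1 : x I ^ 2 ≤ k.factorial :=
      (Finset.single_le_sum (f := fun I => x I ^ 2) (fun _ _ => sq_nonneg _)
        (Finset.mem_univ I)).trans hx
    have h2 : (1 : ℝ) ≤ k.factorial := by exact_mod_cast k.factorial_pos
    rw [Real.norm_eq_abs]
    refine abs_le_of_sq_le_sq ?_ (by positivity)
    nlinarith
  exact he.isCompact_preimage hK

/-- The value of `θ ∧ ζ` on vectors expressed in the left-invariant frame. -/
def obl {k : ℕ} (X : Fin (k + 1) → Heis n) (ζ : Heis n [⋀^Fin k]→L[ℝ] ℝ) : ℝ :=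
  wedge (contact n) (fun _ => ζ) 0 X

/-- The oblique Jacobian: the supremum of `(θ ∧ ζ)(X)` over unit forms `ζ`. -/
def oblJac {k : ℕ} (X : Fin (k + 1) → Heis n) : ℝ := sSup ((fun ζ => obl X ζ) '' unitForms n k)

lemma obl_eq {k : ℕ} (X : Fin (k + 1) → Heis n) (ζ : Heis n [⋀^Fin k]→L[ℝ] ℝ) :
    obl X ζ = ∑ i : Fin (k + 1), (-1) ^ (i : ℕ) * ((X i).2.2 * ζ (i.removeNth X)) := by
  rw [obl, wedge_apply]
  simp

/-- Reading vectors and forms in the left-invariant frame removes the base point: `coframe (-p)` is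
the inverse of `coframe p`. Jacobians can therefore all be computed at the origin. -/
lemma wedge_eq_obl {k : ℕ} (φ : DForm (Heis n) (Heis n) k) (p : Heis n) (v : Fin (k + 1) → Heis n) :
    wedge (contact n) φ p v =
      obl (fun j => coframe p (v j)) ((φ p).compContinuousLinearMap (coframe (-p))) := by
  rw [obl_eq, wedge_apply]
  refine Finset.sum_congr rfl fun i _ => ?_
  rw [ContinuousAlternatingMap.compContinuousLinearMap_apply]
  congr 3
  funext j
  exact (coframe_neg_coframe p _).symm

lemma obl_smul {k : ℕ} (X : Fin (k + 1) → Heis n) (c : ℝ) (ζ : Heis n [⋀^Fin k]→L[ℝ] ℝ) :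
    obl X (c • ζ) = c * obl X ζ := by
  rw [obl_eq, obl_eq, Finset.mul_sum]
  exact Finset.sum_congr rfl fun i _ => by
    rw [ContinuousAlternatingMap.smul_apply, smul_eq_mul]; ring

lemma obl_neg {k : ℕ} (X : Fin (k + 1) → Heis n) (ζ : Heis n [⋀^Fin k]→L[ℝ] ℝ) :
    obl X (-ζ) = -obl X ζ := by
  rw [← neg_one_smul ℝ ζ, obl_smul, neg_one_mul]

lemma continuous_obl (k : ℕ) :
    Continuous fun x : (Fin (k + 1) → Heis n) × (Heis n [⋀^Fin k]→L[ℝ] ℝ) => obl x.1 x.2 := by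
  simp only [obl_eq]
  refine continuous_finsetSum _ fun i _ => continuous_const.mul (Continuous.mul (by fun_prop) ?_)
  rw [← contDiff_zero (𝕜 := ℝ), ← contDiffOn_univ]
  intro x _
  refine contDiffWithinAt_form_apply
    (f := fun x : (Fin (k + 1) → Heis n) × (Heis n [⋀^Fin k]→L[ℝ] ℝ) => x.2)
    (w := fun j x => i.removeNth x.1 j) contDiff_snd.contDiffWithinAt fun j => ?_
  exact ((ContinuousLinearMap.proj (R := ℝ) (φ := fun _ : Fin (k + 1) => Heis n)
    (i.succAbove j)).contDiff.comp contDiff_fst).contDiffWithinAt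

lemma continuous_oblJac (k : ℕ) : Continuous (oblJac (n := n) (k := k)) :=
  (isCompact_unitForms n k).continuous_sSup (continuous_obl k)

lemma obl_le_oblJac {k : ℕ} (X : Fin (k + 1) → Heis n) {ζ : Heis n [⋀^Fin k]→L[ℝ] ℝ}
    (hζ : ζ ∈ unitForms n k) : obl X ζ ≤ oblJac X :=
  le_csSup ((isCompact_unitForms n k).image
    ((continuous_obl k).comp (Continuous.prodMk_right X))).bddAbove (mem_image_of_mem _ hζ)

lemma oblJac_le {k : ℕ} {X : Fin (k + 1) → Heis n} {c : ℝ}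
    (h : ∀ ζ ∈ unitForms n k, obl X ζ ≤ c) : oblJac X ≤ c :=
  csSup_le (Set.Nonempty.image _ ⟨0, zero_mem_unitForms k⟩) (by rintro _ ⟨ζ, hζ, rfl⟩; exact h ζ hζ)

lemma oblJac_nonneg {k : ℕ} (X : Fin (k + 1) → Heis n) : 0 ≤ oblJac X := by
  refine le_trans ?_ (obl_le_oblJac X (zero_mem_unitForms k))
  have := obl_smul X 0 (0 : Heis n [⋀^Fin k]→L[ℝ] ℝ)
  rw [zero_smul, zero_mul] at this
  exact this.ge

lemma abs_obl_le_oblJac {k : ℕ} (X : Fin (k + 1) → Heis n) {ζ : Heis n [⋀^Fin k]→L[ℝ] ℝ}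
    (hζ : ζ ∈ unitForms n k) : |obl X ζ| ≤ oblJac X :=
  abs_le'.2 ⟨obl_le_oblJac X hζ, by
    rw [← obl_neg]; exact obl_le_oblJac X (neg_mem_unitForms hζ)⟩

lemma oblJac_eq_zero {k : ℕ} {X : Fin (k + 1) → Heis n} (h : ∀ i, (X i).2.2 = 0) :
    oblJac X = 0 := by
  refine le_antisymm (oblJac_le fun ζ _ => ?_) (oblJac_nonneg X)
  rw [obl_eq]
  simp [h]

/-- For fixed `ζ`, the pullback of `θ ∧ ζ` has top degree on the parameter space. -/
lemma obl_comp {k : ℕ} (T : (Fin (k + 1) → ℝ) →L[ℝ] Heis n)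
    (A : (Fin (k + 1) → ℝ) →ₗ[ℝ] (Fin (k + 1) → ℝ)) (ζ : Heis n [⋀^Fin k]→L[ℝ] ℝ) :
    obl (fun j => T (A (Pi.single j 1))) ζ =
      LinearMap.det A * obl (fun j => T (Pi.single j 1)) ζ := by
  let f : (Fin (k + 1) → ℝ) [⋀^Fin (k + 1)]→ₗ[ℝ] ℝ :=
    ((wedge (contact n) (fun _ => ζ) 0).compContinuousLinearMap T).toAlternatingMap
  let e := Pi.basisFun ℝ (Fin (k + 1))
  have he : ∀ j, e j = Pi.single j 1 := fun j => Pi.basisFun_apply ℝ _ j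
  have h1 : obl (fun j => T (A (Pi.single j 1))) ζ = f (A ∘ e) := by
    simp only [Function.comp_def, he]; rfl
  have h2 : obl (fun j => T (Pi.single j 1)) ζ = f e := by
    rw [show (e : Fin (k + 1) → _) = fun j => Pi.single j 1 from funext he]; rfl
  have h3 := f.eq_smul_basis_det e
  rw [h1, h2, h3]
  simp only [AlternatingMap.smul_apply, Module.Basis.det_comp, Module.Basis.det_self, smul_eq_mul]
  ring

lemma oblJac_comp {k : ℕ} (T : (Fin (k + 1) → ℝ) →L[ℝ] Heis n)
    {A : (Fin (k + 1) → ℝ) →ₗ[ℝ] (Fin (k + 1) → ℝ)} (hA : LinearMap.det A ≠ 0) :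
    oblJac (fun j => T (A (Pi.single j 1))) =
      |LinearMap.det A| * oblJac (fun j => T (Pi.single j 1)) := by
  have hpos := abs_pos.2 hA
  apply le_antisymm
  · refine oblJac_le fun ζ hζ => ?_
    rw [obl_comp]
    refine (le_abs_self _).trans ?_
    rw [abs_mul]
    gcongr
    exact abs_obl_le_oblJac _ hζ
  · rw [← le_div_iff₀' hpos]
    refine oblJac_le fun ζ hζ => ?_
    rw [le_div_iff₀' hpos]
    have h := abs_obl_le_oblJac (fun j => T (A (Pi.single j 1))) hζ
    rw [obl_comp, abs_mul] at h
    exact le_trans (by gcongr; exact le_abs_self _) h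

/-- The linear functional `L v = (t, ⟨w_i, z⟩)` giving the coordinates in a vertical plane. -/
def frameMap {k : ℕ} (w : Fin k → Hor n) : Heis n →L[ℝ] (Fin (k + 1) → ℝ) :=
  LinearMap.toContinuousLinearMap
    { toFun := fun v => Fin.cons v.2.2 fun i => inner ℝ (w i) (hor n v)
      map_add' := fun v v' => by
        ext i; refine Fin.cases ?_ (fun i => ?_) i <;> simp [inner_add_right]
      map_smul' := fun c v => by
        ext i; refine Fin.cases ?_ (fun i => ?_) i <;> simp [inner_smul_right] }

@[simp] lemma frameMap_zero {k : ℕ} (w : Fin k → Hor n) (v : Heis n) :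
    frameMap w v 0 = v.2.2 := rfl

@[simp] lemma frameMap_succ {k : ℕ} (w : Fin k → Hor n) (v : Heis n) (i : Fin k) :
    frameMap w v i.succ = inner ℝ (w i) (hor n v) := rfl

/-- The left-invariant frame adapted to an orthonormal basis of the horizontal layer. -/
lemma fullSq_frame_eq {k m : ℕ} (b : OrthonormalBasis (Fin m) ℝ (Hor n))
    (ζ : Heis n [⋀^Fin k]→L[ℝ] ℝ) :
    fullSq (consFrame (vert n) fun i => lift (b i) 0) ζ = fullSq (frame 0) ζ := by
  have hm : ∀ v w : Heis n, metric n 0 v w = inner ℝ (hor n v) (hor n w) + v.2.2 * w.2.2 :=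
    fun v w => by rw [inner_hor, metric, contact_zero, contact_zero]; rfl
  have hv : hor n (vert n) = 0 := by ext (i | i) <;> simp [hor_apply, vert]
  refine fullSq_eq_of_isOrtho (isInner_metric 0) (isOrtho_frame 0) ⟨?_, ?_⟩ finrank_heis ?_ ζ
  · rintro (_ | i)
    · rw [consFrame_none, hm, hv]; simp [vert]
    · rw [consFrame_some, hm]; simp
  · rintro (_ | i) (_ | j) h
    · exact absurd rfl h
    · rw [consFrame_none, consFrame_some, hm, hv]; simp
    · rw [consFrame_none, consFrame_some, hm, hv]; simp
    · rw [consFrame_some, consFrame_some, hm]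
      have : i ≠ j := fun h' => h (by rw [h'])
      simp [b.inner_eq_zero this]
  · have h1 := Module.finrank_eq_card_basis b.toBasis
    rw [finrank_euclideanSpace] at h1
    rw [← finrank_heis, Fintype.card_option, Fintype.card_option, h1]

/-- The oblique Jacobian of an adapted frame. -/
lemma oblJac_of_adapted {k : ℕ} {w : Fin k → Hor n} (hw : Orthonormal ℝ w)
    {Y : Fin (k + 1) → Heis n} (h0 : (Y 0).2.2 = 1) (hs : ∀ i : Fin k, Y i.succ = lift (w i) 0) :
    oblJac Y = 1 := by
  -- Only the first vector has a vertical component, so only one term of the wedge product survives.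
  have hobl : ∀ ζ : Heis n [⋀^Fin k]→L[ℝ] ℝ, obl Y ζ = ζ fun i => lift (w i) 0 := by
    intro ζ
    rw [obl_eq, Finset.sum_eq_single 0]
    · have : Fin.removeNth (0 : Fin (k + 1)) Y = fun i => lift (w i) 0 := funext fun i => hs i
      rw [this, h0]; simp
    · intro i _ hi
      obtain ⟨j, rfl⟩ := Fin.exists_succ_eq.2 hi
      rw [hs]; simp
    · simp
  obtain ⟨hk, b, hb⟩ := exists_orthonormalBasis_extending hw
  let e : Option (Fin (2 * n)) → Heis n := consFrame (vert n) fun i => lift (b i) 0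
  let emb : Equiv.Perm (Fin k) → (Fin k → Option (Fin (2 * n))) :=
    fun σ i => some (Fin.castLE hk (σ i))
  have hinj : Function.Injective emb := fun σ τ h => by
    ext i
    have := Option.some_injective _ (congrFun h i)
    exact congrArg Fin.val (Fin.castLE_injective hk this)
  have hemb : ∀ σ, e ∘ emb σ = (fun i => lift (w i) 0) ∘ σ := fun σ => by
    funext i
    simp only [Function.comp_apply, e, emb, consFrame_some, hb]
  have hcard : (∑ _σ : Equiv.Perm (Fin k), (1 : ℝ)) = k.factorial := by
    simp [Finset.card_univ, Fintype.card_perm]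
  have hperm : ∀ (ζ : Heis n [⋀^Fin k]→L[ℝ] ℝ) (σ : Equiv.Perm (Fin k)),
      ζ (e ∘ emb σ) ^ 2 = (ζ fun i => lift (w i) 0) ^ 2 := fun ζ σ => by
    rw [hemb]
    have h1 : ζ ((fun i => lift (w i) 0) ∘ σ) = Equiv.Perm.sign σ • ζ fun i => lift (w i) 0 :=
      ζ.toAlternatingMap.map_perm (fun i => lift (w i) 0) σ
    rw [h1]
    rcases Int.units_eq_one_or (Equiv.Perm.sign σ) with h | h <;> simp [h]
  apply le_antisymm
  · refine oblJac_le fun ζ hζ => ?_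
    rw [hobl]
    -- The `k!` orderings of `w` are among the multi-indices of the adapted basis, and each
    -- contributes the same square.
    have h1 : (k.factorial : ℝ) * (ζ fun i => lift (w i) 0) ^ 2 ≤ k.factorial := by
      calc (k.factorial : ℝ) * (ζ fun i => lift (w i) 0) ^ 2
          = ∑ σ : Equiv.Perm (Fin k), ζ (e ∘ emb σ) ^ 2 := by
            simp only [hperm, ← hcard, Finset.sum_mul, one_mul]
        _ = ∑ I ∈ Finset.univ.map ⟨emb, hinj⟩, ζ (e ∘ I) ^ 2 := by rw [Finset.sum_map]; rfl
        _ ≤ fullSq e ζ := Finset.sum_le_sum_of_subset_of_nonneg (Finset.subset_univ _)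
            fun _ _ _ => sq_nonneg _
        _ ≤ k.factorial := by rw [fullSq_frame_eq]; exact hζ
    have h2 : (0 : ℝ) < k.factorial := by exact_mod_cast k.factorial_pos
    have h3 : (ζ fun i => lift (w i) 0) ^ 2 ≤ 1 := by
      by_contra! h
      nlinarith
    exact (le_abs_self _).trans (abs_le_one_iff_mul_self_le_one.2 (by rwa [← sq]))
  -- The extremal form is the determinant of the components along `w`.
  · let D : (Fin k → ℝ) [⋀^Fin k]→L[ℝ] ℝ :=
      { (Pi.basisFun ℝ (Fin k)).det with
        cont := by
          have h : ∀ v, (Pi.basisFun ℝ (Fin k)).det v = Matrix.det v := fun v => by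
            rw [Pi.basisFun_det]; rfl
          exact (continuous_congr h).2 (Continuous.matrix_det continuous_id) }
    let P : Heis n →L[ℝ] (Fin k → ℝ) :=
      ContinuousLinearMap.pi fun i => (innerSL ℝ (w i)).comp (hor n)
    have hP : ∀ v i, P v i = inner ℝ (w i) (hor n v) := fun v i => rfl
    let ζ := D.compContinuousLinearMap P
    have h1 : (ζ fun i => lift (w i) 0) = 1 := by
      have : (fun i => P (lift (w i) 0)) = Pi.basisFun ℝ (Fin k) := by
        funext i
        ext j
        rw [hP, hor_lift, Pi.basisFun_apply, orthonormal_iff_ite.1 hw, Pi.single_apply]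
      calc (ζ fun i => lift (w i) 0) = (Pi.basisFun ℝ (Fin k)).det fun i => P (lift (w i) 0) := rfl
        _ = 1 := by rw [this, Module.Basis.det_self]
    have h2 : ζ ∈ unitForms n k := by
      rw [unitForms, mem_ofPred_eq, ← fullSq_frame_eq b]
      have h3 : fullSq e ζ = ∑ I ∈ Finset.univ.map ⟨emb, hinj⟩, ζ (e ∘ I) ^ 2 := by
        symm
        refine Finset.sum_subset (Finset.subset_univ _) fun I _ hI => ?_
        by_contra h
        have h0 : ζ (e ∘ I) ≠ 0 := fun h' => h (by rw [h', sq, zero_mul])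
        -- A nonzero coefficient cannot involve the vertical vector or a basis vector orthogonal to
        -- all of `w`; being also without repetition, its multi-index is an ordering of `w`.
        have h4 : ∀ j, ∃ i, I j = some (Fin.castLE hk i) := by
          intro j
          by_contra! hj
          refine h0 (D.map_coord_zero (m := fun j => P (e (I j))) j ?_)
          ext i
          rw [hP]
          rcases hIj : I j with _ | l
          · simp [e, hor_apply, vert]
          · simp only [e, consFrame_some, hor_lift]
            rw [← hb, b.inner_eq_zero]
            · rfl
            · rintro rfl
              exact hj i hIj
        choose s hs using h4
        have hsinj : Function.Injective s := by
          intro i j hij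
          by_contra hne
          exact h0 (ζ.map_eq_zero_of_eq (e ∘ I) (by simp [hs, hij]) hne)
        refine hI (Finset.mem_map.2 ⟨Equiv.ofBijective s
          (Finite.injective_iff_bijective.1 hsinj), Finset.mem_univ _, ?_⟩)
        funext j
        exact (hs j).symm
      rw [h3, Finset.sum_map]
      refine (le_of_eq ?_ : _ ≤ ∑ _σ : Equiv.Perm (Fin k), (1 : ℝ)).trans hcard.le
      refine Finset.sum_congr rfl fun σ _ => ?_
      exact (hperm ζ σ).trans (by rw [h1, one_pow])
    calc (1 : ℝ) = obl Y ζ := by rw [hobl, h1]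
      _ ≤ oblJac Y := obl_le_oblJac Y h2

/-- An orthonormal basis of the horizontal directions of a non-horizontal plane; in the
corresponding coordinates the oblique Jacobian is a determinant. -/
lemma exists_adapted {k : ℕ} {T : (Fin (k + 1) → ℝ) →L[ℝ] Heis n} (hT : Function.Injective T)
    {h₀ : Fin (k + 1) → ℝ} (h₀T : (T h₀).2.2 ≠ 0) :
    ∃ w : Fin k → Hor n, Orthonormal ℝ w ∧
      (∀ h, (T h).2.2 = 0 → hor n (T h) = ∑ i, inner ℝ (w i) (hor n (T h)) • w i) ∧
      LinearMap.det ((frameMap w).comp T).toLinearMap ≠ 0 ∧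
      oblJac (fun j => T (Pi.single j 1)) =
        |LinearMap.det ((frameMap w).comp T).toLinearMap| := by
  let τ : (Fin (k + 1) → ℝ) →ₗ[ℝ] ℝ := (contact n 0).toLinearMap.comp T.toLinearMap
  have hτ : ∀ h, τ h = (T h).2.2 := fun h => contact_zero _
  have hτ0 : LinearMap.range τ = ⊤ := by
    refine LinearMap.range_eq_top.2 (LinearMap.surjective fun h => h₀T ?_)
    rw [← hτ, h]; rfl
  have hK : Module.finrank ℝ (LinearMap.ker τ) = k := by
    have := τ.finrank_range_add_finrank_ker
    rw [hτ0, finrank_top, Module.finrank_self, Module.finrank_fin_fun] at this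
    omega
  -- Vectors of the plane without vertical component are determined by their horizontal coordinates,
  -- so these form a space of dimension `k`, from which `w` is taken.
  let g : LinearMap.ker τ →ₗ[ℝ] Hor n :=
    ((hor n).comp T).toLinearMap.comp (LinearMap.ker τ).subtype
  have hg : Function.Injective g := by
    intro x y hxy
    refine Subtype.ext (hT (heis_ext hxy ?_))
    rw [← hτ, ← hτ, LinearMap.mem_ker.1 x.2, LinearMap.mem_ker.1 y.2]
  have hW : Module.finrank ℝ (LinearMap.range g) = k := by
    rw [LinearMap.finrank_range_of_inj hg, hK]
  let b := (stdOrthonormalBasis ℝ (LinearMap.range g)).reindex (finCongr hW)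
  let w : Fin k → Hor n := fun i => b i
  have hw : Orthonormal ℝ w := b.orthonormal.comp_linearIsometry (LinearMap.range g).subtypeₗᵢ
  have hexp : ∀ h, (T h).2.2 = 0 → hor n (T h) = ∑ i, inner ℝ (w i) (hor n (T h)) • w i := by
    intro h hh
    have hmem : hor n (T h) ∈ LinearMap.range g :=
      ⟨⟨h, LinearMap.mem_ker.2 (by rw [hτ, hh])⟩, rfl⟩
    have := congrArg Subtype.val (b.sum_repr' ⟨_, hmem⟩)
    simpa [w] using this.symm
  set A : (Fin (k + 1) → ℝ) →ₗ[ℝ] (Fin (k + 1) → ℝ) := ((frameMap w).comp T).toLinearMap with hA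
  have hAinj : Function.Injective A := by
    rw [injective_iff_map_eq_zero]
    intro h hh
    have h1 : frameMap w (T h) = 0 := hh
    have h2 : (T h).2.2 = 0 := congrFun h1 0
    refine (injective_iff_map_eq_zero T).1 hT h (heis_ext ?_ h2)
    rw [hexp h h2, _root_.map_zero]
    refine Finset.sum_eq_zero fun i _ => ?_
    rw [show inner ℝ (w i) (hor n (T h)) = 0 from congrFun h1 i.succ, zero_smul]
  have hdet : LinearMap.det A ≠ 0 := by
    have hu : IsUnit A := (LinearMap.isUnit_iff_ker_eq_bot A).2 (LinearMap.ker_eq_bot.2 hAinj)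
    exact ((LinearMap.isUnit_iff_isUnit_det A).1 hu).ne_zero
  refine ⟨w, hw, hexp, hdet, ?_⟩
  -- Reparametrizing by the inverse of `A` makes the frame adapted, with oblique Jacobian one;
  -- undoing the reparametrization multiplies it by the determinant.
  let B := (A.equivOfDetNeZero hdet).symm.toLinearMap
  have hAB : ∀ y, A (B y) = y := fun y => (A.equivOfDetNeZero hdet).apply_symm_apply y
  have hBA : ∀ y, B (A y) = y := fun y => (A.equivOfDetNeZero hdet).symm_apply_apply y
  let Y : (Fin (k + 1) → ℝ) →L[ℝ] Heis n := T.comp (LinearMap.toContinuousLinearMap B)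
  have hY : ∀ y, frameMap w (Y y) = y := fun y => hAB y
  have h1 : oblJac (fun j => Y (Pi.single j 1)) = 1 := by
    refine oblJac_of_adapted hw (w := w) ?_ fun i => ?_
    · have := congrFun (hY (Pi.single 0 1)) 0
      simpa using this
    · have ht : (Y (Pi.single i.succ 1)).2.2 = 0 := by
        have := congrFun (hY (Pi.single i.succ 1)) 0
        simpa using this
      refine heis_ext ?_ ht
      have hexpY : hor n (Y (Pi.single i.succ 1)) =
          ∑ i', inner ℝ (w i') (hor n (Y (Pi.single i.succ 1))) • w i' := hexp _ ht
      rw [hor_lift, hexpY, Finset.sum_eq_single i]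
      · rw [show inner ℝ (w i) (hor n (Y (Pi.single i.succ 1))) = (1 : ℝ) by
          have := congrFun (hY (Pi.single i.succ 1)) i.succ
          simpa using this, one_smul]
      · intro j _ hj
        rw [show inner ℝ (w j) (hor n (Y (Pi.single i.succ 1))) = (0 : ℝ) by
          have := congrFun (hY (Pi.single i.succ 1)) j.succ
          simpa [Pi.single_apply, hj] using this, zero_smul]
      · simp
  have h2 := oblJac_comp Y hdet
  rw [h1, mul_one] at h2
  rw [← h2]
  congr 1
  funext j
  exact congrArg T (hBA _).symm

end Heis

/-! ### Measures carried by a submanifold -/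

lemma tsum_integral_eq {α : Type*} [MeasurableSpace α] {μ : ℕ → Measure α} {G : ℕ → α → ℝ}
    (hG : ∀ i, AEStronglyMeasurable (G i) (μ i)) (hfin : ∑' i, ∫⁻ u, ‖G i u‖ₑ ∂(μ i) ≠ ⊤) :
    ∑' i, ∫⁻ u, ENNReal.ofReal (G i u) ∂(μ i) ≠ ⊤ ∧
    ∑' i, ∫⁻ u, ENNReal.ofReal (-G i u) ∂(μ i) ≠ ⊤ ∧
    ∑' i, ∫ u, G i u ∂(μ i) = (∑' i, ∫⁻ u, ENNReal.ofReal (G i u) ∂(μ i)).toReal -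
      (∑' i, ∫⁻ u, ENNReal.ofReal (-G i u) ∂(μ i)).toReal := by
  have h1 : ∑' i, ∫⁻ u, ENNReal.ofReal (G i u) ∂(μ i) ≠ ⊤ :=
    ne_top_of_le_ne_top hfin (ENNReal.tsum_le_tsum fun i => lintegral_mono fun u =>
      Real.ofReal_le_enorm _)
  have h2 : ∑' i, ∫⁻ u, ENNReal.ofReal (-G i u) ∂(μ i) ≠ ⊤ :=
    ne_top_of_le_ne_top hfin (ENNReal.tsum_le_tsum fun i => lintegral_mono fun u => by
      rw [← enorm_neg]; exact Real.ofReal_le_enorm _)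
  refine ⟨h1, h2, ?_⟩
  rw [ENNReal.tsum_toReal_eq (ENNReal.ne_top_of_tsum_ne_top h1),
    ENNReal.tsum_toReal_eq (ENNReal.ne_top_of_tsum_ne_top h2),
    ← (ENNReal.summable_toReal h1).tsum_sub (ENNReal.summable_toReal h2)]
  refine tsum_congr fun i => integral_eq_lintegral_pos_part_sub_lintegral_neg_part ⟨hG i, ?_⟩
  exact (ENNReal.ne_top_of_tsum_ne_top hfin i).lt_top

lemma ofReal_tsum_integral_le {α : Type*} [MeasurableSpace α] {μ : ℕ → Measure α} {G : ℕ → α → ℝ}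
    (hG : ∀ i, AEStronglyMeasurable (G i) (μ i)) (hfin : ∑' i, ∫⁻ u, ‖G i u‖ₑ ∂(μ i) ≠ ⊤) :
    ENNReal.ofReal (∑' i, ∫ u, G i u ∂(μ i)) ≤ ∑' i, ∫⁻ u, ENNReal.ofReal (G i u) ∂(μ i) := by
  obtain ⟨h1, h2, h3⟩ := tsum_integral_eq hG hfin
  rw [h3]
  refine (ENNReal.ofReal_le_ofReal (sub_le_self _ ENNReal.toReal_nonneg)).trans ?_
  rw [ENNReal.ofReal_toReal h1]

lemma tsum_lintegral_le_ofReal {α : Type*} [MeasurableSpace α] {μ : ℕ → Measure α}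
    {G : ℕ → α → ℝ} (hG : ∀ i, AEStronglyMeasurable (G i) (μ i))
    (hfin : ∑' i, ∫⁻ u, ‖G i u‖ₑ ∂(μ i) ≠ ⊤) :
    ∑' i, ∫⁻ u, ENNReal.ofReal (G i u) ∂(μ i) ≤ ENNReal.ofReal (∑' i, ∫ u, G i u ∂(μ i)) +
      ∑' i, ∫⁻ u, ENNReal.ofReal (-G i u) ∂(μ i) := by
  obtain ⟨h1, h2, h3⟩ := tsum_integral_eq hG hfin
  rw [h3]
  set P := ∑' i, ∫⁻ u, ENNReal.ofReal (G i u) ∂(μ i)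
  set Q := ∑' i, ∫⁻ u, ENNReal.ofReal (-G i u) ∂(μ i)
  calc P = ENNReal.ofReal P.toReal := (ENNReal.ofReal_toReal h1).symm
    _ = ENNReal.ofReal ((P.toReal - Q.toReal) + Q.toReal) := by rw [sub_add_cancel]
    _ ≤ _ := ENNReal.ofReal_add_le
    _ = _ := by rw [ENNReal.ofReal_toReal h2]

namespace OrientedSubmanifold

variable {E : Type*} [NormedAddCommGroup E] [NormedSpace ℝ E] {k : ℕ}

section

variable {S : OrientedSubmanifold E E k}

lemma eq_of_mem_piece {i j : ℕ} {u v : Fin k → ℝ} (hu : u ∈ S.piece i) (hv : v ∈ S.piece j)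
    (h : S.param i u = S.param j v) : i = j := by
  rcases lt_trichotomy i j with hij | hij | hij
  · exact absurd ⟨u, hu.1, h⟩ (hv.2 i hij)
  · exact hij
  · exact absurd ⟨v, hv.1, h.symm⟩ (hu.2 j hij)

lemma exists_mem_piece {p : E} (hp : p ∈ S.carrier) : ∃ i, ∃ u ∈ S.piece i, S.param i u = p := by
  classical
  rw [S.carrier_eq] at hp
  have hex : ∃ i, p ∈ S.param i '' S.dom i := mem_iUnion.1 hp
  obtain ⟨u, hu, hup⟩ := Nat.find_spec hex
  exact ⟨Nat.find hex, u, ⟨hu, fun j hj h => Nat.find_min hex hj (hup ▸ h)⟩, hup⟩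

lemma iUnion_image_part {A : Set E} (hA : A ⊆ S.carrier) :
    ⋃ i, S.param i '' S.part A i = A := by
  ext p
  constructor
  · intro hp
    obtain ⟨i, u, hu, rfl⟩ := mem_iUnion.1 hp
    exact hu.2
  · intro hp
    obtain ⟨i, u, hu, rfl⟩ := exists_mem_piece (hA hp)
    exact mem_iUnion.2 ⟨i, u, ⟨hu, hp⟩, rfl⟩

end

variable [MeasurableSpace E] [BorelSpace E] (S : OrientedSubmanifold E E k)

/-- The measure on `E` given by densities in the parametrizations. -/
def push (f : ℕ → (Fin k → ℝ) → ℝ≥0∞) : Measure E :=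
  Measure.sum fun i => ((volume.restrict (S.piece i)).withDensity (f i)).map (S.param i)

lemma push_apply (f : ℕ → (Fin k → ℝ) → ℝ≥0∞) {A : Set E} (hA : MeasurableSet A) :
    S.push f A = ∑' i, ∫⁻ u in S.part A i, f i u := by
  rw [push, Measure.sum_apply _ hA]
  refine tsum_congr fun i => ?_
  have hm : AEMeasurable (S.param i) (volume.restrict (S.piece i)) :=
    ((S.continuousOn_param i).mono (S.piece_subset i)).aemeasurable (S.measurableSet_piece i)
  have hm' := hm.mono_ac (withDensity_absolutelyContinuous (volume.restrict (S.piece i)) (f i))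
  have hpart := S.measurableSet_part hA i
  rw [Measure.map_apply_of_aemeasurable hm' hA]
  have h1 : (S.param i ⁻¹' A : Set _) =ᵐ[(volume.restrict (S.piece i)).withDensity (f i)]
      S.part A i := by
    refine (withDensity_absolutelyContinuous _ (f i)).ae_eq ?_
    filter_upwards [ae_restrict_mem (S.measurableSet_piece i)] with u hu
    exact propext ⟨fun h => ⟨hu, h⟩, fun h => h.2⟩
  rw [measure_congr h1, withDensity_apply _ hpart, Measure.restrict_restrict hpart,
    inter_eq_left.2 (S.part_subset A i)]

variable {S}

lemma push_mono {f g : ℕ → (Fin k → ℝ) → ℝ≥0∞} {A : Set E} (hA : MeasurableSet A)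
    (h : ∀ i, ∀ u ∈ S.part A i, f i u ≤ g i u) : S.push f A ≤ S.push g A := by
  rw [push_apply _ _ hA, push_apply _ _ hA]
  exact ENNReal.tsum_le_tsum fun i => setLIntegral_mono' (S.measurableSet_part hA i) (h i)

lemma push_eq_zero {f : ℕ → (Fin k → ℝ) → ℝ≥0∞} {A : Set E} (hA : MeasurableSet A)
    (h : ∀ i, ∀ u ∈ S.part A i, f i u = 0) : S.push f A = 0 := by
  refine le_antisymm ((push_mono (g := fun _ _ => 0) hA fun i u hu => (h i u hu).le).trans ?_) bot_le
  rw [push_apply _ _ hA]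
  simp

lemma measurableSet_image {i : ℕ} {D : Set (Fin k → ℝ)} (hD : MeasurableSet D)
    (hDi : D ⊆ S.dom i) : MeasurableSet (S.param i '' D) :=
  hD.image_of_continuousOn_injOn ((S.continuousOn_param i).mono hDi) ((S.injOn_param i).mono hDi)

end OrientedSubmanifold

/-! ### The measure given by the oblique Jacobian, and test forms built from left-invariant ones. -/

namespace Heis

open OrientedSubmanifold

variable {n k : ℕ} (S : OrientedSubmanifold (Heis n) (Heis n) (k + 1))

/-- The tangent vectors of a parametrization, expressed in the left-invariant frame. -/
def trivTangent (i : ℕ) (u : Fin (k + 1) → ℝ) : (Fin (k + 1) → ℝ) →L[ℝ] Heis n :=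
  (coframe (S.param i u)).comp (S.tangent i u)

/-- The oblique Jacobian of a parametrization. -/
def jac (i : ℕ) (u : Fin (k + 1) → ℝ) : ℝ := oblJac fun j => trivTangent S i u (Pi.single j 1)

/-- The value of `θ ∧ ζ` on a parametrization, for a left-invariant form `ζ`. -/
def paramObl (ζ : Heis n [⋀^Fin k]→L[ℝ] ℝ) (i : ℕ) (u : Fin (k + 1) → ℝ) : ℝ :=
  obl (fun j => trivTangent S i u (Pi.single j 1)) ζ

lemma continuousOn_trivTangent (i : ℕ) : ContinuousOn
    (fun u (j : Fin (k + 1)) => trivTangent S i u (Pi.single j 1)) (S.dom i) := by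
  rw [continuousOn_pi]
  intro j
  have h1 : Continuous fun x : Heis n × Heis n => coframe x.1 x.2 := by
    simp only [coframe_apply]
    exact (by fun_prop : Continuous fun x : Heis n × Heis n => x.2.1).prodMk
      ((by fun_prop : Continuous fun x : Heis n × Heis n => x.2.2.1).prodMk
      (((contDiff_contact (m := 0)).continuous.comp continuous_fst).clm_apply continuous_snd))
  exact h1.comp_continuousOn ((S.continuousOn_param i).prodMk
    ((S.continuousOn_tangent i).clm_apply continuousOn_const))

lemma continuousOn_jac (i : ℕ) : ContinuousOn (jac S i) (S.dom i) :=
  (continuous_oblJac k).comp_continuousOn (continuousOn_trivTangent S i)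

lemma continuousOn_paramObl (ζ : Heis n [⋀^Fin k]→L[ℝ] ℝ) (i : ℕ) :
    ContinuousOn (paramObl S ζ i) (S.dom i) :=
  ((continuous_obl k).comp (Continuous.prodMk_left ζ)).comp_continuousOn
    (continuousOn_trivTangent S i)

/-- The measure on `S` with density the oblique Jacobian. -/
def oblMeas : Measure (Heis n) := S.push fun i u => ENNReal.ofReal (jac S i u)

lemma coeff_wedge (φ : DForm (Heis n) (Heis n) k) (i : ℕ) (u : Fin (k + 1) → ℝ) :
    S.coeff i (wedge (contact n) φ) u =
      paramObl S ((φ (S.param i u)).compContinuousLinearMap (coframe (-S.param i u))) i u := by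
  rw [coeff_eq, wedge_eq_obl]
  rfl

lemma comp_coframe_mem_unitForms {φ : DForm (Heis n) (Heis n) k}
    (hφ : SupNormLeOne (metric n) φ) (p : Heis n) :
    (φ p).compContinuousLinearMap (coframe (-p)) ∈ unitForms n k := by
  rw [unitForms, mem_ofPred_eq, ← fullSq_frame_comp_coframe _ p]
  convert (supNormLeOne_metric_iff φ).1 hφ p using 2
  ext v
  simp only [ContinuousAlternatingMap.compContinuousLinearMap_apply]
  congr 1
  funext j
  exact coframe_neg_coframe p _

variable {S}

lemma aestronglyMeasurable_coeff {φ : DForm (Heis n) (Heis n) (k + 1)} (hφ : IsTestForm φ)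
    {A : Set (Heis n)} (hA : MeasurableSet A) (i : ℕ) :
    AEStronglyMeasurable (S.coeff i φ) (volume.restrict (S.part A i)) :=
  ((S.continuousOn_coeff i hφ.contDiff.continuous).mono
    ((S.part_subset A i).trans (S.piece_subset i))).aestronglyMeasurable (S.measurableSet_part hA i)

lemma tsum_coeff_ne_top (hS : S.CarriesCurrent) {φ : DForm (Heis n) (Heis n) (k + 1)}
    (hφ : IsTestForm φ) (A : Set (Heis n)) :
    ∑' i, ∫⁻ u in S.part A i, ‖S.coeff i φ u‖ₑ ≠ ⊤ :=
  ne_top_of_le_ne_top (hS φ hφ) (ENNReal.tsum_le_tsum fun i =>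
    lintegral_mono_set (S.part_subset A i))

/-- At each point an admissible form, read in the left-invariant frame, is a unit form, so its
integrand is bounded by the Jacobian. -/
lemma obliqueMass_le_oblMeas (hS : S.CarriesCurrent) {A : Set (Heis n)} (hA : MeasurableSet A) :
    obliqueMass (metric n) (contact n) (S.current A) ≤ oblMeas S A := by
  refine iSup_le fun φ => iSup_le fun hφ => iSup_le fun hn => ?_
  have hw := isTestForm_wedge hφ
  refine (ofReal_tsum_integral_le (fun i => aestronglyMeasurable_coeff hw hA i)
    (tsum_coeff_ne_top hS hw A)).trans ?_
  rw [oblMeas, push_apply _ _ hA]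
  refine ENNReal.tsum_le_tsum fun i => lintegral_mono fun u => ENNReal.ofReal_le_ofReal ?_
  rw [coeff_wedge]
  exact obl_le_oblJac _ (comp_coframe_mem_unitForms hn _)

/-- Left-invariant forms multiplied by smooth functions. -/
def bumpForm (h : Heis n → ℝ) (ζ : Heis n [⋀^Fin k]→L[ℝ] ℝ) : DForm (Heis n) (Heis n) k :=
  fun p => h p • ζ.compContinuousLinearMap (coframe p)

lemma contDiff_bumpForm {h : Heis n → ℝ} (hh : ContDiff ℝ ∞ h) (ζ : Heis n [⋀^Fin k]→L[ℝ] ℝ) :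
    ContDiff ℝ ∞ (bumpForm h ζ) := by
  refine hh.smul ?_
  rw [contDiff_iff_contDiffAt]
  intro p
  exact (contDiffWithinAt_form_comp (f := fun _ => ζ) (s := univ) contDiffWithinAt_const
    fun v => (contDiff_coframe v).contDiffWithinAt).contDiffAt univ_mem

lemma bumpForm_comp (h : Heis n → ℝ) (ζ : Heis n [⋀^Fin k]→L[ℝ] ℝ) (p : Heis n) :
    (bumpForm h ζ p).compContinuousLinearMap (coframe (-p)) = h p • ζ := by
  ext v
  simp only [bumpForm, ContinuousAlternatingMap.compContinuousLinearMap_apply,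
    ContinuousAlternatingMap.smul_apply]
  congr 2
  funext j
  exact coframe_coframe_neg p _

lemma isTestForm_of_isBounded {φ : DForm (Heis n) (Heis n) k} (hφ : ContDiff ℝ ∞ φ) {R : ℝ}
    (h : ∀ p, φ p ≠ 0 → p ∈ Metric.closedBall (0 : Heis n) R) : IsTestForm φ :=
  ⟨(isSmoothForm_model_iff φ).2 hφ, (isCompact_closedBall (0 : Heis n) R).of_isClosed_subset
    isClosed_closure (closure_minimal h Metric.isClosed_closedBall)⟩

lemma exists_bump {K U : Set (Heis n)} (hK : IsCompact K) (hU : IsOpen U) (hKU : K ⊆ U) :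
    ∃ (h : Heis n → ℝ) (R : ℝ), ContDiff ℝ ∞ h ∧ (∀ p ∈ K, h p = 1) ∧ (∀ p ∉ U, h p = 0) ∧
      (∀ p, h p ≠ 0 → p ∈ Metric.closedBall (0 : Heis n) R) ∧ ∀ p, h p ∈ Icc (0 : ℝ) 1 := by
  obtain ⟨R, hR⟩ := hK.isBounded.subset_ball (0 : Heis n)
  obtain ⟨h, h0, h1, h2⟩ := exists_contMDiffMap_zero_one_of_isClosed (n := (⊤ : ℕ∞)) 𝓘(ℝ, Heis n)
    (s := (U ∩ Metric.ball 0 R)ᶜ) (t := K)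
    (hU.inter Metric.isOpen_ball).isClosed_compl hK.isClosed
    (disjoint_compl_left_iff_subset.2 (subset_inter hKU hR))
  refine ⟨h, R, h.contMDiff.contDiff, fun p hp => h1 hp, fun p hp => h0 fun h => hp h.1,
    fun p hp => ?_, h2⟩
  by_contra hp'
  exact hp (h0 fun h => hp' (Metric.ball_subset_closedBall h.2))

end Heis

namespace Heis

open OrientedSubmanifold

variable {n k : ℕ} {S : OrientedSubmanifold (Heis n) (Heis n) (k + 1)}

/-! ### The oblique mass is the integral of the oblique Jacobian -/

lemma obl_sum {ι : Type*} (s : Finset ι) (X : Fin (k + 1) → Heis n)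
    (ζ : ι → Heis n [⋀^Fin k]→L[ℝ] ℝ) : obl X (∑ m ∈ s, ζ m) = ∑ m ∈ s, obl X (ζ m) := by
  simp only [obl_eq]
  rw [Finset.sum_comm]
  refine Finset.sum_congr rfl fun i _ => ?_
  rw [ContinuousAlternatingMap.sum_apply, Finset.mul_sum, Finset.mul_sum]

/-- The coordinates of unit forms in a fixed basis are bounded by compactness. Hence finitely many
left-invariant forms control the Jacobian. -/
lemma exists_oblJac_le (n k : ℕ) : ∃ (N : ℕ) (b : Fin N → Heis n [⋀^Fin k]→L[ℝ] ℝ) (C : ℝ),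
    0 ≤ C ∧ ∀ X : Fin (k + 1) → Heis n, oblJac X ≤ C * ∑ m, |obl X (b m)| := by
  let b := Module.finBasis ℝ (Heis n [⋀^Fin k]→L[ℝ] ℝ)
  have hc : Continuous fun ζ => b.equivFun ζ := LinearMap.continuous_of_finiteDimensional
    b.equivFun.toLinearMap
  obtain ⟨C, hC⟩ := ((isCompact_unitForms n k).image hc).isBounded.exists_norm_le
  refine ⟨_, b, max C 0, le_max_right _ _, fun X => oblJac_le fun ζ hζ => ?_⟩
  have h1 : ∀ m, |b.equivFun ζ m| ≤ max C 0 := fun m =>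
    (norm_le_pi_norm (b.equivFun ζ) m).trans
      ((hC _ (mem_image_of_mem _ hζ)).trans (le_max_left _ _))
  calc obl X ζ = obl X (∑ m, b.equivFun ζ m • b m) := by rw [b.sum_equivFun]
    _ = ∑ m, b.equivFun ζ m * obl X (b m) := by simp only [obl_sum, obl_smul]
    _ ≤ ∑ m, max C 0 * |obl X (b m)| := Finset.sum_le_sum fun m _ => by
        refine (le_abs_self _).trans ?_
        rw [abs_mul]
        gcongr
        exact h1 m
    _ = _ := by rw [Finset.mul_sum]

lemma coeff_bumpForm (h : Heis n → ℝ) (ζ : Heis n [⋀^Fin k]→L[ℝ] ℝ) (i : ℕ)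
    (u : Fin (k + 1) → ℝ) :
    S.coeff i (wedge (contact n) (bumpForm h ζ)) u = h (S.param i u) * paramObl S ζ i u := by
  rw [coeff_wedge, bumpForm_comp, paramObl, obl_smul]
  rfl

/-- On `K`, where the bump function equals one, the Jacobian is dominated by the coefficients of
finitely many test forms, which are integrable because the submanifold carries a current. -/
lemma oblMeas_lt_top (hS : S.CarriesCurrent) {K : Set (Heis n)} (hK : IsCompact K) :
    oblMeas S K < ⊤ := by
  obtain ⟨N, b, C, hC, hb⟩ := exists_oblJac_le n k
  obtain ⟨h, R, hh, h1, -, h3, h4⟩ := exists_bump hK isOpen_univ (subset_univ K)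
  have htest : ∀ m, IsTestForm (wedge (contact n) (bumpForm h (b m))) := fun m =>
    isTestForm_wedge (isTestForm_of_isBounded (contDiff_bumpForm hh (b m)) fun p hp =>
      h3 p fun h0 => hp (by simp [bumpForm, h0]))
  rw [oblMeas, push_apply _ _ hK.measurableSet]
  calc ∑' i, ∫⁻ u in S.part K i, ENNReal.ofReal (jac S i u)
      ≤ ∑' i, ∫⁻ u in S.part K i, ENNReal.ofReal C *
          ∑ m, ‖S.coeff i (wedge (contact n) (bumpForm h (b m))) u‖ₑ := by
        refine ENNReal.tsum_le_tsum fun i =>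
          setLIntegral_mono' (S.measurableSet_part hK.measurableSet i) fun u hu => ?_
        refine (ENNReal.ofReal_le_ofReal (hb _)).trans ?_
        rw [ENNReal.ofReal_mul hC, ENNReal.ofReal_sum_of_nonneg fun _ _ => abs_nonneg _]
        gcongr with m
        rw [coeff_bumpForm, h1 _ hu.2, one_mul, ← Real.enorm_eq_ofReal_abs]
        rfl
    _ = ENNReal.ofReal C * ∑ m, ∑' i, ∫⁻ u in S.part K i,
          ‖S.coeff i (wedge (contact n) (bumpForm h (b m))) u‖ₑ := by
        rw [← Summable.tsum_finsetSum fun _ _ => ENNReal.summable, ← ENNReal.tsum_mul_left]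
        refine tsum_congr fun i => ?_
        have hm : ∀ m, AEMeasurable
            (fun u => ‖S.coeff i (wedge (contact n) (bumpForm h (b m))) u‖ₑ)
            (volume.restrict (S.part K i)) := fun m =>
          (aestronglyMeasurable_coeff (htest m) hK.measurableSet i).enorm
        rw [lintegral_const_mul'' _ (Finset.aemeasurable_fun_sum _ fun m _ => hm m),
          lintegral_finsetSum' _ fun m _ => hm m]
    _ < ⊤ := ENNReal.mul_lt_top ENNReal.ofReal_lt_top
        (ENNReal.sum_lt_top.2 fun m _ => (tsum_coeff_ne_top hS (htest m) K).lt_top)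

lemma isLocallyFiniteMeasure_oblMeas (hS : S.CarriesCurrent) :
    IsLocallyFiniteMeasure (oblMeas S) :=
  ⟨fun p => ⟨Metric.closedBall p 1, Metric.closedBall_mem_nhds p one_pos,
    oblMeas_lt_top hS (isCompact_closedBall p 1)⟩⟩

/-- Separation of finitely many sets by disjoint open sets, up to small sets. -/
lemma exists_compact_open {X : Type*} [MetricSpace X] [SigmaCompactSpace X] [MeasurableSpace X]
    [BorelSpace X] (μ : Measure X) [IsLocallyFiniteMeasure μ] {ι : Type*} [Finite ι]
    {E : ι → Set X} (hE : ∀ m, MeasurableSet (E m)) (hfin : ∀ m, μ (E m) ≠ ⊤)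
    (hd : Pairwise (Function.onFun Disjoint E)) {ε : ℝ≥0∞} (hε : ε ≠ 0) :
    ∃ K U : ι → Set X, (∀ m, IsCompact (K m)) ∧ (∀ m, IsOpen (U m)) ∧ (∀ m, K m ⊆ E m) ∧
      (∀ m, K m ⊆ U m) ∧ Pairwise (Function.onFun Disjoint U) ∧ (∀ m, μ (E m \ K m) ≤ ε) ∧
      ∀ m, μ (U m \ K m) ≤ ε := by
  have h1 : ∀ m, ∃ K ⊆ E m, IsCompact K ∧ μ (E m \ K) < ε := fun m =>
    (hE m).exists_isCompact_sdiff_lt (hfin m) hε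
  choose K hKE hK hKε using h1
  have h2 : Pairwise (Function.onFun Disjoint fun m => 𝓝ˢ (K m)) := fun i j hij =>
    separatedNhds_iff_disjoint.1
      (SeparatedNhds.of_isCompact_isCompact (hK i) (hK j) (Disjoint.mono (hKE i) (hKE j) (hd hij)))
  obtain ⟨V, hV, hVd⟩ := h2.exists_mem_filter_of_disjoint
  have h3 : ∀ m, ∃ U ⊇ K m, IsOpen U ∧ μ (U \ K m) < ε := fun m => by
    obtain ⟨U, hU, hUo, -, hUε⟩ := (hK m).measurableSet.exists_isOpen_sdiff_lt (μ := μ)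
      ((hK m).measure_lt_top (μ := μ)).ne hε
    exact ⟨U, hU, hUo, hUε⟩
  choose U hKU hUo hUε using h3
  refine ⟨K, fun m => U m ∩ interior (V m), hK, fun m => (hUo m).inter isOpen_interior, hKE,
    fun m => subset_inter (hKU m) (subset_interior_iff_mem_nhdsSet.2 (hV m)), fun i j hij =>
      Disjoint.mono (inter_subset_right.trans interior_subset)
        (inter_subset_right.trans interior_subset) (hVd hij), fun m => (hKε m).le, fun m => ?_⟩
  exact (measure_mono (sdiff_subset_sdiff_left inter_subset_left)).trans (hUε m).le

/-- The form equal to `ζ m` on `E m` is not smooth. Replace each `E m` by a compact `K m` of almost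
full measure, and multiply `ζ m` by a bump function equal to one on `K m` and supported in an open
`U m`; since the `U m` are disjoint, the sum still has norm at most one. By `hpos` the integrand can
be negative only on the sets `U m \ K m`, where the Jacobian bounds it and has small integral. -/
lemma sum_push_le_obliqueMass (hS : S.CarriesCurrent) {A : Set (Heis n)} (hA : MeasurableSet A)
    {ι : Type*} [Fintype ι] {ζ : ι → Heis n [⋀^Fin k]→L[ℝ] ℝ} (hζ : ∀ m, ζ m ∈ unitForms n k)
    {E : ι → Set (Heis n)} (hE : ∀ m, MeasurableSet (E m)) (hEA : ∀ m, E m ⊆ A)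
    (hfin : ∀ m, oblMeas S (E m) ≠ ⊤) (hd : Pairwise (Function.onFun Disjoint E))
    (hpos : ∀ m i, ∀ u ∈ S.part (E m) i, 0 ≤ paramObl S (ζ m) i u) :
    ∑ m, S.push (fun i u => ENNReal.ofReal (paramObl S (ζ m) i u)) (E m) ≤
      obliqueMass (metric n) (contact n) (S.current A) := by
  classical
  have hloc := isLocallyFiniteMeasure_oblMeas hS
  -- Each index costs `ε` twice: once for `E m \ K m`, which is lost, and once for the negative part
  -- on `U m \ K m`.
  have key : ∀ ε : ℝ≥0∞, ε ≠ 0 →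
      ∑ m, S.push (fun i u => ENNReal.ofReal (paramObl S (ζ m) i u)) (E m) ≤
        obliqueMass (metric n) (contact n) (S.current A) + (2 * Fintype.card ι) * ε := by
    intro ε hε
    obtain ⟨K, U, hK, hU, hKE, hKU, hUd, hKε, hUε⟩ :=
      exists_compact_open (oblMeas S) hE hfin hd hε
    choose h R hh h1 h0 hR hI using fun m => exists_bump (hK m) (hU m) (hKU m)
    let φ : DForm (Heis n) (Heis n) k := fun p => ∑ m, bumpForm (h m) (ζ m) p
    have hφ0 : ∀ p, (∀ m, h m p = 0) → φ p = 0 := fun p hp =>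
      Finset.sum_eq_zero fun m _ => by rw [bumpForm, hp, zero_smul]
    have hφ1 : ∀ p m, p ∈ U m → φ p = bumpForm (h m) (ζ m) p := fun p m hp => by
      refine Finset.sum_eq_single m (fun m' _ hm' => ?_) (by simp)
      rw [bumpForm, h0 m' p fun hp' => (hUd hm').le_bot ⟨hp', hp⟩, zero_smul]
    have htest : IsTestForm φ := by
      obtain ⟨M, hM⟩ := (Set.finite_range R).bddAbove
      refine isTestForm_of_isBounded (R := M) (ContDiff.sum fun m _ => contDiff_bumpForm (hh m) _)
        fun p hp => ?_
      by_contra hp'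
      refine hp (hφ0 p fun m => ?_)
      by_contra hm
      exact hp' (Metric.closedBall_subset_closedBall (hM ⟨m, rfl⟩) (hR m p hm))
    have hnorm : SupNormLeOne (metric n) φ := by
      rw [supNormLeOne_metric_iff]
      intro p
      by_cases hp : ∃ m, p ∈ U m
      · obtain ⟨m, hm⟩ := hp
        rw [hφ1 p m hm, bumpForm, fullSq_smul, fullSq_frame_comp_coframe]
        have hm1 := hI m p
        have hm2 : fullSq (frame 0) (ζ m) ≤ (k.factorial : ℝ) := hζ m
        have hm3 := fullSq_nonneg (frame (0 : Heis n)) (ζ m)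
        have hm4 : h m p ^ 2 ≤ 1 := by
          rw [sq_le_one_iff_abs_le_one, abs_of_nonneg hm1.1]; exact hm1.2
        nlinarith
      · push Not at hp
        rw [hφ0 p fun m => h0 m p (hp m)]
        have := fullSq_smul (frame p) 0 (0 : Heis n [⋀^Fin k]→L[ℝ] ℝ)
        rw [zero_smul, sq, zero_mul, zero_mul] at this
        exact this.le.trans (Nat.cast_nonneg _)
    have hw := isTestForm_wedge htest
    have hcoeff0 : ∀ i u, (∀ m, S.param i u ∉ U m) → S.coeff i (wedge (contact n) φ) u = 0 := by
      intro i u hu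
      rw [coeff_wedge, hφ0 _ fun m => h0 m _ (hu m)]
      have := obl_smul (fun j => trivTangent S i u (Pi.single j 1)) 0
        ((0 : Heis n [⋀^Fin k]→L[ℝ] ℝ).compContinuousLinearMap (coframe (-S.param i u)))
      rw [zero_smul, zero_mul] at this
      exact this
    have hcoeff1 : ∀ i u m, S.param i u ∈ U m → S.coeff i (wedge (contact n) φ) u =
        h m (S.param i u) * paramObl S (ζ m) i u := by
      intro i u m hm
      rw [coeff_wedge, hφ1 _ m hm, bumpForm_comp, paramObl, obl_smul]
      rfl
    let G : ℕ → (Fin (k + 1) → ℝ) → ℝ := fun i u => S.coeff i (wedge (contact n) φ) u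
    have hKm : MeasurableSet (⋃ m, K m) := .iUnion fun m => (hK m).measurableSet
    have hKd : Pairwise (Function.onFun Disjoint K) := fun i j hij =>
      Disjoint.mono (hKE i) (hKE j) (hd hij)
    have hGpos : ∀ m i, ∀ u ∈ S.part (K m) i, G i u = paramObl S (ζ m) i u := by
      intro m i u hu
      simp only [G]
      rw [hcoeff1 i u m (hKU m hu.2), h1 m _ hu.2, one_mul]
    have step1 : ∑ m, S.push (fun i u => ENNReal.ofReal (paramObl S (ζ m) i u)) (K m) ≤
        S.push (fun i u => ENNReal.ofReal (G i u)) A := by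
      calc ∑ m, S.push (fun i u => ENNReal.ofReal (paramObl S (ζ m) i u)) (K m)
          ≤ ∑ m, S.push (fun i u => ENNReal.ofReal (G i u)) (K m) :=
            Finset.sum_le_sum fun m _ => push_mono (hK m).measurableSet fun i u hu => by
              rw [hGpos m i u hu]
        _ = S.push (fun i u => ENNReal.ofReal (G i u)) (⋃ m, K m) := by
            rw [measure_iUnion hKd fun m => (hK m).measurableSet, tsum_fintype]
        _ ≤ _ := measure_mono (iUnion_subset fun m => (hKE m).trans (hEA m))
    have step2 : S.push (fun i u => ENNReal.ofReal (-G i u)) A ≤ Fintype.card ι * ε := by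
      let W := ⋃ m, (U m \ K m)
      have hW : MeasurableSet W := .iUnion fun m => (hU m).measurableSet.diff (hK m).measurableSet
      rw [← measure_inter_add_sdiff A hW]
      have h2 : S.push (fun i u => ENNReal.ofReal (-G i u)) (A \ W) = 0 := by
        refine push_eq_zero (hA.diff hW) fun i u hu => ENNReal.ofReal_eq_zero.2 ?_
        rw [neg_nonpos]
        by_cases hp : ∃ m, S.param i u ∈ U m
        · obtain ⟨m, hm⟩ := hp
          have hKm : S.param i u ∈ K m := by
            by_contra hn
            exact hu.2.2 (mem_iUnion.2 ⟨m, hm, hn⟩)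
          rw [hGpos m i u ⟨hu.1, hKm⟩]
          exact hpos m i u ⟨hu.1, hKE m hKm⟩
        · push Not at hp
          exact (hcoeff0 i u hp).ge
      rw [h2, add_zero]
      calc S.push (fun i u => ENNReal.ofReal (-G i u)) (A ∩ W)
          ≤ oblMeas S (A ∩ W) := by
            refine push_mono (hA.inter hW) fun i u hu => ENNReal.ofReal_le_ofReal ?_
            refine (neg_le_abs _).trans ?_
            simp only [G, coeff_wedge]
            exact abs_obl_le_oblJac _ (comp_coframe_mem_unitForms hnorm _)
        _ ≤ oblMeas S W := measure_mono inter_subset_right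
        _ ≤ ∑ m, oblMeas S (U m \ K m) := by
            rw [← tsum_fintype (L := SummationFilter.unconditional ι)]; exact measure_iUnion_le _
        _ ≤ ∑ _m : ι, ε := Finset.sum_le_sum fun m _ => hUε m
        _ = _ := by simp
    have step3 : S.push (fun i u => ENNReal.ofReal (G i u)) A ≤
        obliqueMass (metric n) (contact n) (S.current A) + Fintype.card ι * ε := by
      have h2 := tsum_lintegral_le_ofReal (fun i => aestronglyMeasurable_coeff hw hA i)
        (tsum_coeff_ne_top hS hw A)
      rw [push_apply _ _ hA] at step2 ⊢
      refine h2.trans (add_le_add ?_ step2)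
      exact le_mass htest hnorm
    calc ∑ m, S.push (fun i u => ENNReal.ofReal (paramObl S (ζ m) i u)) (E m)
        ≤ ∑ m, (S.push (fun i u => ENNReal.ofReal (paramObl S (ζ m) i u)) (K m) + ε) := by
          refine Finset.sum_le_sum fun m _ => ?_
          rw [← measure_inter_add_sdiff (E m) (hK m).measurableSet]
          refine add_le_add (measure_mono inter_subset_right) ((le_trans ?_ (hKε m)))
          exact push_mono ((hE m).diff (hK m).measurableSet) fun i u _ =>
            ENNReal.ofReal_le_ofReal (obl_le_oblJac _ (hζ m))
      _ = (∑ m, S.push (fun i u => ENNReal.ofReal (paramObl S (ζ m) i u)) (K m)) +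
          Fintype.card ι * ε := by rw [Finset.sum_add_distrib]; simp
      _ ≤ obliqueMass (metric n) (contact n) (S.current A) + Fintype.card ι * ε +
          Fintype.card ι * ε := by gcongr; exact step1.trans step3
      _ = _ := by ring
  refine ENNReal.le_of_forall_pos_le_add fun δ hδ _ => ?_
  have hc : (2 * Fintype.card ι + 1 : ℝ≥0∞) ≠ 0 := by simp
  have hc' : (2 * Fintype.card ι + 1 : ℝ≥0∞) ≠ ⊤ := by finiteness
  -- Adding one to the denominator covers the case of an empty index type.
  refine (key (δ / (2 * Fintype.card ι + 1)) (ENNReal.div_pos (by positivity) hc').ne').trans ?_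
  gcongr
  calc (2 * Fintype.card ι : ℝ≥0∞) * (δ / (2 * Fintype.card ι + 1))
      ≤ (2 * Fintype.card ι + 1) * (δ / (2 * Fintype.card ι + 1)) := by gcongr; exact le_self_add
    _ ≤ δ := ENNReal.mul_div_le

end Heis

namespace Heis

open OrientedSubmanifold

variable {n k : ℕ} {S : OrientedSubmanifold (Heis n) (Heis n) (k + 1)}

/-- A dense sequence suffices by continuity. The zero form is put in front so that the largest of
the first values is never negative, as `sum_push_le_obliqueMass` requires. -/
lemma exists_seq_unitForms (n k : ℕ) : ∃ ζ : ℕ → Heis n [⋀^Fin k]→L[ℝ] ℝ,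
    ζ 0 = 0 ∧ (∀ m, ζ m ∈ unitForms n k) ∧
    ∀ X : Fin (k + 1) → Heis n,
      ENNReal.ofReal (oblJac X) ≤ ⨆ m, ENNReal.ofReal (obl X (ζ m)) := by
  have : Nonempty (unitForms n k) := ⟨⟨0, zero_mem_unitForms k⟩⟩
  have : TopologicalSpace.SeparableSpace (unitForms n k) :=
    (isCompact_unitForms n k).isSeparable.separableSpace
  let d : ℕ → unitForms n k := TopologicalSpace.denseSeq _
  let ζ : ℕ → Heis n [⋀^Fin k]→L[ℝ] ℝ := fun m => Nat.casesOn m 0 fun m => d m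
  refine ⟨ζ, rfl, fun m => ?_, fun X => ?_⟩
  · rcases m with _ | m
    · exact zero_mem_unitForms k
    · exact (d m).2
  · have hc : Continuous fun ζ => obl X ζ := (continuous_obl k).comp (Continuous.prodMk_right X)
    obtain ⟨ξ, hξ, hX⟩ : oblJac X ∈ (fun ζ => obl X ζ) '' unitForms n k :=
      ((isCompact_unitForms n k).image hc).sSup_mem (Set.Nonempty.image _ ⟨0, zero_mem_unitForms k⟩)
    rw [← hX]
    have hcl : IsClosed {y : unitForms n k | ENNReal.ofReal (obl X (y : Heis n [⋀^Fin k]→L[ℝ] ℝ)) ≤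
        ⨆ m, ENNReal.ofReal (obl X (ζ m))} :=
      isClosed_le (ENNReal.continuous_ofReal.comp (hc.comp continuous_subtype_val)) continuous_const
    have hr : range d ⊆ {y : unitForms n k |
        ENNReal.ofReal (obl X (y : Heis n [⋀^Fin k]→L[ℝ] ℝ)) ≤
        ⨆ m, ENNReal.ofReal (obl X (ζ m))} := by
      rintro _ ⟨m, rfl⟩
      exact le_iSup (fun m => ENNReal.ofReal (obl X (ζ m))) (m + 1)
    exact hcl.closure_subset_iff.2 hr (TopologicalSpace.denseRange_denseSeq _ ⟨ξ, hξ⟩)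

lemma measurable_piecewise_paramObl (ζ : Heis n [⋀^Fin k]→L[ℝ] ℝ) (i : ℕ) :
    Measurable ((S.dom i).indicator (paramObl S ζ i)) := by
  classical
  rw [← Set.piecewise_eq_indicator]
  exact (continuousOn_paramObl S ζ i).measurable_piecewise continuousOn_const
    (S.isOpen_dom i).measurableSet

lemma aemeasurable_paramObl (ζ : Heis n [⋀^Fin k]→L[ℝ] ℝ) {A : Set (Heis n)}
    (hA : MeasurableSet A) (i : ℕ) : AEMeasurable (paramObl S ζ i) (volume.restrict (S.part A i)) :=
  ((continuousOn_paramObl S ζ i).mono ((S.part_subset A i).trans (S.piece_subset i))).aemeasurable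
    (S.measurableSet_part hA i)

/-- Only `N` charts, the first `M + 1` forms and a ball of radius `M` are involved, so the measures
are finite. In each piece, divide the parameters according to the form with the largest value; the
images of these sets are disjoint, also across pieces, and `sum_push_le_obliqueMass` applies to
them. -/
lemma lintegral_iSup_paramObl_le (hS : S.CarriesCurrent) {A : Set (Heis n)} (hA : MeasurableSet A)
    {ζ : ℕ → Heis n [⋀^Fin k]→L[ℝ] ℝ} (hζ0 : ζ 0 = 0) (hζ : ∀ m, ζ m ∈ unitForms n k) (N M : ℕ) :
    ∑ i ∈ Finset.range N, ∫⁻ u in S.part (A ∩ Metric.closedBall 0 M) i,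
      ⨆ m : Fin (M + 1), ENNReal.ofReal (paramObl S (ζ m) i u) ≤
    obliqueMass (metric n) (contact n) (S.current A) := by
  classical
  set B := A ∩ Metric.closedBall (0 : Heis n) M
  have hB : MeasurableSet B := hA.inter Metric.isClosed_closedBall.measurableSet
  have hBfin : oblMeas S B ≠ ⊤ := ne_top_of_le_ne_top
    (oblMeas_lt_top hS (isCompact_closedBall (0 : Heis n) M)).ne (measure_mono inter_subset_right)
  let D : ℕ → Fin (M + 1) → Set (Fin (k + 1) → ℝ) := fun i m => S.part B i ∩
    ⋂ m' : Fin (M + 1), {u | (S.dom i).indicator (paramObl S (ζ m') i) u ≤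
      (S.dom i).indicator (paramObl S (ζ m) i) u}
  have hD : ∀ i m, MeasurableSet (D i m) := fun i m => (S.measurableSet_part hB i).inter
    (.iInter fun m' => measurableSet_le (measurable_piecewise_paramObl _ _)
      (measurable_piecewise_paramObl _ _))
  have hDle : ∀ i m, ∀ u ∈ D i m, ∀ m' : Fin (M + 1),
      paramObl S (ζ m') i u ≤ paramObl S (ζ m) i u := by
    intro i m u hu m'
    have h1 := mem_iInter.1 hu.2 m'
    have h2 : u ∈ S.dom i := S.piece_subset i (S.part_subset B i hu.1)
    simpa only [mem_ofPred_eq, indicator_of_mem h2] using h1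
  have hDcov : ∀ i, S.part B i ⊆ ⋃ m, D i m := by
    intro i u hu
    obtain ⟨m, hm⟩ := Finite.exists_max fun m : Fin (M + 1) => paramObl S (ζ m) i u
    have h2 : u ∈ S.dom i := S.piece_subset i (S.part_subset B i hu)
    refine mem_iUnion.2 ⟨m, hu, mem_iInter.2 fun m' => ?_⟩
    simpa only [mem_ofPred_eq, indicator_of_mem h2] using hm m'
  let F : ℕ → Fin (M + 1) → Set (Fin (k + 1) → ℝ) := fun i => disjointed (D i)
  have hF : ∀ i m, MeasurableSet (F i m) := fun i m =>
    disjointedRec (fun _ _ ht => MeasurableSet.diff ht (hD i _)) (hD i m)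
  have hFD : ∀ i m, F i m ⊆ D i m := fun i m => disjointed_subset _ _
  have hFp : ∀ i m, F i m ⊆ S.piece i := fun i m =>
    (hFD i m).trans (inter_subset_left.trans (S.part_subset B i))
  let E : Fin N × Fin (M + 1) → Set (Heis n) := fun x => S.param x.1 '' F x.1 x.2
  have hmem : ∀ x j u, u ∈ S.piece j → S.param j u ∈ E x → (x.1 : ℕ) = j ∧ u ∈ F j x.2 := by
    rintro ⟨i, m⟩ j u hu ⟨v, hv, hvu⟩
    have hij := eq_of_mem_piece (hFp _ _ hv) hu hvu
    dsimp only at hij hv hvu ⊢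
    refine ⟨hij, ?_⟩
    rw [hij] at hv hvu
    rwa [← S.injOn_param j (S.piece_subset j (hFp _ _ hv)) (S.piece_subset j hu) hvu]
  have hEm : ∀ x, MeasurableSet (E x) := fun x =>
    measurableSet_image (hF _ _) ((hFp _ _).trans (S.piece_subset _))
  have hEB : ∀ x, E x ⊆ B := by
    rintro x _ ⟨u, hu, rfl⟩
    exact (hFD _ _ hu).1.2
  have hmain := sum_push_le_obliqueMass hS hA (ζ := fun x : Fin N × Fin (M + 1) => ζ x.2) (E := E)
    (fun x => hζ _) hEm (fun x => (hEB x).trans inter_subset_left)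
    (fun x => ne_top_of_le_ne_top hBfin (measure_mono (hEB x))) ?_ ?_
  · refine le_trans ?_ hmain
    rw [Finset.sum_range, Fintype.sum_prod_type]
    refine Finset.sum_le_sum fun i _ => ?_
    have hcov : S.part B i ⊆ ⋃ m, F i m := by rw [iUnion_disjointed]; exact hDcov i
    refine (lintegral_mono_set hcov).trans ((lintegral_iUnion_le _ _).trans ?_)
    rw [tsum_fintype]
    refine Finset.sum_le_sum fun m _ => ?_
    rw [push_apply _ _ (hEm _)]
    refine le_trans ?_ (ENNReal.le_tsum (i : ℕ))
    refine (setLIntegral_mono' (hF i m) fun u hu =>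
      iSup_le fun m' => ENNReal.ofReal_le_ofReal (hDle i m u (hFD i m hu) m')).trans ?_
    exact lintegral_mono_set fun u hu => ⟨hFp _ _ hu, u, hu, rfl⟩
  · rintro x y hxy
    refine Set.disjoint_left.2 fun p hp hq => ?_
    obtain ⟨u, hu, rfl⟩ := hp
    obtain ⟨h1, h2⟩ := hmem y _ u (hFp _ _ hu) hq
    have h12 : y.1 = x.1 := Fin.ext h1
    have hne : x.2 ≠ y.2 := fun h => hxy (Prod.ext h12.symm h)
    exact (disjoint_disjointed (D x.1) hne).le_bot ⟨hu, h2⟩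
  · intro x j u hu
    obtain ⟨h1, h2⟩ := hmem x j u hu.1 hu.2
    have h3 := hDle j x.2 u (hFD _ _ h2) 0
    rw [Fin.val_zero, hζ0] at h3
    have h4 := obl_smul (fun j' => trivTangent S j u (Pi.single j' 1)) 0
      (0 : Heis n [⋀^Fin k]→L[ℝ] ℝ)
    rw [zero_smul, zero_mul] at h4
    exact h4.symm.le.trans h3

/-- The oblique mass is the integral of the oblique Jacobian. -/
theorem obliqueMass_eq_oblMeas (hS : S.CarriesCurrent) {A : Set (Heis n)} (hA : MeasurableSet A) :
    obliqueMass (metric n) (contact n) (S.current A) = oblMeas S A := by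
  refine le_antisymm (obliqueMass_le_oblMeas hS hA) ?_
  obtain ⟨ζ, hζ0, hζ, hsup⟩ := exists_seq_unitForms n k
  rw [oblMeas, push_apply _ _ hA, ENNReal.tsum_eq_iSup_nat]
  refine iSup_le fun N => ?_
  let C : ℕ → ℕ → Set (Fin (k + 1) → ℝ) := fun i M => S.part (A ∩ Metric.closedBall 0 M) i
  have hC : ∀ i M, MeasurableSet (C i M) := fun i M =>
    S.measurableSet_part (hA.inter Metric.isClosed_closedBall.measurableSet) i
  -- The same index `M` bounds the number of forms and the radius, so `H i` increases with `M` and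
  -- its supremum dominates the Jacobian; the conclusion is by monotone convergence.
  let H : ℕ → ℕ → (Fin (k + 1) → ℝ) → ℝ≥0∞ := fun i M u =>
    (C i M).indicator (fun u => ⨆ m : Fin (M + 1), ENNReal.ofReal (paramObl S (ζ m) i u)) u
  have hmono : ∀ i u, Monotone fun M => H i M u := by
    intro i u M M' hM
    dsimp only [H]
    by_cases hu : u ∈ C i M
    · have hu' : u ∈ C i M' := ⟨hu.1, hu.2.1, Metric.closedBall_subset_closedBall
        (Nat.cast_le.2 hM) hu.2.2⟩
      rw [indicator_of_mem hu, indicator_of_mem hu']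
      exact iSup_le fun m => le_iSup_of_le (⟨m, by omega⟩ : Fin (M' + 1)) le_rfl
    · rw [indicator_of_notMem hu]
      exact zero_le
  have hle : ∀ i, ∀ u ∈ S.part A i, ENNReal.ofReal (jac S i u) ≤ ⨆ M, H i M u := by
    intro i u hu
    refine (hsup _).trans (iSup_le fun m => ?_)
    obtain ⟨M, hM⟩ := exists_nat_ge (max (m : ℝ) ‖S.param i u‖)
    have hM1 : m ≤ M := Nat.cast_le.1 ((le_max_left _ _).trans hM)
    have hM2 : u ∈ C i M := ⟨hu.1, hu.2, mem_closedBall_zero_iff.2 ((le_max_right _ _).trans hM)⟩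
    refine le_iSup_of_le M ?_
    dsimp only [H]
    rw [indicator_of_mem hM2]
    exact le_iSup_of_le (⟨m, by omega⟩ : Fin (M + 1)) le_rfl
  have hmeas : ∀ i M, AEMeasurable (H i M) (volume.restrict (S.part A i)) := fun i M =>
    (AEMeasurable.iSup fun m : Fin (M + 1) =>
      (aemeasurable_paramObl (ζ m) hA i).ennreal_ofReal).indicator (hC i M)
  calc ∑ i ∈ Finset.range N, ∫⁻ u in S.part A i, ENNReal.ofReal (jac S i u)
      ≤ ∑ i ∈ Finset.range N, ∫⁻ u in S.part A i, ⨆ M, H i M u := Finset.sum_le_sum fun i _ =>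
        setLIntegral_mono' (S.measurableSet_part hA i) (hle i)
    _ = ∑ i ∈ Finset.range N, ⨆ M, ∫⁻ u in S.part A i, H i M u := Finset.sum_congr rfl fun i _ =>
        lintegral_iSup' (hmeas i) (Eventually.of_forall fun u => hmono i u)
    _ = ⨆ M, ∑ i ∈ Finset.range N, ∫⁻ u in S.part A i, H i M u :=
        ENNReal.finsetSum_iSup_of_monotone fun i M M' h => lintegral_mono fun u => hmono i u h
    _ ≤ obliqueMass (metric n) (contact n) (S.current A) := iSup_le fun M => by
        refine le_trans (Finset.sum_le_sum fun i _ => ?_) (lintegral_iSup_paramObl_le hS hA hζ0 hζ N M)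
        dsimp only [H]
        rw [lintegral_indicator (hC i M), Measure.restrict_restrict (hC i M)]
        exact lintegral_mono_set inter_subset_left

end Heis

/-! ### Spherical measures -/

section Spherical

variable {X : Type*}

/-- The size of a set in terms of the balls of radius at most `δ` that contain it. -/
def spherePre (d : X → X → ℝ≥0∞) (s : ℕ) (δ : ℝ≥0) (A : Set X) : ℝ≥0∞ :=
  ⨅ (p : X) (r : ℝ≥0) (_ : r ≤ δ) (_ : A ⊆ {q | d p q ≤ r}), (2 * (r : ℝ≥0∞)) ^ s

/-- The spherical premeasure at scale `δ`. -/
def sphereDelta (d : X → X → ℝ≥0∞) (s : ℕ) (δ : ℝ≥0) : OuterMeasure X :=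
  OuterMeasure.boundedBy (spherePre d s δ)

lemma sphericalOuter_eq (d : X → X → ℝ≥0∞) (s : ℕ) (A : Set X) :
    sphericalOuter d s A = ⨆ (δ : ℝ≥0) (_ : 0 < δ), sphereDelta d s δ A := by
  simp only [sphericalOuter, OuterMeasure.iSup_apply]
  rfl

lemma sphereDelta_anti (d : X → X → ℝ≥0∞) (s : ℕ) {δ δ' : ℝ≥0} (h : δ ≤ δ') (A : Set X) :
    sphereDelta d s δ' A ≤ sphereDelta d s δ A := by
  have : sphereDelta d s δ' ≤ sphereDelta d s δ := by
    refine OuterMeasure.le_boundedBy.2 fun B => (OuterMeasure.boundedBy_le B).trans ?_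
    exact le_iInf fun p => le_iInf fun r => le_iInf fun hr => le_iInf fun hB =>
      iInf_le_of_le p (iInf_le_of_le r (iInf_le_of_le (hr.trans h) (iInf_le_of_le hB le_rfl)))
  exact this A

lemma sphereDelta_le_sphericalOuter (d : X → X → ℝ≥0∞) (s : ℕ) {δ : ℝ≥0} (hδ : 0 < δ)
    (A : Set X) : sphereDelta d s δ A ≤ sphericalOuter d s A := by
  rw [sphericalOuter_eq]
  exact le_iSup₂_of_le δ hδ le_rfl

lemma sphereDelta_le_of_subset_ball {d : X → X → ℝ≥0∞} {s : ℕ} {δ r : ℝ≥0} (hr : r ≤ δ) {p : X}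
    {A : Set X} (hA : A ⊆ {q | d p q ≤ r}) : sphereDelta d s δ A ≤ (2 * (r : ℝ≥0∞)) ^ s :=
  (OuterMeasure.boundedBy_le A).trans
    (iInf_le_of_le p (iInf_le_of_le r (iInf_le_of_le hr (iInf_le_of_le hA le_rfl))))

/-- A measure which is controlled on small balls is controlled by the spherical measure. -/
lemma le_mul_sphericalOuter {d : X → X → ℝ≥0∞} {s : ℕ} {ν : OuterMeasure X} {c : ℝ≥0∞}
    (hc0 : c ≠ 0) (hc : c ≠ ⊤) {δ : ℝ≥0} (hδ : 0 < δ)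
    (h : ∀ (p : X) (r : ℝ≥0), r ≤ δ → ν {q | d p q ≤ r} ≤ c * (2 * (r : ℝ≥0∞)) ^ s) (A : Set X) :
    ν A ≤ c * sphericalOuter d s A := by
  have h1 : ν ≤ c • sphereDelta d s δ := by
    rw [sphereDelta, OuterMeasure.smul_boundedBy hc]
    refine OuterMeasure.le_boundedBy.2 fun B => ?_
    rw [Pi.smul_apply, smul_eq_mul, ← ENNReal.div_le_iff' hc0 hc]
    refine le_iInf fun p => le_iInf fun r => le_iInf fun hr => le_iInf fun hB => ?_
    exact ENNReal.div_le_of_le_mul' ((measure_mono hB).trans (h p r hr))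
  refine (h1 A).trans ?_
  exact mul_le_mul_right (sphereDelta_le_sphericalOuter d s hδ A) c

/-- A ball of small radius cannot meet both of two sets at positive distance, so for small `δ` the
premeasure is infinite on sets meeting both, and the outer measure is additive on them. -/
lemma isMetric_sphericalOuter (X : Type*) [MetricSpace X] (s : ℕ) :
    (sphericalOuter (fun p q : X => edist p q) s).IsMetric := by
  rintro A B ⟨ε, hε, hAB⟩
  refine le_antisymm (measure_union_le _ _) ?_
  have key : ∀ δ₁ : ℝ≥0, 0 < δ₁ → ∀ δ₂ : ℝ≥0, 0 < δ₂ →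
      sphereDelta (fun p q : X => edist p q) s δ₁ A + sphereDelta (fun p q : X => edist p q) s δ₂ B ≤
      sphericalOuter (fun p q : X => edist p q) s (A ∪ B) := by
    intro δ₁ h₁ δ₂ h₂
    obtain ⟨η, hη, hηε⟩ : ∃ η : ℝ≥0, 0 < η ∧ (η : ℝ≥0∞) + η < ε := by
      obtain ⟨η, hη, hηε⟩ := ENNReal.lt_iff_exists_nnreal_btwn.1 (ENNReal.half_pos hε)
      refine ⟨η, ENNReal.coe_pos.1 hη, ?_⟩
      rw [← ENNReal.add_halves ε]
      exact ENNReal.add_lt_add hηε hηε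
    have h3 : 0 < min η (min δ₁ δ₂) := by positivity
    refine (add_le_add (sphereDelta_anti _ s ((min_le_right η _).trans (min_le_left δ₁ δ₂)) A)
      (sphereDelta_anti _ s ((min_le_right η _).trans (min_le_right δ₁ δ₂)) B)).trans ?_
    refine le_trans ?_ (sphereDelta_le_sphericalOuter _ s h3 _)
    refine (OuterMeasure.boundedBy_union_of_top_of_nonempty_inter ?_).ge
    rintro U ⟨a, haA, haU⟩ ⟨b, hbB, hbU⟩
    refine iInf_eq_top.2 fun p => iInf_eq_top.2 fun r => iInf_eq_top.2 fun hr =>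
      iInf_eq_top.2 fun hU => ?_
    exfalso
    have ha : edist p a ≤ r := hU haU
    have hb : edist p b ≤ r := hU hbU
    have hrη : (r : ℝ≥0∞) ≤ η := ENNReal.coe_le_coe.2 (hr.trans (min_le_left _ _))
    refine absurd (hAB a haA b hbB) (not_le.2 ?_)
    calc edist a b ≤ edist a p + edist p b := edist_triangle _ _ _
      _ ≤ η + η := by rw [edist_comm a p]; exact add_le_add (ha.trans hrη) (hb.trans hrη)
      _ < ε := hηε
  rw [sphericalOuter_eq _ s A, sphericalOuter_eq _ s B]
  exact ENNReal.biSup_add_biSup_le' ⟨1, one_pos⟩ ⟨1, one_pos⟩ key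

/-- Lower bound of a measure by the spherical measure, by Vitali's covering theorem. -/
lemma mul_sphericalOuter_le {X : Type*} [MetricSpace X] [SecondCountableTopology X]
    [MeasurableSpace X] [BorelSpace X] (μ : Measure X) [IsFiniteMeasure μ] {s : ℕ} {A : Set X}
    {c C : ℝ≥0∞} (hc0 : c ≠ 0) (hc : c ≠ ⊤) (hC : C ≠ ⊤) {R : ℝ} (hR : 0 ≤ R)
    (h1 : ∀ x ∈ A, ∃ δ > 0, ∀ r ∈ Ioo 0 δ, ∃ q, dist x q ≤ R * r ∧
      c * (2 * ENNReal.ofReal r) ^ s ≤ μ (Metric.closedBall q r))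
    (h2 : ∃ δ > 0, ∀ x ∈ A, ∀ r ∈ Ioo 0 δ, μ (Metric.closedBall x r) ≤ C * ENNReal.ofReal r ^ s)
    (h3 : ∀ B ⊆ A, μ B = 0 → sphericalOuter (fun p q : X => edist p q) s B = 0) :
    c * sphericalOuter (fun p q : X => edist p q) s A ≤ μ A := by
  set d := fun p q : X => edist p q with hd
  refine ENNReal.le_of_forall_pos_le_add fun ε hε _ => ?_
  obtain ⟨U, hAU, hU, hUε⟩ := A.exists_isOpen_le_add μ (ENNReal.coe_ne_zero.2 hε.ne')
  refine le_trans ?_ hUε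
  obtain ⟨δ₀, hδ₀, h2⟩ := h2
  have key : ∀ δ : ℝ≥0, 0 < δ → c * sphereDelta d s δ A ≤ μ U := by
    intro δ hδ
    -- A triple consists of a point `x` of `A`, the center `q` of a ball with large measure, and its
    -- radius `r`. The point `x` need not be in this ball, but the ball about `x` of radius `(R + 1)
    -- * r` contains it.
    let t : Set (X × X × ℝ) := {a | a.1 ∈ A ∧ 0 < a.2.2 ∧ a.2.2 ≤ δ ∧ 3 * ((R + 1) * a.2.2) < δ₀ ∧
      dist a.1 a.2.1 ≤ R * a.2.2 ∧
      c * (2 * ENNReal.ofReal a.2.2) ^ s ≤ μ (Metric.closedBall a.2.1 a.2.2) ∧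
      Metric.closedBall a.1 ((R + 1) * a.2.2) ⊆ U}
    -- The ratio required by Vitali's theorem: the ball about `x` enlarged three times, of radius `3
    -- (R + 1) r`, against the ball about `q` of radius `r`.
    let D : ℝ≥0∞ := C * ENNReal.ofReal (3 * (R + 1)) ^ s / (c * 2 ^ s)
    have hc2 : c * 2 ^ s ≠ 0 := mul_ne_zero hc0 (pow_ne_zero _ two_ne_zero)
    have hc2' : c * 2 ^ s ≠ ⊤ := by finiteness
    have hD : D ≠ ⊤ := ENNReal.div_ne_top (by finiteness) hc2
    have hsub : ∀ a ∈ t, Metric.closedBall a.2.1 a.2.2 ⊆ Metric.closedBall a.1 ((R + 1) * a.2.2) := by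
      rintro a ⟨-, -, -, -, h, -, -⟩
      refine Metric.closedBall_subset_closedBall' ?_
      rw [dist_comm]
      linarith
    obtain ⟨u, hut, huc, hud, hμ⟩ := Vitali.exists_disjoint_covering_ae μ A t D.toNNReal
      (fun a => (R + 1) * a.2.2) (fun a => a.1) (fun a => Metric.closedBall a.2.1 a.2.2) hsub
      (by
        rintro a ⟨haA, har, -, hal, -, hac, -⟩
        refine (h2 a.1 haA _ ⟨by positivity, hal⟩).trans ?_
        rw [ENNReal.coe_toNNReal hD]
        calc C * ENNReal.ofReal (3 * ((R + 1) * a.2.2)) ^ s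
            = C * ENNReal.ofReal (3 * (R + 1)) ^ s * ENNReal.ofReal a.2.2 ^ s := by
              rw [← mul_assoc, ENNReal.ofReal_mul (by positivity), mul_pow, mul_assoc]
          _ = D * (c * 2 ^ s) * ENNReal.ofReal a.2.2 ^ s := by
              rw [ENNReal.div_mul_cancel hc2 hc2']
          _ = D * (c * (2 * ENNReal.ofReal a.2.2) ^ s) := by rw [mul_pow]; ring
          _ ≤ _ := by gcongr)
      (by
        rintro a ⟨-, har, -⟩
        exact ⟨a.2.1, interior_mono Metric.ball_subset_closedBall
          (by rw [Metric.isOpen_ball.interior_eq]; exact Metric.mem_ball_self har)⟩)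
      (fun a _ => Metric.isClosed_closedBall)
      (by
        intro x hx ε' hε'
        obtain ⟨δ₁, hδ₁, hx1⟩ := h1 x hx
        obtain ⟨ρ, hρ, hρU⟩ := Metric.isOpen_iff.1 hU x (hAU hx)
        have hR1 : 0 < R + 1 := by linarith
        obtain ⟨r, hr, hr'⟩ := exists_between (show (0 : ℝ) < min (min δ₁ δ) (min (ρ / (R + 1))
          (min (ε' / (R + 1)) (δ₀ / (3 * (R + 1))))) by positivity)
        simp only [lt_min_iff] at hr'
        obtain ⟨⟨hr1, hr2⟩, hr3, hr4, hr5⟩ := hr'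
        rw [lt_div_iff₀ (by positivity)] at hr3 hr4 hr5
        obtain ⟨q, hq, hq'⟩ := hx1 r ⟨hr, hr1⟩
        refine ⟨(x, q, r), ⟨hx, hr, hr2.le, by linarith, hq, hq', ?_⟩, by
          dsimp only; linarith, rfl⟩
        exact (Metric.closedBall_subset_ball (by dsimp only; linarith)).trans hρU)
    have hcov : A ⊆ (⋃ a ∈ u, Metric.closedBall a.2.1 a.2.2) ∪
        (A \ ⋃ a ∈ u, Metric.closedBall a.2.1 a.2.2) := fun x hx => by
      by_cases h : x ∈ ⋃ a ∈ u, Metric.closedBall a.2.1 a.2.2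
      · exact Or.inl h
      · exact Or.inr ⟨hx, h⟩
    -- What the disjoint balls miss is null for `μ`, and `h3` makes it null for the spherical
    -- measure.
    have hnull : sphereDelta d s δ (A \ ⋃ a ∈ u, Metric.closedBall a.2.1 a.2.2) = 0 :=
      le_antisymm ((sphereDelta_le_sphericalOuter d s hδ _).trans (h3 _ sdiff_subset hμ).le) bot_le
    have hball : ∀ a ∈ t, sphereDelta d s δ (Metric.closedBall a.2.1 a.2.2) ≤
        (2 * ENNReal.ofReal a.2.2) ^ s := by
      rintro a ⟨-, har, har', -⟩
      refine sphereDelta_le_of_subset_ball (r := a.2.2.toNNReal) (p := a.2.1)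
        (Real.toNNReal_le_iff_le_coe.2 har') fun q hq => ?_
      rw [Metric.mem_closedBall, dist_comm] at hq
      show edist a.2.1 q ≤ ENNReal.ofReal a.2.2
      rw [edist_dist]
      exact ENNReal.ofReal_le_ofReal hq
    have : Countable u := huc
    calc c * sphereDelta d s δ A
        ≤ c * (sphereDelta d s δ (⋃ a ∈ u, Metric.closedBall a.2.1 a.2.2) + 0) := by
          rw [← hnull]
          gcongr
          exact (measure_mono hcov).trans (measure_union_le _ _)
      _ ≤ c * ∑' a : u, (2 * ENNReal.ofReal (a : X × X × ℝ).2.2) ^ s := by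
          rw [add_zero]
          gcongr
          exact (measure_biUnion_le _ huc _).trans (ENNReal.tsum_le_tsum fun a => hball a (hut a.2))
      _ = ∑' a : u, c * (2 * ENNReal.ofReal (a : X × X × ℝ).2.2) ^ s := ENNReal.tsum_mul_left.symm
      _ ≤ ∑' a : u, μ (Metric.closedBall (a : X × X × ℝ).2.1 (a : X × X × ℝ).2.2) :=
          ENNReal.tsum_le_tsum fun a => (hut a.2).2.2.2.2.2.1
      _ = μ (⋃ a ∈ u, Metric.closedBall a.2.1 a.2.2) :=
          (measure_biUnion huc hud fun a _ => Metric.isClosed_closedBall.measurableSet).symm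
      _ ≤ μ U := measure_mono (iUnion₂_subset fun a ha => (hsub a (hut ha)).trans
          (hut ha).2.2.2.2.2.2)
  rw [sphericalOuter_eq, ENNReal.mul_iSup]
  refine iSup_le fun δ => ?_
  rw [ENNReal.mul_iSup]
  exact iSup_le fun hδ => key δ hδ

/-- Local-to-global principle for inequalities between set functions. -/
lemma le_of_locally_le {X : Type*} [TopologicalSpace X] [SecondCountableTopology X]
    [MeasurableSpace X] [OpensMeasurableSpace X] {μ σ : Set X → ℝ≥0∞} {s : Set X}
    (hμ0 : μ ∅ = 0) (hμ : ∀ D : ℕ → Set X, μ (⋃ j, D j) ≤ ∑' j, μ (D j))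
    (hσ : ∀ D : ℕ → Set X, (∀ j, MeasurableSet (D j)) → (∀ j, D j ⊆ s) →
      Pairwise (Function.onFun Disjoint D) → ∑' j, σ (D j) ≤ σ (⋃ j, D j))
    (hloc : ∀ x ∈ s, ∃ U ∈ 𝓝 x, ∀ D, MeasurableSet D → D ⊆ U ∩ s → μ D ≤ σ D)
    {A : Set X} (hA : MeasurableSet A) (hAs : A ⊆ s) : μ A ≤ σ A := by
  choose! U hU hUle using hloc
  obtain ⟨t, hts, htc, htU⟩ := TopologicalSpace.countable_cover_nhdsWithin
    (f := fun x => interior (U x)) (s := s)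
    fun x hx => mem_nhdsWithin_of_mem_nhds (interior_mem_nhds.2 (hU x hx))
  rcases t.eq_empty_or_nonempty with rfl | hne
  · have : s = ∅ := by simpa using htU
    have hA0 : A = ∅ := subset_empty_iff.1 (this ▸ hAs)
    subst hA0
    exact hμ0.le.trans bot_le
  · obtain ⟨x, hx⟩ := htc.exists_eq_range hne
    let F : ℕ → Set X := fun j => A ∩ interior (U (x j))
    have hFm : ∀ j, MeasurableSet (F j) := fun j => hA.inter isOpen_interior.measurableSet
    have hcov : A = ⋃ j, disjointed F j := by
      rw [iUnion_disjointed, ← inter_iUnion]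
      refine (inter_eq_left.2 fun a ha => ?_).symm
      have := htU (hAs ha)
      rw [hx, biUnion_range] at this
      exact this
    have hsub : ∀ j, disjointed F j ⊆ F j := fun j => disjointed_subset _ _
    have hxs : ∀ j, x j ∈ s := fun j => hts (hx ▸ mem_range_self j)
    calc μ A = μ (⋃ j, disjointed F j) := by rw [← hcov]
      _ ≤ ∑' j, μ (disjointed F j) := hμ _
      _ ≤ ∑' j, σ (disjointed F j) := ENNReal.tsum_le_tsum fun j =>
          hUle _ (hxs j) _ (MeasurableSet.disjointed hFm j) fun a ha =>
            ⟨interior_subset (hsub j ha).2, hAs (hsub j ha).1⟩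
      _ ≤ σ (⋃ j, disjointed F j) := hσ _ (fun j => MeasurableSet.disjointed hFm j)
          (fun j => (hsub j).trans (inter_subset_left.trans hAs)) (disjoint_disjointed F)
      _ = σ A := by rw [← hcov]

end Spherical

namespace Heis

open OrientedSubmanifold

variable {n k : ℕ}

/-! ### Spherical measures of parametrized sets -/

/-- The left-invariant distance function of a homogeneous norm. -/
def homDist (N : Heis n → ℝ) (p q : Heis n) : ℝ≥0∞ := ENNReal.ofReal (N (mul (inv p) q))

lemma inv_mul_snd (p q : Heis n) : (mul (inv p) q).2.2 = contact n p (q - p) := by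
  rw [mul_snd, inv_snd, symp_inv_left, contact_eq]
  have : symp p (q - p) = symp p q := by
    rw [sub_eq_add_neg, symp_add_right, symp_neg_right, symp_self]; ring
  rw [this, Prod.snd_sub, Prod.snd_sub]
  ring

lemma hor_inv_mul (p q : Heis n) : hor n (mul (inv p) q) = hor n q - hor n p := by
  rw [hor_mul, hor_inv]; abel

/-- The set lies in a box about `p` of horizontal size `L τ` and vertical size `η τ`. Balls of
radius comparable to `τ` have vertical size `τ ^ 2`, so about `2 η / τ + 5` of them, stacked
vertically, cover it. Each costs a multiple of `τ ^ (k + 2)`, and the total is a multiple of `(2 η +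
5 τ) τ ^ (k + 1)`. -/
lemma IsHomNorm.exists_sphereDelta_le {N : Heis n → ℝ} (hN : IsHomNorm N) (k : ℕ) :
    ∃ C : ℝ, 0 < C ∧ ∀ (L η τ : ℝ) (δ : ℝ≥0) (p : Heis n) (A : Set (Heis n)), 0 ≤ L → 0 ≤ η →
      0 < τ → C * (L + 1) * τ ≤ δ →
      (∀ q ∈ A, ‖hor n q - hor n p‖ ≤ L * τ ∧ |contact n p (q - p)| ≤ η * τ) →
      sphereDelta (homDist N) (k + 2) δ A ≤
        ENNReal.ofReal ((2 * η + 5 * τ) * (2 * (C * (L + 1))) ^ (k + 2)) *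
          ENNReal.ofReal τ ^ (k + 1) := by
  obtain ⟨C, hC, hb⟩ := hN.bound
  refine ⟨C, hC, fun L η τ δ p A hL hη hτ hδ hA => ?_⟩
  set r : ℝ := C * (L + 1) * τ with hr
  have hr0 : 0 < r := by positivity
  -- One more than the ratio, because the integer part of a negative height may fall below it by
  -- almost one.
  let m : ℕ := ⌈η / τ⌉₊ + 1
  let B : ℤ → Set (Heis n) := fun j => {q | homDist N (mul p (lift 0 (j * τ ^ 2))) q ≤ r.toNNReal}
  have hcov : A ⊆ ⋃ j ∈ Finset.Icc (-(m : ℤ)) m, B j := by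
    intro q hq
    obtain ⟨h1, h2⟩ := hA q hq
    set t := contact n p (q - p) with ht
    let j : ℤ := ⌊t / τ ^ 2⌋
    have hj1 : (j : ℝ) * τ ^ 2 ≤ t := by
      rw [← le_div_iff₀ (by positivity)]; exact Int.floor_le _
    have hj2 : t < (j + 1) * τ ^ 2 := by
      rw [← div_lt_iff₀ (by positivity)]; exact Int.lt_floor_add_one _
    have hcz : mul (inv (mul p (lift 0 (j * τ ^ 2)))) q =
        mul (inv (lift 0 (j * τ ^ 2))) (mul (inv p) q) := by rw [inv_mul, mul_assoc']
    have hz : symp (inv (lift (0 : Hor n) (j * τ ^ 2))) (mul (inv p) q) = 0 := by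
      have := abs_symp_le_norm (inv (lift (0 : Hor n) (j * τ ^ 2))) (mul (inv p) q)
      simpa using this
    have hB : q ∈ B j := by
      show ENNReal.ofReal _ ≤ ENNReal.ofReal r
      refine ENNReal.ofReal_le_ofReal ?_
      rw [hcz]
      refine (hb _).2.2.trans ?_
      rw [sqrt_zsq, hor_mul, hor_inv, hor_lift, neg_zero, zero_add, hor_inv_mul, mul_snd, hz,
        inv_snd, lift_snd, inv_mul_snd, ← ht]
      have h3 : Real.sqrt |-(j * τ ^ 2) + t + 1 / 2 * 0| ≤ τ := by
        rw [Real.sqrt_le_left hτ.le, abs_le]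
        constructor <;> nlinarith
      rw [hr]
      nlinarith
    refine mem_iUnion₂.2 ⟨j, ?_, hB⟩
    rw [Finset.mem_Icc]
    have h4 : |t| / τ ^ 2 ≤ η / τ := by
      rw [div_le_div_iff₀ (by positivity) hτ]
      nlinarith
    have h5 : η / τ ≤ ⌈η / τ⌉₊ := Nat.le_ceil _
    have h6 : t / τ ^ 2 ≤ |t| / τ ^ 2 := by gcongr; exact le_abs_self t
    have h7 : -(|t| / τ ^ 2) ≤ t / τ ^ 2 := by
      rw [← neg_div]; gcongr; exact neg_abs_le t
    have h8 : (j : ℝ) ≤ t / τ ^ 2 := Int.floor_le _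
    have h9 : t / τ ^ 2 < j + 1 := Int.lt_floor_add_one _
    constructor
    · have : -(m : ℝ) ≤ (j : ℝ) := by simp only [m]; push_cast; linarith
      exact_mod_cast this
    · have : (j : ℝ) ≤ (m : ℝ) := by simp only [m]; push_cast; linarith
      exact_mod_cast this
  have hball : ∀ j, sphereDelta (homDist N) (k + 2) δ (B j) ≤
      (2 * ENNReal.ofReal r) ^ (k + 2) := fun j =>
    sphereDelta_le_of_subset_ball (r := r.toNNReal) (Real.toNNReal_le_iff_le_coe.2 hδ) Subset.rfl
  have hcard : ((Finset.Icc (-(m : ℤ)) m).card : ℝ) ≤ (2 * η + 5 * τ) / τ := by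
    have h1 : ((Finset.Icc (-(m : ℤ)) m).card : ℝ) = 2 * m + 1 := by
      have : ((Finset.Icc (-(m : ℤ)) m).card : ℤ) = 2 * m + 1 := by
        rw [Int.card_Icc]; omega
      exact_mod_cast this
    have h2 : (⌈η / τ⌉₊ : ℝ) < η / τ + 1 := Nat.ceil_lt_add_one (by positivity)
    rw [h1]
    have h3 : (2 * η + 5 * τ) / τ = 2 * (η / τ) + 5 := by field_simp
    rw [h3]
    simp only [m]
    push_cast
    linarith
  calc sphereDelta (homDist N) (k + 2) δ A
      ≤ ∑ j ∈ Finset.Icc (-(m : ℤ)) m, sphereDelta (homDist N) (k + 2) δ (B j) :=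
        (measure_mono hcov).trans (measure_biUnion_finset_le _ _)
    _ ≤ ∑ j ∈ Finset.Icc (-(m : ℤ)) m, (2 * ENNReal.ofReal r) ^ (k + 2) :=
        Finset.sum_le_sum fun j _ => hball j
    _ = ENNReal.ofReal ((Finset.Icc (-(m : ℤ)) m).card * (2 * r) ^ (k + 2)) := by
        have e : (2 * ENNReal.ofReal r) = ENNReal.ofReal (2 * r) := by
          rw [ENNReal.ofReal_mul zero_le_two, ENNReal.ofReal_ofNat]
        rw [Finset.sum_const, nsmul_eq_mul, ENNReal.ofReal_mul (Nat.cast_nonneg _),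
          ENNReal.ofReal_natCast, e, ENNReal.ofReal_pow (by positivity)]
    _ ≤ ENNReal.ofReal ((2 * η + 5 * τ) / τ * (2 * r) ^ (k + 2)) := by gcongr
    _ = ENNReal.ofReal ((2 * η + 5 * τ) * (2 * (C * (L + 1))) ^ (k + 2) * τ ^ (k + 1)) := by
        congr 1
        rw [show 2 * r = 2 * (C * (L + 1)) * τ by rw [hr]; ring, mul_pow, pow_succ τ (k + 1)]
        field_simp
    _ = _ := by
        rw [ENNReal.ofReal_mul (by positivity), ENNReal.ofReal_pow hτ.le]

/-- The spherical measure of a set parametrized by a Lipschitz map is controlled by the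
Lebesgue measure, and the constant is small when the map is almost horizontal. -/
lemma IsHomNorm.exists_sphericalOuter_image_le {N : Heis n → ℝ} (hN : IsHomNorm N) (k : ℕ) :
    ∃ C : ℝ, 0 < C ∧ ∀ (f : (Fin (k + 1) → ℝ) → Heis n) (D : Set (Fin (k + 1) → ℝ)) (L η : ℝ),
      0 ≤ L → 0 ≤ η → volume D ≠ ⊤ →
      (∀ u ∈ D, ∀ v ∈ D, ‖hor n (f u) - hor n (f v)‖ ≤ L * dist u v ∧
        |contact n (f v) (f u - f v)| ≤ η * dist u v) →
      sphericalOuter (homDist N) (k + 2) (f '' D) ≤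
        ENNReal.ofReal (2 * η * (2 * (C * (L + 1))) ^ (k + 2)) * volume D := by
  obtain ⟨C, hC, h⟩ := hN.exists_sphereDelta_le k
  refine ⟨C, hC, fun f D L η hL hη hD hf => ?_⟩
  rw [sphericalOuter_eq]
  refine iSup₂_le fun δ hδ => ?_
  set K := (2 * (C * (L + 1))) ^ (k + 2) with hK
  have hK0 : 0 ≤ K := by positivity
  have key : ∀ ε : ℝ, ε ∈ Ioo 0 ((δ : ℝ) / (C * (L + 1))) →
      sphereDelta (homDist N) (k + 2) δ (f '' D) ≤
        ENNReal.ofReal ((2 * η + 5 * ε) * K) * (volume D + ENNReal.ofReal ε) := by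
    intro ε hε
    have hε0 : ENNReal.ofReal ε ≠ 0 := (ENNReal.ofReal_pos.2 hε.1).ne'
    -- For the supremum norm, Lebesgue measure is the Hausdorff measure without any constant. Hence
    -- `D` has covers by sets of small diameter with almost optimal sum of powers of diameters.
    have hvol : (μH[((k + 1 : ℕ) : ℝ)] D : ℝ≥0∞) = volume D := by
      have := hausdorffMeasure_pi_real (ι := Fin (k + 1))
      rw [Fintype.card_fin] at this
      rw [this]
    have hlt : (⨅ (t : ℕ → Set (Fin (k + 1) → ℝ)) (_ : D ⊆ ⋃ n, t n)
        (_ : ∀ n, Metric.ediam (t n) ≤ ENNReal.ofReal ε),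
          ∑' n, ⨆ _ : (t n).Nonempty, Metric.ediam (t n) ^ ((k + 1 : ℕ) : ℝ)) <
        volume D + ENNReal.ofReal ε := by
      refine lt_of_le_of_lt ?_ (ENNReal.lt_add_right hD hε0)
      rw [← hvol, Measure.hausdorffMeasure_apply]
      exact le_iSup₂_of_le (ENNReal.ofReal ε) (ENNReal.ofReal_pos.2 hε.1) le_rfl
    simp only [iInf_lt_iff] at hlt
    obtain ⟨t, htD, htε, ht⟩ := hlt
    have hcov : f '' D ⊆ ⋃ j, f '' (t j ∩ D) := by
      rintro _ ⟨u, hu, rfl⟩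
      obtain ⟨j, hj⟩ := mem_iUnion.1 (htD hu)
      exact mem_iUnion.2 ⟨j, u, ⟨hj, hu⟩, rfl⟩
    have hone : ∀ j, sphereDelta (homDist N) (k + 2) δ (f '' (t j ∩ D)) ≤
        ENNReal.ofReal ((2 * η + 5 * ε) * K) *
          ⨆ _ : (t j).Nonempty, Metric.ediam (t j) ^ ((k + 1 : ℕ) : ℝ) := by
      intro j
      rcases (t j ∩ D).eq_empty_or_nonempty with he | ⟨v, hv⟩
      · rw [he, image_empty, measure_empty]; exact zero_le
      rw [iSup_pos ⟨v, hv.1⟩, ENNReal.rpow_natCast]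
      have hfin : Metric.ediam (t j) ≠ ⊤ := ne_top_of_le_ne_top ENNReal.ofReal_ne_top (htε j)
      set τ := (Metric.ediam (t j)).toReal with hτ
      have hτe : Metric.ediam (t j) = ENNReal.ofReal τ := (ENNReal.ofReal_toReal hfin).symm
      have hτε : τ ≤ ε := ENNReal.toReal_le_of_le_ofReal hε.1.le (htε j)
      have hdist : ∀ u ∈ t j ∩ D, dist u v ≤ τ := fun u hu => by
        rw [dist_edist]
        exact ENNReal.toReal_mono hfin (Metric.edist_le_ediam_of_mem hu.1 hv.1)
      -- A set of diameter zero is a point, and its image is covered by a ball of radius zero at no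
      -- cost.
      rcases (ENNReal.toReal_nonneg : 0 ≤ τ).eq_or_lt with h0 | hpos
      · have hsub : f '' (t j ∩ D) ⊆ {q | homDist N (f v) q ≤ (0 : ℝ≥0)} := by
          rintro _ ⟨u, hu, rfl⟩
          have : u = v := dist_le_zero.1 ((hdist u hu).trans h0.ge)
          subst this
          simp [homDist, inv_mul_self, hN.map_zero]
        refine (sphereDelta_le_of_subset_ball (zero_le) hsub).trans ?_
        simp
      · rw [hτe]
        refine (h L η τ δ (f v) _ hL hη hpos ?_ ?_).trans ?_
        · have h1 := hε.2
          rw [lt_div_iff₀ (by positivity)] at h1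
          calc C * (L + 1) * τ ≤ C * (L + 1) * ε := by gcongr
            _ ≤ δ := by linarith
        · rintro _ ⟨u, hu, rfl⟩
          obtain ⟨h1, h2⟩ := hf u hu.2 v hv.2
          have h3 := hdist u hu
          exact ⟨h1.trans (by gcongr), h2.trans (by gcongr)⟩
        · gcongr
    calc sphereDelta (homDist N) (k + 2) δ (f '' D)
        ≤ ∑' j, sphereDelta (homDist N) (k + 2) δ (f '' (t j ∩ D)) :=
          (measure_mono hcov).trans (measure_iUnion_le _)
      _ ≤ ∑' j, ENNReal.ofReal ((2 * η + 5 * ε) * K) *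
          ⨆ _ : (t j).Nonempty, Metric.ediam (t j) ^ ((k + 1 : ℕ) : ℝ) :=
          ENNReal.tsum_le_tsum hone
      _ = ENNReal.ofReal ((2 * η + 5 * ε) * K) *
          ∑' j, ⨆ _ : (t j).Nonempty, Metric.ediam (t j) ^ ((k + 1 : ℕ) : ℝ) :=
          ENNReal.tsum_mul_left
      _ ≤ _ := by gcongr
  -- As the diameters tend to zero, the rounding term `5 ε` disappears and only the slope `η`
  -- remains. This makes the bound useful for almost horizontal maps.
  have hlim : Tendsto (fun ε : ℝ => ENNReal.ofReal ((2 * η + 5 * ε) * K) *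
      (volume D + ENNReal.ofReal ε)) (𝓝[>] 0)
      (𝓝 (ENNReal.ofReal ((2 * η + 5 * 0) * K) * (volume D + ENNReal.ofReal 0))) := by
    refine ENNReal.Tendsto.mul ?_ (Or.inr (by finiteness)) ?_ (Or.inr ENNReal.ofReal_ne_top)
    · exact (ENNReal.continuous_ofReal.comp (by fun_prop)).continuousWithinAt
    · exact (continuous_const.add ENNReal.continuous_ofReal).continuousWithinAt
  rw [mul_zero, add_zero, ENNReal.ofReal_zero, add_zero] at hlim
  refine ge_of_tendsto hlim ?_
  filter_upwards [Ioo_mem_nhdsGT (show (0 : ℝ) < δ / (C * (L + 1)) by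
    have : (0 : ℝ) < δ := hδ
    positivity)] with ε hε using key ε hε

end Heis

/-! ### Local estimates for parametrizations; negligibility of null sets and of horizontal points.
-/

namespace Heis

open OrientedSubmanifold

variable {n k : ℕ} {S : OrientedSubmanifold (Heis n) (Heis n) (k + 1)}

lemma hasStrictFDerivAt_param (i : ℕ) {u : Fin (k + 1) → ℝ} (hu : u ∈ S.dom i) :
    HasStrictFDerivAt (S.param i) (S.tangent i u) u := by
  have h := ((S.contDiffOn_param i).contDiffAt ((S.isOpen_dom i).mem_nhds hu)).hasStrictFDerivAt
    one_ne_zero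
  exact h

/-- The contact form on the tangent vectors of a parametrization. -/
def contactTangent (S : OrientedSubmanifold (Heis n) (Heis n) (k + 1)) (i : ℕ)
    (u : Fin (k + 1) → ℝ) : (Fin (k + 1) → ℝ) →L[ℝ] ℝ :=
  (contact n (S.param i u)).comp (S.tangent i u)

lemma continuous_contact : Continuous (contact n) := (contDiff_contact (m := 0)).continuous

/-- Half of `η` is spent on the remainder of strict differentiability, with `B` bounding the contact
form, and half on the variation of the contact form with the base point. -/
lemma abs_contact_sub_le (i : ℕ) {u₀ : Fin (k + 1) → ℝ} (hu₀ : u₀ ∈ S.dom i) {η : ℝ}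
    (hη : 0 < η) : ∃ U ∈ 𝓝 u₀, U ⊆ S.dom i ∧ ∀ u ∈ U, ∀ v ∈ U, ∀ w ∈ U,
      |contact n (S.param i w) (S.param i u - S.param i v) - contactTangent S i u₀ (u - v)| ≤
        η * ‖u - v‖ := by
  set f := S.param i
  set T := S.tangent i u₀
  have hc : ContinuousAt (fun w => contact n (f w)) u₀ :=
    continuous_contact.continuousAt.comp
      ((S.continuousOn_param i).continuousAt ((S.isOpen_dom i).mem_nhds hu₀))
  set B := ‖contact n (f u₀)‖ + 1 with hB
  have hB0 : 0 < B := by positivity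
  obtain ⟨U₁, hU₁, h₁⟩ := ((hasStrictFDerivAt_param i hu₀).approximates_deriv_on_nhds
    (c := (η / (2 * B)).toNNReal) (Or.inr (Real.toNNReal_pos.2 (by positivity))))
  have h2 : ∀ᶠ w in 𝓝 u₀, ‖contact n (f w)‖ < B :=
    hc.norm.eventually_lt continuousAt_const (by simp [hB])
  have h3 : ∀ᶠ w in 𝓝 u₀, ‖(contact n (f w)).comp T - (contact n (f u₀)).comp T‖ < η / 2 := by
    have : ContinuousAt (fun w => ‖(contact n (f w)).comp T - (contact n (f u₀)).comp T‖) u₀ :=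
      ((hc.clm_comp continuousAt_const).sub continuousAt_const).norm
    exact this.eventually_lt continuousAt_const (by simpa using hη)
  refine ⟨U₁ ∩ {w | ‖contact n (f w)‖ < B ∧
    ‖(contact n (f w)).comp T - (contact n (f u₀)).comp T‖ < η / 2} ∩ S.dom i,
    inter_mem (inter_mem hU₁ (h2.and h3)) ((S.isOpen_dom i).mem_nhds hu₀), inter_subset_right,
    fun u hu v hv w hw => ?_⟩
  have h4 := h₁ u hu.1.1 v hv.1.1
  rw [Real.coe_toNNReal _ (by positivity)] at h4
  have e : contact n (f w) (f u - f v) - contactTangent S i u₀ (u - v) =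
      contact n (f w) (f u - f v - T (u - v)) +
        ((contact n (f w)).comp T - (contact n (f u₀)).comp T) (u - v) := by
    simp [contactTangent, f, T]
  rw [e]
  calc _ ≤ |contact n (f w) (f u - f v - T (u - v))| +
        |((contact n (f w)).comp T - (contact n (f u₀)).comp T) (u - v)| := abs_add_le _ _
    _ ≤ B * (η / (2 * B) * ‖u - v‖) + η / 2 * ‖u - v‖ := by
        refine add_le_add ?_ ?_
        · exact (ContinuousLinearMap.le_opNorm _ _).trans
            (mul_le_mul hw.1.2.1.le h4 (norm_nonneg _) hB0.le)
        · exact (ContinuousLinearMap.le_opNorm _ _).trans (mul_le_mul_of_nonneg_right hw.1.2.2.le (norm_nonneg _))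
    _ = η * ‖u - v‖ := by field_simp; ring

lemma exists_local_estimates (i : ℕ) {u₀ : Fin (k + 1) → ℝ} (hu₀ : u₀ ∈ S.dom i) {η : ℝ}
    (hη : 0 < η) : ∃ U ∈ 𝓝 u₀, U ⊆ S.dom i ∧ ∀ u ∈ U, ∀ v ∈ U,
      ‖hor n (S.param i u) - hor n (S.param i v)‖ ≤
        (‖(hor n).comp (S.tangent i u₀)‖ + 1) * dist u v ∧
      |contact n (S.param i v) (S.param i u - S.param i v)| ≤
        (‖contactTangent S i u₀‖ + η) * dist u v := by
  obtain ⟨U, hU, hUd, h⟩ := abs_contact_sub_le i hu₀ hη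
  have h1 : HasStrictFDerivAt (fun u => hor n (S.param i u)) ((hor n).comp (S.tangent i u₀)) u₀ :=
    (hor n).hasStrictFDerivAt.comp u₀ (hasStrictFDerivAt_param i hu₀)
  obtain ⟨V, hV, h2⟩ := h1.approximates_deriv_on_nhds (c := 1) (Or.inr one_pos)
  refine ⟨U ∩ V, inter_mem hU hV, inter_subset_left.trans hUd, fun u hu v hv => ⟨?_, ?_⟩⟩
  · have h3 := h2 u hu.2 v hv.2
    rw [dist_eq_norm]
    calc ‖hor n (S.param i u) - hor n (S.param i v)‖
        ≤ ‖hor n (S.param i u) - hor n (S.param i v) - (hor n).comp (S.tangent i u₀) (u - v)‖ +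
          ‖(hor n).comp (S.tangent i u₀) (u - v)‖ := by
          simpa using norm_add_le (hor n (S.param i u) - hor n (S.param i v) -
            (hor n).comp (S.tangent i u₀) (u - v)) ((hor n).comp (S.tangent i u₀) (u - v))
      _ ≤ 1 * ‖u - v‖ + ‖(hor n).comp (S.tangent i u₀)‖ * ‖u - v‖ :=
          add_le_add h3 (ContinuousLinearMap.le_opNorm _ _)
      _ = _ := by ring
  · have h3 := h u hu.1 v hv.1 v hv.1
    have h4 := (contactTangent S i u₀).le_opNorm (u - v)
    rw [Real.norm_eq_abs] at h4
    rw [dist_eq_norm]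
    have h5 := abs_sub_abs_le_abs_sub (contact n (S.param i v) (S.param i u - S.param i v))
      (contactTangent S i u₀ (u - v))
    linarith

/-- If some tangent vector is not horizontal, the Jacobian is the absolute value of a nonzero
determinant. -/
lemma contactTangent_eq_zero_of_jac (i : ℕ) {u : Fin (k + 1) → ℝ} (hu : u ∈ S.dom i)
    (h : jac S i u = 0) : contactTangent S i u = 0 := by
  by_contra hne
  obtain ⟨h₀, hh₀⟩ : ∃ h₀, contactTangent S i u h₀ ≠ 0 := by
    by_contra! h'
    exact hne (ContinuousLinearMap.ext h')
  obtain ⟨w, -, -, hdet, hj⟩ := exists_adapted (T := trivTangent S i u)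
    ((coframe_injective _).comp (S.tangent_injective i hu)) (h₀ := h₀) hh₀
  rw [jac, hj, abs_eq_zero] at h
  exact hdet h

variable {N : Heis n → ℝ}

lemma measure_iUnion_image_le {α β : Type*} (σ : OuterMeasure β) (f : α → β) (D : ℕ → Set α) :
    σ (f '' ⋃ j, D j) ≤ ∑' j, σ (f '' D j) := by
  rw [image_iUnion]; exact measure_iUnion_le _

/-- The spherical measure vanishes on the images of Lebesgue null sets. -/
lemma IsHomNorm.sphericalOuter_image_eq_zero (hN : IsHomNorm N) (i : ℕ)
    {D : Set (Fin (k + 1) → ℝ)} (hD : D ⊆ S.dom i) (h0 : volume D = 0) :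
    sphericalOuter (homDist N) (k + 2) (S.param i '' D) = 0 := by
  obtain ⟨C, hC, h⟩ := hN.exists_sphericalOuter_image_le k
  have h1 : ∀ u ∈ D, ∃ U ∈ 𝓝 u, sphericalOuter (homDist N) (k + 2) (S.param i '' (U ∩ D)) = 0 := by
    intro u hu
    obtain ⟨U, hU, -, hle⟩ := exists_local_estimates i (hD hu) one_pos
    refine ⟨U, hU, ?_⟩
    have hvol : volume (U ∩ D) = 0 := measure_mono_null inter_subset_right h0
    have := h (S.param i) (U ∩ D) _ _ (by positivity) (by positivity) (by rw [hvol]; simp)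
      fun u hu v hv => hle u hu.1 v hv.1
    rw [hvol, mul_zero] at this
    exact le_antisymm this zero_le
  choose! U hU hU0 using h1
  obtain ⟨t, htD, htc, hcov⟩ := TopologicalSpace.countable_cover_nhdsWithin (f := U) (s := D)
    fun u hu => mem_nhdsWithin_of_mem_nhds (hU u hu)
  have hsub : S.param i '' D ⊆ ⋃ u ∈ t, S.param i '' (U u ∩ D) := by
    rintro _ ⟨v, hv, rfl⟩
    obtain ⟨u, hu, hvu⟩ := mem_iUnion₂.1 (hcov hv)
    exact mem_iUnion₂.2 ⟨u, hu, v, ⟨hvu, hv⟩, rfl⟩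
  exact measure_mono_null hsub ((measure_biUnion_null_iff htc).2 fun u hu => hU0 u (htD hu))

/-- The spherical measure vanishes on the set of points where the tangent plane is horizontal. -/
lemma IsHomNorm.sphericalOuter_characteristic (hN : IsHomNorm N) (i : ℕ) :
    sphericalOuter (homDist N) (k + 2) (S.param i '' {u ∈ S.dom i | jac S i u = 0}) = 0 := by
  obtain ⟨C, hC, h⟩ := hN.exists_sphericalOuter_image_le k
  have hdom := S.isOpen_dom i
  have hT : ContinuousOn (fun u => ‖(hor n).comp (S.tangent i u)‖) (S.dom i) :=
    (continuousOn_const.clm_comp (S.continuousOn_tangent i)).norm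
  -- Cut into countably many parts on which the horizontal derivative is bounded, for a uniform
  -- constant, and the volume is finite.
  let A : ℕ → Set (Fin (k + 1) → ℝ) := fun m => {u ∈ S.dom i | jac S i u = 0} ∩
    (S.dom i ∩ (fun u => ‖(hor n).comp (S.tangent i u)‖) ⁻¹' Iio (m : ℝ)) ∩ Metric.ball 0 m
  have hAm : ∀ m, MeasurableSet (A m) := by
    intro m
    refine MeasurableSet.inter (MeasurableSet.inter ?_ (hT.isOpen_inter_preimage hdom
      isOpen_Iio).measurableSet) Metric.isOpen_ball.measurableSet
    have : {u ∈ S.dom i | jac S i u = 0} = S.dom i \ (S.dom i ∩ jac S i ⁻¹' {0}ᶜ) := by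
      ext u
      simp only [Set.mem_sdiff, mem_inter_iff, mem_preimage, mem_compl_iff, mem_singleton_iff,
        mem_ofPred_eq]
      tauto
    rw [this]
    exact hdom.measurableSet.diff
      ((continuousOn_jac S i).isOpen_inter_preimage hdom isOpen_compl_singleton).measurableSet
  have hcov : S.param i '' {u ∈ S.dom i | jac S i u = 0} ⊆ ⋃ m, S.param i '' A m := by
    rintro _ ⟨u, hu, rfl⟩
    obtain ⟨m, hm⟩ := exists_nat_gt (max ‖(hor n).comp (S.tangent i u)‖ ‖u‖)
    exact mem_iUnion.2 ⟨m, u, ⟨⟨hu, hu.1, (le_max_left _ _).trans_lt hm⟩,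
      mem_ball_zero_iff.2 ((le_max_right _ _).trans_lt hm)⟩, rfl⟩
  refine measure_mono_null hcov (measure_iUnion_null fun m => ?_)
  have hfin : volume (A m) < ⊤ :=
    (measure_mono inter_subset_right).trans_lt Metric.isBounded_ball.measure_lt_top
  -- The contact form vanishes on the tangent plane at these points, so the vertical slope can be
  -- taken as small as desired nearby. The bound then tends to zero with `η`.
  have key : ∀ η : ℝ, 0 < η → sphericalOuter (homDist N) (k + 2) (S.param i '' A m) ≤
      ENNReal.ofReal (2 * η * (2 * (C * ((m + 1) + 1))) ^ (k + 2)) * volume (A m) := by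
    intro η hη
    refine le_of_locally_le (s := A m)
      (μ := fun D => sphericalOuter (homDist N) (k + 2) (S.param i '' D))
      (σ := fun D => ENNReal.ofReal (2 * η * (2 * (C * (((m : ℝ) + 1) + 1))) ^ (k + 2)) * volume D)
      (by simp) (fun D => measure_iUnion_image_le _ _ D) ?_ ?_ (hAm m) Subset.rfl
    · intro D hD _ hd
      rw [ENNReal.tsum_mul_left, measure_iUnion hd hD]
    · intro u hu
      obtain ⟨U, hU, -, hle⟩ := exists_local_estimates i hu.1.1.1 hη
      refine ⟨U, hU, fun D hD hDU => h (S.param i) D _ _ (by positivity) hη.le ?_ ?_⟩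
      · exact ne_top_of_le_ne_top hfin.ne (measure_mono (hDU.trans inter_subset_right))
      · intro v hv w hw
        obtain ⟨h1, h2⟩ := hle v (hDU hv).1 w (hDU hw).1
        rw [contactTangent_eq_zero_of_jac i hu.1.1.1 hu.1.1.2, norm_zero, zero_add] at h2
        refine ⟨h1.trans ?_, h2⟩
        gcongr
        exact (le_of_lt hu.1.2.2 : _ ≤ (m : ℝ))
  have hlim : Tendsto (fun η : ℝ => ENNReal.ofReal (2 * η * (2 * (C * ((m + 1) + 1))) ^ (k + 2)) *
      volume (A m)) (𝓝[>] 0)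
      (𝓝 (ENNReal.ofReal (2 * 0 * (2 * (C * ((m + 1) + 1))) ^ (k + 2)) * volume (A m))) := by
    refine ENNReal.Tendsto.mul_const ?_ (Or.inr hfin.ne)
    exact (ENNReal.continuous_ofReal.comp (by fun_prop)).continuousWithinAt
  rw [mul_zero, zero_mul, ENNReal.ofReal_zero, zero_mul] at hlim
  refine le_antisymm (ge_of_tendsto hlim ?_) zero_le
  filter_upwards [self_mem_nhdsWithin] with η hη using key η hη

end Heis

namespace Heis

open OrientedSubmanifold

variable {n k : ℕ} {S : OrientedSubmanifold (Heis n) (Heis n) (k + 1)}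

/-! ### Blow-up at non-characteristic points -/

lemma inv_mul_eq_coframe (p q : Heis n) : mul (inv p) q = coframe p (q - p) :=
  heis_ext (by rw [hor_inv_mul, hor_coframe, map_sub]) (by rw [inv_mul_snd, coframe_snd])

lemma continuous_coframe : Continuous (coframe (n := n)) :=
  continuous_clm_apply.2 fun v => (contDiff_coframe (m := 0) v).continuous

lemma coframe_sub_le (i : ℕ) {u₀ : Fin (k + 1) → ℝ} (hu₀ : u₀ ∈ S.dom i) {η : ℝ}
    (hη : 0 < η) : ∃ U ∈ 𝓝 u₀, U ⊆ S.dom i ∧ ∀ u ∈ U, ∀ v ∈ U, ∀ w ∈ U,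
      ‖coframe (S.param i w) (S.param i u - S.param i v) - trivTangent S i u₀ (u - v)‖ ≤
        η * ‖u - v‖ := by
  set f := S.param i
  set T := S.tangent i u₀
  have hc : ContinuousAt (fun w => coframe (f w)) u₀ :=
    continuous_coframe.continuousAt.comp
      ((S.continuousOn_param i).continuousAt ((S.isOpen_dom i).mem_nhds hu₀))
  set B := ‖coframe (f u₀)‖ + 1 with hB
  have hB0 : 0 < B := by positivity
  obtain ⟨U₁, hU₁, h₁⟩ := ((hasStrictFDerivAt_param i hu₀).approximates_deriv_on_nhds
    (c := (η / (2 * B)).toNNReal) (Or.inr (Real.toNNReal_pos.2 (by positivity))))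
  have h2 : ∀ᶠ w in 𝓝 u₀, ‖coframe (f w)‖ < B :=
    hc.norm.eventually_lt continuousAt_const (by simp [hB])
  have h3 : ∀ᶠ w in 𝓝 u₀, ‖(coframe (f w)).comp T - (coframe (f u₀)).comp T‖ < η / 2 := by
    have : ContinuousAt (fun w => ‖(coframe (f w)).comp T - (coframe (f u₀)).comp T‖) u₀ :=
      ((hc.clm_comp continuousAt_const).sub continuousAt_const).norm
    exact this.eventually_lt continuousAt_const (by simpa using hη)
  refine ⟨U₁ ∩ {w | ‖coframe (f w)‖ < B ∧
    ‖(coframe (f w)).comp T - (coframe (f u₀)).comp T‖ < η / 2} ∩ S.dom i,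
    inter_mem (inter_mem hU₁ (h2.and h3)) ((S.isOpen_dom i).mem_nhds hu₀), inter_subset_right,
    fun u hu v hv w hw => ?_⟩
  have h4 := h₁ u hu.1.1 v hv.1.1
  rw [Real.coe_toNNReal _ (by positivity)] at h4
  have e : coframe (f w) (f u - f v) - trivTangent S i u₀ (u - v) =
      coframe (f w) (f u - f v - T (u - v)) +
        ((coframe (f w)).comp T - (coframe (f u₀)).comp T) (u - v) := by
    simp [trivTangent, f, T]
  rw [e]
  calc _ ≤ ‖coframe (f w) (f u - f v - T (u - v))‖ +
        ‖((coframe (f w)).comp T - (coframe (f u₀)).comp T) (u - v)‖ := norm_add_le _ _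
    _ ≤ B * (η / (2 * B) * ‖u - v‖) + η / 2 * ‖u - v‖ := by
        refine add_le_add ?_ ?_
        · exact (ContinuousLinearMap.le_opNorm _ _).trans
            (mul_le_mul hw.1.2.1.le h4 (norm_nonneg _) hB0.le)
        · exact (ContinuousLinearMap.le_opNorm _ _).trans
            (mul_le_mul_of_nonneg_right hw.1.2.2.le (norm_nonneg _))
    _ = η * ‖u - v‖ := by field_simp; ring

/-- The parametrization in the coordinates of a vertical plane through `param v`. -/
def blow (S : OrientedSubmanifold (Heis n) (Heis n) (k + 1)) (i : ℕ) (w : Fin k → Hor n)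
    (v u : Fin (k + 1) → ℝ) : Fin (k + 1) → ℝ :=
  frameMap w (mul (inv (S.param i v)) (S.param i u))

lemma blow_sub (i : ℕ) (w : Fin k → Hor n) (v u u' : Fin (k + 1) → ℝ) :
    blow S i w v u - blow S i w v u' =
      frameMap w (coframe (S.param i v) (S.param i u - S.param i u')) := by
  rw [blow, blow, inv_mul_eq_coframe, inv_mul_eq_coframe, ← map_sub, ← map_sub, sub_sub_sub_cancel_right]

lemma blow_self (i : ℕ) (w : Fin k → Hor n) (v : Fin (k + 1) → ℝ) : blow S i w v v = 0 := by
  rw [blow, inv_mul_self, map_zero]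

/-- The derivative of `blow`. -/
def blowDeriv (S : OrientedSubmanifold (Heis n) (Heis n) (k + 1)) (i : ℕ) (w : Fin k → Hor n)
    (v u : Fin (k + 1) → ℝ) : (Fin (k + 1) → ℝ) →L[ℝ] (Fin (k + 1) → ℝ) :=
  (frameMap w).comp ((coframe (S.param i v)).comp (S.tangent i u))

lemma hasStrictFDerivAt_blow (i : ℕ) (w : Fin k → Hor n) (v : Fin (k + 1) → ℝ)
    {u : Fin (k + 1) → ℝ} (hu : u ∈ S.dom i) :
    HasStrictFDerivAt (blow S i w v) (blowDeriv S i w v u) u := by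
  have h1 : blow S i w v = fun u => frameMap w (coframe (S.param i v)
      (S.param i u - S.param i v)) := by
    funext u
    rw [blow, inv_mul_eq_coframe]
  rw [h1]
  exact (frameMap w).hasStrictFDerivAt.comp u ((coframe (S.param i v)).hasStrictFDerivAt.comp u
    ((hasStrictFDerivAt_param i hu).sub_const _))

/-- `w` is an orthonormal basis of the horizontal directions tangent to `S` at `u₀`. -/
structure IsAdapted (S : OrientedSubmanifold (Heis n) (Heis n) (k + 1)) (i : ℕ)
    (u₀ : Fin (k + 1) → ℝ) (w : Fin k → Hor n) : Prop where
  mem_dom : u₀ ∈ S.dom i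
  orthonormal : Orthonormal ℝ w
  expand : ∀ h, (trivTangent S i u₀ h).2.2 = 0 →
    hor n (trivTangent S i u₀ h) = ∑ l, inner ℝ (w l) (hor n (trivTangent S i u₀ h)) • w l
  det_ne_zero : (blowDeriv S i w u₀ u₀).det ≠ 0
  jac_eq : jac S i u₀ = |(blowDeriv S i w u₀ u₀).det|

lemma exists_isAdapted (i : ℕ) {u₀ : Fin (k + 1) → ℝ} (hu₀ : u₀ ∈ S.dom i)
    (hj : jac S i u₀ ≠ 0) : ∃ w, IsAdapted S i u₀ w := by
  obtain ⟨l, hl⟩ : ∃ l, (trivTangent S i u₀ (Pi.single l 1)).2.2 ≠ 0 := by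
    by_contra! h
    exact hj (oblJac_eq_zero h)
  obtain ⟨w, h1, h2, h3, h4⟩ := exists_adapted (T := trivTangent S i u₀)
    ((coframe_injective _).comp (S.tangent_injective i hu₀)) hl
  exact ⟨w, hu₀, h1, h2, h3, h4⟩

namespace IsAdapted

variable {i : ℕ} {u₀ : Fin (k + 1) → ℝ} {w : Fin k → Hor n}

lemma exists_norm_le (h : IsAdapted S i u₀ w) :
    ∃ K : ℝ, 0 < K ∧ ∀ x, ‖x‖ ≤ K * ‖blowDeriv S i w u₀ u₀ x‖ := by
  obtain ⟨K, hK, hA⟩ := (blowDeriv S i w u₀ u₀).toLinearMap.exists_antilipschitzWith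
    (LinearMap.ker_eq_bot.2 ((LinearMap.equivOfDetNeZero _ h.det_ne_zero).injective))
  exact ⟨K, hK, fun x => by simpa using ZeroHomClass.bound_of_antilipschitz _ hA x⟩

/-- Uniform bounds near a non-characteristic point. -/
lemma exists_nhds_blow (h : IsAdapted S i u₀ w) {Λ : ℝ} (hΛ : 1 < Λ) : ∃ U ∈ 𝓝 u₀,
    U ⊆ S.dom i ∧ (∀ v ∈ U, InjOn (blow S i w v) U) ∧
      (∀ v ∈ U, ∀ u ∈ U, jac S i u ≤ Λ * |(blowDeriv S i w v u).det| ∧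
        |(blowDeriv S i w v u).det| ≤ Λ * jac S i u) ∧
      (∀ v ∈ U, ∀ W ∈ 𝓝 v, blow S i w v '' W ∈ 𝓝 0) ∧ ∀ v ∈ U, 0 < jac S i v := by
  obtain ⟨K, hK, hA⟩ := h.exists_norm_le
  -- With this constant, two parameters `u` and `u'` with the same value of `blow` satisfy `‖u - u'‖
  -- ≤ ‖u - u'‖ / 2`, hence coincide.
  obtain ⟨U₁, hU₁, hU₁d, h1⟩ := coframe_sub_le (S := S) i h.mem_dom
    (η := (2 * K * (‖frameMap w‖ + 1))⁻¹) (by positivity)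
  have hdom := (S.isOpen_dom i).mem_nhds h.mem_dom
  have hj0 : 0 < jac S i u₀ := by rw [h.jac_eq]; exact abs_pos.2 h.det_ne_zero
  have hcj : ContinuousAt (jac S i) u₀ := (continuousOn_jac S i).continuousAt hdom
  have hcf : ContinuousAt (S.param i) u₀ := (S.continuousOn_param i).continuousAt hdom
  have hct : ContinuousAt (S.tangent i) u₀ := (S.continuousOn_tangent i).continuousAt hdom
  have hcd : ContinuousAt (fun x : (Fin (k + 1) → ℝ) × (Fin (k + 1) → ℝ) =>
      |(blowDeriv S i w x.1 x.2).det|) (u₀, u₀) := by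
    refine (ContinuousLinearMap.continuous_det.continuousAt.comp ?_).abs
    refine continuousAt_const.clm_comp (ContinuousAt.clm_comp ?_ ?_)
    · exact continuous_coframe.continuousAt.comp (hcf.comp continuousAt_fst)
    · exact hct.comp continuousAt_snd
  have hcj2 : ContinuousAt (fun x : (Fin (k + 1) → ℝ) × (Fin (k + 1) → ℝ) => jac S i x.2)
    (u₀, u₀) :=
    ContinuousAt.comp (g := jac S i) (f := Prod.snd) (x := (u₀, u₀)) hcj continuousAt_snd
  have e1 : ∀ᶠ x in 𝓝 (u₀, u₀), jac S i x.2 < Λ * |(blowDeriv S i w x.1 x.2).det| :=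
    hcj2.eventually_lt (continuousAt_const.mul hcd) (by
      show jac S i u₀ < Λ * |(blowDeriv S i w u₀ u₀).det|
      rw [← h.jac_eq]; nlinarith)
  have e2 : ∀ᶠ x in 𝓝 (u₀, u₀), |(blowDeriv S i w x.1 x.2).det| < Λ * jac S i x.2 :=
    hcd.eventually_lt (continuousAt_const.mul hcj2) (by
      show |(blowDeriv S i w u₀ u₀).det| < Λ * jac S i u₀
      rw [← h.jac_eq]; nlinarith)
  have e3 := e1.and e2
  rw [nhds_prod_eq, Filter.eventually_prod_iff] at e3
  obtain ⟨pa, hpa, pb, hpb, hp⟩ := e3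
  have e4 : ∀ᶠ v in 𝓝 u₀, 0 < jac S i v := continuousAt_const.eventually_lt hcj hj0
  refine ⟨U₁ ∩ {v | pa v ∧ pb v ∧ 0 < jac S i v}, inter_mem hU₁ (hpa.and (hpb.and e4)),
    inter_subset_left.trans hU₁d, ?_, ?_, ?_, fun v hv => hv.2.2.2⟩
  · intro v hv u hu u' hu' huu'
    have h3 := h1 u hu.1 u' hu'.1 v hv.1
    have h4 : frameMap w (coframe (S.param i v) (S.param i u - S.param i u')) = 0 := by
      rw [← blow_sub, huu', sub_self]
    have h5 : blowDeriv S i w u₀ u₀ (u - u') = -frameMap w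
        (coframe (S.param i v) (S.param i u - S.param i u') - trivTangent S i u₀ (u - u')) := by
      rw [(frameMap w).map_sub, h4]; simp [blowDeriv, trivTangent]
    have h6 := hA (u - u')
    rw [h5, norm_neg] at h6
    have h7 : ‖u - u'‖ ≤ K * ((‖frameMap w‖ + 1) * ((2 * K * (‖frameMap w‖ + 1))⁻¹ * ‖u - u'‖)) := by
      refine h6.trans ?_
      gcongr
      refine ((frameMap w).le_opNorm _).trans ?_
      gcongr
      linarith
    have h8 : K * ((‖frameMap w‖ + 1) * ((2 * K * (‖frameMap w‖ + 1))⁻¹ * ‖u - u'‖)) =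
        ‖u - u'‖ / 2 := by field_simp
    have h9 : ‖u - u'‖ ≤ 0 := by linarith
    exact sub_eq_zero.1 (norm_le_zero_iff.1 h9)
  · intro v hv u hu
    have := hp hv.2.1 hu.2.2.1
    exact ⟨this.1.le, this.2.le⟩
  -- The derivative of `blow` at the base point is invertible, so `blow` is open there and maps `v`
  -- to zero.
  · intro v hv W hW
    have hd := (hp hv.2.1 hv.2.2.1).1
    have hj := hv.2.2.2
    have hne : (blowDeriv S i w v v).det ≠ 0 := by
      intro h0
      rw [h0, abs_zero, mul_zero] at hd
      exact absurd hd (not_lt.2 hj.le)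
    have hs := hasStrictFDerivAt_blow (S := S) i w v (hU₁d hv.1)
    have hm := hs.map_nhds_eq_of_surj (LinearMap.range_eq_top.2
      (LinearMap.equivOfDetNeZero _ hne).surjective)
    rw [blow_self] at hm
    rw [← hm]
    exact image_mem_map hW

end IsAdapted

end Heis

/-! ### Approximation of the submanifold by vertical planes. -/

namespace Heis

open OrientedSubmanifold

variable {n k : ℕ} {S : OrientedSubmanifold (Heis n) (Heis n) (k + 1)}

/-- The component of a horizontal vector orthogonal to an orthonormal family. -/
def transverse (w : Fin k → Hor n) : Hor n →L[ℝ] Hor n :=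
  ContinuousLinearMap.id ℝ _ - ∑ l, (innerSL ℝ (w l)).smulRight (w l)

lemma transverse_apply (w : Fin k → Hor n) (z : Hor n) :
    transverse w z = z - ∑ l, inner ℝ (w l) z • w l := by
  simp [transverse]

lemma frameMap_plane {w : Fin k → Hor n} (hw : Orthonormal ℝ w) (y : Fin (k + 1) → ℝ) :
    frameMap w (plane w y) = y := by
  funext j
  refine Fin.cases ?_ (fun l => ?_) j
  · rw [frameMap_zero, plane_snd]
  · rw [frameMap_succ, hor_plane, hw.inner_right_fintype]

lemma hor_inv_plane_mul (w : Fin k → Hor n) (x : Heis n) :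
    hor n (mul (inv (plane w (frameMap w x))) x) = transverse w (hor n x) := by
  rw [hor_inv_mul, hor_plane, transverse_apply]
  simp only [frameMap_succ]

lemma inv_plane_mul_snd (w : Fin k → Hor n) (x : Heis n) :
    |(mul (inv (plane w (frameMap w x))) x).2.2| ≤
      ‖hor n (plane w (frameMap w x))‖ * ‖transverse w (hor n x)‖ / 2 := by
  set P := plane w (frameMap w x)
  have h1 : (x - P).2.2 = 0 := by
    rw [Prod.snd_sub, Prod.snd_sub, plane_snd, frameMap_zero, sub_self]
  rw [inv_mul_snd, contact_eq, h1, zero_sub, abs_neg, abs_mul]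
  have h2 := abs_symp_le_norm P (x - P)
  rw [map_sub, ← hor_inv_mul, hor_inv_plane_mul] at h2
  rw [abs_of_pos (by norm_num : (0 : ℝ) < 1 / 2)]
  linarith

variable {N : Heis n → ℝ}

lemma IsHomNorm.exists_abs_frameMap_le (hN : IsHomNorm N) {w : Fin k → Hor n}
    (hw : Orthonormal ℝ w) {R : ℝ} (hR : 0 ≤ R) : ∃ B : ℝ, 0 < B ∧ ∀ (x : Heis n) (r : ℝ),
      0 ≤ r → N x ≤ R * r → (∀ l : Fin k, |frameMap w x l.succ| ≤ B * r) ∧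
        |frameMap w x 0| ≤ B * r ^ 2 := by
  obtain ⟨C, hC, hb⟩ := hN.bound
  refine ⟨C * R + (C * R) ^ 2 + 1, by positivity, fun x r hr hx => ⟨fun l => ?_, ?_⟩⟩
  · have h1 := (hb x).1
    rw [sqrt_zsq] at h1
    rw [frameMap_succ]
    have h2 := abs_real_inner_le_norm (w l) (hor n x)
    rw [hw.1 l, one_mul] at h2
    have h3 : C * N x ≤ C * (R * r) := by gcongr
    have h4 : 0 ≤ ((C * R) ^ 2 + 1) * r := by positivity
    linarith
  · have h1 := (hb x).2.1
    rw [frameMap_zero]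
    have h3 : Real.sqrt |x.2.2| ≤ C * (R * r) := h1.trans (by gcongr)
    have h5 := (Real.sqrt_le_left (by positivity)).1 h3
    have h4 : 0 ≤ (C * R + 1) * r ^ 2 := by positivity
    nlinarith

namespace IsAdapted

variable {i : ℕ} {u₀ : Fin (k + 1) → ℝ} {w : Fin k → Hor n}

/-- Horizontal tangent vectors lie in the span of `w`, so the transverse component depends only on
the vertical component, through a map from a space of dimension at most one. -/
lemma exists_transverse_trivTangent_le (h : IsAdapted S i u₀ w) : ∃ C : ℝ, 0 ≤ C ∧ ∀ v,
    ‖transverse w (hor n (trivTangent S i u₀ v))‖ ≤ C * |(trivTangent S i u₀ v).2.2| := by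
  have hz : ∀ v, (trivTangent S i u₀ v).2.2 = 0 →
      transverse w (hor n (trivTangent S i u₀ v)) = 0 := fun v hv => by
    rw [transverse_apply, ← h.expand v hv, sub_self]
  by_cases hv₀ : ∃ v₀, (trivTangent S i u₀ v₀).2.2 ≠ 0
  · obtain ⟨v₀, hv₀⟩ := hv₀
    set τ := (trivTangent S i u₀ v₀).2.2
    refine ⟨‖transverse w (hor n (trivTangent S i u₀ v₀))‖ / |τ|, by positivity, fun v => ?_⟩
    set a := (trivTangent S i u₀ v).2.2 / τ with ha
    have h1 := hz (v - a • v₀) (by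
      rw [map_sub, map_smul, Prod.snd_sub, Prod.snd_sub, Prod.smul_snd, Prod.smul_snd, smul_eq_mul,
        ha, div_mul_cancel₀ _ hv₀, sub_self])
    rw [map_sub, map_sub, map_sub, map_smul, map_smul, map_smul, sub_eq_zero] at h1
    rw [h1, norm_smul, Real.norm_eq_abs, ha, abs_div]
    apply le_of_eq
    field_simp
  · push Not at hv₀
    exact ⟨0, le_rfl, fun v => by simp [hz v (hv₀ v)]⟩

/-- The submanifold is almost contained in vertical planes at small scales. -/
lemma exists_transverse_le (h : IsAdapted S i u₀ w) : ∃ C : ℝ, 0 ≤ C ∧ ∀ ε : ℝ, 0 < ε →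
    ∃ U ∈ 𝓝 u₀, ∀ v ∈ U, ∀ u ∈ U,
      ‖transverse w (hor n (mul (inv (S.param i v)) (S.param i u)))‖ ≤
        C * |blow S i w v u 0| + ε * ‖blow S i w v u‖ := by
  obtain ⟨C, hC, hle⟩ := h.exists_transverse_trivTangent_le
  obtain ⟨K, hK, hA⟩ := h.exists_norm_le
  refine ⟨C, hC, fun ε hε => ?_⟩
  set Q := (transverse w).comp (hor n)
  -- The first bound makes `‖u - v‖` at most `2 K` times the norm of the blown-up coordinates; the
  -- second converts the remaining error into `ε` times that norm.
  set η := min (2 * K * (‖frameMap w‖ + 1))⁻¹ (ε / (2 * K * (‖Q‖ + C + 1))) with hη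
  obtain ⟨U, hU, -, hc⟩ := coframe_sub_le (S := S) i h.mem_dom (η := η) (by positivity)
  refine ⟨U, hU, fun v hv u hu => ?_⟩
  set x := mul (inv (S.param i v)) (S.param i u) with hx
  set T := trivTangent S i u₀
  have h1 : ‖x - T (u - v)‖ ≤ η * ‖u - v‖ := by
    rw [hx, inv_mul_eq_coframe]; exact hc u hu v hv v hv
  have hy : blow S i w v u = frameMap w x := rfl
  have h2 : ‖u - v‖ ≤ 2 * K * ‖blow S i w v u‖ := by
    have h3 := hA (u - v)
    have h4 : blowDeriv S i w u₀ u₀ (u - v) = frameMap w x - frameMap w (x - T (u - v)) := by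
      rw [← map_sub, sub_sub_cancel]; rfl
    have h5 : ‖frameMap w (x - T (u - v))‖ ≤
        (‖frameMap w‖ + 1) * ((2 * K * (‖frameMap w‖ + 1))⁻¹ * ‖u - v‖) := by
      refine ((frameMap w).le_opNorm _).trans (mul_le_mul (by linarith) (h1.trans ?_)
        (norm_nonneg _) (by positivity))
      gcongr
      exact min_le_left _ _
    have h6 : (‖frameMap w‖ + 1) * ((2 * K * (‖frameMap w‖ + 1))⁻¹ * ‖u - v‖) =
      ‖u - v‖ / (2 * K) := by field_simp
    rw [h6] at h5
    rw [h4] at h3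
    have h7 := norm_sub_le (frameMap w x) (frameMap w (x - T (u - v)))
    have h8 : ‖u - v‖ ≤ K * (‖frameMap w x‖ + ‖u - v‖ / (2 * K)) :=
      h3.trans (by gcongr; linarith)
    have h9 : K * (‖frameMap w x‖ + ‖u - v‖ / (2 * K)) = K * ‖frameMap w x‖ + ‖u - v‖ / 2 := by
      field_simp
    rw [hy]
    linarith
  have h3 : |(T (u - v)).2.2| ≤ |blow S i w v u 0| + η * ‖u - v‖ := by
    have h4 : (T (u - v)).2.2 = blow S i w v u 0 - (x - T (u - v)).2.2 := by
      rw [hy, frameMap_zero, Prod.snd_sub, Prod.snd_sub, sub_sub_cancel]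
    have h5 : |(x - T (u - v)).2.2| ≤ ‖x - T (u - v)‖ :=
      (norm_snd_le (x - T (u - v)).2).trans (norm_snd_le _)
    rw [h4]
    exact (abs_sub _ _).trans (by linarith)
  have h4 : transverse w (hor n x) = Q (x - T (u - v)) + transverse w (hor n (T (u - v))) := by
    rw [map_sub]; simp [Q]
  calc ‖transverse w (hor n x)‖ ≤ ‖Q (x - T (u - v))‖ + ‖transverse w (hor n (T (u - v)))‖ := by
        rw [h4]; exact norm_add_le _ _
    _ ≤ ‖Q‖ * (η * ‖u - v‖) + C * (|blow S i w v u 0| + η * ‖u - v‖) :=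
        add_le_add ((Q.le_opNorm _).trans (by gcongr)) ((hle _).trans (by gcongr))
    _ = C * |blow S i w v u 0| + (‖Q‖ + C) * (η * ‖u - v‖) := by ring
    _ ≤ C * |blow S i w v u 0| + (‖Q‖ + C + 1) *
          (ε / (2 * K * (‖Q‖ + C + 1)) * (2 * K * ‖blow S i w v u‖)) := by
        have h5 : ‖Q‖ + C ≤ ‖Q‖ + C + 1 := by linarith
        have h6 : η ≤ ε / (2 * K * (‖Q‖ + C + 1)) := hη.le.trans (min_le_right _ _)
        gcongr
    _ = C * |blow S i w v u 0| + ε * ‖blow S i w v u‖ := by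
        field_simp

/-- At scale `r` the coordinates in the plane are `O(r)` horizontally and `O(r ^ 2)` vertically. By
`exists_transverse_le` the transverse component is `o(r)`, and the vertical discrepancy, bounded by
a product of horizontal norms, is `o(r ^ 2)`; both are negligible for the homogeneous norm. Either
the point of the submanifold or its projection may be assumed near, since both upper and lower
bounds on balls are needed. -/
lemma exists_inv_plane_mul_le (hN : IsHomNorm N) (h : IsAdapted S i u₀ w) {η R : ℝ} (hη : 0 < η)
    (hR : 0 ≤ R) : ∃ U ∈ 𝓝 u₀, ∃ δ > 0, ∀ v ∈ U, ∀ u ∈ U, ∀ r ∈ Ioo 0 δ,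
      (N (mul (inv (S.param i v)) (S.param i u)) ≤ R * r ∨ N (plane w (blow S i w v u)) ≤ R * r) →
      N (mul (inv (plane w (blow S i w v u))) (mul (inv (S.param i v)) (S.param i u))) ≤
        η * r := by
  obtain ⟨B, hB, hBx⟩ := hN.exists_abs_frameMap_le h.orthonormal hR
  obtain ⟨C, hC, hb⟩ := hN.bound
  obtain ⟨C₁, hC₁, ht⟩ := h.exists_transverse_le
  -- Both terms of the norm estimate are to be at most `κ r`. The second entry of the minimum `η₁`
  -- below keeps the vertical discrepancy below `(κ r) ^ 2`, as `k B r` bounds the horizontal norm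
  -- in the plane.
  set κ := η / (2 * C) with hκ
  have hκ0 : 0 < κ := by positivity
  set η₁ := min κ (κ ^ 2 / (k * B + 1)) with hη₁
  have hη₁0 : 0 < η₁ := by positivity
  obtain ⟨U, hU, hUt⟩ := ht (η₁ / (2 * B)) (by positivity)
  refine ⟨U, hU, min 1 (η₁ / (2 * (C₁ * B + 1))), by positivity, fun v hv u hu r hr hor' => ?_⟩
  set x := mul (inv (S.param i v)) (S.param i u)
  have hr1 : r < 1 := hr.2.trans_le (min_le_left _ _)
  have hr2 : r < η₁ / (2 * (C₁ * B + 1)) := hr.2.trans_le (min_le_right _ _)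
  have hr0 : 0 < r := hr.1
  have hy : blow S i w v u = frameMap w x := rfl
  have hyb : (∀ l : Fin k, |blow S i w v u l.succ| ≤ B * r) ∧ |blow S i w v u 0| ≤ B * r ^ 2 := by
    rcases hor' with h1 | h1
    · exact hBx x r hr.1.le h1
    · have := hBx _ r hr.1.le h1
      rwa [frameMap_plane h.orthonormal] at this
  have hy0 : |blow S i w v u 0| ≤ B * r := hyb.2.trans (by gcongr; nlinarith)
  have hyn : ‖blow S i w v u‖ ≤ B * r := by
    refine (pi_norm_le_iff_of_nonneg (by positivity)).2 fun j => ?_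
    exact Fin.cases hy0 hyb.1 j
  have hQ : ‖transverse w (hor n x)‖ ≤ η₁ * r := by
    refine (hUt v hv u hu).trans ?_
    have h1 : C₁ * |blow S i w v u 0| ≤ C₁ * (B * r ^ 2) := by gcongr; exact hyb.2
    have h2 : η₁ / (2 * B) * ‖blow S i w v u‖ ≤ η₁ / (2 * B) * (B * r) := by gcongr
    have h3 : η₁ / (2 * B) * (B * r) = η₁ / 2 * r := by field_simp
    rw [lt_div_iff₀ (by positivity)] at hr2
    nlinarith
  have hP : ‖hor n (plane w (blow S i w v u))‖ ≤ k * B * r := by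
    rw [hor_plane]
    refine (norm_sum_le _ _).trans ?_
    calc ∑ l, ‖blow S i w v u l.succ • w l‖ ≤ ∑ _l : Fin k, B * r := by
          refine Finset.sum_le_sum fun l _ => ?_
          rw [norm_smul, h.orthonormal.1 l, mul_one]
          exact hyb.1 l
      _ = k * B * r := by simp; ring
  refine (hb _).2.2.trans ?_
  rw [sqrt_zsq, hy, hor_inv_plane_mul]
  have h3 : Real.sqrt |(mul (inv (plane w (frameMap w x))) x).2.2| ≤ κ * r := by
    rw [Real.sqrt_le_left (by positivity)]
    refine (inv_plane_mul_snd w x).trans ?_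
    have h4 : ‖hor n (plane w (frameMap w x))‖ * ‖transverse w (hor n x)‖ ≤
        (k * B * r) * (κ ^ 2 / (k * B + 1) * r) := by
      refine mul_le_mul hP (hQ.trans ?_) (norm_nonneg _) (by positivity)
      gcongr
      exact min_le_right _ _
    have h5 : (k * B * r) * (κ ^ 2 / (k * B + 1) * r) = (k * B / (k * B + 1)) * (κ * r) ^ 2 := by
      field_simp
    have h6 : k * B / (k * B + 1) ≤ 1 := by
      rw [div_le_one (by positivity)]; linarith
    have h7 : (k * B / (k * B + 1)) * (κ * r) ^ 2 ≤ 1 * (κ * r) ^ 2 := by gcongr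
    nlinarith [sq_nonneg (κ * r)]
  have h4 : ‖transverse w (hor n x)‖ ≤ κ * r := hQ.trans (by gcongr; exact min_le_left _ _)
  calc _ ≤ C * (κ * r + κ * r) := by gcongr
    _ = η * r := by rw [hκ]; field_simp; ring

end IsAdapted

end Heis

/-! ### Oblique mass of small balls near non-horizontal points. -/

namespace Heis

open OrientedSubmanifold

variable {n k : ℕ} {S : OrientedSubmanifold (Heis n) (Heis n) (k + 1)}
variable {N : Heis n → ℝ}

lemma IsHomNorm.mul_inv_comm (hN : IsHomNorm N) (p q : Heis n) :
    N (mul (inv p) q) = N (mul (inv q) p) := by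
  rw [← hN.map_inv, inv_mul, inv_inv']

lemma IsHomNorm.triangle (hN : IsHomNorm N) (p q r : Heis n) :
    N (mul (inv p) r) ≤ N (mul (inv p) q) + N (mul (inv q) r) := by
  have h : mul (inv p) r = mul (mul (inv p) q) (mul (inv q) r) := by
    rw [mul_assoc', mul_inv_mul_cancel]
  rw [h]
  exact hN.mul_le _ _

lemma mul_inv_mul_inv_mul (a p q : Heis n) :
    mul (inv (mul (inv p) a)) (mul (inv p) q) = mul (inv a) q := by
  rw [inv_mul, inv_inv', mul_assoc', mul_inv_mul_cancel]

lemma IsHomNorm.measurableSet_inter_ball (hN : IsHomNorm N) (i : ℕ) {U : Set (Fin (k + 1) → ℝ)}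
    (hU : IsOpen U) (hUd : U ⊆ S.dom i) (q : Heis n) (r : ℝ) :
    MeasurableSet (U ∩ {u | N (mul (inv q) (S.param i u)) ≤ r}) := by
  have hc : ContinuousOn (fun u => N (mul (inv q) (S.param i u))) U :=
    (hN.continuous.comp (continuous_mul_left _)).comp_continuousOn
      ((S.continuousOn_param i).mono hUd)
  have h1 : U ∩ {u | N (mul (inv q) (S.param i u)) ≤ r} =
      U \ (U ∩ (fun u => N (mul (inv q) (S.param i u))) ⁻¹' Ioi r) := by
    ext u
    simp only [mem_inter_iff, Set.mem_sdiff, mem_preimage, mem_Ioi, mem_ofPred_eq, not_and, not_lt]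
    tauto
  rw [h1]
  exact hU.measurableSet.diff (hc.isOpen_inter_preimage hU isOpen_Ioi).measurableSet

namespace IsAdapted

variable {i : ℕ} {u₀ : Fin (k + 1) → ℝ} {w : Fin k → Hor n}

lemma volume_blow_image (i : ℕ) (w : Fin k → Hor n) {v : Fin (k + 1) → ℝ}
    {D : Set (Fin (k + 1) → ℝ)} (hD : MeasurableSet D) (hDi : D ⊆ S.dom i)
    (hinj : InjOn (blow S i w v) D) :
    ∫⁻ u in D, ENNReal.ofReal |(blowDeriv S i w v u).det| = volume (blow S i w v '' D) :=
  lintegral_abs_det_fderiv_eq_addHaar_image volume hD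
    (fun _ hu => (hasStrictFDerivAt_blow i w v (hDi hu)).hasFDerivAt.hasFDerivWithinAt) hinj

/-- Upper bound of the oblique mass of small balls. -/
lemma exists_lintegral_jac_le (hN : IsHomNorm N) (h : IsAdapted S i u₀ w) {Λ : ℝ} (hΛ : 1 < Λ) :
    ∃ U ∈ 𝓝 u₀, ∃ δ > 0, ∀ D ⊆ U, MeasurableSet D → ∀ (q : Heis n), ∀ r ∈ Ioo 0 δ,
      (∀ u ∈ D, N (mul (inv q) (S.param i u)) ≤ r) →
      ∫⁻ u in D, ENNReal.ofReal (jac S i u) ≤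
        ENNReal.ofReal Λ * (ENNReal.ofReal r ^ (k + 2) * sliceSup N w) := by
  -- The factor `√Λ` pays for replacing the Jacobian by the determinant, and `(1 + η) ^ (k + 2)` for
  -- enlarging the radius.
  obtain ⟨η, hη, hηΛ⟩ : ∃ η : ℝ, 0 < η ∧ Real.sqrt Λ * (1 + η) ^ (k + 2) < Λ := by
    have hc : ContinuousAt (fun η : ℝ => Real.sqrt Λ * (1 + η) ^ (k + 2)) 0 := by fun_prop
    have h1 : Real.sqrt Λ * (1 + 0) ^ (k + 2) < Λ := by
      rw [add_zero, one_pow, mul_one, Real.sqrt_lt' (by linarith)]; nlinarith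
    have h2 := (hc.eventually_lt continuousAt_const h1).filter_mono
      (nhdsWithin_le_nhds (s := Ioi 0))
    obtain ⟨η, h3, h4⟩ := (h2.and self_mem_nhdsWithin).exists
    exact ⟨η, h4, h3⟩
  have hs : 1 < Real.sqrt Λ := by rw [Real.lt_sqrt zero_le_one]; simpa
  obtain ⟨U₁, hU₁, hU₁d, hinj, hdet, -, -⟩ := h.exists_nhds_blow hs
  -- The constant is two because the base point will be a point of `D`, and any two points of the
  -- ball are within `2 r`.
  obtain ⟨U₂, hU₂, δ, hδ, hnear⟩ := h.exists_inv_plane_mul_le hN hη zero_le_two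
  refine ⟨U₁ ∩ U₂, inter_mem hU₁ hU₂, δ, hδ, fun D hDU hDm q r hr hD => ?_⟩
  rcases D.eq_empty_or_nonempty with rfl | ⟨v, hv⟩
  · simp
  set a := mul (inv (S.param i v)) q
  have hsub : blow S i w v '' D ⊆ slice N w a ((1 + η) * r) := by
    rintro _ ⟨u, hu, rfl⟩
    set x := mul (inv (S.param i v)) (S.param i u)
    have h1 : N x ≤ 2 * r := by
      have h2 := hN.triangle (S.param i v) q (S.param i u)
      rw [hN.mul_inv_comm (S.param i v) q] at h2
      linarith [hD u hu, hD v hv]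
    have h2 := hnear v (hDU hv).2 u (hDU hu).2 r hr (Or.inl h1)
    have h3 := hN.triangle a x (plane w (blow S i w v u))
    rw [mul_inv_mul_inv_mul, hN.mul_inv_comm x] at h3
    show N _ ≤ _
    linarith [hD u hu]
  have hDi : D ⊆ S.dom i := fun u hu => hU₁d (hDU hu).1
  calc ∫⁻ u in D, ENNReal.ofReal (jac S i u)
      ≤ ∫⁻ u in D, ENNReal.ofReal (Real.sqrt Λ) *
          ENNReal.ofReal |(blowDeriv S i w v u).det| := by
        refine setLIntegral_mono' hDm fun u hu => ?_
        rw [← ENNReal.ofReal_mul (by positivity)]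
        exact ENNReal.ofReal_le_ofReal (hdet v (hDU hv).1 u (hDU hu).1).1
    _ = ENNReal.ofReal (Real.sqrt Λ) * volume (blow S i w v '' D) := by
        rw [lintegral_const_mul' _ _ ENNReal.ofReal_ne_top, volume_blow_image i w hDm hDi
          ((hinj v (hDU hv).1).mono fun u hu => (hDU hu).1)]
    _ ≤ ENNReal.ofReal (Real.sqrt Λ) *
          (ENNReal.ofReal ((1 + η) * r) ^ (k + 2) * sliceSup N w) := by
        have hr0 := hr.1
        gcongr
        exact (measure_mono hsub).trans (volume_slice_le hN w a (by positivity))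
    _ = ENNReal.ofReal (Real.sqrt Λ * (1 + η) ^ (k + 2)) *
          (ENNReal.ofReal r ^ (k + 2) * sliceSup N w) := by
        rw [ENNReal.ofReal_mul (p := 1 + η) (by positivity), mul_pow,
          ENNReal.ofReal_mul (p := Real.sqrt Λ) (by positivity),
          ENNReal.ofReal_pow (p := 1 + η) (by positivity)]
        ring
    _ ≤ _ := by gcongr

/-- Lower bound of the oblique mass of well-chosen small balls. -/
lemma exists_le_lintegral_jac (hN : IsHomNorm N) (h : IsAdapted S i u₀ w) {Λ : ℝ} (hΛ : 1 < Λ) :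
    ∃ R : ℝ, 0 ≤ R ∧ ∃ U₀ ∈ 𝓝 u₀, ∀ U ⊆ U₀, IsOpen U → ∀ v ∈ U, ∃ δ > 0, ∀ r ∈ Ioo 0 δ, ∃ q,
      N (mul (inv (S.param i v)) q) ≤ R * r ∧
      ENNReal.ofReal r ^ (k + 2) * sliceSup N w ≤ ENNReal.ofReal Λ *
        ∫⁻ u in U ∩ {u | N (mul (inv q) (S.param i u)) ≤ r}, ENNReal.ofReal (jac S i u) := by
  -- One factor `1 + η` pays for a center that is only nearly optimal, one for the comparison of
  -- determinant and Jacobian, and `(1 + η) ^ (k + 2)` for the smaller radius of the slice.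
  obtain ⟨η, hη, hηΛ⟩ : ∃ η : ℝ, 0 < η ∧ (1 + η) ^ 2 * (1 + η) ^ (k + 2) < Λ := by
    have hc : ContinuousAt (fun η : ℝ => (1 + η) ^ 2 * (1 + η) ^ (k + 2)) 0 := by fun_prop
    have h1 : ((1 : ℝ) + 0) ^ 2 * (1 + 0) ^ (k + 2) < Λ := by simpa using hΛ
    have h2 := (hc.eventually_lt continuousAt_const h1).filter_mono
      (nhdsWithin_le_nhds (s := Ioi 0))
    obtain ⟨η, h3, h4⟩ := (h2.and self_mem_nhdsWithin).exists
    exact ⟨η, h4, h3⟩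
  have h1η : 1 < 1 + η := by linarith
  obtain ⟨a₀, ha₀⟩ : ∃ a, sliceSup N w ≤ ENNReal.ofReal (1 + η) * volume (slice N w a 1) := by
    have hlt : sliceSup N w / ENNReal.ofReal (1 + η) < ⨆ a, volume (slice N w a 1) := by
      change _ < sliceSup N w
      rw [ENNReal.div_lt_iff (Or.inl (by simp; linarith)) (Or.inl ENNReal.ofReal_ne_top)]
      have h2 := ENNReal.mul_lt_mul_right (sliceSup_pos hN w).ne'
        (sliceSup_ne_top hN h.orthonormal) (ENNReal.one_lt_ofReal.2 h1η)
      rwa [mul_one] at h2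
    obtain ⟨a, ha⟩ := lt_iSup_iff.1 hlt
    refine ⟨a, ?_⟩
    rw [ENNReal.div_lt_iff (Or.inl (by simp; linarith)) (Or.inl ENNReal.ofReal_ne_top)] at ha
    rw [mul_comm]
    exact ha.le
  have hNa := hN.nonneg a₀
  obtain ⟨U₁, hU₁, hU₁d, hinj, hdet, hopen, -⟩ := h.exists_nhds_blow h1η
  obtain ⟨U₂, hU₂, δ, hδ, hnear⟩ := h.exists_inv_plane_mul_le hN hη
    (show 0 ≤ N a₀ + 1 by positivity)
  obtain ⟨B, hB, hBx⟩ := hN.exists_abs_frameMap_le h.orthonormal (show 0 ≤ N a₀ + 1 by positivity)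
  refine ⟨N a₀, hNa, U₁ ∩ U₂, inter_mem hU₁ hU₂, fun U hUs hUo v hv => ?_⟩
  obtain ⟨ε, hε, hball⟩ := Metric.mem_nhds_iff.1 (hopen v (hUs hv).1 U (hUo.mem_nhds hv))
  -- The bound `ε / (2 * B)` puts the whole slice inside the image of `U` under `blow`, so that
  -- every point of the slice comes from the submanifold.
  refine ⟨min δ (min 1 (ε / (2 * B))), by positivity, fun r hr => ?_⟩
  have hr0 : 0 < r := hr.1
  have hrδ : r < δ := hr.2.trans_le (min_le_left _ _)
  have hr1 : r < 1 := hr.2.trans_le ((min_le_right _ _).trans (min_le_left _ _))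
  have hrε : r < ε / (2 * B) := hr.2.trans_le ((min_le_right _ _).trans (min_le_right _ _))
  -- The slice of radius `r'` leaves room for the displacement `η r'` between plane and submanifold,
  -- since `r' + η r' = r`. The nearly optimal center `a₀` is rescaled by `r'` and then translated
  -- to the base point.
  set r' := r / (1 + η) with hr'
  have hr'0 : 0 < r' := by positivity
  have hr'r : r' ≤ r := div_le_self hr0.le h1η.le
  set b := dilation r' a₀ with hb
  have hNb : N b = r' * N a₀ := hN.map_dilation r' hr'0 _
  set q := mul (S.param i v) b with hq
  have hqb : mul (inv (S.param i v)) q = b := inv_mul_mul_cancel _ _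
  refine ⟨q, ?_, ?_⟩
  · rw [hqb, hNb, mul_comm]; gcongr
  set D := U ∩ {u | N (mul (inv q) (S.param i u)) ≤ r} with hD
  have hDi : D ⊆ S.dom i := fun u hu => hU₁d (hUs hu.1).1
  have hDm : MeasurableSet D :=
    hN.measurableSet_inter_ball i hUo (fun u hu => hU₁d (hUs hu).1) q r
  have hsub : slice N w b r' ⊆ blow S i w v '' D := by
    intro y hy
    have hy' : N (mul (inv b) (plane w y)) ≤ r' := hy
    have hP : N (plane w y) ≤ (N a₀ + 1) * r' := by
      have h2 := hN.mul_le b (mul (inv b) (plane w y))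
      rw [mul_inv_mul_cancel] at h2
      linarith
    have hyB := hBx _ r' hr'0.le hP
    rw [frameMap_plane h.orthonormal] at hyB
    have hyε : y ∈ Metric.ball 0 ε := by
      rw [mem_ball_zero_iff]
      have h3 : ‖y‖ ≤ B * r := by
        refine (pi_norm_le_iff_of_nonneg (by positivity)).2 fun j => ?_
        refine Fin.cases (hyB.2.trans ?_) (fun l => (hyB.1 l).trans (by gcongr)) j
        gcongr
        nlinarith
      rw [lt_div_iff₀ (by positivity)] at hrε
      nlinarith
    obtain ⟨u, hu, huy⟩ := hball hyε
    refine ⟨u, ⟨hu, ?_⟩, huy⟩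
    show N _ ≤ r
    rw [← huy] at hP hy'
    have h3 := hnear v (hUs hv).2 u (hUs hu).2 r' ⟨hr'0, hr'r.trans_lt hrδ⟩ (Or.inr hP)
    have h4 := hN.triangle b (plane w (blow S i w v u))
      (mul (inv (S.param i v)) (S.param i u))
    rw [← hqb, mul_inv_mul_inv_mul, hqb] at h4
    have h5 : r' + η * r' = r := by rw [hr']; field_simp
    linarith
  calc ENNReal.ofReal r ^ (k + 2) * sliceSup N w
      ≤ ENNReal.ofReal r ^ (k + 2) * (ENNReal.ofReal (1 + η) * volume (slice N w a₀ 1)) := by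
        gcongr
    _ = ENNReal.ofReal (1 + η) * ENNReal.ofReal (1 + η) ^ (k + 2) * volume (slice N w b r') := by
        rw [hb, volume_slice_dilation hN w a₀ hr'0, ← ENNReal.ofReal_pow hr'0.le]
        have h6 : ENNReal.ofReal r = ENNReal.ofReal (1 + η) * ENNReal.ofReal r' := by
          rw [← ENNReal.ofReal_mul (by positivity), hr', mul_div_cancel₀ _ (by positivity)]
        rw [h6, mul_pow, ENNReal.ofReal_pow hr'0.le]
        ring
    _ ≤ ENNReal.ofReal (1 + η) * ENNReal.ofReal (1 + η) ^ (k + 2) *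
          ∫⁻ u in D, ENNReal.ofReal |(blowDeriv S i w v u).det| := by
        rw [volume_blow_image i w hDm hDi ((hinj v (hUs hv).1).mono fun u hu => (hUs hu.1).1)]
        gcongr
    _ ≤ ENNReal.ofReal (1 + η) * ENNReal.ofReal (1 + η) ^ (k + 2) *
          ∫⁻ u in D, ENNReal.ofReal (1 + η) * ENNReal.ofReal (jac S i u) := by
        refine mul_le_mul_right ?_ _
        refine setLIntegral_mono' hDm fun u hu => ?_
        rw [← ENNReal.ofReal_mul (by positivity)]
        exact ENNReal.ofReal_le_ofReal (hdet v (hUs hv).1 u (hUs hu.1).1).2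
    _ = ENNReal.ofReal ((1 + η) ^ 2 * (1 + η) ^ (k + 2)) *
          ∫⁻ u in D, ENNReal.ofReal (jac S i u) := by
        rw [lintegral_const_mul' _ _ ENNReal.ofReal_ne_top, ENNReal.ofReal_mul (by positivity),
          ENNReal.ofReal_pow (by positivity), ENNReal.ofReal_pow (by positivity)]
        ring
    _ ≤ _ := by gcongr

end IsAdapted

end Heis

namespace Heis

open OrientedSubmanifold

variable {n k : ℕ} {S : OrientedSubmanifold (Heis n) (Heis n) (k + 1)}
variable {N : Heis n → ℝ}

/-! ### The metric of a homogeneous norm -/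

lemma norm_le_norm_hor_add (p : Heis n) : ‖p‖ ≤ ‖hor n p‖ + |p.2.2| := by
  have h1 : ∀ j, ‖hor n p j‖ ≤ ‖hor n p‖ := fun j => PiLp.norm_apply_le _ j
  have h2 := abs_nonneg p.2.2
  have h3 := norm_nonneg (hor n p)
  refine max_le ?_ (max_le ?_ ?_)
  · exact (pi_norm_le_iff_of_nonneg (by positivity)).2 fun j =>
      (h1 (Sum.inl j)).trans (by linarith)
  · exact (pi_norm_le_iff_of_nonneg (by positivity)).2 fun j =>
      (h1 (Sum.inr j)).trans (by linarith)
  · rw [Real.norm_eq_abs]; linarith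

lemma IsHomNorm.exists_norm_le (hN : IsHomNorm N) :
    ∃ C : ℝ, 0 < C ∧ ∀ p, ‖p‖ ≤ C * N p + (C * N p) ^ 2 := by
  obtain ⟨C, hC, hb⟩ := hN.bound
  refine ⟨C, hC, fun p => (norm_le_norm_hor_add p).trans ?_⟩
  obtain ⟨h1, h2, -⟩ := hb p
  rw [sqrt_zsq] at h1
  have h3 := hN.nonneg p
  rw [Real.sqrt_le_left (by positivity)] at h2
  linarith

lemma IsHomNorm.eq_of_nonpos (hN : IsHomNorm N) {p q : Heis n} (h : N (mul (inv p) q) ≤ 0) :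
    p = q := by
  obtain ⟨C, hC, hb⟩ := hN.exists_norm_le
  have h0 : N (mul (inv p) q) = 0 := le_antisymm h (hN.nonneg _)
  have h1 := hb (mul (inv p) q)
  rw [h0, mul_zero, zero_pow two_ne_zero, add_zero] at h1
  have h2 := congrArg (mul p) (norm_le_zero_iff.1 h1)
  rwa [mul_inv_mul_cancel, mul_zero', eq_comm] at h2

/-- Left translation. -/
def translation (p : Heis n) : Heis n ≃ₜ Heis n where
  toFun := mul p
  invFun := mul (inv p)
  left_inv q := inv_mul_mul_cancel p q
  right_inv q := mul_inv_mul_cancel p q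
  continuous_toFun := continuous_mul_left p
  continuous_invFun := continuous_mul_left (inv p)

/-- With left translation, this shows that the metric of the norm induces the usual topology. The
metric structure can therefore be put on the given topological space without changing its Borel
sets. -/
lemma IsHomNorm.comap_nhds_zero (hN : IsHomNorm N) : comap N (𝓝 0) = 𝓝 0 := by
  refine le_antisymm ?_ ?_
  · obtain ⟨C, hC, hb⟩ := hN.exists_norm_le
    have h1 : Tendsto (fun p : Heis n => p) (comap N (𝓝 0)) (𝓝 0) := by
      refine squeeze_zero_norm hb ?_
      have h2 : Tendsto (fun t : ℝ => C * t + (C * t) ^ 2) (𝓝 0) (𝓝 0) := by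
        have h3 : Continuous fun t : ℝ => C * t + (C * t) ^ 2 := by fun_prop
        simpa using h3.tendsto 0
      exact h2.comp tendsto_comap
    exact h1
  · have h1 := hN.continuous.tendsto 0
    rw [hN.map_zero] at h1
    exact h1.le_comap

/-- The left-invariant metric of a homogeneous norm, with the topology of this metric. -/
abbrev IsHomNorm.rawMetricSpace (hN : IsHomNorm N) : MetricSpace (Heis n) where
  dist p q := N (mul (inv p) q)
  dist_self p := by rw [inv_mul_self, hN.map_zero]
  dist_comm := hN.mul_inv_comm
  dist_triangle := hN.triangle
  eq_of_dist_eq_zero h := hN.eq_of_nonpos h.le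

/-- The left-invariant metric of a homogeneous norm. -/
abbrev IsHomNorm.metricSpace (hN : IsHomNorm N) : MetricSpace (Heis n) :=
  hN.rawMetricSpace.replaceTopology <| by
    refine TopologicalSpace.ext_nhds fun p => ?_
    refine Eq.trans ?_ (@nhds_comap_dist _ hN.rawMetricSpace.toPseudoMetricSpace p)
    have h1 : (fun q : Heis n => N (mul (inv q) p)) = N ∘ (translation p).symm :=
      funext fun q => hN.mul_inv_comm q p
    change _ = comap (fun q : Heis n => N (mul (inv q) p)) (𝓝 0)
    rw [h1, ← comap_comap, hN.comap_nhds_zero, Homeomorph.comap_nhds_eq]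
    change _ = 𝓝 (mul p 0)
    rw [mul_zero']

lemma IsHomNorm.edist_eq (hN : IsHomNorm N) :
    (fun p q => hN.metricSpace.toPseudoMetricSpace.toPseudoEMetricSpace.toEDist.edist p q) =
      homDist N :=
  funext fun p => funext fun q => @edist_dist _ hN.metricSpace.toPseudoMetricSpace p q

/-- The spherical outer measure is a metric outer measure, so Carathéodory's criterion applies. -/
lemma IsHomNorm.measurableSet_caratheodory (hN : IsHomNorm N) (s : ℕ) {A : Set (Heis n)}
    (hA : MeasurableSet A) : MeasurableSet[(sphericalOuter (homDist N) s).caratheodory] A := by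
  have h1 := @isMetric_sphericalOuter (Heis n) hN.metricSpace s
  rw [hN.edist_eq] at h1
  have h2 := @OuterMeasure.IsMetric.borel_le_caratheodory (Heis n)
    (@MetricSpace.toEMetricSpace _ hN.metricSpace) _ h1
  refine h2 A ?_
  rw [← BorelSpace.measurable_eq (α := Heis n)]
  exact hA

lemma IsHomNorm.mul_sphericalOuter_le (hN : IsHomNorm N) (μ : Measure (Heis n)) [IsFiniteMeasure μ]
    {s : ℕ} {A : Set (Heis n)} {c C : ℝ≥0∞} (hc0 : c ≠ 0) (hc : c ≠ ⊤) (hC : C ≠ ⊤) {R : ℝ}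
    (hR : 0 ≤ R)
    (h1 : ∀ x ∈ A, ∃ δ > 0, ∀ r ∈ Ioo 0 δ, ∃ q, N (mul (inv x) q) ≤ R * r ∧
      c * (2 * ENNReal.ofReal r) ^ s ≤ μ {p | N (mul (inv q) p) ≤ r})
    (h2 : ∃ δ > 0, ∀ x ∈ A, ∀ r ∈ Ioo 0 δ,
      μ {p | N (mul (inv x) p) ≤ r} ≤ C * ENNReal.ofReal r ^ s)
    (h3 : ∀ B ⊆ A, μ B = 0 → sphericalOuter (homDist N) s B = 0) :
    c * sphericalOuter (homDist N) s A ≤ μ A := by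
  have hball : ∀ (q : Heis n) (r : ℝ), {p | N (mul (inv q) p) ≤ r} =
      @Metric.closedBall _ hN.metricSpace.toPseudoMetricSpace q r := fun q r => by
    ext p
    change N (mul (inv q) p) ≤ r ↔ N (mul (inv p) q) ≤ r
    rw [hN.mul_inv_comm]
  simp only [hball] at h1 h2
  rw [← hN.edist_eq] at h3 ⊢
  exact @ObliqueMass.mul_sphericalOuter_le (Heis n) hN.metricSpace _ _ _ μ _ s A c C hc0 hc hC R hR
    h1 h2 h3

end Heis

lemma measurableSet_inter_preimage {X Y : Type*} [TopologicalSpace X] [MeasurableSpace X]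
    [BorelSpace X] [TopologicalSpace Y] [MeasurableSpace Y] [BorelSpace Y] {f : X → Y} {U : Set X}
    (hU : MeasurableSet U) (hf : ContinuousOn f U) {B : Set Y} (hB : MeasurableSet B) :
    MeasurableSet (U ∩ f ⁻¹' B) := by
  have h1 : Measurable fun u : U => f u := (continuousOn_iff_continuous_domRestrict.1 hf).measurable
  have h2 := (MeasurableEmbedding.subtype_coe hU).measurableSet_image.2 (h1 hB)
  convert h2 using 1
  ext u
  simp only [mem_inter_iff, mem_preimage, mem_image, Subtype.exists, exists_and_left, exists_prop,
    exists_eq_right_right]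
  exact and_comm

lemma le_of_forall_one_lt_le_mul {x y : ℝ≥0∞} (h : ∀ Λ : ℝ, 1 < Λ → x ≤ ENNReal.ofReal Λ * y) :
    x ≤ y := by
  have h1 : Tendsto (fun Λ : ℝ => ENNReal.ofReal Λ * y) (𝓝[>] 1) (𝓝 (ENNReal.ofReal 1 * y)) :=
    ENNReal.Tendsto.mul_const (ENNReal.continuous_ofReal.continuousWithinAt)
      (Or.inl (by simp))
  rw [ENNReal.ofReal_one, one_mul] at h1
  refine ge_of_tendsto h1 ?_
  filter_upwards [self_mem_nhdsWithin] with Λ hΛ using h Λ hΛ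

lemma sphericalIntegral_const {X : Type*} {d : X → X → ℝ≥0∞} {s : ℕ} {A : Set X}
    (hA : MeasurableSet[(sphericalOuter d s).caratheodory] A) (c : ℝ≥0) :
    sphericalIntegral d s A (fun _ => c) = c * sphericalOuter d s A := by
  let _ : MeasurableSpace X := (sphericalOuter d s).caratheodory
  rw [sphericalIntegral, lintegral_indicator_const hA, toMeasure_apply _ _ hA]

namespace Heis

open OrientedSubmanifold

variable {n k : ℕ} {S : OrientedSubmanifold (Heis n) (Heis n) (k + 1)}
variable {N : Heis n → ℝ}

/-! ### The oblique mass and the spherical measure -/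

open scoped Classical in
/-- The density of the oblique mass with respect to the spherical measure. -/
def density (N : Heis n → ℝ) (k : ℕ) : ℝ≥0 :=
  if h : ∃ w : Fin k → Hor n, Orthonormal ℝ w then (sliceSup N h.choose / 2 ^ (k + 2)).toNNReal
  else 0

/-- A ball of radius `r` has weight `(2 r) ^ (k + 2)` in the spherical measure and maximal slice `r
^ (k + 2) * sliceSup`, whence the power of two. The choice of `w` in the definition is immaterial by
`sliceSup_eq`. -/
lemma IsHomNorm.density_mul (hN : IsHomNorm N) {w : Fin k → Hor n} (hw : Orthonormal ℝ w) :
    (density N k : ℝ≥0∞) * 2 ^ (k + 2) = sliceSup N w := by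
  have h : ∃ w : Fin k → Hor n, Orthonormal ℝ w := ⟨w, hw⟩
  rw [density, dif_pos h, sliceSup_eq hN hw h.choose_spec, ENNReal.coe_toNNReal
    (ENNReal.div_ne_top (sliceSup_ne_top hN h.choose_spec) (by positivity)),
    ENNReal.div_mul_cancel (by positivity) (by finiteness)]

lemma IsHomNorm.density_pos (hN : IsHomNorm N) {w : Fin k → Hor n} (hw : Orthonormal ℝ w) :
    density N k ≠ 0 := by
  intro h0
  have h1 := hN.density_mul hw
  rw [h0, ENNReal.coe_zero, zero_mul] at h1
  exact (sliceSup_pos hN w).ne h1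

namespace IsAdapted

variable {i : ℕ} {u₀ : Fin (k + 1) → ℝ} {w : Fin k → Hor n}

/-- The upper bound on all small balls, summed over covers by `le_mul_sphericalOuter`. -/
lemma exists_lintegral_jac_le_sphericalOuter (hN : IsHomNorm N) (h : IsAdapted S i u₀ w) {Λ : ℝ}
    (hΛ : 1 < Λ) : ∃ U ∈ 𝓝 u₀, ∀ D, MeasurableSet D → D ⊆ U →
      ∫⁻ u in D, ENNReal.ofReal (jac S i u) ≤ ENNReal.ofReal Λ *
        (density N k * sphericalOuter (homDist N) (k + 2) (S.param i '' D)) := by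
  obtain ⟨U₁, hU₁, δ, hδ, hle⟩ := h.exists_lintegral_jac_le hN hΛ
  refine ⟨interior U₁ ∩ S.dom i, inter_mem (interior_mem_nhds.2 hU₁)
    ((S.isOpen_dom i).mem_nhds h.mem_dom), fun D hDm hDU => ?_⟩
  have hDi : D ⊆ S.dom i := fun u hu => (hDU hu).2
  set μ := (volume.restrict D).withDensity fun u => ENNReal.ofReal (jac S i u) with hμ
  have hDV : ∀ (p : Heis n) (r : ℝ), MeasurableSet (D ∩ {u | N (mul (inv p) (S.param i u)) ≤ r}) :=
    fun p r => by
      have h1 := hDm.inter (hN.measurableSet_inter_ball (S := S) i (S.isOpen_dom i) Subset.rfl p r)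
      rwa [← inter_assoc, inter_eq_left.2 hDi] at h1
  have hcompl : μ Dᶜ = 0 :=
    withDensity_absolutelyContinuous _ _ (by rw [Measure.restrict_apply hDm.compl]; simp)
  have hball : ∀ (p : Heis n) (r : ℝ≥0), μ (S.param i ⁻¹' {q | homDist N p q ≤ r}) ≤
      ∫⁻ u in D ∩ {u | N (mul (inv p) (S.param i u)) ≤ r}, ENNReal.ofReal (jac S i u) := by
    intro p r
    have hsub : S.param i ⁻¹' {q | homDist N p q ≤ r} ⊆
        (D ∩ {u | N (mul (inv p) (S.param i u)) ≤ r}) ∪ Dᶜ := by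
      intro u hu
      by_cases huD : u ∈ D
      · refine Or.inl ⟨huD, ?_⟩
        have h1 : ENNReal.ofReal (N (mul (inv p) (S.param i u))) ≤ r := hu
        rwa [ENNReal.ofReal_le_iff_le_toReal ENNReal.coe_ne_top, ENNReal.coe_toReal] at h1
      · exact Or.inr huD
    refine (measure_mono hsub).trans ((measure_union_le _ _).trans ?_)
    rw [hcompl, add_zero, hμ, withDensity_apply _ (hDV p r), Measure.restrict_restrict (hDV p r),
      inter_eq_left.2 inter_subset_left]
  have hκ := hN.density_mul h.orthonormal
  have key := le_mul_sphericalOuter (d := homDist N) (s := k + 2)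
    (ν := OuterMeasure.map (S.param i) μ.toOuterMeasure)
    (c := ENNReal.ofReal Λ * density N k) (δ := (δ / 2).toNNReal)
    (mul_ne_zero (by simp; linarith) (by exact_mod_cast hN.density_pos h.orthonormal))
    (by finiteness) (Real.toNNReal_pos.2 (by positivity)) ?_ (S.param i '' D)
  · rw [← mul_assoc]
    refine le_trans ?_ key
    rw [OuterMeasure.map_apply, Measure.coe_toOuterMeasure]
    refine le_trans ?_ (measure_mono (subset_preimage_image (S.param i) D))
    rw [hμ, withDensity_apply _ hDm, Measure.restrict_restrict hDm, inter_self]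
  · intro p r hr
    rw [OuterMeasure.map_apply, Measure.coe_toOuterMeasure]
    refine (hball p r).trans ?_
    -- Covers may use balls of radius zero, to which the estimate does not apply; they contain one
    -- point of the submanifold at most.
    rcases (zero_le : 0 ≤ r).eq_or_lt with rfl | hr0
    · have h0 : volume (D ∩ {u | N (mul (inv p) (S.param i u)) ≤ (0 : ℝ≥0)}) = 0 := by
        refine Set.Subsingleton.measure_zero (fun u hu v hv => ?_) _
        refine S.injOn_param i (hDi hu.1) (hDi hv.1) ?_
        rw [← hN.eq_of_nonpos hu.2, ← hN.eq_of_nonpos hv.2]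
      rw [Measure.restrict_eq_zero.2 h0, lintegral_zero_measure]
      exact zero_le
    · have hr' : (r : ℝ) ∈ Ioo 0 δ := by
        refine ⟨hr0, ?_⟩
        have h1 : (r : ℝ) ≤ δ / 2 := by
          have h2 := NNReal.coe_le_coe.2 hr
          rwa [Real.coe_toNNReal _ (by positivity)] at h2
        linarith
      refine (hle _ (fun u hu => interior_subset (hDU hu.1).1) (hDV p r) p r hr'
        fun u hu => hu.2).trans ?_
      rw [← hκ, ENNReal.ofReal_coe_nnreal, mul_pow]
      apply le_of_eq
      ring

/-- Vitali's theorem for the image of the Jacobian measure: all small balls centered on the set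
satisfy the upper bound, and balls with nearby centers satisfy the lower bound with almost the same
constant. -/
lemma exists_sphericalOuter_le_lintegral_jac (hN : IsHomNorm N) (h : IsAdapted S i u₀ w) {Λ : ℝ}
    (hΛ : 1 < Λ) : ∃ U ∈ 𝓝 u₀, ∀ D, MeasurableSet D → D ⊆ U →
      density N k * sphericalOuter (homDist N) (k + 2) (S.param i '' D) ≤
        ENNReal.ofReal Λ * ∫⁻ u in D, ENNReal.ofReal (jac S i u) := by
  obtain ⟨U₁, hU₁, δ, hδ, hle⟩ := h.exists_lintegral_jac_le hN hΛ
  obtain ⟨R, hR, U₂, hU₂, hge⟩ := h.exists_le_lintegral_jac hN hΛ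
  obtain ⟨U₃, hU₃, hU₃d, -, -, -, hpos⟩ := h.exists_nhds_blow hΛ
  have hM := sliceSup_ne_top hN h.orthonormal
  have hκ := hN.density_mul h.orthonormal
  have hκ0 : (density N k : ℝ≥0∞) ≠ 0 := by exact_mod_cast hN.density_pos h.orthonormal
  have hΛ0 : ENNReal.ofReal Λ ≠ 0 := by simp; linarith
  -- Keeping the neighborhood in one ball of radius `δ / 2` makes its measure finite by the upper
  -- bound.
  have hball : {u | N (mul (inv (S.param i u₀)) (S.param i u)) < δ / 2} ∈ 𝓝 u₀ := by
    have hc : ContinuousAt (fun u => N (mul (inv (S.param i u₀)) (S.param i u))) u₀ :=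
      (hN.continuous.comp (continuous_mul_left _)).continuousAt.comp
        ((S.continuousOn_param i).continuousAt ((S.isOpen_dom i).mem_nhds h.mem_dom))
    refine hc.eventually_lt continuousAt_const ?_
    rw [inv_mul_self, hN.map_zero]
    positivity
  set U := interior (U₁ ∩ U₂ ∩ U₃ ∩
    {u | N (mul (inv (S.param i u₀)) (S.param i u)) < δ / 2}) with hU
  have hUs := interior_subset (s := U₁ ∩ U₂ ∩ U₃ ∩
    {u | N (mul (inv (S.param i u₀)) (S.param i u)) < δ / 2})
  have hUo : IsOpen U := isOpen_interior
  have hUd : U ⊆ S.dom i := fun u hu => hU₃d (hUs hu).1.2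
  refine ⟨U, interior_mem_nhds.2 (inter_mem (inter_mem (inter_mem hU₁ hU₂) hU₃) hball),
    fun D hDm hDU => ?_⟩
  have hjc : ContinuousOn (jac S i) U := (continuousOn_jac S i).mono hUd
  set μU := (volume.restrict U).withDensity fun u => ENNReal.ofReal (jac S i u) with hμU
  have hμUapp : ∀ E, MeasurableSet (U ∩ E) →
      μU E = ∫⁻ u in U ∩ E, ENNReal.ofReal (jac S i u) := by
    intro E hE
    have h1 : μU E = μU (U ∩ E) := by
      refine le_antisymm ?_ (measure_mono inter_subset_right)
      have h2 : μU Uᶜ = 0 := withDensity_absolutelyContinuous _ _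
        (by rw [Measure.restrict_apply hUo.measurableSet.compl]; simp)
      have h3 : E ⊆ (U ∩ E) ∪ Uᶜ := fun u hu => by
        by_cases huU : u ∈ U
        exacts [Or.inl ⟨huU, hu⟩, Or.inr huU]
      refine (measure_mono h3).trans ((measure_union_le _ _).trans ?_)
      rw [h2, add_zero]
    rw [h1, hμU, withDensity_apply _ hE, Measure.restrict_restrict hE,
      inter_eq_left.2 inter_subset_left]
  have hfin : IsFiniteMeasure μU := by
    refine ⟨?_⟩
    rw [hμUapp univ (by simpa using hUo.measurableSet), inter_univ]
    refine (hle U (fun u hu => (hUs hu).1.1.1) hUo.measurableSet (S.param i u₀) (δ / 2)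
      ⟨by positivity, by linarith⟩ fun u hu => (hUs hu).2.le).trans_lt ?_
    finiteness
  have hfm : AEMeasurable (S.param i) μU :=
    (((S.continuousOn_param i).mono hUd).aemeasurable hUo.measurableSet).mono_ac
      (withDensity_absolutelyContinuous _ _)
  set μ := μU.map (S.param i) with hμ
  have hpre : ∀ B, MeasurableSet B → MeasurableSet (U ∩ S.param i ⁻¹' B) := fun B hB =>
    measurableSet_inter_preimage hUo.measurableSet ((S.continuousOn_param i).mono hUd) hB
  have hμapp : ∀ B, MeasurableSet B →
      μ B = ∫⁻ u in U ∩ S.param i ⁻¹' B, ENNReal.ofReal (jac S i u) := fun B hB => by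
    rw [hμ, Measure.map_apply_of_aemeasurable hfm hB, hμUapp _ (hpre B hB)]
  have hBall : ∀ (q : Heis n) (r : ℝ), MeasurableSet {p | N (mul (inv q) p) ≤ r} := fun q r =>
    (isClosed_le (hN.continuous.comp (continuous_mul_left _)) continuous_const).measurableSet
  have hDi : D ⊆ S.dom i := hDU.trans hUd
  have hA : U ∩ S.param i ⁻¹' (S.param i '' D) = D := by
    ext u
    constructor
    · rintro ⟨hu, v, hv, hvu⟩
      rwa [← S.injOn_param i (hDi hv) (hUd hu) hvu]
    · exact fun hu => ⟨hDU hu, u, hu, rfl⟩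
  have key := hN.mul_sphericalOuter_le μ (s := k + 2) (A := S.param i '' D)
    (c := density N k / ENNReal.ofReal Λ) (C := ENNReal.ofReal Λ * sliceSup N w) (R := R)
    (ENNReal.div_ne_zero.2 ⟨hκ0, ENNReal.ofReal_ne_top⟩)
    (ENNReal.div_ne_top ENNReal.coe_ne_top hΛ0) (by finiteness) hR ?_ ?_ ?_
  · rw [hμapp _ (measurableSet_image hDm hDi), hA, ENNReal.mul_div_right_comm.symm,
      ENNReal.div_le_iff' hΛ0 ENNReal.ofReal_ne_top] at key
    exact key
  · rintro _ ⟨v, hv, rfl⟩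
    obtain ⟨δ', hδ', h1⟩ := hge U (fun u hu => (hUs hu).1.1.2) hUo v (hDU hv)
    refine ⟨δ', hδ', fun r hr => ?_⟩
    obtain ⟨q, hq, h2⟩ := h1 r hr
    refine ⟨q, hq, ?_⟩
    rw [hμapp _ (hBall q r), ENNReal.mul_div_right_comm.symm,
      ENNReal.div_le_iff' hΛ0 ENNReal.ofReal_ne_top]
    refine le_trans (le_of_eq ?_) h2
    rw [← hκ, mul_pow]
    ring
  · refine ⟨δ, hδ, ?_⟩
    rintro _ ⟨v, hv, rfl⟩ r hr
    rw [hμapp _ (hBall _ r)]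
    refine (hle _ (fun u hu => (hUs hu.1).1.1.1) (hpre _ (hBall _ r)) (S.param i v) r hr
      fun u hu => hu.2).trans (le_of_eq ?_)
    ring
  -- The Jacobian is positive on `U`, so a null set for `μ` comes from a Lebesgue null set of
  -- parameters, whose image is null for the spherical measure.
  · intro B hB hB0
    set B' := toMeasurable μ B
    have hB' : ∫⁻ u in U ∩ S.param i ⁻¹' B', ENNReal.ofReal (jac S i u) = 0 := by
      rw [← hμapp _ (measurableSet_toMeasurable μ B), measure_toMeasurable, hB0]
    have hE := hpre B' (measurableSet_toMeasurable μ B)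
    have hvol : volume (U ∩ S.param i ⁻¹' B') = 0 := by
      rw [lintegral_eq_zero_iff' ((hjc.mono inter_subset_left).aemeasurable hE).ennreal_ofReal,
        Filter.EventuallyEq, ae_restrict_iff' hE] at hB'
      refine measure_mono_null (fun u hu => ?_) hB'
      simp only [mem_compl_iff, mem_ofPred_eq, Pi.zero_apply, ENNReal.ofReal_eq_zero, not_le,
        Classical.not_imp]
      exact ⟨hu, hpos u (hUs hu.1).1.2⟩
    refine measure_mono_null ?_ (hN.sphericalOuter_image_eq_zero i
      (inter_subset_left.trans hUd) hvol)
    intro p hp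
    obtain ⟨u, hu, rfl⟩ := hB hp
    exact ⟨u, ⟨hDU hu, subset_toMeasurable μ B hp⟩, rfl⟩

end IsAdapted

lemma IsHomNorm.tsum_sphericalOuter_image (hN : IsHomNorm N) (s : ℕ) {A : ℕ → Set (Heis n)}
    (hA : ∀ j, MeasurableSet (A j)) (hd : Pairwise (Function.onFun Disjoint A)) :
    sphericalOuter (homDist N) s (⋃ j, A j) = ∑' j, sphericalOuter (homDist N) s (A j) :=
  OuterMeasure.iUnion_eq_of_caratheodory _ (fun j => hN.measurableSet_caratheodory s (hA j)) hd

/-- The area formula on the non-characteristic part of a chart. -/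
lemma IsHomNorm.lintegral_jac_eq_of_ne_zero (hN : IsHomNorm N) (i : ℕ)
    {D : Set (Fin (k + 1) → ℝ)} (hD : MeasurableSet D)
    (hDi : D ⊆ {u ∈ S.dom i | jac S i u ≠ 0}) :
    ∫⁻ u in D, ENNReal.ofReal (jac S i u) =
      density N k * sphericalOuter (homDist N) (k + 2) (S.param i '' D) := by
  have hdisj : ∀ D : ℕ → Set (Fin (k + 1) → ℝ), (∀ j, D j ⊆ {u ∈ S.dom i | jac S i u ≠ 0}) →
      Pairwise (Function.onFun Disjoint D) →
      Pairwise (Function.onFun Disjoint fun j => S.param i '' D j) := fun D hD hd j l hjl =>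
    disjoint_left.2 <| by
      rintro _ ⟨u, hu, rfl⟩ ⟨v, hv, hvu⟩
      rw [S.injOn_param i (hD l hv).1 (hD j hu).1 hvu] at hv
      exact disjoint_left.1 (hd hjl) hu hv
  -- The local comparisons lose a factor `Λ > 1` on neighborhoods depending on `Λ`. Countable
  -- additivity makes them global for each fixed `Λ`, which then tends to one.
  refine le_antisymm (le_of_forall_one_lt_le_mul fun Λ hΛ => ?_)
    (le_of_forall_one_lt_le_mul fun Λ hΛ => ?_)
  · refine le_of_locally_le (s := {u ∈ S.dom i | jac S i u ≠ 0})
      (μ := fun D => ∫⁻ u in D, ENNReal.ofReal (jac S i u))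
      (σ := fun D => ENNReal.ofReal Λ *
        (density N k * sphericalOuter (homDist N) (k + 2) (S.param i '' D)))
      (by simp) (fun D => lintegral_iUnion_le _ _) ?_ ?_ hD hDi
    · intro D hD hDs hd
      simp only [image_iUnion]
      rw [ENNReal.tsum_mul_left, ENNReal.tsum_mul_left, hN.tsum_sphericalOuter_image (k + 2)
        (fun j => measurableSet_image (hD j) fun u hu => (hDs j hu).1) (hdisj D hDs hd)]
    · intro u hu
      obtain ⟨w, hw⟩ := exists_isAdapted i hu.1 hu.2
      obtain ⟨U, hU, hle⟩ := hw.exists_lintegral_jac_le_sphericalOuter hN hΛ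
      exact ⟨U, hU, fun D hD hDU => hle D hD fun u hu => (hDU hu).1⟩
  · refine le_of_locally_le (s := {u ∈ S.dom i | jac S i u ≠ 0})
      (μ := fun D => density N k * sphericalOuter (homDist N) (k + 2) (S.param i '' D))
      (σ := fun D => ENNReal.ofReal Λ * ∫⁻ u in D, ENNReal.ofReal (jac S i u))
      (by simp) (fun D => ?_) ?_ ?_ hD hDi
    · rw [ENNReal.tsum_mul_left]
      gcongr
      exact measure_iUnion_image_le _ _ D
    · intro D hD _ hd
      rw [ENNReal.tsum_mul_left, lintegral_iUnion hD hd]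
    · intro u hu
      obtain ⟨w, hw⟩ := exists_isAdapted i hu.1 hu.2
      obtain ⟨U, hU, hle⟩ := hw.exists_sphericalOuter_le_lintegral_jac hN hΛ
      exact ⟨U, hU, fun D hD hDU => hle D hD fun u hu => (hDU hu).1⟩

/-- The area formula in a chart. -/
lemma IsHomNorm.lintegral_jac_eq (hN : IsHomNorm N) (i : ℕ)
    {D : Set (Fin (k + 1) → ℝ)} (hD : MeasurableSet D) (hDi : D ⊆ S.dom i) :
    ∫⁻ u in D, ENNReal.ofReal (jac S i u) =
      density N k * sphericalOuter (homDist N) (k + 2) (S.param i '' D) := by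
  have hm : MeasurableSet (D ∩ jac S i ⁻¹' {0}ᶜ) :=
    measurableSet_inter_preimage hD ((continuousOn_jac S i).mono hDi)
      (measurableSet_singleton 0).compl
  have hm0 : MeasurableSet (D ∩ jac S i ⁻¹' {0}) :=
    measurableSet_inter_preimage hD ((continuousOn_jac S i).mono hDi) (measurableSet_singleton 0)
  have hun : D = (D ∩ jac S i ⁻¹' {0}ᶜ) ∪ (D ∩ jac S i ⁻¹' {0}) := by
    rw [← inter_union_distrib_left, ← preimage_union, compl_union_self, preimage_univ, inter_univ]
  have hdisj : Disjoint (D ∩ jac S i ⁻¹' {0}ᶜ) (D ∩ jac S i ⁻¹' {0}) :=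
    disjoint_left.2 fun u hu hu' => hu.2 hu'.2
  -- Points with vanishing Jacobian contribute to neither side.
  have h0 : sphericalOuter (homDist N) (k + 2) (S.param i '' (D ∩ jac S i ⁻¹' {0})) = 0 :=
    measure_mono_null (image_mono (t := {u ∈ S.dom i | jac S i u = 0})
      fun u hu => ⟨hDi hu.1, hu.2⟩) (hN.sphericalOuter_characteristic i)
  have h1 : ∫⁻ u in D, ENNReal.ofReal (jac S i u) =
      ∫⁻ u in D ∩ jac S i ⁻¹' {0}ᶜ, ENNReal.ofReal (jac S i u) := by
    conv_lhs => rw [hun]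
    rw [lintegral_union hm0 hdisj, setLIntegral_congr_fun (g := fun _ => 0) hm0 fun u hu => by
      simp only [mem_singleton_iff.1 hu.2, ENNReal.ofReal_zero]]
    simp
  rw [h1, hN.lintegral_jac_eq_of_ne_zero i hm fun u hu => ⟨hDi hu.1, hu.2⟩]
  congr 1
  refine le_antisymm (measure_mono (image_mono inter_subset_left)) ?_
  conv_lhs => rw [hun, image_union]
  refine (measure_union_le _ _).trans ?_
  rw [h0, add_zero]

/-- The oblique mass is a multiple of the spherical measure. -/
theorem IsHomNorm.obliqueMass_eq_sphericalIntegral (hN : IsHomNorm N) (hS : S.CarriesCurrent)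
    {A : Set (Heis n)} (hA : MeasurableSet A) (hAS : A ⊆ S.carrier) :
    obliqueMass (metric n) (contact n) (S.current A) =
      sphericalIntegral (homDist N) (k + 2) A fun _ => density N k := by
  have hpart : ∀ i, S.part A i ⊆ S.dom i := fun i =>
    (S.part_subset A i).trans (S.piece_subset i)
  rw [obliqueMass_eq_oblMeas hS hA, oblMeas, push_apply _ _ hA,
    sphericalIntegral_const (hN.measurableSet_caratheodory (k + 2) hA)]
  rw [tsum_congr fun i => hN.lintegral_jac_eq i (S.measurableSet_part hA i) (hpart i),
    ENNReal.tsum_mul_left]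
  congr 1
  conv_rhs => rw [← iUnion_image_part hAS]
  refine (hN.tsum_sphericalOuter_image (k + 2)
    (fun i => measurableSet_image (S.measurableSet_part hA i) (hpart i)) ?_).symm
  intro i j hij
  refine disjoint_left.2 ?_
  rintro _ ⟨u, hu, rfl⟩ ⟨v, hv, hvu⟩
  exact hij (eq_of_mem_piece (S.part_subset A i hu) (S.part_subset A j hv) hvu.symm)

end Heis

end ObliqueMass

end

theorem mainTheorem7 :
    -- the oblique mass depends only on the subRiemannian data
    (∀ (n : ℕ), 1 ≤ n →
      ∀ (E : Type*) [NormedAddCommGroup E] [NormedSpace ℝ E] [FiniteDimensional ℝ E]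
        (V : Type*) [TopologicalSpace V] [ChartedSpace E V] [IsManifold 𝓘(ℝ, E) ∞ V]
        [T2Space V] [SecondCountableTopology V],
      Module.finrank ℝ E = 2 * n + 1 →
      ∀ (g g' : Bundle.ContMDiffRiemannianMetric 𝓘(ℝ, E) ∞ E
          (fun x : V => TangentSpace 𝓘(ℝ, E) x))
        (θ θ' : V → E →L[ℝ] ℝ),
      ObliqueMass.IsContactForm θ → ObliqueMass.IsContactForm θ' →
      ObliqueMass.IsUnitForm (ObliqueMass.metricOf g) θ →
      ObliqueMass.IsUnitForm (ObliqueMass.metricOf g') θ' →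
      ObliqueMass.SameSubRiemannian (ObliqueMass.metricOf g) θ (ObliqueMass.metricOf g') θ' →
      (θ = θ' ∨ (ObliqueMass.IsNormalized n (ObliqueMass.metricOf g) θ ∧
        ObliqueMass.IsNormalized n (ObliqueMass.metricOf g') θ')) →
      ∀ (k : ℕ) (S : ObliqueMass.OrientedSubmanifold E V (k + 1)), S.CarriesCurrent →
        ObliqueMass.obliqueMass (ObliqueMass.metricOf g) θ (S.current S.carrier) =
          ObliqueMass.obliqueMass (ObliqueMass.metricOf g') θ' (S.current S.carrier)) ∧
    -- continuous density with respect to the spherical Hausdorff measure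
    (∀ (n : ℕ), 1 ≤ n → ∀ (k : ℕ)
      (S : ObliqueMass.OrientedSubmanifold (ObliqueMass.Heis n) (ObliqueMass.Heis n) (k + 1)),
      S.CarriesCurrent →
      ∀ d : ObliqueMass.Heis n → ObliqueMass.Heis n → ℝ≥0∞,
      (d = ObliqueMass.Heis.subRiemannianDist ∨ d = ObliqueMass.Heis.koranyiDist) →
      ∃ c : ObliqueMass.Heis n → ℝ≥0, ContinuousOn c S.carrier ∧
        ∀ A : Set (ObliqueMass.Heis n), MeasurableSet A → A ⊆ S.carrier →
          ObliqueMass.obliqueMass (ObliqueMass.Heis.metric n) (ObliqueMass.Heis.contact n)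
              (S.current A) =
            ObliqueMass.sphericalIntegral d (k + 2) A c) ∧
    -- the oblique mass as a limit of rescaled masses
    (∀ (n : ℕ), 1 ≤ n → ∀ (k : ℕ)
      (S : ObliqueMass.OrientedSubmanifold (ObliqueMass.Heis n) (ObliqueMass.Heis n) (k + 1)),
      S.CarriesCurrent →
      ObliqueMass.mass (ObliqueMass.Heis.metric n) (S.current S.carrier) ≠ ⊤ →
      Tendsto (fun r : ℝ => (ENNReal.ofReal (r ^ (k + 2)))⁻¹ *
          ObliqueMass.mass (ObliqueMass.Heis.metric n)
            (ObliqueMass.pushforward (ObliqueMass.Heis.dilation r) (S.current S.carrier)))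
        atTop
        (𝓝 (ObliqueMass.obliqueMass (ObliqueMass.Heis.metric n) (ObliqueMass.Heis.contact n)
          (S.current S.carrier)))) := by
  refine ⟨?_, ?_, ?_⟩
  · intro n hn E _ _ _ V _ _ _ _ _ hdim g g' θ θ' hθ hθ' hu hu' hs hN k S _
    exact ObliqueMass.obliqueMass_eq_of_sameSubRiemannian hn hdim g g' θ θ' hθ.1 hθ'.1 hu hu' hs hN _
  · intro n hn k S hS d hd
    -- Both distances come from homogeneous norms, so one argument serves for both.
    obtain ⟨N, hN, rfl⟩ : ∃ N : ObliqueMass.Heis n → ℝ, ObliqueMass.Heis.IsHomNorm N ∧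
        d = ObliqueMass.Heis.homDist N := by
      rcases hd with rfl | rfl
      · exact ⟨_, ObliqueMass.Heis.isHomNorm_srNorm hn,
          funext fun p => funext fun q => ObliqueMass.Heis.subRiemannianDist_eq_srNorm hn p q⟩
      · exact ⟨_, ObliqueMass.Heis.isHomNorm_gauge, rfl⟩
    exact ⟨fun _ => ObliqueMass.Heis.density N k, continuousOn_const,
      fun A hA hAS => hN.obliqueMass_eq_sphericalIntegral hS hA hAS⟩
  · intro n _ k S hS hfin
    exact ObliqueMass.Heis.tendsto_mass_dilation
      (fun c η => S.current_smul c η _) (fun η φ hη hφ => S.current_add hS hη hφ _) hfin
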